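/- Let $n,p,k\in\mathbb R$ with $n\neq 1$, $p\neq 0$, $k\neq 0$. For complex-valued $C^1$ functions $G(x,v,\bar v)$, $H(x,v,\bar v)$, with $x$ in an open interval $J\subseteq(0,\infty)$ and $v\in\mathbb C\setminus\{0\}$ (subscripts $v,\bar v$ denoting Wirtinger derivatives), consider the time-translation-group resolving system of the radial Schrödinger equation $iu_t=u_{rr}+(n-1)u_r/r+k|u|^pu$, $$G_x+HG_v-GH_v+\bar HG_{\bar v}-\bar GH_{\bar v}=0,\qquad iG-(n-1)H/x-H_x-HH_v-\bar HH_{\bar v}=k\,|v|^{p}v .$$ The solutions of the separable power form $$H=h_1(x)v+h_2(x)|v|^{2a}v,\qquad G=-\Psi(H)-ik|v|^pv,\qquad a\in\mathbb R\setminus\{0\},$$ with $h_1,h_2$ complex-valued and $\Psi(H)=i\big((n-1)H/x+H_x+HH_v+\bar HH_{\bar v}\big)$, are exactly the following 12 families, and all of them are phase-equivariant, i.e. $H=h(x,|v|)v$, $G=g(x,|v|)v$. (The constants $C_i$ are real except for $C_3$ in 12; in each family the same choice of upper or lower sign is made throughout, and $J$ is such that no expression that is inverted vanishes on $J$.) 1.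 $H=0$, $G=-ik|v|^pv$. 2. $H=iC_1x|v|^{2/n}v$, $G=\big(iC_1^2x^2|v|^{4/n}+C_1n|v|^{2/n}-ik|v|^p\big)v$, for $n\neq0$, $C_1\neq0$. 3. $H=\big((2-n)x^{-1}\pm i\sqrt{2k(1-2/n)}\,|v|^{1/(2-n)}\big)v$, $G=\big(\pm(4-n)\sqrt{2k(1-2/n)}\,x^{-1}|v|^{1/(2-n)}+ik(1-4/n)|v|^{2/(2-n)}\big)v$, for $p=2/(2-n)$, $n\neq0,2$, $k(1-2/n)>0$. 4. $H=\big((2-n)x^{-1}\pm i\sqrt k\,|v|^{(3-n)/(n-2)}\big)v$, $G=0$, for $p=2(3-n)/(n-2)$, $k>0$, $n\neq2,3$. 5. $H=\big((2-n)x^{-1}\mp\sqrt{(2-n)k}\,|v|^{(n-3)/(2-n)}\big)v$, $G=0$, for $p=2(3-n)/(n-2)$, $k(2-n)>0$, $n\neq2,3$. 6. $H=\big(-(k/n)x+C_1x^{1-n}\big)|v|^{-1}v$, $G=0$, for $p=-1$, $n\neq0$. 7. $H=x(C_1-k\ln x)|v|^{-1}v$, $G=0$, for $p=-1$, $n=0$.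 8. $H=\big((2-n)(x+C_1x^{n-1})^{-1}(1+(C_2+\tfrac{k}{2n}x^2)|v|^{-1})-\tfrac knx|v|^{-1}\big)v$, $G=0$, for $p=-1$, $n\neq0,2$. 9. $H=\big(x(x^2+C_1)^{-1}(2-(kC_1\ln x+C_2)|v|^{-1})-\tfrac k2x|v|^{-1}\big)v$, $G=0$, for $p=-1$, $n=0$. 10. $H=\big((\ln x+C_1)^{-1}x^{-1}(1+(C_2+\tfrac k4x^2)|v|^{-1})-\tfrac k2x|v|^{-1}\big)v$, $G=0$, for $p=-1$, $n=2$. 11. $H=\pm\sqrt{C_1}\,\big(C_2J_{|1-n/2|}(\sqrt{C_1}x)+C_3Y_{|1-n/2|}(\sqrt{C_1}x)\big)^{-1}\big((C_2J_{\mp n/2}(\sqrt{C_1}x)+C_3Y_{\mp n/2}(\sqrt{C_1}x))(1+(k/C_1)|v|^{-1})+C_4x^{-n/2}|v|^{-1}\big)v$, $G=iC_1v$, for $p=-1$, $\pm(1-n/2)\geq0$, $C_1>0$. 12. $H=\sqrt{C_1}\,\big(C_2I_{|1-n/2|}(\sqrt{C_1}x)+C_3e^{i\pi|1-n/2|}K_{|1-n/2|}(\sqrt{C_1}x)\big)^{-1}\big((C_2I_{\mp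 n/2}(\sqrt{C_1}x)+C_3e^{\mp i\pi n/2}K_{\mp n/2}(\sqrt{C_1}x))(1-(k/C_1)|v|^{-1})+C_4x^{-n/2}|v|^{-1}\big)v$, $G=-iC_1v$, for $p=-1$, $\pm(1-n/2)\geq0$, $C_1>0$, where $C_3\in\mathbb C$ is such that $C_3e^{i\pi|1-n/2|}$ is real. Here $J_\nu,Y_\nu$ are the Bessel functions and $I_\nu,K_\nu$ the modified Bessel functions of real order. Families 4 to 10 satisfy the translation-invariance condition $G=0$. -/

import Mathlib

open scoped Topology

noncomputable section

/-! Bessel functions of real order `ν` at a real argument `x > 0`. -/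

/-- Bessel function of the first kind. (`Real.Gamma` vanishes at the nonpositive integers, so that
division by it agrees there with the usual convention `1 / Γ = 0`.) -/
def besselJ (ν x : ℝ) : ℝ :=
  ∑' j : ℕ, (-1) ^ j / ((Nat.factorial j : ℝ) * Real.Gamma (ν + j + 1)) * (x / 2) ^ (2 * (j : ℝ) + ν)

open scoped Classical in
/-- Bessel function of the second kind; at an integer order it is the limit over the orders
`μ → ν`, `μ ≠ ν`. -/
def besselY (ν x : ℝ) : ℝ :=
  if ∃ m : ℤ, ν = m then
    Filter.limUnder (𝓝[≠] ν) fun μ : ℝ =>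
      (besselJ μ x * Real.cos (μ * Real.pi) - besselJ (-μ) x) / Real.sin (μ * Real.pi)
  else (besselJ ν x * Real.cos (ν * Real.pi) - besselJ (-ν) x) / Real.sin (ν * Real.pi)

/-- Modified Bessel function of the first kind. -/
def besselI (ν x : ℝ) : ℝ :=
  ∑' j : ℕ, 1 / ((Nat.factorial j : ℝ) * Real.Gamma (ν + j + 1)) * (x / 2) ^ (2 * (j : ℝ) + ν)

/-- Modified Bessel function of the second kind, `K_ν(x) = ∫₀^∞ e^{-x cosh t} cosh (ν t) dt`. -/
def besselK (ν x : ℝ) : ℝ :=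
  ∫ t in Set.Ioi (0 : ℝ), Real.exp (-(x * Real.cosh t)) * Real.cosh (ν * t)

namespace RadialNLS

/-! A function `F(x, v, v̄)` is a function of the real variable `x` and the complex variable `v`;
its derivatives in `v` and `v̄` are the Wirtinger derivatives. -/

/-- `F_x` -/
def dx (F : ℝ → ℂ → ℂ) (x : ℝ) (v : ℂ) : ℂ := deriv (fun s => F s v) x

/-- `F_v = (∂F/∂(Re v) - i ∂F/∂(Im v)) / 2` -/
def dv (F : ℝ → ℂ → ℂ) (x : ℝ) (v : ℂ) : ℂ :=
  (fderiv ℝ (F x) v 1 - Complex.I * fderiv ℝ (F x) v Complex.I) / 2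

/-- `F_v̄ = (∂F/∂(Re v) + i ∂F/∂(Im v)) / 2` -/
def dvbar (F : ℝ → ℂ → ℂ) (x : ℝ) (v : ℂ) : ℂ :=
  (fderiv ℝ (F x) v 1 + Complex.I * fderiv ℝ (F x) v Complex.I) / 2

/-- The complex number `|v|^s`. -/
def absPow (v : ℂ) (s : ℝ) : ℂ := ((‖v‖ ^ s : ℝ) : ℂ)

/-- `(H, G)` is a (`C¹`) solution of the time-translation-group resolving system
of `i u_t = u_rr + (n-1) u_r / r + k |u|^p u` on `x ∈ J`, `v ≠ 0`.
The monomial `v^{1+p/2} v̄^{p/2}` is `|v|^p v`. -/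
structure IsSolution (n p k : ℝ) (J : Set ℝ) (H G : ℝ → ℂ → ℂ) : Prop where
  contDiffOn_H : ContDiffOn ℝ 1 (fun q : ℝ × ℂ => H q.1 q.2) (J ×ˢ {v : ℂ | v ≠ 0})
  contDiffOn_G : ContDiffOn ℝ 1 (fun q : ℝ × ℂ => G q.1 q.2) (J ×ˢ {v : ℂ | v ≠ 0})
  eq_one : ∀ x ∈ J, ∀ v : ℂ, v ≠ 0 →
    dx G x v + H x v * dv G x v - G x v * dv H x v
      + (starRingEnd ℂ) (H x v) * dvbar G x v - (starRingEnd ℂ) (G x v) * dvbar H x v = 0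
  eq_two : ∀ x ∈ J, ∀ v : ℂ, v ≠ 0 →
    Complex.I * G x v - ((n - 1 : ℝ) : ℂ) * H x v / (x : ℂ) - dx H x v
      - H x v * dv H x v - (starRingEnd ℂ) (H x v) * dvbar H x v = (k : ℂ) * absPow v p * v

/-- The operator `Ψ` for which the second equation of the system is `G + Ψ(H) = -i k |v|^p v`. -/
def Psi (n : ℝ) (H : ℝ → ℂ → ℂ) (x : ℝ) (v : ℂ) : ℂ :=
  Complex.I * (((n - 1 : ℝ) : ℂ) * H x v / (x : ℂ) + dx H x v
    + H x v * dv H x v + (starRingEnd ℂ) (H x v) * dvbar H x v)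

/-- The separable power ansatz `H = h₁(x) v + h₂(x) v^{a+1} v̄^a`, `G = -Ψ(H) - i k |v|^p v`,
with `a ≠ 0`. -/
def HasAnsatzForm (n p k : ℝ) (J : Set ℝ) (H G : ℝ → ℂ → ℂ) : Prop :=
  ∃ a : ℝ, a ≠ 0 ∧ ∃ h₁ h₂ : ℝ → ℂ, ∀ x ∈ J, ∀ v : ℂ, v ≠ 0 →
    H x v = h₁ x * v + h₂ x * (absPow v (2 * a) * v) ∧
    G x v = -Psi n H x v - Complex.I * (k : ℂ) * (absPow v p * v)

/-- `H = h(x,|v|) v` and `G = g(x,|v|) v`. -/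
def IsPhaseEquivariant (J : Set ℝ) (H G : ℝ → ℂ → ℂ) : Prop :=
  ∃ h g : ℝ → ℝ → ℂ, ∀ x ∈ J, ∀ v : ℂ, v ≠ 0 → H x v = h x ‖v‖ * v ∧ G x v = g x ‖v‖ * v

/-- The translation-invariance condition `G = 0`. -/
def IsTranslationInvariant (J : Set ℝ) (G : ℝ → ℂ → ℂ) : Prop :=
  ∀ x ∈ J, ∀ v : ℂ, v ≠ 0 → G x v = 0

/-! The twelve explicit families. A sign `±` is a real number `ε` equal to `1` or `-1`. -/

def Family1 (p k : ℝ) (J : Set ℝ) (H G : ℝ → ℂ → ℂ) : Prop :=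
  ∀ x ∈ J, ∀ v : ℂ, v ≠ 0 →
    H x v = 0 ∧ G x v = -Complex.I * (k : ℂ) * absPow v p * v

def Family2 (n p k : ℝ) (J : Set ℝ) (H G : ℝ → ℂ → ℂ) : Prop :=
  n ≠ 0 ∧ ∃ C₁ : ℝ, C₁ ≠ 0 ∧ ∀ x ∈ J, ∀ v : ℂ, v ≠ 0 →
    H x v = Complex.I * (C₁ : ℂ) * (x : ℂ) * absPow v (2 / n) * v ∧
    G x v = (Complex.I * (C₁ : ℂ) ^ 2 * (x : ℂ) ^ 2 * absPow v (4 / n)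
      + (C₁ : ℂ) * (n : ℂ) * absPow v (2 / n) - Complex.I * (k : ℂ) * absPow v p) * v

def Family3 (n p k : ℝ) (J : Set ℝ) (H G : ℝ → ℂ → ℂ) : Prop :=
  p = 2 / (2 - n) ∧ n ≠ 0 ∧ n ≠ 2 ∧ 0 < k * (1 - 2 / n) ∧
  ∃ ε : ℝ, (ε = 1 ∨ ε = -1) ∧ ∀ x ∈ J, ∀ v : ℂ, v ≠ 0 →
    H x v = (((2 - n) * x⁻¹ : ℝ)
      + Complex.I * (ε * √(2 * k * (1 - 2 / n)) : ℝ) * absPow v (1 / (2 - n))) * v ∧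
    G x v = ((ε * (4 - n) * √(2 * k * (1 - 2 / n)) * x⁻¹ : ℝ) * absPow v (1 / (2 - n))
      + Complex.I * (k * (1 - 4 / n) : ℝ) * absPow v (2 / (2 - n))) * v

def Family4 (n p k : ℝ) (J : Set ℝ) (H G : ℝ → ℂ → ℂ) : Prop :=
  p = 2 * (3 - n) / (n - 2) ∧ n ≠ 2 ∧ n ≠ 3 ∧ 0 < k ∧
  ∃ ε : ℝ, (ε = 1 ∨ ε = -1) ∧ ∀ x ∈ J, ∀ v : ℂ, v ≠ 0 →
    H x v = (((2 - n) * x⁻¹ : ℝ)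
      + Complex.I * (ε * √k : ℝ) * absPow v ((3 - n) / (n - 2))) * v ∧
    G x v = 0

def Family5 (n p k : ℝ) (J : Set ℝ) (H G : ℝ → ℂ → ℂ) : Prop :=
  p = 2 * (3 - n) / (n - 2) ∧ n ≠ 2 ∧ n ≠ 3 ∧ 0 < k * (2 - n) ∧
  ∃ ε : ℝ, (ε = 1 ∨ ε = -1) ∧ ∀ x ∈ J, ∀ v : ℂ, v ≠ 0 →
    H x v = (((2 - n) * x⁻¹ : ℝ)
      - (ε * √((2 - n) * k) : ℝ) * absPow v ((n - 3) / (2 - n))) * v ∧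
    G x v = 0

def Family6 (n p k : ℝ) (J : Set ℝ) (H G : ℝ → ℂ → ℂ) : Prop :=
  p = -1 ∧ n ≠ 0 ∧
  ∃ C₁ : ℝ, ∀ x ∈ J, ∀ v : ℂ, v ≠ 0 →
    H x v = ((-(k / n) * x + C₁ * x ^ (1 - n)) * ‖v‖⁻¹ : ℝ) * v ∧
    G x v = 0

def Family7 (n p k : ℝ) (J : Set ℝ) (H G : ℝ → ℂ → ℂ) : Prop :=
  p = -1 ∧ n = 0 ∧
  ∃ C₁ : ℝ, ∀ x ∈ J, ∀ v : ℂ, v ≠ 0 →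
    H x v = (x * (C₁ - k * Real.log x) * ‖v‖⁻¹ : ℝ) * v ∧
    G x v = 0

def Family8 (n p k : ℝ) (J : Set ℝ) (H G : ℝ → ℂ → ℂ) : Prop :=
  p = -1 ∧ n ≠ 0 ∧ n ≠ 2 ∧
  ∃ C₁ C₂ : ℝ, (∀ x ∈ J, x + C₁ * x ^ (n - 1) ≠ 0) ∧ ∀ x ∈ J, ∀ v : ℂ, v ≠ 0 →
    H x v = ((2 - n) * (x + C₁ * x ^ (n - 1))⁻¹ * (1 + (C₂ + k / (2 * n) * x ^ 2) * ‖v‖⁻¹)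
      - k / n * x * ‖v‖⁻¹ : ℝ) * v ∧
    G x v = 0

def Family9 (n p k : ℝ) (J : Set ℝ) (H G : ℝ → ℂ → ℂ) : Prop :=
  p = -1 ∧ n = 0 ∧
  ∃ C₁ C₂ : ℝ, (∀ x ∈ J, x ^ 2 + C₁ ≠ 0) ∧ ∀ x ∈ J, ∀ v : ℂ, v ≠ 0 →
    H x v = (x * (x ^ 2 + C₁)⁻¹ * (2 - (k * C₁ * Real.log x + C₂) * ‖v‖⁻¹)
      - k / 2 * x * ‖v‖⁻¹ : ℝ) * v ∧
    G x v = 0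

def Family10 (n p k : ℝ) (J : Set ℝ) (H G : ℝ → ℂ → ℂ) : Prop :=
  p = -1 ∧ n = 2 ∧
  ∃ C₁ C₂ : ℝ, (∀ x ∈ J, Real.log x + C₁ ≠ 0) ∧ ∀ x ∈ J, ∀ v : ℂ, v ≠ 0 →
    H x v = ((Real.log x + C₁)⁻¹ * x⁻¹ * (1 + (C₂ + k / 4 * x ^ 2) * ‖v‖⁻¹)
      - k / 2 * x * ‖v‖⁻¹ : ℝ) * v ∧
    G x v = 0

def Family11 (n p k : ℝ) (J : Set ℝ) (H G : ℝ → ℂ → ℂ) : Prop :=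
  p = -1 ∧ ∃ ε : ℝ, (ε = 1 ∨ ε = -1) ∧ 0 ≤ ε * (1 - n / 2) ∧
  ∃ C₁ C₂ C₃ C₄ : ℝ, 0 < C₁ ∧
    (∀ x ∈ J, C₂ * besselJ |1 - n / 2| (√C₁ * x) + C₃ * besselY |1 - n / 2| (√C₁ * x) ≠ 0) ∧
    ∀ x ∈ J, ∀ v : ℂ, v ≠ 0 →
      H x v = (ε * √C₁ *
        (C₂ * besselJ |1 - n / 2| (√C₁ * x) + C₃ * besselY |1 - n / 2| (√C₁ * x))⁻¹ *
        ((C₂ * besselJ (-ε * n / 2) (√C₁ * x) + C₃ * besselY (-ε * n / 2) (√C₁ * x))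
          * (1 + k / C₁ * ‖v‖⁻¹) + C₄ * x ^ (-n / 2) * ‖v‖⁻¹) : ℝ) * v ∧
      G x v = Complex.I * (C₁ : ℂ) * v

/-- Here `C₃` is complex with `C₃ e^{iπ|1-n/2|}` real, so that `H / v` is real. -/
def Family12 (n p k : ℝ) (J : Set ℝ) (H G : ℝ → ℂ → ℂ) : Prop :=
  p = -1 ∧ ∃ ε : ℝ, (ε = 1 ∨ ε = -1) ∧ 0 ≤ ε * (1 - n / 2) ∧
  ∃ (C₁ C₂ C₄ : ℝ) (C₃ : ℂ), 0 < C₁ ∧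
    (C₃ * Complex.exp (Complex.I * Real.pi * (|1 - n / 2| : ℝ))).im = 0 ∧
    (∀ x ∈ J, C₂ * besselI |1 - n / 2| (√C₁ * x)
      + C₃ * Complex.exp (Complex.I * Real.pi * (|1 - n / 2| : ℝ))
        * besselK |1 - n / 2| (√C₁ * x) ≠ 0) ∧
    ∀ x ∈ J, ∀ v : ℂ, v ≠ 0 →
      H x v = (√C₁ : ℝ) *
        (C₂ * besselI |1 - n / 2| (√C₁ * x)
          + C₃ * Complex.exp (Complex.I * Real.pi * (|1 - n / 2| : ℝ))
            * besselK |1 - n / 2| (√C₁ * x))⁻¹ *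
        ((C₂ * besselI (-ε * n / 2) (√C₁ * x)
          + C₃ * Complex.exp (-ε * Complex.I * Real.pi * n / 2)
            * besselK (-ε * n / 2) (√C₁ * x))
          * (1 - (k / C₁ * ‖v‖⁻¹ : ℝ)) + (C₄ * x ^ (-n / 2) * ‖v‖⁻¹ : ℝ)) * v ∧
      G x v = -Complex.I * (C₁ : ℂ) * v

/-- The families with `G = 0`. -/
def IsListedStatic (n p k : ℝ) (J : Set ℝ) (H G : ℝ → ℂ → ℂ) : Prop :=
  Family4 n p k J H G ∨ Family5 n p k J H G ∨ Family6 n p k J H G ∨ Family7 n p k J H G ∨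
  Family8 n p k J H G ∨ Family9 n p k J H G ∨ Family10 n p k J H G

/-- `(H, G)` is one of the twelve explicit solutions on `x ∈ J`, `v ≠ 0`. -/
def IsListed (n p k : ℝ) (J : Set ℝ) (H G : ℝ → ℂ → ℂ) : Prop :=
  Family1 p k J H G ∨ Family2 n p k J H G ∨ Family3 n p k J H G ∨
  IsListedStatic n p k J H G ∨ Family11 n p k J H G ∨ Family12 n p k J H G

end RadialNLS

end

/-! Put `N = n - 1`, `h₁ = a + i b`, `h₂ = α + i β`, and let `q` be twice the exponent of the
ansatz. Then `H` and `G` are `v` times functions of `x` and `|v|`, and the system becomes one in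
`(x, |v|)`. Powers of `|v|` with different exponents are linearly independent, so comparing the
exponents `0, q, 2q, 3q, p, p + q` gives an overdetermined system of ordinary differential and
algebraic equations for the coefficients (`CoeffSystem`, `exists_coeffSystem`). The nonlinearity
couples to the rest only at the resonances `p = -q, q, 2q, 3q`.

The substance is solving this system. With `t = x d/dx`, `A = x a`, `c = x b` it is autonomous up to
constants times powers of `x`. To divide freely and split products, the functions are sent to a
formally real differential field: germs along an ultrafilter finer than the residual filter
(`SmoothGerm.exists_field`). There, elimination leads to a polynomial relation with real
coefficients between two elements. If the relation is not trivial, then `x` and the unknowns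
generate a field of transcendence degree one over `ℝ`. Such a field has a place over `x = ∞`
compatible with `t`: logarithmic derivatives are integral, and `t` maps integral elements into the
maximal ideal (`FunctionField.exists_place`, `DifferentialField.exists_place`). This is incompatible
with the pole of `x`. A trivial relation is dealt with by looking at its coefficients. In this way
the phase `b` is shown to vanish (`eq_zero_of_log_deriv`, `eq_zero_of_logistic`,
`eq_zero_of_affine`), `h₁` is shown to be `0` or `(2 - n)/x` (`conic_false`, `const_of_conic`), and
five patterns remain (`classify_generic`, `classify_neg`, `classify_double`, `classify_single`).

The field only sees some small open set. Uniqueness for linear first order equations carries each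
pattern to all of `J` (`eq_of_power`, `eq_of_double`, `eq_of_static`). Four patterns are families 2
to 5, and `h₂ = 0` gives family 1. The fifth has `p = q = -1` and real coefficients: a Riccati
equation for `a` with a constant `E`, where `G = -i E v`, and a linear equation for `α`. The
substitution `a = y'/y`, `α = w/y` makes it linear (`IsLinearStatic`). For `E = 0` it is solved by
powers and logarithms (families 6 to 10). For `E ≠ 0` it is Bessel's equation (families 11 and 12),
and completeness rests on the derivative formulas and the nonvanishing Wronskians of `J, Y` and of
`I, K`, derived here from the definitions.

Conversely, each family is checked by substitution, through `solution_of_coefficients` and, for `p =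
-1`, through the linear system. -/

namespace FunctionField

/-! ### Places of function fields compatible with a derivation -/

open Polynomial WithZero IsDedekindDomain

variable {k L : Type*} [Field k] [CharZero k] [Field L] [Algebra k L] [Algebra k[X] L]
  [Algebra (RatFunc k) L] [IsScalarTower k[X] (RatFunc k) L] [IsScalarTower k k[X] L]
  [FunctionField k L]

theorem derivation_algebraMap (t : Derivation k L L)
    (ht : t (algebraMap k[X] L X) = -algebraMap k[X] L X) (p : k[X]) :
    t (algebraMap k[X] L p) = algebraMap k[X] L (-X * derivative p) := by
  induction p using Polynomial.induction_on' with
  | add p q hp hq => simp only [map_add, hp, hq, mul_add]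
  | monomial n a =>
    have h1 : algebraMap k[X] L (monomial n a) = a • (algebraMap k[X] L X) ^ n := by
      rw [← C_mul_X_pow_eq_monomial, map_mul, map_pow, Algebra.smul_def,
        IsScalarTower.algebraMap_apply k k[X] L]
      rfl
    have h2 : (algebraMap k[X] L) (C a) = algebraMap k L a := by
      rw [IsScalarTower.algebraMap_apply k k[X] L]; rfl
    rw [h1, Derivation.map_smul, Derivation.leibniz_pow, ht, derivative_monomial,
      ← C_mul_X_pow_eq_monomial]
    rw [Algebra.smul_def a]
    simp only [map_mul, map_neg, map_pow, h2, smul_eq_mul, nsmul_eq_mul, map_natCast]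
    rcases n with _ | n
    · simp
    · simp only [Nat.add_sub_cancel]; push_cast; ring

/-- A finite extension of `k(X)`, with a derivation `t` extending `-X d/dX`, has a place over
`X = 0` which is compatible with `t`. -/
theorem exists_place (t : Derivation k L L)
    (ht : t (algebraMap k[X] L X) = -algebraMap k[X] L X) :
    ∃ v : Valuation L ℤᵐ⁰, (∀ r : k, r ≠ 0 → v (algebraMap k L r) = 1) ∧
      v (algebraMap k[X] L X) < 1 ∧ (∀ f, v (t f) ≤ v f) ∧ ∀ f, v f ≤ 1 → v (t f) < 1 := by
  have : IsScalarTower k[X] (ringOfIntegers k L) L := inferInstance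
  let B := ringOfIntegers k L
  have hint : Algebra.IsIntegral k[X] B := inferInstanceAs (Algebra.IsIntegral k[X] (integralClosure k[X] L))
  have hinj := ringOfIntegers.algebraMap_injective k L
  have : FaithfulSMul k[X] B := (faithfulSMul_iff_algebraMap_injective _ _).2 hinj
  have hXp : Prime (X : k[X]) := prime_X
  have : (Ideal.span {(X : k[X])}).IsMaximal :=
    PrincipalIdealRing.isMaximal_of_irreducible hXp.irreducible
  obtain ⟨P, hPmax, hP⟩ := Ideal.exists_maximal_ideal_liesOver_of_isIntegral (S := B)
    (Ideal.span {(X : k[X])})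
  have hXP : algebraMap k[X] B X ∈ P := by
    have : X ∈ P.under k[X] := by rw [← hP.over]; exact Ideal.mem_span_singleton_self _
    exact this
  have hPne : P ≠ ⊥ := by
    rintro rfl
    rw [Ideal.mem_bot] at hXP
    exact X_ne_zero (hinj (by rw [hXP, map_zero]))
  let w : HeightOneSpectrum B := ⟨P, hPmax.isPrime, hPne⟩
  let v : Valuation L ℤᵐ⁰ := w.valuation L
  have hvB : ∀ b : B, v (algebraMap B L b) ≤ 1 := fun b => w.valuation_le_one b
  have hvp : ∀ p : k[X], v (algebraMap k[X] L p) ≤ 1 := fun p => by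
    rw [IsScalarTower.algebraMap_apply k[X] B L]; exact hvB _
  have hvk : ∀ r : k, r ≠ 0 → v (algebraMap k L r) = 1 := by
    intro r hr
    have h0 : ∀ r : k, v (algebraMap k L r) ≤ 1 := fun r => by
      rw [IsScalarTower.algebraMap_apply k k[X] L]; exact hvp _
    refine le_antisymm (h0 r) ?_
    have h1 := h0 r⁻¹
    rw [map_inv₀, map_inv₀] at h1
    have hr' : v (algebraMap k L r) ≠ 0 := by
      rw [Valuation.ne_zero_iff]; simpa using hr
    exact (inv_le_one₀ (zero_lt_iff.2 hr')).1 h1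
  have hvX : v (algebraMap k[X] L X) < 1 := by
    rw [IsScalarTower.algebraMap_apply k[X] B L]
    exact (w.valuation_lt_one_iff_mem _).2 hXP
  have hX0 : algebraMap k[X] L X ≠ 0 := by
    rw [IsScalarTower.algebraMap_apply k[X] (RatFunc k) L]
    simp [RatFunc.X_ne_zero]
  set g : ℤᵐ⁰ := exp (-1) with hg
  have hg1 : g < 1 := by rw [hg, ← exp_zero]; exact exp_lt_exp.2 (by norm_num)
  have hgle : ∀ z : ℤᵐ⁰, z < 1 → z ≤ g := by
    intro z hz
    by_cases h : z = 0
    · rw [h]; exact zero_le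
    rw [← exp_log h] at hz ⊢
    rw [← exp_zero, exp_lt_exp] at hz
    exact exp_le_exp.2 (by lia)
  -- the derivation is bounded on the integers
  obtain ⟨C, hC1, hC⟩ : ∃ C : ℤᵐ⁰, 1 ≤ C ∧ ∀ b : B, v (t (algebraMap B L b)) ≤ C := by
    have hfin : Module.Finite k[X] B := inferInstance
    obtain ⟨S, hS⟩ := hfin.fg_top
    -- The `1` absorbs the Leibniz terms `x * t p` with `p` a polynomial, since `t p = -X p'` is
    -- integral.
    refine ⟨S.sup (fun s => v (t (algebraMap B L s))) ⊔ 1, le_sup_right, fun b => ?_⟩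
    have hb : b ∈ Submodule.span k[X] (S : Set B) := by rw [hS]; trivial
    induction hb using Submodule.span_induction with
    | mem x hx => exact le_trans (Finset.le_sup (f := fun s => v (t (algebraMap B L s))) hx) le_sup_left
    | zero => simp
    | add x y _ _ hx hy =>
      rw [map_add, map_add]
      exact le_trans (v.map_add _ _) (max_le hx hy)
    | smul p x _ hx =>
      rw [Algebra.smul_def, map_mul, ← IsScalarTower.algebraMap_apply k[X] B L, Derivation.leibniz,
        derivation_algebraMap t ht, smul_eq_mul, smul_eq_mul]
      refine le_trans (v.map_add _ _) (max_le ?_ ?_)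
      · rw [map_mul]
        exact le_trans (mul_le_of_le_one_left' (hvp p)) hx
      · rw [map_mul]
        exact le_trans (mul_le_one' (hvB _) (hvp _)) le_sup_right
  -- hence on the valuation ring
  have hC' : ∀ u : L, v u ≤ 1 → v (t u) ≤ C := by
    intro u hu
    obtain ⟨b, s, hs⟩ := w.exists_primeCompl_mul_eq_of_integer u hu
    have hs1 : v (algebraMap B L s) = 1 := by
      have := s.2
      exact w.valuation_eq_one_iff_notMem.2 this
    have h := congrArg t hs
    rw [Derivation.leibniz, smul_eq_mul, smul_eq_mul] at h
    have h2 : algebraMap B L s * t u = t (algebraMap B L b) - u * t (algebraMap B L s) := by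
      rw [← h]; ring
    have h3 : v (t u) = v (algebraMap B L s * t u) := by rw [map_mul, hs1, one_mul]
    rw [h3, h2]
    refine le_trans (v.map_sub _ _) (max_le (hC b) ?_)
    rw [map_mul]
    exact le_trans (mul_le_of_le_one_left' hu) (hC s)
  -- a bound on units bounds logarithmic derivatives
  have hlog : ∀ M : ℤᵐ⁰, (∀ u : L, v u ≤ 1 → v (t u) ≤ M) → ∀ z : L, v (t z) ≤ v z * max M 1 := by
    intro M hM z
    by_cases hz : z = 0
    · simp [hz]
    set x := algebraMap k[X] L X with hx
    have hvx0 : v x ≠ 0 := (Valuation.ne_zero_iff _).2 hX0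
    have hvz0 : v z ≠ 0 := (Valuation.ne_zero_iff _).2 hz
    set e : ℤ := log (v x) with he
    have hee : e < 0 := by
      rw [← exp_log hvx0, ← exp_zero, exp_lt_exp] at hvX; exact hvX
    set b : ℤ := log (v z) with hb
    -- The exponents make `z ^ e * x ^ (-b)` a unit. As `t x = -x`, its logarithmic derivative is `e
    -- * (t z / z) + b`; the nonzero integer `e` has valuation `1`, so a bound for derivatives of
    -- integral elements bounds `t z / z` for every `z`.
    have hu : v (z ^ e * x ^ (-b)) = 1 := by
      rw [map_mul, map_zpow₀, map_zpow₀, ← exp_log hvz0, ← exp_log hvx0, ← he, ← hb, ← exp_zsmul,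
        ← exp_zsmul, ← exp_add, ← exp_zero]
      congr 1
      simp only [smul_eq_mul]; ring
    have hu0 : z ^ e * x ^ (-b) ≠ 0 := by
      rw [← Valuation.ne_zero_iff v, hu]; exact one_ne_zero
    have hd : t (z ^ e * x ^ (-b)) = (z ^ e * x ^ (-b)) * (e * (t z / z) + b) := by
      rw [Derivation.leibniz, Derivation.leibniz_zpow, Derivation.leibniz_zpow, ht]
      simp only [smul_eq_mul, zsmul_eq_mul]
      rw [zpow_sub_one₀ hz, zpow_sub_one₀ hX0]
      push_cast
      field_simp
      ring
    have h1 := hM _ hu.le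
    rw [hd, map_mul, hu, one_mul] at h1
    have he0 : (e : k) ≠ 0 := by exact_mod_cast hee.ne
    have hve : v (e : L) = 1 := by
      have := hvk e he0
      rwa [map_intCast] at this
    have hvb : v (b : L) ≤ 1 := by
      by_cases hb0 : (b : k) = 0
      · have : (b : L) = 0 := by
          have := congrArg (algebraMap k L) hb0
          rwa [map_intCast, map_zero] at this
        simp [this]
      · have := hvk b hb0
        rw [map_intCast] at this
        exact this.le
    have h2 : v (t z / z) ≤ max M 1 := by
      have h3 : v (e * (t z / z)) ≤ max M 1 := by
        have : (e : L) * (t z / z) = (e * (t z / z) + b) - b := by ring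
        rw [this]
        exact le_trans (v.map_sub _ _) (max_le_max h1 hvb)
      rwa [map_mul, hve, one_mul] at h3
    calc v (t z) = v (z * (t z / z)) := by rw [mul_div_cancel₀ _ hz]
      _ = v z * v (t z / z) := map_mul _ _ _
      _ ≤ v z * max M 1 := by gcongr
  -- improvement of the bound
  have hstep : ∀ M : ℤᵐ⁰, (∀ u : L, v u ≤ 1 → v (t u) ≤ M) →
      ∀ u : L, v u ≤ 1 → v (t u) ≤ g * max M 1 := by
    intro M hM
    have hsmall : ∀ z : L, v z < 1 → v (t z) ≤ g * max M 1 := by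
      intro z hz
      refine le_trans (hlog M hM z) ?_
      gcongr
      exact hgle _ hz
    intro u hu
    -- An integral `u` differs from some `b : B` by an element of the maximal ideal, for which
    -- `hsmall` already gains the factor `g`.
    obtain ⟨b, hb⟩ := w.exists_valuation_sub_lt_of_integer (K := L) hu 1
    have hb' : v (algebraMap B L b - u) < 1 := by simpa using hb
    suffices h : v (t (algebraMap B L b)) ≤ g * max M 1 by
      have : t u = t (algebraMap B L b) - t (algebraMap B L b - u) := by rw [map_sub]; ring
      rw [this]
      exact le_trans (v.map_sub _ _) (max_le h (hsmall _ hb'))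
    -- the residue of `b` is algebraic over `k`
    have : IsScalarTower k k[X] B := by
      refine IsScalarTower.of_algebraMap_eq fun r => ?_
      apply Subtype.ext
      exact IsScalarTower.algebraMap_apply k k[X] L r
    let _ : Field (B ⧸ P) := Ideal.Quotient.field P
    set β : B ⧸ P := Ideal.Quotient.mk P b with hβ
    have hβint : IsIntegral k β := by
      obtain ⟨f, hf, hfb⟩ := hint.isIntegral b
      refine ⟨f.map (evalRingHom 0), hf.map _, ?_⟩
      rw [eval₂_map]
      have hcomp : (algebraMap k (B ⧸ P)).comp (evalRingHom 0)
          = (Ideal.Quotient.mk P).comp (algebraMap k[X] B) := by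
        apply Polynomial.ringHom_ext
        · intro a
          simp only [RingHom.comp_apply, coe_evalRingHom, eval_C]
          rw [IsScalarTower.algebraMap_apply k B (B ⧸ P), IsScalarTower.algebraMap_apply k k[X] B]
          rfl
        · simp only [RingHom.comp_apply, coe_evalRingHom, eval_X, map_zero]
          exact (Ideal.Quotient.eq_zero_iff_mem.2 hXP).symm
      rw [hcomp, hβ, ← hom_eval₂, hfb, map_zero]
    set p := minpoly k β with hp
    have hsep : p.Separable := (minpoly.irreducible hβint).separable
    have hmk : ∀ f : k[X], Ideal.Quotient.mk P (aeval b f) = aeval β f := fun f => by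
      rw [hβ]; exact (aeval_algHom_apply (Ideal.Quotient.mkₐ k P) b f).symm
    have hpb : aeval b p ∈ P := by
      rw [← Ideal.Quotient.eq_zero_iff_mem, hmk]; exact minpoly.aeval k β
    have hpb' : aeval b (derivative p) ∉ P := by
      rw [← Ideal.Quotient.eq_zero_iff_mem, hmk]
      exact hsep.aeval_derivative_ne_zero (minpoly.aeval k β)
    have hkB : IsScalarTower k B L := by
      refine IsScalarTower.of_algebraMap_eq fun r => ?_
      rw [IsScalarTower.algebraMap_apply k k[X] L, IsScalarTower.algebraMap_apply k k[X] B,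
        ← IsScalarTower.algebraMap_apply k[X] B L]
    have hmap : ∀ f : k[X], algebraMap B L (aeval b f) = aeval (algebraMap B L b) f := fun f =>
      (aeval_algebraMap_apply L b f).symm
    have h1 : v (algebraMap B L (aeval b p)) < 1 := (w.valuation_lt_one_iff_mem _).2 hpb
    have h2 : v (algebraMap B L (aeval b (derivative p))) = 1 :=
      w.valuation_eq_one_iff_notMem.2 hpb'
    -- By separability `p'(b)` is a unit, while `p(b)` lies in `P`. The bound for `t (p(b)) = p'(b)
    -- * t b` therefore passes to `t b`.
    have h3 : t (algebraMap B L (aeval b p))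
        = algebraMap B L (aeval b (derivative p)) * t (algebraMap B L b) := by
      rw [hmap, hmap, Derivation.map_aeval, smul_eq_mul]
    have h4 := hsmall _ h1
    rwa [h3, map_mul, h2, one_mul] at h4
  -- A bound `M` improves to `g * max M 1`, so the bounds shrink geometrically until they reach `g`.
  have hiter : ∀ n : ℕ, ∀ u : L, v u ≤ 1 → v (t u) ≤ max (g ^ n * C) g := by
    intro n
    induction n with
    | zero => intro u hu; rw [pow_zero, one_mul]; exact le_max_of_le_left (hC' u hu)
    | succ n ih =>
      intro u hu
      refine le_trans (hstep _ ih u hu) ?_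
      have hcases : max (max (g ^ n * C) g) 1 = g ^ n * C ∨ max (max (g ^ n * C) g) 1 = 1 := by
        rcases le_total (max (g ^ n * C) g) 1 with h | h
        · exact Or.inr (max_eq_right h)
        · rw [max_eq_left h]
          rcases max_choice (g ^ n * C) g with h' | h'
          · exact Or.inl h'
          · exact absurd (h' ▸ h) hg1.not_ge
      rcases hcases with h | h
      · rw [h, ← mul_assoc, ← pow_succ']
        exact le_max_left _ _
      · rw [h, mul_one]
        exact le_max_right _ _
  have hfinal : ∀ u : L, v u ≤ 1 → v (t u) ≤ g := by
    intro u hu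
    have hC0 : C ≠ 0 := (lt_of_lt_of_le zero_lt_one hC1).ne'
    -- This many steps suffice for `g ^ n * C ≤ g`, with `g = exp (-1)`.
    have := hiter ((log C).toNat + 1) u hu
    refine le_trans this (max_le ?_ le_rfl)
    obtain ⟨m, rfl⟩ : ∃ m, C = exp m := ⟨_, (exp_log hC0).symm⟩
    rw [log_exp, hg, ← exp_nsmul, ← exp_add, exp_le_exp]
    have := Int.self_le_toNat m
    simp only [nsmul_eq_mul, mul_neg, mul_one]
    push_cast
    linarith
  refine ⟨v, hvk, hvX, fun f => ?_, fun f hf => lt_of_le_of_lt (hfinal f hf) hg1⟩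
  have := hlog g hfinal f
  rwa [max_eq_right hg1.le, mul_one] at this

end FunctionField

/-! ### Algebraic closure as a matroid, and compatible places over `x = ∞` -/

namespace DifferentialField

open Polynomial WithZero AlgebraicIndependent

variable {K : Type*} [Field K] [Algebra ℝ K]

/-- Differentiate the minimal polynomial: its derivative does not vanish at `f`. In particular an `x
≠ 0` with `t x = x` is transcendental over `ℝ`. -/
theorem derivation_eq_zero_of_isAlgebraic (t : Derivation ℝ K K) {f : K} (hf : IsAlgebraic ℝ f) :
    t f = 0 := by
  have hint := hf.isIntegral
  have h1 : t (aeval f (minpoly ℝ f)) = 0 := by rw [minpoly.aeval, map_zero]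
  rw [Derivation.map_aeval, smul_eq_mul] at h1
  exact (mul_eq_zero.1 h1).resolve_left
    ((minpoly.irreducible hint).separable.aeval_derivative_ne_zero (minpoly.aeval ℝ f))

/-- The elements of `K` which are algebraic over the field generated by `s`. -/
def acl (s : Set K) : Set K := (matroid ℝ K).closure s

theorem acl_eq (s : Set K) :
    acl s = Subalgebra.algebraicClosure (Algebra.adjoin ℝ s) K := matroid_closure_eq

theorem mem_acl_iff {s : Set K} {a : K} : a ∈ acl s ↔ IsAlgebraic (Algebra.adjoin ℝ s) a := by
  rw [acl_eq]; rfl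

theorem subset_acl (s : Set K) : s ⊆ acl s := (matroid ℝ K).subset_closure s (Set.subset_univ _)

theorem acl_subset {s s' : Set K} (h : s ⊆ acl s') : acl s ⊆ acl s' :=
  (matroid ℝ K).closure_subset_closure_of_subset_closure h

theorem mul_mem_acl {s : Set K} {a b : K} (ha : a ∈ acl s) (hb : b ∈ acl s) : a * b ∈ acl s := by
  rw [mem_acl_iff] at *; exact ha.mul hb

theorem inv_mem_acl {s : Set K} {a : K} (ha : a ∈ acl s) : a⁻¹ ∈ acl s := by
  rw [mem_acl_iff] at *; exact ha.inv

theorem div_mem_acl {s : Set K} {a b : K} (ha : a ∈ acl s) (hb : b ∈ acl s) : a / b ∈ acl s := by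
  rw [div_eq_mul_inv]; exact mul_mem_acl ha (inv_mem_acl hb)

theorem sub_mem_acl {s : Set K} {a b : K} (ha : a ∈ acl s) (hb : b ∈ acl s) : a - b ∈ acl s := by
  rw [mem_acl_iff] at *; exact ha.sub hb

theorem algebraMap_mem_acl (s : Set K) (r : ℝ) : algebraMap ℝ K r ∈ acl s := by
  rw [mem_acl_iff]
  exact isAlgebraic_algebraMap (⟨_, (Algebra.adjoin ℝ s).algebraMap_mem r⟩ : Algebra.adjoin ℝ s)

theorem of_pow_mem_acl {s : Set K} {a : K} {n : ℕ} (hn : 0 < n) (ha : a ^ n ∈ acl s) :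
    a ∈ acl s := by
  rw [mem_acl_iff] at *; exact ha.of_pow hn

theorem isAlgebraic_of_mem_acl_empty {a : K} (ha : a ∈ acl (∅ : Set K)) : IsAlgebraic ℝ a := by
  rw [mem_acl_iff] at ha
  refine ha.of_ringHom_of_comp_eq
    (f := algebraMap ℝ (Algebra.adjoin ℝ (∅ : Set K))) (g := RingHom.id K) ?_ ?_ ?_
  · rintro ⟨y, hy⟩
    rw [Algebra.adjoin_empty, Algebra.mem_bot] at hy
    obtain ⟨r, rfl⟩ := hy
    exact ⟨r, rfl⟩
  · exact fun _ _ h => h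
  · rfl

/-- If `u`, `d` satisfy a polynomial relation and the transcendental element `x` is algebraic over
`u`, `d`, then everything algebraic over `u`, `d` is algebraic over `x`. -/
theorem acl_pair_subset {u d x : K} (hx : Transcendental ℝ x) (hxm : x ∈ acl {u, d})
    (P : MvPolynomial (Fin 2) ℝ) (hP : MvPolynomial.aeval ![u, d] P = 0)
    (hP0 : ∃ a b : ℝ, MvPolynomial.eval ![a, b] P ≠ 0) : acl {u, d} ⊆ acl {x} := by
  have hx0 : x ∉ acl ∅ := fun h => hx (isAlgebraic_of_mem_acl_empty h)
  -- one of `u`, `d` generates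
  have hg : ∃ g, acl {u, d} ⊆ acl {g} := by
    by_contra! hcon
    have hud : u ≠ d := by
      rintro rfl
      exact hcon u (by simp)
    -- If neither element is algebraic over the other, the pair is independent, and then `P` would
    -- be the zero polynomial.
    have hind : (matroid ℝ K).Indep {u, d} := by
      rw [Matroid.indep_iff_forall_notMem_closure_sdiff]
      intro e he
      rcases he with rfl | he
      · have : ({e, d} : Set K) \ {e} = {d} := by
          ext z; simp only [Set.mem_sdiff, Set.mem_insert_iff, Set.mem_singleton_iff]
          constructor
          · tauto
          · rintro rfl; exact ⟨Or.inr rfl, hud.symm⟩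
        rw [this]
        intro h
        refine hcon d (acl_subset ?_)
        rintro z (rfl | rfl)
        · exact h
        · exact subset_acl _ rfl
      · obtain rfl : e = d := he
        have : ({u, e} : Set K) \ {e} = {u} := by
          ext z; simp only [Set.mem_sdiff, Set.mem_insert_iff, Set.mem_singleton_iff]
          constructor
          · tauto
          · rintro rfl; exact ⟨Or.inl rfl, hud⟩
        rw [this]
        intro h
        refine hcon u (acl_subset ?_)
        rintro z (rfl | rfl)
        · exact subset_acl _ rfl
        · exact h
    rw [matroid_indep_iff] at hind
    have hinj : Function.Injective ![u, d] := by
      intro i j hij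
      fin_cases i <;> fin_cases j <;> simp_all
    have hr : Set.range ![u, d] = {u, d} := by simp [Matrix.range_cons, Set.pair_comm]
    have hind2 : AlgebraicIndependent ℝ ![u, d] := by
      refine AlgebraicIndependent.of_subtype_range hinj ?_
      rw [hr]; exact hind
    have hP1 := hind2.eq_zero_of_aeval_eq_zero P hP
    obtain ⟨a, b, hab⟩ := hP0
    exact hab (by rw [hP1, map_zero])
  obtain ⟨g, hg⟩ := hg
  -- Exchange: `x` is algebraic over `g` but not over `ℝ`, so `g` is algebraic over `x`.
  have hxg : x ∈ (matroid ℝ K).closure (insert g ∅) \ (matroid ℝ K).closure ∅ :=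
    ⟨by rw [insert_empty_eq]; exact hg hxm, hx0⟩
  have h2 := (Matroid.closure_exchange hxg).1
  rw [insert_empty_eq] at h2
  refine hg.trans (acl_subset ?_)
  rintro z rfl
  exact h2

/-- A place over `x = ∞` which is compatible with the derivation, on a finitely generated algebraic
extension of `ℝ(x)` closed under the derivation. -/
theorem exists_place (t : Derivation ℝ K K) {x : K} (hx0 : x ≠ 0) (hx : t x = x)
    (S : Set K) [Finite S] (hS : S ⊆ acl {x})
    (hxS : x ∈ S) (hst : ∀ s ∈ S, t s ∈ IntermediateField.adjoin ℝ S) :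
    ∃ (E : IntermediateField ℝ K) (tE : Derivation ℝ E E) (v : Valuation E ℤᵐ⁰),
      S ⊆ E ∧ (∀ f : E, (tE f : K) = t f) ∧ (∀ r : ℝ, r ≠ 0 → v (algebraMap ℝ E r) = 1) ∧
      (∀ f : E, (f : K) = x → 1 < v f) ∧ (∀ f, v (tE f) ≤ v f) ∧
      ∀ f, v f ≤ 1 → v (tE f) < 1 := by
  set E := IntermediateField.adjoin ℝ S with hE
  have hSE : S ⊆ E := IntermediateField.subset_adjoin ℝ S
  have htE : ∀ f ∈ E, t f ∈ E := by
    intro f hf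
    induction hf using IntermediateField.adjoin_induction with
    | mem y hy => exact hst y hy
    | algebraMap r => rw [Derivation.map_algebraMap]; exact zero_mem _
    | add y z _ _ hy hz => rw [map_add]; exact add_mem hy hz
    | mul y z hy' hz' hy hz =>
      rw [Derivation.leibniz]; exact add_mem (mul_mem hy' hz) (mul_mem hz' hy)
    | inv y hy' hy =>
      rw [Derivation.leibniz_inv, smul_eq_mul]
      exact mul_mem (neg_mem (pow_mem (inv_mem hy') 2)) hy
  let tE : Derivation ℝ E E := Derivation.mk'
    { toFun := fun f => ⟨t f, htE f f.2⟩
      map_add' := fun f g => Subtype.ext (by simp)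
      map_smul' := fun r f => Subtype.ext (by simp) }
    (fun f g => Subtype.ext (by
      simp only [LinearMap.coe_mk, AddHom.coe_mk, smul_eq_mul]
      push_cast
      rw [Derivation.leibniz]; rfl))
  have htE' : ∀ f : E, (tE f : K) = t f := fun f => rfl
  set X : E := ⟨x, hSE hxS⟩ with hX
  have hX0 : X ≠ 0 := fun h => hx0 (congrArg Subtype.val h)
  -- A place over `x = ∞` is a place over `z = 0`, and `t z = -z` is the normalisation used in
  -- `FunctionField.exists_place`. The field `E` is made a function field through `z`.
  set z : E := X⁻¹ with hz
  have hz0 : z ≠ 0 := inv_ne_zero hX0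
  have htX : tE X = X := Subtype.ext hx
  have htz : tE z = -z := by
    rw [hz, Derivation.leibniz_inv, htX, smul_eq_mul]; field_simp
  have hztr : Transcendental ℝ z := fun h => by
    have := derivation_eq_zero_of_isAlgebraic tE h
    rw [htz] at this
    exact hz0 (neg_eq_zero.1 this)
  have hzinj : Function.Injective (aeval (R := ℝ) z) := transcendental_iff_injective.1 hztr
  have hnz : nonZeroDivisors ℝ[X] ≤ (nonZeroDivisors E).comap (aeval (R := ℝ) z) :=
    nonZeroDivisors_le_comap_nonZeroDivisors_of_injective _ hzinj
  let i1 : Algebra ℝ[X] E := (aeval (R := ℝ) z).toAlgebra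
  let i2 : Algebra (RatFunc ℝ) E := (RatFunc.liftAlgHom (aeval (R := ℝ) z) hnz).toAlgebra
  have hXz : algebraMap ℝ[X] E Polynomial.X = z := aeval_X z
  have i3 : IsScalarTower ℝ[X] (RatFunc ℝ) E := by
    refine IsScalarTower.of_algebraMap_eq fun p => ?_
    change aeval z p = RatFunc.liftAlgHom (aeval (R := ℝ) z) hnz (algebraMap _ _ p)
    rw [RatFunc.liftAlgHom_apply, RatFunc.num_algebraMap, RatFunc.denom_algebraMap]
    simp
  have i4 : IsScalarTower ℝ ℝ[X] E :=
    IsScalarTower.of_algebraMap_eq fun r => ((aeval (R := ℝ) z).commutes r).symm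
  have i5 : IsScalarTower ℝ (RatFunc ℝ) E := by
    refine IsScalarTower.of_algebraMap_eq fun r => ?_
    rw [IsScalarTower.algebraMap_apply ℝ ℝ[X] E, IsScalarTower.algebraMap_apply ℝ ℝ[X] (RatFunc ℝ),
      ← IsScalarTower.algebraMap_apply ℝ[X] (RatFunc ℝ) E]
  have i6 : FunctionField ℝ E := by
    let S' : Set E := Subtype.val ⁻¹' S
    have : Finite S' := (Set.toFinite S).preimage Subtype.val_injective.injOn
    have htop : IntermediateField.adjoin (RatFunc ℝ) S' = ⊤ := by
      rw [eq_top_iff]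
      rintro ⟨f, hf⟩ -
      induction hf using IntermediateField.adjoin_induction with
      | mem y hy => exact IntermediateField.subset_adjoin _ _ (show y ∈ S from hy)
      | algebraMap r =>
        have : (⟨algebraMap ℝ K r, E.algebraMap_mem r⟩ : E)
            = algebraMap (RatFunc ℝ) E (algebraMap ℝ (RatFunc ℝ) r) := by
          rw [← IsScalarTower.algebraMap_apply ℝ (RatFunc ℝ) E]; rfl
        rw [this]
        exact (IntermediateField.adjoin (RatFunc ℝ) S').algebraMap_mem _
      | add y z _ _ hy hz => exact add_mem hy hz
      | mul y z _ _ hy hz => exact mul_mem hy hz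
      | inv y hy' hy => exact inv_mem hy
    have hfin : FiniteDimensional (RatFunc ℝ) (IntermediateField.adjoin (RatFunc ℝ) S') := by
      refine IntermediateField.finiteDimensional_adjoin fun s hs => ?_
      have hs2 : (s : K) ∈ acl {x} := hS hs
      have hs3 : (s : K) ∈ acl {x⁻¹} := by
        refine acl_subset ?_ hs2
        rintro y rfl
        have := inv_mem_acl (subset_acl {y⁻¹} (Set.mem_singleton (y⁻¹)))
        rwa [inv_inv] at this
      rw [mem_acl_iff] at hs3
      have hs4 : IsAlgebraic ℝ[X] s := by
        have hmem : ∀ p : ℝ[X], aeval x⁻¹ p ∈ Algebra.adjoin ℝ {x⁻¹} := fun p =>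
          aeval_mem_adjoin_singleton ℝ _
        refine IsAlgebraic.of_ringHom_of_comp_eq (S := Algebra.adjoin ℝ {x⁻¹})
          (f := ((aeval (R := ℝ) x⁻¹).codRestrict (Algebra.adjoin ℝ {x⁻¹}) hmem : ℝ[X] →+* _))
          (g := (algebraMap E K)) hs3 ?_ Subtype.val_injective ?_
        · rintro ⟨y, hy⟩
          rw [Algebra.adjoin_singleton_eq_range_aeval] at hy
          obtain ⟨p, rfl⟩ := hy
          exact ⟨p, rfl⟩
        · ext p
          · have h1 := congrArg Subtype.val ((aeval (R := ℝ) z).commutes p)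
            simp
            exact h1.symm
          · simp
            rw [hXz]; rfl
      have hs5 : IsAlgebraic (RatFunc ℝ) s := hs4.extendScalars
        (by exact IsFractionRing.injective ℝ[X] (RatFunc ℝ))
      exact hs5.isIntegral
    rw [htop] at hfin
    exact Module.Finite.equiv (IntermediateField.topEquiv (F := RatFunc ℝ) (E := E)).toLinearEquiv
  obtain ⟨v, h1, h2, h3, h4⟩ := FunctionField.exists_place (k := ℝ) (L := E) tE (by rw [hXz, htz])
  refine ⟨E, tE, v, hSE, htE', h1, ?_, h3, h4⟩
  intro f hf
  obtain rfl : f = X := Subtype.ext hf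
  rw [hXz, hz, map_inv₀] at h2
  have : v X ≠ 0 := (Valuation.ne_zero_iff _).2 hX0
  exact (inv_lt_one₀ (zero_lt_iff.2 this)).1 h2

end DifferentialField

/-! ### Elimination in the complex Riccati equation -/

namespace DifferentialField

open Polynomial WithZero

variable {K : Type*} [Field K] [Algebra ℝ K]

/-- A real valuation on a differential field over `ℝ` which is compatible with the derivation. -/
structure IsCompatible (t : Derivation ℝ K K) (v : Valuation K ℤᵐ⁰) : Prop where
  const : ∀ r : ℝ, r ≠ 0 → v (algebraMap ℝ K r) = 1
  le : ∀ f, v (t f) ≤ v f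
  lt_one : ∀ f, v f ≤ 1 → v (t f) < 1

theorem derivation_ofNat (t : Derivation ℝ K K) (n : ℕ) [n.AtLeastTwo] :
    t (ofNat(n) : K) = 0 := by
  rw [← Nat.cast_ofNat, Derivation.map_natCast]

/-- Either an element satisfying a polynomial equation is constant, or the polynomial vanishes. -/
theorem derivation_eq_zero_or (t : Derivation ℝ K K) {y : K} (P : ℝ[X]) (h : aeval y P = 0) :
    t y = 0 ∨ ∀ a : ℝ, P.eval a = 0 := by
  by_cases hP : P = 0
  · right; intro a; rw [hP, eval_zero]
  · left; exact derivation_eq_zero_of_isAlgebraic t ⟨P, hP, h⟩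

section Riccati

/-! ### The Riccati equation `tA = s + c² - (N-1)A - A²`, `tc = c(1-N-2A) + D`, with `u = N + 2A`
and `δ = D/c` -/

variable {t : Derivation ℝ K K} {N : ℝ} {A c s D u δ : K}

/-- The form in which the Riccati equation is used: `4 (s + c²)` is expressed by `u` and `t u`, so
that applying `t - 2` will remove `s`. -/
theorem riccati_four_mul (hA : t A = s + c ^ 2 - (algebraMap ℝ K N - 1) * A - A ^ 2)
    (hu : u = algebraMap ℝ K N + 2 * A) :
    4 * (s + c ^ 2) = 2 * t u + u ^ 2 - 2 * u + algebraMap ℝ K N * (2 - algebraMap ℝ K N) := by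
  have h1 : t u = 2 * t A := by
    rw [hu, map_add, Derivation.map_algebraMap, Derivation.leibniz, derivation_ofNat]
    simp
  rw [h1, hA, hu]; ring

/-- Logarithmic derivative of the quotient `D / c`: `D` contributes `2` and `c` contributes `1 - u +
δ`. -/
theorem riccati_delta (hc : t c = c * (1 - u) + D) (hD : t D = 2 * D) (hc0 : c ≠ 0)
    (hδ : D = c * δ) : t δ = δ * (1 + u - δ) := by
  have h1 := hD
  rw [hδ, Derivation.leibniz, hc, smul_eq_mul, smul_eq_mul, hδ] at h1
  have h2 : c * (t δ) = c * (δ * (1 + u - δ)) := by linear_combination h1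
  exact mul_left_cancel₀ hc0 h2

/-- Since `t s = 2 s`, the operator `t - 2` kills `s` and leaves `8 c (t c - c)`. -/
theorem riccati_diff (hs : t s = 2 * s) (hc : t c = c * (1 - u) + D) (hδ : D = c * δ) {P : K}
    (hP : 4 * (s + c ^ 2) = P) : t P - 2 * P = 8 * c ^ 2 * (δ - u) := by
  rw [← hP, Derivation.leibniz, derivation_ofNat, map_add, Derivation.leibniz_pow, hs, hc, hδ]
  simp only [smul_eq_mul, nsmul_eq_mul]
  push_cast
  ring

/-- The logarithmic derivative of `Y` involves `c` only through `t c / c = 1 - u + δ`, so `c` is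
eliminated. The factor `δ - u` clears the denominator. -/
theorem riccati_diff_diff (hc : t c = c * (1 - u) + D) (hδ : D = c * δ) {Y : K}
    (hY : Y = 8 * c ^ 2 * (δ - u)) :
    t Y * (δ - u) = Y * (2 * (1 - u + δ) * (δ - u) + t δ - t u) := by
  rw [hY, Derivation.leibniz, Derivation.leibniz, derivation_ofNat, Derivation.leibniz_pow, map_sub,
    hc, hδ]
  simp only [smul_eq_mul, nsmul_eq_mul]
  push_cast
  ring

/-- A nonzero `c` with `tc = 2c` excludes that `s + c²` is constant. -/
theorem riccati_const_false [CharZero K] (hs : t s = 2 * s) (hc : t c = 2 * c) (hc0 : c ≠ 0)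
    (h : t (s + c ^ 2) = 0) : False := by
  have h1 : 2 * s + 4 * c ^ 2 = 0 := by
    rw [map_add, Derivation.leibniz_pow, hs, hc] at h
    simp only [smul_eq_mul, nsmul_eq_mul] at h
    push_cast at h
    linear_combination h
  have h2 : t (2 * s + 4 * c ^ 2) = 4 * s + 16 * c ^ 2 := by
    simp only [map_add, Derivation.leibniz, Derivation.leibniz_pow, hs, hc, derivation_ofNat,
      smul_eq_mul, nsmul_eq_mul]
    push_cast
    ring
  rw [h1, map_zero] at h2
  have h3 : 8 * c ^ 2 = 0 := by linear_combination -2 * h1 - h2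
  exact hc0 (by simpa using h3)

/-- The final contradiction when `u` is constant, `δ = 0`. -/
theorem riccati_stationary_false [CharZero K] (hreal : ∀ f g : K, f ^ 2 + g ^ 2 = 0 → f = 0)
    (hs : t s = 2 * s) (hc : t c = c * (1 - u)) (hc0 : c ≠ 0) (hu0 : u ≠ 0) (hu : t u = 0)
    (h4 : 4 * (s + c ^ 2) = 2 * t u + u ^ 2 - 2 * u + algebraMap ℝ K N * (2 - algebraMap ℝ K N)) :
    False := by
  have hdP := riccati_diff (D := 0) (δ := 0) hs (by rw [hc, add_zero]) (by ring) h4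
  have hP : t (2 * t u + u ^ 2 - 2 * u + algebraMap ℝ K N * (2 - algebraMap ℝ K N)) = 0 := by
    simp [Derivation.leibniz_pow, hu, derivation_ofNat]
  have hcc : t (8 * c ^ 2 * u) = 0 := by
    have : 8 * c ^ 2 * u
        = 2 * (2 * t u + u ^ 2 - 2 * u + algebraMap ℝ K N * (2 - algebraMap ℝ K N)) := by
      linear_combination hdP - hP
    rw [this, Derivation.leibniz, hP, derivation_ofNat]; simp
  have h1 : c ^ 2 * u * (1 - u) = 0 := by
    simp only [Derivation.leibniz, Derivation.leibniz_pow, hc, hu, derivation_ofNat,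
      smul_eq_mul, nsmul_eq_mul] at hcc
    push_cast at hcc
    linear_combination hcc / 16
  have h2 : u = 1 := by
    rcases mul_eq_zero.1 h1 with h | h
    · exact absurd h (mul_ne_zero (pow_ne_zero _ hc0) hu0)
    · linear_combination -h
  have hs0 : s = 0 := by
    have : t (4 * (s + c ^ 2)) = 8 * s := by
      simp only [map_add, Derivation.leibniz, Derivation.leibniz_pow, hs, hc, derivation_ofNat, h2,
        smul_eq_mul, nsmul_eq_mul]
      push_cast
      ring
    rw [h4, hP] at this
    simpa using this.symm
  -- With `u = 1` and `s = 0` the Riccati relation is a vanishing sum of two squares, which formal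
  -- reality excludes for `c ≠ 0`.
  have h5 : (2 * c) ^ 2 + (algebraMap ℝ K N - 1) ^ 2 = 0 := by
    rw [hu, hs0, h2] at h4
    linear_combination h4
  have := hreal _ _ h5
  exact hc0 (by simpa using this)

/-- Boundedness of `u` and `δ` at a place over `x = ∞` is impossible. -/
theorem riccati_bounded_false {v : Valuation K ℤᵐ⁰} (hv : IsCompatible t v) {x : K} {e d : ℝ}
    (hx : 1 < v x) (hd : d ≠ 0) (hδ : algebraMap ℝ K d * x ^ 2 = c * δ)
    (h4 : 4 * (algebraMap ℝ K e * x ^ 2 + c ^ 2)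
      = 2 * t u + u ^ 2 - 2 * u + algebraMap ℝ K N * (2 - algebraMap ℝ K N))
    (hvu : v u ≤ 1) (hvδ : v δ ≤ 1) : False := by
  have hconst : ∀ r : ℝ, v (algebraMap ℝ K r) ≤ 1 := fun r => by
    by_cases hr : r = 0
    · simp [hr]
    · exact (hv.const r hr).le
  have hnat : ∀ (n : ℕ) [n.AtLeastTwo], v (OfNat.ofNat n : K) ≤ 1 := fun n _ => by
    have := hconst (OfNat.ofNat n)
    rwa [map_ofNat] at this
  have hvx0 : v x ≠ 0 := (zero_lt_one.trans hx).ne'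
  have hcx : v x ^ 2 ≤ v c := by
    have h1 := congrArg v hδ
    rw [map_mul, map_mul, hv.const d hd, one_mul, map_pow] at h1
    rw [h1]
    exact mul_le_of_le_one_right' hvδ
  -- Since `v c ≥ v x ^ 2` and `x` has a pole, `c ^ 2` dominates `e x ^ 2`. The left side of `h4`
  -- then has a pole, while the right side is integral.
  have hc1 : v (algebraMap ℝ K e * x ^ 2) < v (c ^ 2) := by
    rw [map_mul, map_pow, map_pow]
    calc v (algebraMap ℝ K e) * v x ^ 2 ≤ v x ^ 2 := mul_le_of_le_one_left' (hconst e)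
      _ < (v x ^ 2) ^ 2 := by
        have h1 : 1 < v x ^ 2 := one_lt_pow₀ hx two_ne_zero
        exact lt_self_pow₀ h1 one_lt_two
      _ ≤ v c ^ 2 := by gcongr
  have h2 : v (4 * (algebraMap ℝ K e * x ^ 2 + c ^ 2)) = v c ^ 2 := by
    have h4' : v (4 : K) = 1 := by
      have := hv.const 4 (by norm_num)
      rwa [map_ofNat] at this
    rw [map_mul, h4', one_mul, Valuation.map_add_eq_of_lt_right v hc1, map_pow]
  have h3 : v (4 * (algebraMap ℝ K e * x ^ 2 + c ^ 2)) ≤ 1 := by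
    rw [h4, ← Valuation.mem_integer_iff]
    have m1 : u ∈ v.integer := hvu
    have m2 : t u ∈ v.integer := (hv.lt_one u hvu).le
    have m3 : (2 : K) ∈ v.integer := hnat 2
    have m4 : algebraMap ℝ K N ∈ v.integer := hconst N
    exact add_mem (sub_mem (add_mem (mul_mem m3 m2) (pow_mem m1 2)) (mul_mem m3 m1))
      (mul_mem m4 (sub_mem m3 m4))
  rw [h2] at h3
  have h5 : 1 < v c ^ 2 := by
    have h1 : 1 < v x ^ 2 := one_lt_pow₀ hx two_ne_zero
    exact one_lt_pow₀ (h1.trans_le hcx) two_ne_zero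
  exact absurd h3 h5.not_ge

/-- A place over `x = ∞` for the Riccati equation with a polynomial relation between `u`, `δ`. -/
theorem riccati_exists_place [CharZero K] {x : K} (hx : t x = x) (hx0 : x ≠ 0) {d : ℝ} (hd : d ≠ 0)
    (hc : t c = c * (1 - u + δ)) (hδ : algebraMap ℝ K d * x ^ 2 = c * δ) (hδt : t δ = δ * (1 + u - δ))
    (htu : t u ∈ Algebra.adjoin ℝ {u, δ}) (hne : δ - u ≠ 0)
    (hY : ∃ Y ∈ Algebra.adjoin ℝ {u, δ}, Y = 8 * c ^ 2 * (δ - u))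
    (R : MvPolynomial (Fin 2) ℝ) (hR : MvPolynomial.aeval ![u, δ] R = 0)
    (hR0 : ∃ a b : ℝ, MvPolynomial.eval ![a, b] R ≠ 0) :
    ∃ (E : IntermediateField ℝ K) (tE : Derivation ℝ E E) (v : Valuation E ℤᵐ⁰),
      IsCompatible tE v ∧ (∀ f : E, (tE f : K) = t f) ∧ (x ∈ E ∧ u ∈ E ∧ δ ∈ E ∧ c ∈ E) ∧
      ∀ f : E, (f : K) = x → 1 < v f := by
  have hadj : ∀ f ∈ Algebra.adjoin ℝ {u, δ}, f ∈ acl {u, δ} := fun f hf => by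
    rw [mem_acl_iff]
    exact isAlgebraic_algebraMap (⟨f, hf⟩ : Algebra.adjoin ℝ {u, δ})
  have hum : u ∈ acl {u, δ} := subset_acl _ (by simp)
  have hδm : δ ∈ acl {u, δ} := subset_acl _ (by simp)
  -- `Y` determines `c ^ 2` over `u, δ`, and then `c δ` determines `x ^ 2`. With the relation `R`
  -- everything is algebraic over `x`.
  have hcm : c ∈ acl {u, δ} := by
    obtain ⟨Y, hY1, hY2⟩ := hY
    have : c ^ 2 = Y / (algebraMap ℝ K 8 * (δ - u)) := by
      rw [hY2, map_ofNat]; field_simp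
    refine of_pow_mem_acl two_pos ?_
    rw [this]
    exact div_mem_acl (hadj _ hY1) (mul_mem_acl (algebraMap_mem_acl _ _) (sub_mem_acl hδm hum))
  have hdK : algebraMap ℝ K d ≠ 0 := by simpa using hd
  have hxm : x ∈ acl {u, δ} := by
    refine of_pow_mem_acl two_pos ?_
    have : x ^ 2 = c * δ / algebraMap ℝ K d := by rw [← hδ]; field_simp
    rw [this]
    exact div_mem_acl (mul_mem_acl hcm hδm) (algebraMap_mem_acl _ _)
  have hxtr : Transcendental ℝ x := fun h => hx0 (by
    rw [← hx]; exact derivation_eq_zero_of_isAlgebraic t h)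
  have hsub := acl_pair_subset hxtr hxm R hR hR0
  have hS : ({x, u, δ, c} : Set K) ⊆ acl {x} := by
    rintro z (rfl | rfl | rfl | rfl)
    · exact subset_acl _ rfl
    · exact hsub hum
    · exact hsub hδm
    · exact hsub hcm
  set F := IntermediateField.adjoin ℝ ({x, u, δ, c} : Set K) with hF
  have hSF : ({x, u, δ, c} : Set K) ⊆ F := IntermediateField.subset_adjoin _ _
  have mx : x ∈ F := hSF (by simp)
  have mu : u ∈ F := hSF (by simp)
  have mδ : δ ∈ F := hSF (by simp)
  have mc : c ∈ F := hSF (by simp)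
  have hadjF : Algebra.adjoin ℝ {u, δ} ≤ F.toSubalgebra := by
    refine Algebra.adjoin_le ?_
    rintro z (rfl | rfl)
    · exact mu
    · exact mδ
  obtain ⟨E, tE, v, h1, h2, h3, h4, h5, h6⟩ := exists_place t hx0 hx ({x, u, δ, c} : Set K) hS
    (by simp) (by
      rintro z (rfl | rfl | rfl | rfl)
      · rw [hx]; exact mx
      · exact hadjF htu
      · rw [hδt]; exact mul_mem mδ (sub_mem (add_mem (one_mem _) mu) mδ)
      · rw [hc]; exact mul_mem mc (add_mem (sub_mem (one_mem _) mu) mδ))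
  exact ⟨E, tE, v, ⟨h3, h5, h6⟩, h2, ⟨h1 (by simp), h1 (by simp), h1 (by simp), h1 (by simp)⟩, h4⟩

end Riccati

end DifferentialField

/-! ### The polynomial relation between `u` and `δ` -/

namespace DifferentialField

open Polynomial WithZero

variable {K : Type*} [Field K] [Algebra ℝ K]

section Riccati

variable {t : Derivation ℝ K K} {N : ℝ} {A c s D u δ : K}

/-- The derivation of `ℝ[u, δ]` with `tu = F`, `tδ = δ(1+u-δ)`. -/
noncomputable def pairDerivation (F : MvPolynomial (Fin 2) ℝ) :
    Derivation ℝ (MvPolynomial (Fin 2) ℝ) (MvPolynomial (Fin 2) ℝ) :=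
  MvPolynomial.mkDerivation ℝ
    ![F, MvPolynomial.X 1 * (1 + MvPolynomial.X 0 - MvPolynomial.X 1)]

theorem pairDerivation_X_zero (F : MvPolynomial (Fin 2) ℝ) :
    pairDerivation F (MvPolynomial.X 0) = F := by
  rw [pairDerivation, MvPolynomial.mkDerivation_X]; rfl

theorem pairDerivation_X_one (F : MvPolynomial (Fin 2) ℝ) :
    pairDerivation F (MvPolynomial.X 1)
      = MvPolynomial.X 1 * (1 + MvPolynomial.X 0 - MvPolynomial.X 1) := by
  rw [pairDerivation, MvPolynomial.mkDerivation_X]; rfl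

theorem pairDerivation_C (F : MvPolynomial (Fin 2) ℝ) (r : ℝ) :
    pairDerivation F (MvPolynomial.C r) = 0 := by
  exact MvPolynomial.derivation_C _ _

/-- Evaluation at `(u, δ)` intertwines the two derivations, so iterated derivatives can be computed
formally in the polynomial ring. -/
theorem aeval_pairDerivation {F : MvPolynomial (Fin 2) ℝ}
    (hu : t u = MvPolynomial.aeval ![u, δ] F) (hδ : t δ = δ * (1 + u - δ))
    (p : MvPolynomial (Fin 2) ℝ) :
    t (MvPolynomial.aeval ![u, δ] p) = MvPolynomial.aeval ![u, δ] (pairDerivation F p) := by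
  induction p using MvPolynomial.induction_on with
  | C a => rw [pairDerivation_C, MvPolynomial.aeval_C, Derivation.map_algebraMap, map_zero]
  | add p q hp hq => simp only [map_add, hp, hq]
  | mul_X p i hp =>
    rw [map_mul, Derivation.leibniz, Derivation.leibniz, hp, map_add, MvPolynomial.aeval_X]
    simp only [smul_eq_mul, map_mul, MvPolynomial.aeval_X]
    congr 2
    fin_cases i
    · simp [pairDerivation_X_zero, hu]
    · simp [pairDerivation_X_one, hδ]

/-- `4(s + c²)` as a polynomial in `u`, `δ`. -/
noncomputable def riccatiPotential (N : ℝ) (F : MvPolynomial (Fin 2) ℝ) : MvPolynomial (Fin 2) ℝ :=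
  MvPolynomial.C 2 * F + MvPolynomial.X 0 ^ 2 - MvPolynomial.C 2 * MvPolynomial.X 0
    + MvPolynomial.C (N * (2 - N))

/-- `8c²(δ - u)` as a polynomial in `u`, `δ`. -/
noncomputable def riccatiDefect (N : ℝ) (F : MvPolynomial (Fin 2) ℝ) : MvPolynomial (Fin 2) ℝ :=
  pairDerivation F (riccatiPotential N F) - MvPolynomial.C 2 * riccatiPotential N F

/-- The resulting relation between `u` and `δ`. -/
noncomputable def riccatiRelation (N : ℝ) (F : MvPolynomial (Fin 2) ℝ) : MvPolynomial (Fin 2) ℝ :=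
  pairDerivation F (riccatiDefect N F) * (MvPolynomial.X 1 - MvPolynomial.X 0)
    - riccatiDefect N F * (MvPolynomial.C 2 * (1 - MvPolynomial.X 0 + MvPolynomial.X 1)
      * (MvPolynomial.X 1 - MvPolynomial.X 0)
      + MvPolynomial.X 1 * (1 + MvPolynomial.X 0 - MvPolynomial.X 1) - F)

/-- When `t u` is a polynomial in `u, δ`, eliminating `s` and then `c` yields one relation between
`u` and `δ`. If it is nontrivial, the unknowns are algebraic over `x` and a compatible place exists.
Otherwise its coefficients all vanish, which constrains the parameters. -/
theorem riccati_alternative [CharZero K] {x : K} (hx : t x = x) (hx0 : x ≠ 0) {e d : ℝ}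
    (hd : d ≠ 0)
    (h4 : 4 * (algebraMap ℝ K e * x ^ 2 + c ^ 2)
      = 2 * t u + u ^ 2 - 2 * u + algebraMap ℝ K N * (2 - algebraMap ℝ K N))
    (hc : t c = c * (1 - u) + algebraMap ℝ K d * x ^ 2) (hδ : algebraMap ℝ K d * x ^ 2 = c * δ)
    (hδt : t δ = δ * (1 + u - δ)) {F : MvPolynomial (Fin 2) ℝ}
    (hu : t u = MvPolynomial.aeval ![u, δ] F) (hne : δ - u ≠ 0) :
    (∀ a b : ℝ, MvPolynomial.eval ![a, b] (riccatiRelation N F) = 0) ∨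
    ∃ (E : IntermediateField ℝ K) (tE : Derivation ℝ E E) (v : Valuation E ℤᵐ⁰),
      IsCompatible tE v ∧ (∀ f : E, (tE f : K) = t f) ∧ (x ∈ E ∧ u ∈ E ∧ δ ∈ E ∧ c ∈ E) ∧
      ∀ f : E, (f : K) = x → 1 < v f := by
  by_cases h : ∀ a b : ℝ, MvPolynomial.eval ![a, b] (riccatiRelation N F) = 0
  · exact Or.inl h
  right
  push Not at h
  have hmem : ∀ p : MvPolynomial (Fin 2) ℝ,
      MvPolynomial.aeval ![u, δ] p ∈ Algebra.adjoin ℝ {u, δ} := fun p => by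
    have hr : Set.range ![u, δ] = {u, δ} := by simp [Matrix.range_cons, Set.pair_comm]
    rw [← hr, Algebra.adjoin_range_eq_range_aeval]
    exact ⟨p, rfl⟩
  have h2 : algebraMap ℝ K 2 = 2 := map_ofNat _ 2
  have hP : 4 * (algebraMap ℝ K e * x ^ 2 + c ^ 2)
      = MvPolynomial.aeval ![u, δ] (riccatiPotential N F) := by
    rw [h4, hu, riccatiPotential]; simp [h2]
  have hs : t (algebraMap ℝ K e * x ^ 2) = 2 * (algebraMap ℝ K e * x ^ 2) := by
    simp only [Derivation.leibniz, Derivation.leibniz_pow, Derivation.map_algebraMap, hx,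
      smul_eq_mul, nsmul_eq_mul]
    push_cast; ring
  have hY : MvPolynomial.aeval ![u, δ] (riccatiDefect N F) = 8 * c ^ 2 * (δ - u) := by
    rw [← riccati_diff hs hc hδ hP, aeval_pairDerivation hu hδt, riccatiDefect]
    simp [h2]
  have hR := riccati_diff_diff hc hδ hY
  rw [aeval_pairDerivation hu hδt, hδt, hu] at hR
  refine riccati_exists_place hx hx0 hd (by rw [hc, hδ]; ring) hδ hδt (hu ▸ hmem F) hne
    ⟨_, hmem _, hY⟩ (riccatiRelation N F) ?_ h
  rw [riccatiRelation]
  simp only [map_sub, map_mul, map_add, MvPolynomial.aeval_X, map_one, MvPolynomial.aeval_C, h2]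
  simp only [Matrix.cons_val_zero, Matrix.cons_val_one]
  linear_combination hR

end Riccati

/-- The quadratic form of `tu` in the generic case. -/
noncomputable def pairQuadratic (f₁ f₂ f₃ f₄ f₅ : ℝ) : MvPolynomial (Fin 2) ℝ :=
  MvPolynomial.C f₁ * MvPolynomial.X 0 + MvPolynomial.C f₂ * MvPolynomial.X 1
   + MvPolynomial.C f₃ * MvPolynomial.X 0 ^ 2
   + MvPolynomial.C f₄ * (MvPolynomial.X 0 * MvPolynomial.X 1)
   + MvPolynomial.C f₅ * MvPolynomial.X 1 ^ 2

/-- Here `p` is the potential, `p₁, p₂` its partial derivatives, `y` the defect and `t'` the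
derivative of the defect along the flow `(f, g)`. Instantiating the equations by `rfl` gives
explicit real polynomials in `a, b`, whose coefficients are then extracted by finite differences. -/
theorem eval_riccatiRelation (N f₁ f₂ f₃ f₄ f₅ a b f g p p₁ p₂ y t' : ℝ)
    (hf : f = f₁ * a + f₂ * b + f₃ * a ^ 2 + f₄ * (a * b) + f₅ * b ^ 2)
    (hg : g = b * (1 + a - b))
    (hp : p = 2 * f + a ^ 2 - 2 * a + N * (2 - N))
    (hp₁ : p₁ = 2 * (f₁ + 2 * f₃ * a + f₄ * b) + 2 * a - 2)
    (hp₂ : p₂ = 2 * (f₂ + f₄ * a + 2 * f₅ * b))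
    (hy : y = p₁ * f + p₂ * g - 2 * p)
    (ht : t' = (2 * (2 * f₃ * f + f₄ * g) + 2 * f) * f
      + p₁ * ((f₁ + 2 * f₃ * a + f₄ * b) * f + (f₂ + f₄ * a + 2 * f₅ * b) * g)
      + 2 * (f₄ * f + 2 * f₅ * g) * g
      + p₂ * (g * (1 + a - b) + b * (f - g)) - 2 * (p₁ * f + p₂ * g)) :
    MvPolynomial.eval ![a, b] (riccatiRelation N (pairQuadratic f₁ f₂ f₃ f₄ f₅))
      = t' * (b - a) - y * (2 * (1 - a + b) * (b - a) + g - f) := by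
  have hd (F : MvPolynomial (Fin 2) ℝ) (n : ℕ) : pairDerivation F (n : MvPolynomial (Fin 2) ℝ) = 0 :=
    Derivation.map_natCast _ _
  subst ht hy hp hp₁ hp₂ hg hf
  simp only [riccatiRelation, riccatiDefect, riccatiPotential, map_add, map_sub,
    Derivation.leibniz, Derivation.leibniz_pow, pairDerivation_X_zero, pairDerivation_X_one,
    pairDerivation_C, smul_eq_mul, map_mul, map_pow, MvPolynomial.eval_X, MvPolynomial.eval_C,
    map_one, nsmul_eq_mul, map_zero, Derivation.map_one_eq_zero, map_natCast,
    Matrix.cons_val_zero, Matrix.cons_val_one, pairQuadratic, hd]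
  push_cast
  ring

theorem relation_false (N r : ℝ) (hN : N ≠ 0)
    (h : ∀ a b : ℝ, MvPolynomial.eval ![a, b]
      (riccatiRelation N (pairQuadratic 1 0 (-1) (2 * r) (-(r * (1 + r) / 2)))) = 0) : False := by
  have h' : ∀ a b : ℝ, _ := fun a b => (eval_riccatiRelation N _ _ _ _ _ a b _ _ _ _ _ _ _
    rfl rfl rfl rfl rfl rfl rfl).symm.trans (h a b)
  have hM : N * (2 - N) = 0 := by
    have e1 := h' 0 1
    have e2 := h' 0 2
    have e3 := h' 0 3
    have e4 := h' 0 (-1)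
    have e5 := h' 0 (-2)
    have e6 := h' 0 (-3)
    -- Central differences, exact up to degree six: they isolate the coefficient of `b` at `a = 0`,
    -- which is `6 N (2 - N)`.
    linear_combination (1 / 6) * (3 / 4 * (e1 - e4) - 3 / 20 * (e2 - e5) + 1 / 60 * (e3 - e6))
  have hN2 : N = 2 := by
    rcases mul_eq_zero.1 hM with h | h
    · exact absurd h hN
    · linarith
  subst hN2
  have h5 : ∀ a b : ℝ, r * (r ^ 4 - 5 / 2 * r ^ 3 + 6 * r ^ 2 + 3 / 2 * r - 8) * b ^ 5
      + (-4 * r ^ 4 - 23 * r ^ 2 + 33 * r) * a * b ^ 4 + r * (10 * r ^ 2 + 21 * r - 37) * a ^ 2 * b ^ 3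
      + (-18 * r ^ 2 + 22 * r - 2) * a ^ 3 * b ^ 2 = 0 := by
    intro a b
    have e1 := h' a b
    have e2 := h' (2 * a) (2 * b)
    have e3 := h' (3 * a) (3 * b)
    have e4 := h' (4 * a) (4 * b)
    have e5 := h' (5 * a) (5 * b)
    -- The fifth difference along the ray through `(a, b)` isolates the homogeneous part of degree
    -- five. The value at the origin is zero for `N = 2`.
    linear_combination (1 / 120) * (e5 - 5 * e4 + 10 * e3 - 10 * e2 + 5 * e1)
  have e1 := h5 1 1
  have e2 := h5 (-1) 1
  have e3 := h5 2 1
  have e4 := h5 0 1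
  -- The coefficients of `a² b³` and `a³ b²` have no common real root `r`.
  have c2 : r * (10 * r ^ 2 + 21 * r - 37) = 0 := by linear_combination (e1 + e2 - 2 * e4) / 2
  have c3 : -18 * r ^ 2 + 22 * r - 2 = 0 := by
    linear_combination (e3 - 3 * e1 + 3 * e4 - e2) / 6
  rcases mul_eq_zero.1 c2 with h | h
  · rw [h] at c3; norm_num at c3
  · nlinarith



/-- The pure coefficient of `a ^ 5` is `6` whatever `N` is; a fifth difference at `b = 0` extracts
it. -/
theorem relation_false' (N : ℝ)
    (h : ∀ a b : ℝ, MvPolynomial.eval ![a, b] (riccatiRelation N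
      (pairQuadratic (1 + N / 2) (-(3 * N / 8)) (-(3 / 2)) (27 / 8) (-(15 / 8)))) = 0) : False := by
  have h' : ∀ a b : ℝ, _ := fun a b => (eval_riccatiRelation N _ _ _ _ _ a b _ _ _ _ _ _ _
    rfl rfl rfl rfl rfl rfl rfl).symm.trans (h a b)
  have e0 := h' 0 0
  have e1 := h' 1 0
  have e2 := h' 2 0
  have e3 := h' 3 0
  have e4 := h' 4 0
  have e5 := h' 5 0
  have : (6 : ℝ) = 0 := by
    linear_combination (1 / 120) * (e5 - 5 * e4 + 10 * e3 - 10 * e2 + 5 * e1 - e0)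
  norm_num at this

/-- This quadratic form does not exclude an identically vanishing relation. The surviving parameters
are those for which the defect `8 c² (δ - u)` vanishes as well. -/
theorem relation_eq_zero (N ρ : ℝ)
    (h : ∀ a b : ℝ, MvPolynomial.eval ![a, b] (riccatiRelation N
      (pairQuadratic 1 0 (-ρ) 0 0)) = 0) : N * (2 - N) = 0 ∧ ρ * (1 - 2 * ρ) = 0 := by
  have h' : ∀ a b : ℝ, _ := fun a b => (eval_riccatiRelation N _ _ _ _ _ a b _ _ _ _ _ _ _
    rfl rfl rfl rfl rfl rfl rfl).symm.trans (h a b)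
  have hM : N * (2 - N) = 0 := by
    have e1 := h' 0 1
    linear_combination (1 / 8) * e1
  refine ⟨hM, ?_⟩
  have e0 := h' 1 0
  have e1 := h' 1 1
  have e2 := h' 1 (-1)
  linear_combination (1 / 4) * (e1 + e2 - 2 * e0) - hM

-- Vanishing of the phase by integrality at a place

end DifferentialField

namespace DifferentialField

open Polynomial WithZero

variable {K : Type*} [Field K] [Algebra ℝ K]

local notation "κ" => algebraMap ℝ K

section Place

variable {t : Derivation ℝ K K} {v : Valuation K ℤᵐ⁰}

theorem IsCompatible.const_le (hv : IsCompatible t v) (r : ℝ) : v (κ r) ≤ 1 := by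
  by_cases hr : r = 0
  · simp [hr]
  · exact (hv.const r hr).le

theorem IsCompatible.ofNat_le (hv : IsCompatible t v) (n : ℕ) [n.AtLeastTwo] :
    v (ofNat(n) : K) ≤ 1 := by
  have := hv.const_le (OfNat.ofNat n)
  rwa [map_ofNat] at this

/-- `g` is the logarithmic derivative of `w`. Each unknown with an equation `t w = w g` thus bounds
a linear form in the unknowns at the place. -/
theorem IsCompatible.le_one_of_eq_mul (hv : IsCompatible t v) {w g : K} (hw : w ≠ 0)
    (h : t w = w * g) : v g ≤ 1 := by
  have h1 := hv.le w
  rw [h, map_mul] at h1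
  have h2 : v w ≠ 0 := (Valuation.ne_zero_iff _).2 hw
  exact (mul_le_iff_le_one_right (zero_lt_iff.2 h2)).1 h1

/-- The sharper form for a unit `w`: its logarithmic derivative even lies in the maximal ideal. -/
theorem IsCompatible.lt_one_of_eq_mul (hv : IsCompatible t v) {w g : K} (hw : v w = 1)
    (h : t w = w * g) : v g < 1 := by
  have h1 := hv.lt_one w hw.le
  rwa [h, map_mul, hw, one_mul] at h1

theorem IsCompatible.of_const_mul_le (hv : IsCompatible t v) {r : ℝ} (hr : r ≠ 0) {f : K}
    (h : v (κ r * f) ≤ 1) : v f ≤ 1 := by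
  rwa [map_mul, hv.const r hr, one_mul] at h

end Place

section Riccati

variable {t : Derivation ℝ K K} {N : ℝ} {A c s D u δ w x : K}

theorem derivation_const_mul_sq (hx : t x = x) (e : ℝ) :
    t (κ e * x ^ 2) = 2 * (κ e * x ^ 2) := by
  simp only [Derivation.leibniz, Derivation.leibniz_pow, Derivation.map_algebraMap, hx,
    smul_eq_mul, nsmul_eq_mul]
  push_cast; ring

theorem aeval_pairQuadratic (f₁ f₂ f₃ f₄ f₅ : ℝ) (u δ : K) :
    MvPolynomial.aeval ![u, δ] (pairQuadratic f₁ f₂ f₃ f₄ f₅)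
      = κ f₁ * u + κ f₂ * δ + κ f₃ * u ^ 2 + κ f₄ * (u * δ) + κ f₅ * δ ^ 2 := by
  simp only [pairQuadratic, map_add, map_mul, map_pow, MvPolynomial.aeval_C, MvPolynomial.aeval_X,
    Matrix.cons_val_zero, Matrix.cons_val_one]

variable [CharZero K]

/-- The phase of `h₁` vanishes in the case `p = 2q`, `h₂` imaginary, when `w ≠ 0`. -/
theorem eq_zero_of_log_deriv (hreal : ∀ f g : K, f ^ 2 + g ^ 2 = 0 → f = 0) (hx : t x = x)
    (hx0 : x ≠ 0) {e d r : ℝ} (hN : N ≠ 0) (hr : r ≠ 1)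
    (h4 : 4 * (κ e * x ^ 2 + c ^ 2) = 2 * t u + u ^ 2 - 2 * u + κ N * (2 - κ N))
    (hc : t c = c * (1 - u) + κ d * x ^ 2) (hw0 : w ≠ 0) (hw : t w = w * (1 + u - w))
    (hwd : κ r * (κ d * x ^ 2) = c * (2 * u - w)) : c = 0 := by
  by_contra hc0
  have hs := derivation_const_mul_sq hx e
  by_cases hd : d = 0
  · subst hd
    have hwu : w = 2 * u := by
      have : c * (2 * u - w) = 0 := by rw [← hwd]; simp
      linear_combination -(mul_eq_zero.1 this).resolve_left hc0
    have hu0 : u ≠ 0 := fun h => hw0 (by rw [hwu, h, mul_zero])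
    have htu : t u = u * (1 - u) := by
      rw [hwu, Derivation.leibniz, derivation_ofNat] at hw
      simp only [smul_eq_mul] at hw
      have : (2 : K) * t u = 2 * (u * (1 - u)) := by linear_combination hw
      exact mul_left_cancel₀ two_ne_zero this
    have hc' : t c = c * (1 - u) := by rw [hc]; simp
    have h5 := riccati_diff (D := 0) (δ := 0) hs (by rw [hc', add_zero]) (by ring) h4
    have h6 : t (2 * t u + u ^ 2 - 2 * u + κ N * (2 - κ N)) = -2 * u * t u := by
      rw [htu]
      simp only [map_add, map_sub, Derivation.leibniz, Derivation.leibniz_pow, htu,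
        derivation_ofNat, Derivation.map_algebraMap, Derivation.map_one_eq_zero, smul_eq_mul,
        nsmul_eq_mul]
      push_cast
      ring
    rw [h6, htu] at h5
    have h7 : 4 * c ^ 2 * u + u ^ 3 - κ N * (2 - κ N) = 0 := by
      linear_combination h5 / 2
    have h8 := congrArg t h7
    simp only [map_add, map_sub, Derivation.leibniz, Derivation.leibniz_pow, htu, hc',
        derivation_ofNat, Derivation.map_algebraMap, smul_eq_mul, nsmul_eq_mul, map_zero] at h8
    push_cast at h8
    -- The derivative of `h7` factors, with a sum of squares as last factor.
    have h9 : u * (1 - u) * ((2 * c) ^ 2 + u ^ 2) = 0 := by linear_combination h8 / 3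
    rcases mul_eq_zero.1 h9 with h | h
    · have htu0 : t u = 0 := by rw [htu, h]
      exact riccati_stationary_false hreal hs hc' hc0 hu0 htu0 h4
    · exact hc0 (by simpa using hreal _ _ h)
  · obtain ⟨δ, hD⟩ : ∃ δ, κ d * x ^ 2 = c * δ := ⟨κ d * x ^ 2 / c, by field_simp⟩
    have hdK : κ d ≠ 0 := by simpa using hd
    have hδ0 : δ ≠ 0 := by
      rintro rfl
      rw [mul_zero] at hD
      exact mul_ne_zero hdK (pow_ne_zero _ hx0) hD
    have hδt := riccati_delta hc (derivation_const_mul_sq hx d) hc0 hD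
    have hw' : w = 2 * u - κ r * δ := by
      rw [hD] at hwd
      have : c * (κ r * δ) = c * (2 * u - w) := by linear_combination hwd
      linear_combination mul_left_cancel₀ hc0 this
    have htu : t u = u - u ^ 2 + 2 * κ r * u * δ - κ r * (1 + κ r) / 2 * δ ^ 2 := by
      have h1 := hw
      rw [hw', map_sub, Derivation.leibniz, Derivation.leibniz, derivation_ofNat,
        Derivation.map_algebraMap, hδt] at h1
      simp only [smul_eq_mul] at h1
      linear_combination h1 / 2
    have hrK : κ r ≠ 1 := by
      intro h; exact hr ((algebraMap ℝ K).injective (by rw [h, map_one]))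
    -- If `δ = u`, the equations for `t δ` and `t u` give `(r - 1)(r - 2) = 0`, and `r = 2` would
    -- mean `w = 2u - 2δ = 0`.
    by_cases hne : δ - u = 0
    · have hδu : δ = u := by linear_combination hne
      have h1 := htu
      rw [← hδu, hδt] at h1
      have h2 : (κ r - 1) * (κ r - 2) = 0 := by
        have : δ ^ 2 * ((κ r - 1) * (κ r - 2)) = 0 := by linear_combination 2 * h1 + 2 * δ * hδu
        exact (mul_eq_zero.1 this).resolve_left (pow_ne_zero _ hδ0)
      rcases mul_eq_zero.1 h2 with h | h
      · exact hrK (by linear_combination h)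
      · apply hw0
        rw [hw', ← hδu]
        linear_combination -δ * h
    · have h2 : κ 2 = 2 := map_ofNat _ 2
      have htu' : t u = MvPolynomial.aeval ![u, δ]
          (pairQuadratic 1 0 (-1) (2 * r) (-(r * (1 + r) / 2))) := by
        rw [aeval_pairQuadratic, htu]
        simp only [map_one, map_zero, map_neg, map_mul, map_div₀, map_add, h2]
        ring
      rcases riccati_alternative hx hx0 hd h4 hc hD hδt htu' hne with h | h
      · exact relation_false N r hN h
      · obtain ⟨E, tE, v, hv, htE, ⟨mx, mu, mδ, mc⟩, hvx⟩ := h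
        let u' : E := ⟨u, mu⟩
        let δ' : E := ⟨δ, mδ⟩
        let c' : E := ⟨c, mc⟩
        let x' : E := ⟨x, mx⟩
        let w' : E := 2 * u' - algebraMap ℝ E r * δ'
        have hw'w : (w' : K) = w := hw'.symm
        have e1 : v (1 + u' - w') ≤ 1 := by
          refine hv.le_one_of_eq_mul (w := w') ?_ ?_
          · intro h; apply hw0; rw [← hw'w, h]; rfl
          · refine Subtype.ext ?_
            rw [htE, hw'w, hw, ← hw'w]; rfl
        have e2 : v (1 + u' - δ') ≤ 1 := by
          refine hv.le_one_of_eq_mul (w := δ') ?_ ?_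
          · intro h; exact hδ0 (congrArg Subtype.val h)
          · refine Subtype.ext ?_
            rw [htE]; exact hδt
        -- The logarithmic derivatives `1 + u - w` and `1 + u - δ` are integral. Since `w = 2u - r
        -- δ`, a combination of them is `(r - 1) u`, so `u` and then `δ` are bounded.
        have hrv : v (algebraMap ℝ E (r - 1) * u') ≤ 1 := by
          have : algebraMap ℝ E (r - 1) * u' = (1 + u' - w') - 1
              + algebraMap ℝ E r * ((1 + u' - δ') - 1) := by
            simp only [w', map_sub, map_one]; ring
          rw [this, ← Valuation.mem_integer_iff]
          exact add_mem (sub_mem e1 (one_mem _)) (mul_mem (hv.const_le r) (sub_mem e2 (one_mem _)))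
        have e3 : v u' ≤ 1 := hv.of_const_mul_le (sub_ne_zero.2 hr) hrv
        have e4 : v δ' ≤ 1 := by
          have : δ' = 1 + u' - (1 + u' - δ') := by ring
          rw [this, ← Valuation.mem_integer_iff]
          exact sub_mem (add_mem (one_mem _) e3) e2
        refine riccati_bounded_false hv (x := x') (c := c') (u := u') (δ := δ') (e := e) (N := N)
          (hvx _ rfl) hd (Subtype.ext (by exact hD)) (Subtype.ext ?_) e3 e4
        rw [show ((2 * tE u' + u' ^ 2 - 2 * u' + algebraMap ℝ E N * (2 - algebraMap ℝ E N) : E) : K)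
          = 2 * (tE u' : K) + u ^ 2 - 2 * u + κ N * (2 - κ N) from rfl, htE]
        exact h4

/-- The phase of `h₁` vanishes in the case `p = q`, `h₂` imaginary, when `w ≠ 0` and `q ≠ 2`. -/
theorem eq_zero_of_logistic (hreal : ∀ f g : K, f ^ 2 + g ^ 2 = 0 → f = 0) (hx : t x = x)
    (hx0 : x ≠ 0) {e d ρ : ℝ} (hρ : ρ ≠ 0)
    (h4 : 4 * (κ e * x ^ 2 + c ^ 2) = 2 * t u + u ^ 2 - 2 * u + κ N * (2 - κ N))
    (hc : t c = c * (1 - u) + κ d * x ^ 2) (hu0 : u ≠ 0) (htu : t u = u * (1 - κ ρ * u)) :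
    c = 0 := by
  by_contra hc0
  have hs := derivation_const_mul_sq hx e
  have hρK : κ ρ ≠ 0 := by simpa using hρ
  have hdP : t (2 * t u + u ^ 2 - 2 * u + κ N * (2 - κ N))
      - 2 * (2 * t u + u ^ 2 - 2 * u + κ N * (2 - κ N))
      = -2 * (1 - 2 * κ ρ) * κ ρ * u ^ 3 - 2 * (κ N * (2 - κ N)) := by
    rw [htu]
    simp only [map_add, map_sub, Derivation.leibniz, Derivation.leibniz_pow, htu,
      derivation_ofNat, Derivation.map_algebraMap, Derivation.map_one_eq_zero, smul_eq_mul,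
      nsmul_eq_mul]
    push_cast
    ring
  have hP : 2 * t u + u ^ 2 - 2 * u + κ N * (2 - κ N)
      = (1 - 2 * κ ρ) * u ^ 2 + κ N * (2 - κ N) := by rw [htu]; ring
  by_cases hd : d = 0
  · subst hd
    have hc' : t c = c * (1 - u) := by rw [hc]; simp
    have h5 := riccati_diff (D := 0) (δ := 0) hs (by rw [hc', add_zero]) (by ring) h4
    rw [hdP] at h5
    have h7 : (1 - 2 * κ ρ) * κ ρ * u ^ 3 + κ N * (2 - κ N) - 4 * c ^ 2 * u = 0 := by
      linear_combination -h5 / 2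
    have h8 := congrArg t h7
    simp only [map_add, map_sub, Derivation.leibniz, Derivation.leibniz_pow, htu, hc',
        derivation_ofNat, Derivation.map_algebraMap, smul_eq_mul, nsmul_eq_mul, map_zero,
        Derivation.map_one_eq_zero] at h8
    push_cast at h8
    have h9 : 3 * (1 - 2 * κ ρ) * κ ρ * u ^ 3 * (1 - κ ρ * u)
        - ((1 - 2 * κ ρ) * κ ρ * u ^ 3 + κ N * (2 - κ N)) * (3 - (2 + κ ρ) * u) = 0 := by
      linear_combination h8 - (3 - (2 + κ ρ) * u) * h7
    have h2 : κ 2 = 2 := map_ofNat _ 2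
    have h3 : κ 3 = 3 := map_ofNat _ 3
    -- Eliminating `c²` between `h7` and its derivative leaves an equation for `u` alone. Either `u`
    -- is constant, or its coefficients vanish, which leaves `N (2 - N) = 0` with `ρ = 1/2` or `ρ =
    -- 1`.
    rcases derivation_eq_zero_or t (y := u) (C 3 * (1 - C 2 * C ρ) * C ρ * X ^ 3 * (1 - C ρ * X)
        - ((1 - C 2 * C ρ) * C ρ * X ^ 3 + C (N * (2 - N))) * (C 3 - (C 2 + C ρ) * X)) (by
          simp only [map_mul, map_sub, map_add, aeval_C, aeval_X, map_pow, map_one, h2, h3]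
          exact h9) with h | h
    · exact riccati_stationary_false hreal hs hc' hc0 hu0 h h4
    · simp only [eval_mul, eval_sub, eval_add, eval_C, eval_X, eval_pow, eval_one] at h
      have hM : N * (2 - N) = 0 := by linear_combination (-1 / 3) * h 0
      have h10 : (1 - 2 * ρ) * ρ * (1 - ρ) = 0 := by
        linear_combination (1 / 2) * h 1 + (1 / 2) * (3 - (2 + ρ)) * hM
      have hMK : κ N * (2 - κ N) = 0 := by
        have := congrArg κ hM
        simpa [h2] using this
      rw [hMK] at h7
      rcases mul_eq_zero.1 h10 with h11 | h11
      · have h12 : (1 - 2 * κ ρ) * κ ρ = 0 := by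
          have := congrArg κ h11
          simpa [h2] using this
        rw [h12] at h7
        have : c ^ 2 * u = 0 := by linear_combination -h7 / 4
        exact (mul_ne_zero (pow_ne_zero _ hc0) hu0) this
      · have h12 : κ ρ = 1 := by
          have : ρ = 1 := by linarith
          rw [this, map_one]
        rw [h12] at h7
        have h13 : (2 * c) ^ 2 + u ^ 2 = 0 := by
          have : u * ((2 * c) ^ 2 + u ^ 2) = 0 := by linear_combination -h7
          exact (mul_eq_zero.1 this).resolve_left hu0
        exact hc0 (by simpa using hreal _ _ h13)
  · obtain ⟨δ, hD⟩ : ∃ δ, κ d * x ^ 2 = c * δ := ⟨κ d * x ^ 2 / c, by field_simp⟩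
    have hdK : κ d ≠ 0 := by simpa using hd
    have hδ0 : δ ≠ 0 := by
      rintro rfl
      rw [mul_zero] at hD
      exact mul_ne_zero hdK (pow_ne_zero _ hx0) hD
    have hδt := riccati_delta hc (derivation_const_mul_sq hx d) hc0 hD
    by_cases hne : δ - u = 0
    · have hδu : δ = u := by linear_combination hne
      rw [hδu, htu] at hδt
      have : u ^ 2 * κ ρ = 0 := by linear_combination -hδt
      exact (mul_ne_zero (pow_ne_zero _ hu0) hρK) this
    · have htu' : t u = MvPolynomial.aeval ![u, δ] (pairQuadratic 1 0 (-ρ) 0 0) := by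
        rw [aeval_pairQuadratic, htu]
        simp only [map_one, map_zero, map_neg]
        ring
      rcases riccati_alternative hx hx0 hd h4 hc hD hδt htu' hne with h | h
      -- For these parameters `t - 2` annihilates `4 (s + c²)`, so `c² (δ - u) = 0`.
      · obtain ⟨hM, h1⟩ := relation_eq_zero N ρ h
        have hMK : κ N * (2 - κ N) = 0 := by
          have := congrArg κ hM
          simpa [show κ 2 = 2 from map_ofNat _ 2] using this
        have h1K : κ ρ * (1 - 2 * κ ρ) = 0 := by
          have := congrArg κ h1
          simpa [show κ 2 = 2 from map_ofNat _ 2] using this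
        have h5 := riccati_diff hs hc hD h4
        rw [hdP, hMK] at h5
        have : c ^ 2 * (δ - u) = 0 := by linear_combination -h5 / 8 - u ^ 3 / 4 * h1K
        exact (mul_ne_zero (pow_ne_zero _ hc0) hne) this
      · obtain ⟨E, tE, v, hv, htE, ⟨mx, mu, mδ, mc⟩, hvx⟩ := h
        let u' : E := ⟨u, mu⟩
        let δ' : E := ⟨δ, mδ⟩
        let c' : E := ⟨c, mc⟩
        let x' : E := ⟨x, mx⟩
        have e1 : v (1 - algebraMap ℝ E ρ * u') ≤ 1 := by
          refine hv.le_one_of_eq_mul (w := u') ?_ ?_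
          · intro h; exact hu0 (congrArg Subtype.val h)
          · refine Subtype.ext ?_
            rw [htE]; exact htu
        have e2 : v (1 + u' - δ') ≤ 1 := by
          refine hv.le_one_of_eq_mul (w := δ') ?_ ?_
          · intro h; exact hδ0 (congrArg Subtype.val h)
          · refine Subtype.ext ?_
            rw [htE]; exact hδt
        have e3 : v u' ≤ 1 := by
          refine hv.of_const_mul_le hρ ?_
          have : algebraMap ℝ E ρ * u' = 1 - (1 - algebraMap ℝ E ρ * u') := by ring
          rw [this, ← Valuation.mem_integer_iff]
          exact sub_mem (one_mem _) e1
        have e4 : v δ' ≤ 1 := by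
          have : δ' = 1 + u' - (1 + u' - δ') := by ring
          rw [this, ← Valuation.mem_integer_iff]
          exact sub_mem (add_mem (one_mem _) e3) e2
        refine riccati_bounded_false hv (x := x') (c := c') (u := u') (δ := δ') (e := e) (N := N)
          (hvx _ rfl) hd (Subtype.ext (by exact hD)) (Subtype.ext ?_) e3 e4
        rw [show ((2 * tE u' + u' ^ 2 - 2 * u' + algebraMap ℝ E N * (2 - algebraMap ℝ E N) : E) : K)
          = 2 * (tE u' : K) + u ^ 2 - 2 * u + κ N * (2 - κ N) from rfl, htE]
        exact h4

end Riccati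

end DifferentialField

/-! ### The phase in the case `p = q = -1` -/

namespace DifferentialField

open Polynomial WithZero

variable {K : Type*} [Field K] [Algebra ℝ K]

local notation "κ" => algebraMap ℝ K

section Riccati

variable {t : Derivation ℝ K K} {N : ℝ} {c u δ ρ x : K}

/-- At a compatible place, the exceptional relation forces `N = 0`. -/
theorem place_false [CharZero K] {v : Valuation K ℤᵐ⁰} (hv : IsCompatible t v) (hx : t x = x) (hvx : 1 < v x)
    {e d : ℝ} (hN : N ≠ 0) (hd : d ≠ 0)
    (h4 : 4 * (κ e * x ^ 2 + c ^ 2) = 2 * t u + u ^ 2 - 2 * u + κ N * (2 - κ N))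
    (hD : κ d * x ^ 2 = c * δ) (hδt : t δ = δ * (1 + u - δ)) (hδ0 : δ ≠ 0)
    (hρ : ρ = (3 * δ - 4 * u) / 2) (hρt : t ρ = ρ * (1 + ρ + (u + κ N) / 2)) : False := by
  have h2 : κ 2 = 2 := map_ofNat _ 2
  have m2 : (2 : K) ∈ v.integer := hv.ofNat_le 2
  have m3 : (3 : K) ∈ v.integer := hv.ofNat_le 3
  have m4 : (4 : K) ∈ v.integer := hv.ofNat_le 4
  have e2 : v (1 + u - δ) ≤ 1 := hv.le_one_of_eq_mul hδ0 hδt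
  have e2' : 1 + u - δ ∈ v.integer := e2
  by_cases hvu : v u ≤ 1
  · have e4 : v δ ≤ 1 := by
      have : δ = 1 + u - (1 + u - δ) := by ring
      rw [this, ← Valuation.mem_integer_iff]
      exact sub_mem (add_mem (one_mem _) hvu) e2
    exact riccati_bounded_false hv hvx hd hD h4 hvu e4
  push Not at hvu
  have hu0 : u ≠ 0 := by rintro rfl; simp at hvu
  have hiu : v u⁻¹ < 1 := by rw [map_inv₀]; exact inv_lt_one_of_one_lt₀ hvu
  -- `δ / u ≡ 1`
  have hg : v (u - δ) ≤ 1 := by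
    have : u - δ = (1 + u - δ) - 1 := by ring
    rw [this, ← Valuation.mem_integer_iff]
    exact sub_mem e2' (one_mem _)
  have hvδ : v δ = v u := by
    have : δ = u - (u - δ) := by ring
    rw [this]
    exact Valuation.map_sub_eq_of_lt_left v (hg.trans_lt hvu)
  have hvδ1 : 1 < v δ := by rw [hvδ]; exact hvu
  have hiδ : v δ⁻¹ < 1 := by rw [map_inv₀]; exact inv_lt_one_of_one_lt₀ hvδ1
  have hiδ' : δ⁻¹ ∈ v.integer := hiδ.le
  have hgδ : v ((u - δ) * δ⁻¹) < 1 := by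
    rw [map_mul]; exact (mul_le_of_le_one_left' hg).trans_lt hiδ
  -- `ρ / δ ≡ -1/2`
  have hσ1 : v (ρ * δ⁻¹) = 1 := by
    have : ρ * δ⁻¹ = κ (-(1 / 2)) - 2 * ((u - δ) * δ⁻¹) := by
      rw [hρ, map_neg, map_div₀, map_one, h2]; field_simp; ring
    rw [this, Valuation.map_sub_eq_of_lt_left v, hv.const _ (by norm_num)]
    rw [hv.const _ (by norm_num), map_mul]
    exact (mul_le_of_le_one_left' m2).trans_lt hgδ
  -- The unit `ρ / δ` has logarithmic derivative `N/2 - (5/2)(u - δ)`.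
  have hσ2 : v (κ (N / 2) - κ (5 / 2) * (u - δ)) < 1 := by
    refine hv.lt_one_of_eq_mul hσ1 ?_
    rw [Derivation.leibniz, Derivation.leibniz_inv, hδt, hρt]
    simp only [smul_eq_mul, map_div₀, h2, map_ofNat κ 5]
    rw [hρ]
    field_simp
    ring
  -- `x / δ` is integral
  obtain ⟨z, hz⟩ : ∃ z, x = δ * z := ⟨x * δ⁻¹, by field_simp⟩
  have hcz : c = κ d * δ * z ^ 2 := by
    have : c * δ = κ d * δ * z ^ 2 * δ := by rw [← hD, hz]; ring
    exact mul_right_cancel₀ hδ0 this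
  have hlhs : 4 * (κ e * z ^ 2 + κ d ^ 2 * z ^ 4) = 1 + (2 * ((u - δ) * δ⁻¹)
      + ((u - δ) * δ⁻¹) ^ 2 + 2 * (t u * u⁻¹) * (u * δ⁻¹) * δ⁻¹ - 2 * (u * δ⁻¹) * δ⁻¹
      + κ N * (2 - κ N) * δ⁻¹ * δ⁻¹) := by
    rw [hz, hcz] at h4
    have h5 : 4 * (κ e * z ^ 2 + κ d ^ 2 * z ^ 4)
        = (2 * t u + u ^ 2 - 2 * u + κ N * (2 - κ N)) * δ⁻¹ * δ⁻¹ := by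
      rw [← h4]; field_simp
    rw [h5]
    field_simp
    ring
  have huδ : u * δ⁻¹ ∈ v.integer := by
    have : u * δ⁻¹ = 1 + (u - δ) * δ⁻¹ := by field_simp; ring
    rw [this]; exact add_mem (one_mem _) hgδ.le
  have htu : t u * u⁻¹ ∈ v.integer := by
    rw [Valuation.mem_integer_iff, map_mul, map_inv₀]
    have h0 : v u ≠ 0 := (zero_lt_one.trans hvu).ne'
    exact mul_inv_le_one_of_le₀ (hv.le u) zero_le
  have mN : κ N ∈ v.integer := hv.const_le N
  have hsmall : v (2 * ((u - δ) * δ⁻¹)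
      + ((u - δ) * δ⁻¹) ^ 2 + 2 * (t u * u⁻¹) * (u * δ⁻¹) * δ⁻¹ - 2 * (u * δ⁻¹) * δ⁻¹
      + κ N * (2 - κ N) * δ⁻¹ * δ⁻¹) < 1 := by
    have s : ∀ a b : K, a ∈ v.integer → v b < 1 → v (a * b) < 1 := fun a b ha hb => by
      rw [map_mul]; exact (mul_le_of_le_one_left' ha).trans_lt hb
    refine Valuation.map_add_lt v (Valuation.map_sub_lt v (Valuation.map_add_lt v
      (Valuation.map_add_lt v ?_ ?_) ?_) ?_) ?_
    · exact s _ _ m2 hgδ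
    · rw [sq]; exact s _ _ hgδ.le hgδ
    · exact s _ _ (mul_mem (mul_mem m2 htu) huδ) hiδ
    · exact s _ _ (mul_mem m2 huδ) hiδ
    · exact s _ _ (mul_mem (mul_mem mN (sub_mem m2 mN)) hiδ') hiδ
  have hval : v (4 * (κ e * z ^ 2 + κ d ^ 2 * z ^ 4)) = 1 := by
    rw [hlhs, Valuation.map_add_eq_of_lt_left v, map_one]
    rw [map_one]; exact hsmall
  -- Since `4 (e z² + d² z⁴) ≡ 1` with `d ≠ 0`, the element `z` has neither a pole nor a zero at the
  -- place.
  have hz1 : v z = 1 := by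
    have md : κ d ∈ v.integer := hv.const_le d
    have me : κ e ∈ v.integer := hv.const_le e
    have hle : v z ≤ 1 := by
      by_contra hcon
      push Not at hcon
      have h1 : v (κ e * z ^ 2) < v (κ d ^ 2 * z ^ 4) := by
        rw [map_mul, map_mul, map_pow, map_pow, map_pow, hv.const d hd, one_pow, one_mul]
        calc v (κ e) * v z ^ 2 ≤ v z ^ 2 := mul_le_of_le_one_left' me
          _ < v z ^ 4 := pow_lt_pow_right₀ hcon (by norm_num)
      have h44 : v (4 : K) = 1 := by
        have := hv.const 4 (by norm_num)
        rwa [map_ofNat] at this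
      rw [map_mul, h44, one_mul, Valuation.map_add_eq_of_lt_right v h1, map_mul, map_pow, map_pow,
        hv.const d hd, one_pow, one_mul] at hval
      exact (one_lt_pow₀ hcon (by norm_num)).ne' hval
    refine le_antisymm hle ?_
    by_contra hcon
    push Not at hcon
    have : v (4 * (κ e * z ^ 2 + κ d ^ 2 * z ^ 4)) < 1 := by
      have hz' : z ∈ v.integer := hle
      have : 4 * (κ e * z ^ 2 + κ d ^ 2 * z ^ 4) = (4 * (κ e * z + κ d ^ 2 * z ^ 3)) * z := by ring
      rw [this, map_mul]
      refine (mul_le_of_le_one_left' ?_).trans_lt hcon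
      exact mul_mem m4 (add_mem (mul_mem me hz') (mul_mem (pow_mem md 2) (pow_mem hz' 3)))
    exact this.ne hval
  -- Now `z = x / δ` is a unit with logarithmic derivative `δ - u`. Together with `hσ2` this puts
  -- the constant `N/2` in the maximal ideal.
  have hzt : v (δ - u) < 1 := by
    refine hv.lt_one_of_eq_mul hz1 ?_
    have h1 := hx
    rw [hz, Derivation.leibniz, hδt] at h1
    simp only [smul_eq_mul] at h1
    have : δ * t z = δ * (z * (δ - u)) := by linear_combination h1
    exact mul_left_cancel₀ hδ0 this
  have hfin : v (κ (N / 2)) < 1 := by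
    have : κ (N / 2) = (κ (N / 2) - κ (5 / 2) * (u - δ)) - κ (5 / 2) * (δ - u) := by ring
    rw [this]
    refine Valuation.map_sub_lt v hσ2 ?_
    rw [map_mul]
    exact (mul_le_of_le_one_left' (hv.const_le _)).trans_lt hzt
  rw [hv.const _ (by simpa using hN)] at hfin
  exact lt_irrefl _ hfin

/-- The phase of `h₁` vanishes in the case `p = q = -1`. -/
theorem eq_zero_of_affine [CharZero K] (hreal : ∀ f g : K, f ^ 2 + g ^ 2 = 0 → f = 0)
    (hx : t x = x) (hx0 : x ≠ 0) {e d : ℝ} (hN : N ≠ 0)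
    (h4 : 4 * (κ e * x ^ 2 + c ^ 2) = 2 * t u + u ^ 2 - 2 * u + κ N * (2 - κ N))
    (hc : t c = c * (1 - u) + κ d * x ^ 2) (hρ0 : ρ ≠ 0)
    (hρt : t ρ = ρ * (1 + ρ + (u + κ N) / 2)) (hρd : 3 * (κ d * x ^ 2) = c * (4 * u + 2 * ρ)) :
    c = 0 := by
  by_contra hc0
  have hs := derivation_const_mul_sq hx e
  have h2 : κ 2 = 2 := map_ofNat _ 2
  have h3 : κ 3 = 3 := map_ofNat _ 3
  by_cases hd : d = 0
  · subst hd
    have hρu : ρ = -2 * u := by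
      have : c * (4 * u + 2 * ρ) = 0 := by rw [← hρd]; simp
      linear_combination (mul_eq_zero.1 this).resolve_left hc0 / 2
    have hu0 : u ≠ 0 := fun h => hρ0 (by rw [hρu, h, mul_zero])
    have htu : t u = u * (1 + κ N / 2 - 3 / 2 * u) := by
      rw [hρu, Derivation.leibniz, map_neg, derivation_ofNat] at hρt
      simp only [smul_eq_mul] at hρt
      linear_combination -hρt / 2
    have hc' : t c = c * (1 - u) := by rw [hc]; simp
    have h5 := riccati_diff (D := 0) (δ := 0) hs (by rw [hc', add_zero]) (by ring) h4
    have hP : 2 * t u + u ^ 2 - 2 * u + κ N * (2 - κ N)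
        = κ N * u - 2 * u ^ 2 + κ N * (2 - κ N) := by rw [htu]; ring
    have hdP : t (κ N * u - 2 * u ^ 2 + κ N * (2 - κ N)) = (κ N - 4 * u) * t u := by
      simp only [map_add, map_sub, Derivation.leibniz, Derivation.leibniz_pow,
        derivation_ofNat, Derivation.map_algebraMap, smul_eq_mul, nsmul_eq_mul]
      push_cast
      ring
    rw [hP, hdP, htu] at h5
    have h7 : (κ N - 4 * u) * (u * (1 + κ N / 2 - 3 / 2 * u))
        - 2 * (κ N * u - 2 * u ^ 2 + κ N * (2 - κ N)) + 8 * c ^ 2 * u = 0 := by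
      linear_combination h5
    have h8 := congrArg t h7
    have h32 : t (3 / 2 * u) = 3 / 2 * t u := by
      rw [show (3 / 2 * u : K) = κ (3 / 2) * u by rw [map_div₀, h2, h3], Derivation.leibniz,
        Derivation.map_algebraMap]
      simp only [smul_eq_mul]
      rw [map_div₀, h2, h3]; ring
    have hN2 : t (κ N / 2) = 0 := by
      rw [show (κ N / 2 : K) = κ (N / 2) by rw [map_div₀, h2], Derivation.map_algebraMap]
    simp only [map_add, map_sub, Derivation.leibniz _ (_ * _) _, Derivation.leibniz _ (κ N) _,
        Derivation.leibniz _ (4 : K) _, Derivation.leibniz _ (2 : K) _,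
        Derivation.leibniz _ (_ - _) _, Derivation.leibniz _ u _, Derivation.leibniz _ (8 : K) _,
        Derivation.leibniz_pow, hc', h32, hN2,
        derivation_ofNat, Derivation.map_algebraMap, smul_eq_mul, nsmul_eq_mul, map_zero,
        Derivation.map_one_eq_zero] at h8
    push_cast at h8
    rw [htu] at h8
    set F := u * (1 + κ N / 2 - 3 / 2 * u) with hF
    have h9 : (-4 * F + (κ N - 4 * u) * (1 + κ N / 2 - 3 * u) - 2 * (κ N - 4 * u)) * F
        - ((κ N - 4 * u) * F - 2 * (κ N * u - 2 * u ^ 2 + κ N * (2 - κ N)))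
          * (3 + κ N / 2 - 7 / 2 * u) = 0 := by
      rw [hF] at h7 h8 ⊢
      linear_combination h8 - (3 + κ N / 2 - 7 / 2 * u) * h7
    have h7' : κ 7 = 7 := map_ofNat _ 7
    have h4' : κ 4 = 4 := map_ofNat _ 4
    rcases derivation_eq_zero_or t (y := u)
      ((-C 4 * (X * (1 + C (N / 2) - C (3 / 2) * X)) + (C N - C 4 * X) * (1 + C (N / 2) - C 3 * X)
        - C 2 * (C N - C 4 * X)) * (X * (1 + C (N / 2) - C (3 / 2) * X))
        - ((C N - C 4 * X) * (X * (1 + C (N / 2) - C (3 / 2) * X))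
          - C 2 * (C N * X - C 2 * X ^ 2 + C (N * (2 - N)))) * (C 3 + C (N / 2) - C (7 / 2) * X)) (by
          simp only [map_mul, map_sub, map_add, map_neg, aeval_C, aeval_X, map_pow, map_one, map_div₀,
            h2, h3, h4', h7']
          rw [← hF]
          linear_combination h9) with h | h
    · exact riccati_stationary_false hreal hs hc' hc0 hu0 h h4
    · simp only [eval_mul, eval_sub, eval_add, eval_neg, eval_C, eval_X, eval_pow, eval_one] at h
      have e0 := h 0
      have e1 := h 1
      have e2 := h 2
      have e3 := h 3
      have e4 := h 4
      -- The fourth difference shows that the coefficient of `u⁴` is `-6` for every `N`, so the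
      -- polynomial is not identically zero.
      have : (6 : ℝ) = 0 := by
        linear_combination -(1 / 24) * (e4 - 4 * e3 + 6 * e2 - 4 * e1 + e0)
      norm_num at this
  · obtain ⟨δ, hD⟩ : ∃ δ, κ d * x ^ 2 = c * δ := ⟨κ d * x ^ 2 / c, by field_simp⟩
    have hdK : κ d ≠ 0 := by simpa using hd
    have hδ0 : δ ≠ 0 := by
      rintro rfl
      rw [mul_zero] at hD
      exact mul_ne_zero hdK (pow_ne_zero _ hx0) hD
    have hδt := riccati_delta hc (derivation_const_mul_sq hx d) hc0 hD
    have hρ : ρ = (3 * δ - 4 * u) / 2 := by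
      have : c * (3 * δ) = c * (4 * u + 2 * ρ) := by rw [← hρd, hD]; ring
      linear_combination -mul_left_cancel₀ hc0 this / 2
    have htu : 4 * t u = 3 * (δ * (1 + u - δ)) - 2 * t ρ := by
      have h1 : 2 * ρ = 3 * δ - 4 * u := by rw [hρ]; ring
      have h5 := congrArg t h1
      simp only [map_sub, Derivation.leibniz, derivation_ofNat, smul_eq_mul, hδt] at h5
      linear_combination h5
    rw [hρt, hρ] at htu
    by_cases hne : δ - u = 0
    · have hδu : δ = u := by linear_combination hne
      rw [hδu] at hδt htu hδ0
      have : u * κ N = 0 := by linear_combination -2 * htu + 8 * hδt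
      exact mul_ne_zero hδ0 (by simpa using hN) this
    · have h8 : κ 8 = 8 := map_ofNat _ 8
      have h27 : κ 27 = 27 := map_ofNat _ 27
      have h15 : κ 15 = 15 := map_ofNat _ 15
      have htu' : t u = MvPolynomial.aeval ![u, δ] (pairQuadratic (1 + N / 2) (-(3 * N / 8))
          (-(3 / 2)) (27 / 8) (-(15 / 8))) := by
        rw [aeval_pairQuadratic]
        simp only [map_one, map_neg, map_mul, map_div₀, map_add, h2, h3, h8, h27, h15]
        linear_combination htu / 4
      rcases riccati_alternative hx hx0 hd h4 hc hD hδt htu' hne with h | h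
      · exact relation_false' N h
      · obtain ⟨E, tE, v, hv, htE, ⟨mx, mu, mδ, mc⟩, hvx⟩ := h
        let u' : E := ⟨u, mu⟩
        let δ' : E := ⟨δ, mδ⟩
        let c' : E := ⟨c, mc⟩
        let x' : E := ⟨x, mx⟩
        let ρ' : E := (3 * δ' - 4 * u') / 2
        have hρ' : (ρ' : K) = ρ := hρ.symm
        refine place_false hv (x := x') (c := c') (u := u') (δ := δ') (ρ := ρ') (e := e) (N := N)
          (Subtype.ext (by rw [htE]; exact hx)) (hvx _ rfl) hN hd (Subtype.ext ?_)
          (Subtype.ext (by exact hD)) (Subtype.ext (by rw [htE]; exact hδt))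
          (fun h => hδ0 (congrArg Subtype.val h)) rfl
          (Subtype.ext (by rw [htE, hρ', hρt, ← hρ']; rfl))
        rw [show ((2 * tE u' + u' ^ 2 - 2 * u' + algebraMap ℝ E N * (2 - algebraMap ℝ E N) : E) : K)
          = 2 * (tE u' : K) + u ^ 2 - 2 * u + κ N * (2 - κ N) from rfl, htE]
        exact h4

end Riccati

end DifferentialField

/-! ### The case `p = 2q` with `h₁` real: a conic in `A` and `w` -/

namespace DifferentialField

open Polynomial WithZero

variable {K : Type*} [Field K] [Algebra ℝ K]

local notation "κ" => algebraMap ℝ K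

section Real

variable {t : Derivation ℝ K K} {N r : ℝ} {A s w x : K}

/-- The quadratic form obtained by eliminating `h₂` in the case `p = 2q`. -/
noncomputable def conic {R : Type*} [CommRing R] (N r A w : R) : R :=
  r * w ^ 2 + (-2 * N + (4 * r ^ 2 - 5 * r - 4) * A) * w
    + (N ^ 2 + N + (11 - 4 * r) * N * A + (16 - 8 * r) * A ^ 2)

/-- The equation `h1` and its derivative both contain the unknown amplitude `β²` and the constant
`k`. Combining them as `A * t(h1) - (t A) * h1` removes the terms in `k`, and `β²` then factors out.
-/
theorem conic_relation {X β Z q k : K} (hq : q = 2 - 2 * κ r)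
    (hA : t A = s - (κ N - 1) * A - A ^ 2) (hβ0 : β ≠ 0)
    (hq0 : t q = 0) (hk0 : t k = 0)
    (hZ : Z = t β + κ N * β + (q + 2) * A * β) (hZw : Z = w * β) (hX : X = β ^ 2)
    (hw : t w = w * (1 + κ N + 2 * A - w))
    (h1 : X * (2 * κ r * w - 2 * κ N - 4 * A) = 2 * k * q * A) :
    (2 * κ r * w - 2 * κ N) * s = A * (2 * conic (κ N) (κ r) A w) := by
  have hβt : t β = β * (w - κ N - (q + 2) * A) := by linear_combination hZw - hZ
  have hX0 : X ≠ 0 := by rw [hX]; exact pow_ne_zero _ hβ0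
  have hXt : t X = 2 * X * (w - κ N - (q + 2) * A) := by
    rw [hX, Derivation.leibniz_pow, hβt]
    simp only [smul_eq_mul, nsmul_eq_mul]; push_cast; ring
  have h2 := congrArg t h1
  simp only [Derivation.leibniz, map_sub, derivation_ofNat, Derivation.map_algebraMap, hXt, hw, hk0,
    hq0, smul_eq_mul] at h2
  have h3 : X * ((2 * κ r * w - 2 * κ N) * s - A * (2 * conic (κ N) (κ r) A w)) = 0 := by
    rw [conic]
    rw [hA] at h2
    rw [hq] at h1 h2
    linear_combination -A * h2 + (A * 0 + (s - (κ N - 1) * A - A ^ 2)) * h1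
  linear_combination (mul_eq_zero.1 h3).resolve_left hX0

/-- The case `p = 2q`, `h₁` real, `Ar ≠ 0`. -/
theorem conic_false [CharZero K] (hx : t x = x) (hx0 : x ≠ 0) {e : ℝ} (he : e ≠ 0) (hN : N ≠ 0) (hr : r ≠ 1)
    (hA : t A = κ e * x ^ 2 - (κ N - 1) * A - A ^ 2) (hw0 : w ≠ 0)
    (hw : t w = w * (1 + κ N + 2 * A - w))
    (hrel : (2 * κ r * w - 2 * κ N) * (κ e * x ^ 2) = A * (2 * conic (κ N) (κ r) A w)) : False := by
  have h2 : κ 2 = 2 := map_ofNat _ 2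
  have hNK : κ N ≠ 0 := by simpa using hN
  have heK : κ e ≠ 0 := by simpa using he
  obtain ⟨s, hs⟩ : ∃ s, s = κ e * x ^ 2 := ⟨_, rfl⟩
  have hst : t s = 2 * s := by rw [hs]; exact derivation_const_mul_sq hx e
  have hs0 : s ≠ 0 := by rw [hs]; exact mul_ne_zero heK (pow_ne_zero _ hx0)
  obtain ⟨M, hM⟩ : ∃ M, M = 2 * κ r * w - 2 * κ N := ⟨_, rfl⟩
  rw [← hM, ← hs] at hrel
  rw [← hs] at hA
  have hMt : t M = 2 * κ r * t w := by
    rw [hM]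
    simp only [Derivation.leibniz, map_sub, derivation_ofNat, Derivation.map_algebraMap, smul_eq_mul]
    ring
  -- If `M = 0`, then `w` is constant, hence so are `A` and `s`; but `t s = 2 s` and `s ≠ 0`.
  have hM0 : M ≠ 0 := by
    intro h0
    have h3 : κ r * t w = 0 := by
      rw [h0, map_zero] at hMt
      linear_combination -hMt / 2
    have hrK : κ r ≠ 0 := by
      intro h
      rw [hM, h] at h0
      exact hNK (by linear_combination -h0 / 2)
    have htw := (mul_eq_zero.1 h3).resolve_left hrK
    have h4 : 1 + κ N + 2 * A - w = 0 := by
      rw [hw] at htw; exact (mul_eq_zero.1 htw).resolve_left hw0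
    have htA : t A = 0 := by
      have := congrArg t h4
      simp only [map_add, map_sub, Derivation.leibniz, derivation_ofNat, Derivation.map_algebraMap,
        smul_eq_mul, htw, map_zero, Derivation.map_one_eq_zero] at this
      linear_combination this / 2
    have h5 : s = (κ N - 1) * A + A ^ 2 := by rw [htA] at hA; linear_combination -hA
    have h6 := congrArg t h5
    simp only [map_add, map_sub, Derivation.leibniz, Derivation.leibniz_pow, Derivation.map_algebraMap,
        smul_eq_mul, nsmul_eq_mul, htA, Derivation.map_one_eq_zero, hst] at h6
    exact hs0 (by linear_combination h6 / 2)
  have hA0 : A ≠ 0 := by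
    rintro rfl
    rw [zero_mul] at hrel
    exact mul_ne_zero hM0 hs0 hrel
  -- the relation between `A` and `w`
  obtain ⟨Q, hQ⟩ : ∃ Q, Q = 2 * conic (κ N) (κ r) A w := ⟨_, rfl⟩
  obtain ⟨QA, hQA⟩ : ∃ QA, QA = 2 * ((4 * κ r ^ 2 - 5 * κ r - 4) * w + (11 - 4 * κ r) * κ N
    + 2 * (16 - 8 * κ r) * A) := ⟨_, rfl⟩
  obtain ⟨Qw, hQw⟩ : ∃ Qw, Qw = 2 * (2 * κ r * w + (-2 * κ N + (4 * κ r ^ 2 - 5 * κ r - 4) * A)) :=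
    ⟨_, rfl⟩
  have hQt : t Q = QA * t A + Qw * t w := by
    rw [hQ, conic, hQA, hQw]
    simp only [map_add, map_sub, map_neg, Derivation.leibniz, Derivation.leibniz_pow,
      Derivation.map_algebraMap, derivation_ofNat, smul_eq_mul, nsmul_eq_mul]
    push_cast
    ring
  have hR : Q * (Q - M * (κ N - 1 + A)) + QA * A * (Q - M * (κ N - 1 + A))
      + Qw * M * (w * (1 + κ N + 2 * A - w)) - 2 * κ r * (w * (1 + κ N + 2 * A - w)) * Q
      - 2 * M * Q = 0 := by
    rw [← hQ] at hrel
    have h3 := congrArg t hrel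
    rw [Derivation.leibniz, Derivation.leibniz, hst, hMt, hQt, hw] at h3
    simp only [smul_eq_mul] at h3
    have h4 : M * t A = A * (Q - M * (κ N - 1 + A)) := by rw [hA]; linear_combination hrel
    have h5 : A * (Q * (Q - M * (κ N - 1 + A)) + QA * A * (Q - M * (κ N - 1 + A))
      + Qw * M * (w * (1 + κ N + 2 * A - w)) - 2 * κ r * (w * (1 + κ N + 2 * A - w)) * Q
      - 2 * M * Q) = 0 := by
      linear_combination -M * h3 + (2 * κ r * (w * (1 + κ N + 2 * A - w)) + 2 * M) * hrel
        - (Q + A * QA) * h4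
    exact (mul_eq_zero.1 h5).resolve_left hA0
  let R : MvPolynomial (Fin 2) ℝ :=
    let A := MvPolynomial.X 0
    let w := MvPolynomial.X 1
    let N := MvPolynomial.C N
    let r := MvPolynomial.C r
    let M := 2 * r * w - 2 * N
    let Q := 2 * conic N r A w
    let QA := 2 * ((4 * r ^ 2 - 5 * r - 4) * w + (11 - 4 * r) * N + 2 * (16 - 8 * r) * A)
    let Qw := 2 * (2 * r * w + (-2 * N + (4 * r ^ 2 - 5 * r - 4) * A))
    Q * (Q - M * (N - 1 + A)) + QA * A * (Q - M * (N - 1 + A))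
      + Qw * M * (w * (1 + N + 2 * A - w)) - 2 * r * (w * (1 + N + 2 * A - w)) * Q
      - 2 * M * Q
  have hR' : MvPolynomial.aeval ![A, w] R = 0 := by
    rw [hQ, hQA, hQw, hM, conic] at hR
    simp only [R, conic, map_add, map_sub, map_mul, map_pow, map_neg, map_one, map_ofNat,
      MvPolynomial.aeval_C, MvPolynomial.aeval_X, Matrix.cons_val_zero, Matrix.cons_val_one]
    exact hR
  have hR0 : ∃ a b : ℝ, MvPolynomial.eval ![a, b] R ≠ 0 := by
    by_contra! hcon
    -- At `A = 0` the relation is `-8 N (w - N - 1)² (r w - N)`, which is not identically zero.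
    have h3 : ∀ b : ℝ, N * (b - N - 1) ^ 2 * (r * b - N) = 0 := by
      intro b
      have h4 := hcon 0 b
      simp only [R, conic, map_add, map_sub, map_mul, map_pow, map_neg, map_one, map_ofNat,
        MvPolynomial.eval_C, MvPolynomial.eval_X, Matrix.cons_val_zero, Matrix.cons_val_one] at h4
      linear_combination -h4 / 8
    have h5 : ∀ b : ℝ, b = N + 1 ∨ r * b = N := by
      intro b
      rcases mul_eq_zero.1 (h3 b) with h | h
      · rcases mul_eq_zero.1 h with h | h
        · exact absurd h hN
        · left; have := pow_eq_zero_iff (two_ne_zero) |>.1 h; linarith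
      · right; linarith
    have h6 := h5 (N + 2)
    have h7 := h5 (N + 3)
    have h8 : r * (N + 2) = N := h6.resolve_left (by linarith)
    have h9 : r * (N + 3) = N := h7.resolve_left (by linarith)
    have h10 : r = 0 := by linarith
    rw [h10] at h8
    exact hN (by linarith)
  have hAm : A ∈ acl {A, w} := subset_acl _ (by simp)
  have hwm : w ∈ acl {A, w} := subset_acl _ (by simp)
  have hMm : M ∈ acl {A, w} := by
    rw [hM, ← h2, ← map_mul, ← map_mul]
    exact sub_mem_acl (mul_mem_acl (algebraMap_mem_acl _ _) hwm) (algebraMap_mem_acl _ _)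
  have hQm : Q ∈ acl {A, w} := by
    rw [mem_acl_iff]
    let P : MvPolynomial (Fin 2) ℝ :=
      2 * conic (MvPolynomial.C N) (MvPolynomial.C r) (MvPolynomial.X 0) (MvPolynomial.X 1)
    have hP : MvPolynomial.aeval ![A, w] P = Q := by
      rw [hQ]
      simp only [P, conic, map_add, map_sub, map_mul, map_pow, map_neg, map_ofNat,
        MvPolynomial.aeval_C, MvPolynomial.aeval_X, Matrix.cons_val_zero, Matrix.cons_val_one]
    have hPm : Q ∈ Algebra.adjoin ℝ {A, w} := by
      have hr : Set.range ![A, w] = {A, w} := by simp [Matrix.range_cons, Set.pair_comm]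
      rw [← hr, Algebra.adjoin_range_eq_range_aeval]
      exact ⟨P, hP⟩
    exact isAlgebraic_algebraMap (⟨Q, hPm⟩ : Algebra.adjoin ℝ {A, w})
  have hxm : x ∈ acl {A, w} := by
    refine of_pow_mem_acl two_pos ?_
    have : x ^ 2 = A * Q / (M * κ e) := by
      rw [← hQ] at hrel
      rw [← hrel, hs]; field_simp
    rw [this]
    exact div_mem_acl (mul_mem_acl hAm hQm) (mul_mem_acl hMm (algebraMap_mem_acl _ _))
  have hxtr : Transcendental ℝ x := fun h => hx0 (by
    rw [← hx]; exact derivation_eq_zero_of_isAlgebraic t h)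
  have hsub := acl_pair_subset hxtr hxm R hR' hR0
  have hS : ({x, A, w} : Set K) ⊆ acl {x} := by
    rintro z (rfl | rfl | rfl)
    · exact subset_acl _ rfl
    · exact hsub hAm
    · exact hsub hwm
  set F := IntermediateField.adjoin ℝ ({x, A, w} : Set K) with hF
  have hSF : ({x, A, w} : Set K) ⊆ F := IntermediateField.subset_adjoin _ _
  have mx : x ∈ F := hSF (by simp)
  have mA : A ∈ F := hSF (by simp)
  have mw : w ∈ F := hSF (by simp)
  have mN : κ N ∈ F := F.algebraMap_mem N
  obtain ⟨E, tE, v, i1, i2, i3, i4, i5, i6⟩ := exists_place t hx0 hx ({x, A, w} : Set K) hS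
    (by simp) (by
      rintro z (rfl | rfl | rfl)
      · rw [hx]; exact mx
      · rw [hA, hs]
        exact sub_mem (sub_mem (mul_mem (F.algebraMap_mem e) (pow_mem mx 2))
          (mul_mem (sub_mem mN (one_mem _)) mA)) (pow_mem mA 2)
      · rw [hw]
        exact mul_mem mw (sub_mem (add_mem (add_mem (one_mem _) mN)
          (mul_mem (by rw [← h2]; exact F.algebraMap_mem 2) mA)) mw))
  have hv : IsCompatible tE v := ⟨i3, i5, i6⟩
  let x' : E := ⟨x, i1 (by simp)⟩
  let A' : E := ⟨A, i1 (by simp)⟩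
  let w' : E := ⟨w, i1 (by simp)⟩
  have hvx : 1 < v x' := i4 _ rfl
  have hA' : tE A' = algebraMap ℝ E e * x' ^ 2 - (algebraMap ℝ E N - 1) * A' - A' ^ 2 :=
    Subtype.ext (by rw [i2]; rw [hs] at hA; exact hA)
  have hw' : tE w' = w' * (1 + algebraMap ℝ E N + 2 * A' - w') :=
    Subtype.ext (by rw [i2]; exact hw)
  have hrel' : (2 * algebraMap ℝ E r * w' - 2 * algebraMap ℝ E N) * (algebraMap ℝ E e * x' ^ 2)
      = A' * (2 * conic (algebraMap ℝ E N) (algebraMap ℝ E r) A' w') :=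
    Subtype.ext (by rw [hM, hs] at hrel; exact hrel)
  have hA0' : A' ≠ 0 := fun h => hA0 (congrArg Subtype.val h)
  have hw0' : w' ≠ 0 := fun h => hw0 (congrArg Subtype.val h)
  -- If `A` were integral, the Riccati equation would make `e x²` integral.
  have hvA : 1 < v A' := by
    by_contra! hcon
    have m1 : A' ∈ v.integer := hcon
    have m2 : tE A' ∈ v.integer := (hv.le A').trans hcon
    have m3 : algebraMap ℝ E N ∈ v.integer := hv.const_le N
    have : algebraMap ℝ E e * x' ^ 2 ∈ v.integer := by
      have : algebraMap ℝ E e * x' ^ 2 = tE A' + (algebraMap ℝ E N - 1) * A' + A' ^ 2 := by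
        rw [hA']; ring
      rw [this]
      exact add_mem (add_mem m2 (mul_mem (sub_mem m3 (one_mem _)) m1)) (pow_mem m1 2)
    rw [Valuation.mem_integer_iff, map_mul, hv.const e he, one_mul, map_pow] at this
    exact absurd this (one_lt_pow₀ hvx two_ne_zero).not_ge
  have hva : v A'⁻¹ < 1 := by rw [map_inv₀]; exact inv_lt_one_of_one_lt₀ hvA
  have ma : A'⁻¹ ∈ v.integer := hva.le
  have hvg : v (1 + algebraMap ℝ E N + 2 * A' - w') ≤ 1 := hv.le_one_of_eq_mul hw0' hw'
  obtain ⟨g, hg⟩ : ∃ g, g = 1 + algebraMap ℝ E N + 2 * A' - w' := ⟨_, rfl⟩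
  rw [← hg] at hvg
  have mg : g ∈ v.integer := hvg
  obtain ⟨τ, hτ⟩ : ∃ τ, tE A' = A' * τ := ⟨A'⁻¹ * tE A', by field_simp⟩
  have mτ : τ ∈ v.integer := hv.le_one_of_eq_mul hA0' hτ
  obtain ⟨a, ha⟩ : ∃ a, a = A'⁻¹ := ⟨_, rfl⟩
  have haA : a * A' = 1 := by rw [ha]; field_simp
  have hw2 : w' = 1 + algebraMap ℝ E N + 2 * A' - g := by rw [hg]; ring
  have hse : algebraMap ℝ E e * x' ^ 2 = A' * (τ + algebraMap ℝ E N - 1 + A') := by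
    linear_combination hτ - hA'
  rw [hse] at hrel'
  have hrel2 : (2 * algebraMap ℝ E r * w' - 2 * algebraMap ℝ E N)
      * (τ + algebraMap ℝ E N - 1 + A')
      = 2 * conic (algebraMap ℝ E N) (algebraMap ℝ E r) A' w' := by
    refine mul_left_cancel₀ hA0' ?_
    linear_combination hrel'
  have mN' : algebraMap ℝ E N ∈ v.integer := hv.const_le N
  have mr' : algebraMap ℝ E r ∈ v.integer := hv.const_le r
  have m2 : (2 : E) ∈ v.integer := hv.ofNat_le 2
  have m4 : (4 : E) ∈ v.integer := hv.ofNat_le 4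
  obtain ⟨N', hN'⟩ : ∃ z, z = algebraMap ℝ E N := ⟨_, rfl⟩
  obtain ⟨r', hr'⟩ : ∃ z, z = algebraMap ℝ E r := ⟨_, rfl⟩
  obtain ⟨f, hf⟩ : ∃ f, f = 1 + N' - g := ⟨_, rfl⟩
  rw [← hN'] at hrel2 hw2 mN'
  rw [← hr'] at hrel2 mr'
  have hw3 : w' = 2 * A' + f := by rw [hw2, hf]; ring
  rw [← ha] at ma
  have mf : f ∈ v.integer := by rw [hf]; exact sub_mem (add_mem (one_mem _) mN') mg
  -- Integrality of the logarithmic derivative of `w` gives `w = 2A + f` with `f` integral.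
  -- Substituting in the relation and dividing by `A²`, the leading terms sum to `16 (1 - r)²` and
  -- the rest is a multiple of `a = 1/A`. So this nonzero constant would lie in the maximal ideal.
  have key : (4 * (1 - r')) ^ 2 = a * ((2 * r' * (2 + f * a) - 2 * N' * a) * τ
      - 2 * r' * (2 + f * a) * g
      - 2 * ((f - N') * (-4 * (1 - r') + (2 * r' * f - 2 * N') * a)
        - 2 * (1 - r') * (2 * r' * f - 2 * N'))) := by
    have h3 : a ^ 2 * ((2 * r' * w' - 2 * N') * (τ + N' - 1 + A')) = a ^ 2 * (2 * conic N' r' A' w') := by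
      rw [hrel2]
    rw [conic, hw3] at h3
    have hg2 : g = 1 + N' - f := by rw [hf]; ring
    rw [hg2]
    have h4 : ∀ z : E, a ^ 2 * (z * A') = a * z := fun z => by
      linear_combination a * z * haA
    have h5 : ∀ z : E, a ^ 2 * (z * A' ^ 2) = z := fun z => by
      linear_combination (z * (a * A' + 1)) * haA
    linear_combination -h3 - h5 (16 * (1 - r') ^ 2) - h4 (4 * r' - 4 * r' * f - 12 * r' * N'
      - 4 * r' * τ + 8 * r' ^ 2 * f - 8 * f + 16 * N')
  have hlt : v ((4 * (1 - r')) ^ 2) < 1 := by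
    rw [key, map_mul, mul_comm, ha]
    refine (mul_le_of_le_one_left' ?_).trans_lt hva
    rw [← ha]
    have mfa : 2 + f * a ∈ v.integer := add_mem m2 (mul_mem mf ma)
    have m1r : 1 - r' ∈ v.integer := sub_mem (one_mem _) mr'
    have mrf : 2 * r' * f - 2 * N' ∈ v.integer :=
      sub_mem (mul_mem (mul_mem m2 mr') mf) (mul_mem m2 mN')
    exact sub_mem (sub_mem (mul_mem (sub_mem (mul_mem (mul_mem m2 mr') mfa)
      (mul_mem (mul_mem m2 mN') ma)) mτ) (mul_mem (mul_mem (mul_mem m2 mr') mfa) mg))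
      (mul_mem m2 (sub_mem (mul_mem (sub_mem mf mN')
        (add_mem (mul_mem (neg_mem m4) m1r) (mul_mem mrf ma)))
        (mul_mem (mul_mem m2 m1r) mrf)))
  have hone : v ((4 * (1 - r')) ^ 2) = 1 := by
    have : (4 * (1 - r')) ^ 2 = algebraMap ℝ E ((4 * (1 - r)) ^ 2) := by
      rw [hr']; simp only [map_pow, map_mul, map_sub, map_one, map_ofNat]
    rw [this, hv.const]
    exact pow_ne_zero _ (mul_ne_zero (by norm_num) (sub_ne_zero.2 hr.symm))
  exact hlt.ne hone

end Real

end DifferentialField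

/-! ### The case `p = 2q` with `h₂` imaginary: resultants and amplitudes -/

namespace DifferentialField

open Polynomial WithZero

variable {K : Type*} [Field K] [Algebra ℝ K]

local notation "κ" => algebraMap ℝ K

section Real

variable {t : Derivation ℝ K K} {N r q k : ℝ} {A c β x Z w : K}

/-- The resultant in `w` of the conic and its derivative. -/
noncomputable def conicResultant {R : Type*} [CommRing R] (N r A : R) : R :=
  let b := -2 * N + (4 * r ^ 2 - 5 * r - 4) * A
  let c := N ^ 2 + N + (11 - 4 * r) * N * A + (16 - 8 * r) * A ^ 2
  let b' := 4 * r ^ 2 - 5 * r - 4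
  let c' := (11 - 4 * r) * N + 2 * (16 - 8 * r) * A
  let a := -A * (N - 1 + A)
  let g := 1 + N + 2 * A
  let h := 2 * r * g + b
  let α := r * (b * g + b' * a + 2 * c) - h * b
  let β := r * (c' * a) - h * c
  r * β ^ 2 - b * α * β + c * α ^ 2

/-- The analogue of `conicResultant` when the conic is linear in `w`. -/
noncomputable def conicResultantLinear {R : Type*} [CommRing R] (N A : R) : R :=
  let b := -2 * N - 4 * A
  let c := N ^ 2 + N + 11 * N * A + 16 * A ^ 2
  let c' := 11 * N + 32 * A
  let a := -A * (N - 1 + A)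
  let g := 1 + N + 2 * A
  4 * c * a + b * (c' * a) - c * b * g - c ^ 2

theorem derivation_conic (hw : t w = w * (1 + κ N + 2 * A - w)) {a : K} (hA : t A = a) :
    t (conic (κ N) (κ r) A w)
      = (2 * κ r * w + (-2 * κ N + (4 * κ r ^ 2 - 5 * κ r - 4) * A)) * (w * (1 + κ N + 2 * A - w))
        + ((4 * κ r ^ 2 - 5 * κ r - 4) * w + (11 - 4 * κ r) * κ N + 2 * (16 - 8 * κ r) * A) * a := by
  rw [conic, ← hw]
  simp only [map_add, map_sub, map_neg, Derivation.leibniz, Derivation.leibniz_pow,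
    Derivation.map_algebraMap, derivation_ofNat, smul_eq_mul, nsmul_eq_mul, hA]
  push_cast
  ring

/-- For `e = 0` the equation of `A` is autonomous. The conic and its derivative have the common root
`w`, so a resultant, a polynomial in `A` over `ℝ`, vanishes, and `A` is constant unless this
resultant is identically zero. The latter leaves only `N = 2`, `r = 2/3`, where the conic splits
into two lines: `hL` excludes one, and the other gives a new equation for `A`. -/
theorem const_of_conic [CharZero K] (hN : N ≠ 0) (hr : r ≠ 1)
    (hA : t A = -A * (κ N - 1 + A))
    (hw : t w = w * (1 + κ N + 2 * A - w)) (hQ : conic (κ N) (κ r) A w = 0)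
    (hL : 2 * κ r * w - 2 * κ N - 4 * A ≠ 0) : t A = 0 := by
  have hQt := derivation_conic (r := r) hw hA
  rw [hQ, map_zero] at hQt
  have hQ' := hQ
  rw [conic] at hQ'
  by_cases hr0 : r = 0
  · subst hr0
    rw [map_zero] at hQ' hQt
    have hR : conicResultantLinear (κ N) A = 0 := by
      simp only [conicResultantLinear]
      linear_combination -(-2 * κ N - 4 * A) * hQt
        - ((-2 * κ N - 4 * A) * (1 + κ N + 2 * A - w) + (κ N ^ 2 + κ N + 11 * κ N * A + 16 * A ^ 2)
          + 4 * A * (κ N - 1 + A)) * hQ'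
    rcases derivation_eq_zero_or t (y := A) (conicResultantLinear (C N) X) (by
      simp only [conicResultantLinear, map_add, map_sub, map_mul, map_pow, map_neg, map_one,
        map_ofNat, aeval_C, aeval_X]
      exact hR) with h | h
    · exact h
    · exfalso
      simp only [conicResultantLinear, eval_add, eval_sub, eval_mul, eval_pow, eval_neg, eval_one,
        eval_C, eval_X, eval_ofNat] at h
      have h1 : N ^ 2 * (N + 1) ^ 2 = 0 := by linear_combination h 0
      have h2 : N = -1 := by
        rcases mul_eq_zero.1 h1 with h | h
        · exact absurd (pow_eq_zero_iff two_ne_zero |>.1 h) hN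
        · have := pow_eq_zero_iff two_ne_zero |>.1 h; linarith
      rw [h2] at h
      have := h 1
      norm_num at this
  · have hR : conicResultant (κ N) (κ r) A = 0 := by
      obtain ⟨b, hb⟩ : ∃ b, b = -2 * κ N + (4 * κ r ^ 2 - 5 * κ r - 4) * A := ⟨_, rfl⟩
      obtain ⟨c, hc⟩ : ∃ c, c = κ N ^ 2 + κ N + (11 - 4 * κ r) * κ N * A + (16 - 8 * κ r) * A ^ 2 :=
        ⟨_, rfl⟩
      obtain ⟨b', hb'⟩ : ∃ b', b' = 4 * κ r ^ 2 - 5 * κ r - 4 := ⟨_, rfl⟩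
      obtain ⟨c', hc'⟩ : ∃ c', c' = (11 - 4 * κ r) * κ N + 2 * (16 - 8 * κ r) * A := ⟨_, rfl⟩
      obtain ⟨a, ha⟩ : ∃ a, a = -A * (κ N - 1 + A) := ⟨_, rfl⟩
      obtain ⟨g, hg⟩ : ∃ g, g = 1 + κ N + 2 * A := ⟨_, rfl⟩
      simp only [conicResultant]
      rw [← hb, ← hc, ← ha, ← hg, ← hb', ← hc']
      rw [← hb, ← hc] at hQ'
      have hQt' : 0 = (2 * κ r * w + b) * (w * (g - w)) + (b' * w + c') * a := by
        rw [hb, hg, hb', hc', ha]; linear_combination hQt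
      -- Reducing the derivative modulo the conic makes it linear in `w`; substituting its root into
      -- the conic gives the resultant.
      have hlin : (κ r * (b * g + b' * a + 2 * c) - (2 * κ r * g + b) * b) * w
          + (κ r * (c' * a) - (2 * κ r * g + b) * c) = 0 := by
        linear_combination -κ r * hQt' + (2 * κ r * w - (2 * κ r * g + b)) * hQ'
      obtain ⟨α, hα⟩ : ∃ α, α = κ r * (b * g + b' * a + 2 * c) - (2 * κ r * g + b) * b := ⟨_, rfl⟩
      obtain ⟨β, hβ⟩ : ∃ β, β = κ r * (c' * a) - (2 * κ r * g + b) * c := ⟨_, rfl⟩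
      rw [← hα, ← hβ] at hlin ⊢
      linear_combination α ^ 2 * hQ' - (κ r * (α * w - β) + b * α) * hlin
    rcases derivation_eq_zero_or t (y := A) (conicResultant (C N) (C r) X) (by
      simp only [conicResultant, map_add, map_sub, map_mul, map_pow, map_neg, map_one,
        map_ofNat, aeval_C, aeval_X]
      exact hR) with h | h
    · exact h
    replace h : ∀ a : ℝ, conicResultant N r a = 0 := by
      intro a
      rw [← h a]
      simp only [conicResultant, eval_add, eval_sub, eval_mul, eval_pow, eval_neg, eval_one,
        eval_C, eval_X, eval_ofNat]
    have h0 : r * N ^ 2 * (N + 1) ^ 2 * ((N + 1) * r - N) ^ 2 = 0 := by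
      have := h 0
      simp only [conicResultant] at this
      linear_combination (1 / 4) * this
    have h0' : N + 1 = 0 ∨ (N + 1) * r - N = 0 := by
      simpa [hr0, hN] using h0
    rcases h0' with hN1 | hNr
    · exfalso
      have hN1' : N = -1 := by linarith
      rw [hN1'] at h
      -- The linear coefficient in `A` of the resultant at `N = -1`, by central differences exact up
      -- to degree six.
      have e1 : 16 * r * (4 * r - 11) = 3 / 4 * (conicResultant (-1) r 1 - conicResultant (-1) r (-1))
          - 3 / 20 * (conicResultant (-1) r 2 - conicResultant (-1) r (-2))
          + 1 / 60 * (conicResultant (-1) r 3 - conicResultant (-1) r (-3)) := by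
        simp only [conicResultant]; ring
      simp only [h, sub_zero, mul_zero, add_zero] at e1
      have hr11 : r = 11 / 4 := by
        have : 4 * r - 11 = 0 := by simpa [hr0] using e1
        linarith
      rw [hr11] at h
      have := h 1
      simp only [conicResultant] at this
      norm_num at this
    · have hN1 : N + 1 ≠ 0 := by
        intro h; rw [h] at hNr; exact hN (by linarith)
      have hrN : r = N / (N + 1) := by field_simp; linarith
      -- The same kind of formula for the coefficient of `A²`, with `r = N / (N + 1)` inserted.
      have e2 : 4 * N ^ 3 * (N + 3) ^ 2 * (N - 2) ^ 2 / (N + 1) ^ 3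
          = -(49 / 36) * conicResultant N r 0
            + 3 / 4 * (conicResultant N r 1 + conicResultant N r (-1))
            - 3 / 40 * (conicResultant N r 2 + conicResultant N r (-2))
            + 1 / 180 * (conicResultant N r 3 + conicResultant N r (-3)) := by
        rw [hrN]
        simp only [conicResultant]
        field_simp
        ring
      simp only [h, sub_zero, mul_zero, add_zero] at e2
      have hcases : N + 3 = 0 ∨ N - 2 = 0 := by simpa [hN, hN1] using e2
      rcases hcases with hN3 | hN2
      · exfalso
        have hN3' : N = -3 := by linarith
        rw [hrN, hN3'] at h
        have := h 1
        simp only [conicResultant] at this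
        norm_num at this
      · have hN2' : N = 2 := by linarith
        have hr23 : r = 2 / 3 := by rw [hrN, hN2']; norm_num
        have k2 : κ 2 = 2 := map_ofNat _ 2
        have k3 : κ 3 = 3 := map_ofNat _ 3
        have k16 : κ 16 = 16 := map_ofNat _ 16
        have k9 : κ 9 = 9 := map_ofNat _ 9
        subst hN2' hr23
        simp only [map_div₀, k2, k3] at hQ' hL hA hw
        have hfac : (w - 3 - 3 * A) * (3 * w - 16 * A - 9) = 0 := by
          linear_combination 9 / 2 * hQ'
        have hw16 : 3 * w = 16 * A + 9 := by
          rcases mul_eq_zero.1 hfac with h | h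
          · exact absurd (by linear_combination 4 / 3 * h) hL
          · linear_combination h
        have h5 := congrArg t hw16
        simp only [map_add, Derivation.leibniz, derivation_ofNat, smul_eq_mul, hw, hA] at h5
        have h6 : (16 * A + 9) * (2 * A * 3 - 16 * A) + 3 * 16 * A * (1 + A) = 0 := by
          linear_combination 3 * h5 - (6 * A - 3 * w - 16 * A) * hw16
        rcases derivation_eq_zero_or t (y := A)
          ((C 16 * X + C 9) * (C 2 * X * C 3 - C 16 * X) + C 3 * C 16 * X * (1 + X)) (by
            simp only [map_mul, map_sub, map_add, aeval_C, aeval_X, map_one, k2, k3, k16, k9]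
            exact h6) with h | h
        · exact h
        · exfalso
          have := h 1
          simp only [eval_mul, eval_sub, eval_add, eval_C, eval_X, eval_one] at this
          norm_num at this

/-- The amplitudes in the case `p = 2q` with `h₂` imaginary. -/
theorem classify_double_imaginary [CharZero K] (hreal : ∀ f g : K, f ^ 2 + g ^ 2 = 0 → f = 0)
    (hx : t x = x) (hx0 : x ≠ 0) {e d : ℝ} (hN : N ≠ 0) (hq : q ≠ 0) (hk : k ≠ 0)
    (hA : t A = κ e * x ^ 2 + c ^ 2 - (κ N - 1) * A - A ^ 2)
    (hc : t c = c * (1 - κ N - 2 * A) + κ d * x ^ 2) (hβ : β ≠ 0)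
    (hZ : Z = t β + κ N * β + (κ q + 2) * A * β) (hZt : t Z = Z * (1 - κ q * A))
    (h1 : -2 * β * t β - 2 * κ q * β ^ 2 * A + κ q * β * Z + 2 * κ k * κ q * A = 0)
    (h4 : -2 * t (c * β) + 2 * (c * β) - 2 * κ q * A * (c * β) + κ q * β * (κ d * x ^ 2) = 0) :
    (A = 0 ∧ c = 0 ∧ t β = β ∧ q * (N + 1) = 2) ∨
    (A = 1 - κ N ∧ c = 0 ∧ t β = 0 ∧ q * (N - 1) = 2 - N ∧ β ^ 2 = κ k) ∨
    (A = 1 - κ N ∧ c = 0 ∧ t β = 0 ∧ q * (1 - N) = 1 ∧ N + 1 ≠ 0 ∧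
      β ^ 2 * (κ N + 1) = 2 * κ k * (κ N - 1)) := by
  have k2 : κ 2 = 2 := map_ofNat _ 2
  obtain ⟨r, hr⟩ : ∃ r, r = 1 - q / 2 := ⟨_, rfl⟩
  have hqr : q = 2 - 2 * r := by rw [hr]; ring
  have hr1 : r ≠ 1 := by rw [hr]; intro h; exact hq (by linarith)
  have hqK : κ q = 2 - 2 * κ r := by rw [hqr, map_sub, map_mul, k2]
  have hq0 : κ q ≠ 0 := by simpa using hq
  have hk0 : κ k ≠ 0 := by simpa using hk
  have hN0 : κ N ≠ 0 := by simpa using hN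
  -- With this ratio `t β / β` is affine in `w` and `A`, the equation of `Z` becomes logistic, and
  -- `h1`, `h4` turn into purely algebraic relations.
  obtain ⟨w, hwZ⟩ : ∃ w, Z = w * β := ⟨Z / β, by field_simp⟩
  have hβt : t β = β * (w - κ N - (κ q + 2) * A) := by linear_combination hwZ - hZ
  have hw : t w = w * (1 + κ N + 2 * A - w) := by
    rw [hwZ, Derivation.leibniz, hβt] at hZt
    simp only [smul_eq_mul] at hZt
    have : β * t w = β * (w * (1 + κ N + 2 * A - w)) := by linear_combination hZt
    exact mul_left_cancel₀ hβ this
  have hX0 : β ^ 2 ≠ 0 := pow_ne_zero _ hβ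
  have h1' : β ^ 2 * (2 * κ r * w - 2 * κ N - 4 * A) = 2 * κ k * κ q * A := by
    rw [hβt, hwZ] at h1
    linear_combination -h1 + β ^ 2 * w * hqK
  have h4' : κ r * (κ d * x ^ 2) = c * (2 * (κ N + 2 * A) - w) := by
    rw [Derivation.leibniz, hc, hβt] at h4
    simp only [smul_eq_mul] at h4
    have : β * (κ r * (κ d * x ^ 2)) = β * (c * (2 * (κ N + 2 * A) - w)) := by
      linear_combination -h4 / 2 + β * (κ d * x ^ 2) / 2 * hqK
    exact mul_left_cancel₀ hβ this
  have hV := riccati_four_mul hA rfl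
  have hc' : t c = c * (1 - (κ N + 2 * A)) + κ d * x ^ 2 := by rw [hc]; ring
  by_cases hw0 : w = 0
  · -- the relation between `A` and `β²` is linear
    have hβt0 : t β = β * (-κ N - (κ q + 2) * A) := by rw [hβt, hw0]; ring
    have hXA : A * (2 * β ^ 2 + κ k * κ q) = -κ N * β ^ 2 := by
      rw [hw0] at h1'; linear_combination -h1' / 2
    have hA0 : A ≠ 0 := by
      rintro rfl
      rw [zero_mul] at hXA
      exact mul_ne_zero hN0 hX0 (by linear_combination hXA)
    have hu0 : κ N + 2 * A ≠ 0 := by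
      intro h
      have : A * (κ k * κ q) = 0 := by linear_combination hXA - β ^ 2 * h
      exact mul_ne_zero hA0 (mul_ne_zero hk0 hq0) this
    have htA : κ N * t A = -2 * A * (κ N + (κ q + 2) * A) * (κ N + 2 * A) := by
      have h5 := congrArg t hXA
      simp only [Derivation.leibniz, Derivation.leibniz_pow, map_add, map_neg, derivation_ofNat,
        Derivation.map_algebraMap, smul_eq_mul, nsmul_eq_mul, hβt0] at h5
      push_cast at h5
      have : β ^ 2 * (κ N * t A + 2 * A * (κ N + (κ q + 2) * A) * (κ N + 2 * A)) = 0 := by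
        linear_combination -A * h5 + t A * hXA
      linear_combination (mul_eq_zero.1 this).resolve_left hX0
    -- For `c ≠ 0` and `d ≠ 0`, the proportionality `r δ = 2u` yields a polynomial equation for `A`,
    -- so `A` is constant. Then `t c = 2 c` with `s + c²` constant, which is impossible.
    have hc0 : c = 0 := by
      by_contra hc0
      by_cases hd : d = 0
      · rw [hd, map_zero, zero_mul, mul_zero, hw0] at h4'
        exact mul_ne_zero hc0 hu0 (by linear_combination -h4' / 2)
      · have hdK : κ d ≠ 0 := by simpa using hd
        obtain ⟨δ, hD⟩ : ∃ δ, κ d * x ^ 2 = c * δ := ⟨κ d * x ^ 2 / c, by field_simp⟩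
        have hδ0 : δ ≠ 0 := by
          rintro rfl
          rw [mul_zero] at hD
          exact mul_ne_zero hdK (pow_ne_zero _ hx0) hD
        have hδt := riccati_delta hc' (derivation_const_mul_sq hx d) hc0 hD
        have hδu : κ r * δ = 2 * (κ N + 2 * A) := by
          rw [hD, hw0] at h4'
          have : c * (κ r * δ) = c * (2 * (κ N + 2 * A)) := by linear_combination h4'
          exact mul_left_cancel₀ hc0 this
        have h5 := congrArg t hδu
        simp only [Derivation.leibniz, map_add, derivation_ofNat,
          Derivation.map_algebraMap, smul_eq_mul, hδt] at h5
        have h6 : κ N * (κ r + (κ r - 2) * (κ N + 2 * A)) + 4 * κ r * A * (κ N + (κ q + 2) * A) = 0 := by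
          have : (κ N + 2 * A) * (κ N * (κ r + (κ r - 2) * (κ N + 2 * A))
              + 4 * κ r * A * (κ N + (κ q + 2) * A)) = 0 := by
            linear_combination κ N * κ r / 2 * h5 + 2 * κ r * htA
              - κ N / 2 * (κ r * (1 + κ N + 2 * A) - κ r * δ - 2 * (κ N + 2 * A)) * hδu
          exact (mul_eq_zero.1 this).resolve_left hu0
        have k4 : κ 4 = 4 := map_ofNat _ 4
        have htA0 : t A = 0 := by
          rcases derivation_eq_zero_or t (y := A)
            (C N * (C r + (C r - C 2) * (C N + C 2 * X)) + C 4 * C r * X * (C N + (C q + C 2) * X)) (by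
              simp only [map_mul, map_sub, map_add, aeval_C, aeval_X, k2, k4]
              exact h6) with h | h
          · exact h
          · exfalso
            simp only [eval_mul, eval_sub, eval_add, eval_C, eval_X] at h
            have e0 := h 0
            have e1 := h 1
            have e2 := h (-1)
            have f2 : r * (q + 2) = 0 := by linear_combination (e1 + e2 - 2 * e0) / 8
            have f1 : N * (3 * r - 2) = 0 := by linear_combination (e1 - e2) / 4
            have f0 : N * (r + (r - 2) * N) = 0 := by linear_combination e0
            have g1 : 3 * r - 2 = 0 := (mul_eq_zero.1 f1).resolve_left hN
            have g2 : r = 2 / 3 := by linarith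
            rw [hqr, g2] at f2
            norm_num at f2
        have hδ1 : κ r * (δ * (1 + (κ N + 2 * A) - δ)) = 0 := by
          rw [htA0] at h5; linear_combination h5
        have hr0 : κ r ≠ 0 := by
          intro h; rw [h, zero_mul] at hδu
          exact hu0 (by linear_combination -hδu / 2)
        have hδ2 : 1 + (κ N + 2 * A) - δ = 0 :=
          (mul_eq_zero.1 ((mul_eq_zero.1 hδ1).resolve_left hr0)).resolve_left hδ0
        refine riccati_const_false (derivation_const_mul_sq hx e) (c := c) ?_ hc0 ?_
        · rw [hc', hD]; linear_combination -c * hδ2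
        · have h7 : κ e * x ^ 2 + c ^ 2 = (κ N - 1) * A + A ^ 2 := by
            rw [htA0] at hA; linear_combination -hA
          rw [h7]
          simp [Derivation.leibniz, Derivation.leibniz_pow, htA0]
    have hs : t (κ e * x ^ 2) = 2 * (κ e * x ^ 2) := derivation_const_mul_sq hx e
    have hAs : κ e * x ^ 2 = t A + (κ N - 1) * A + A ^ 2 := by rw [hA, hc0]; ring
    have htA0 : t A = 0 := by
      have hs' : κ N ^ 2 * t (κ e * x ^ 2) = 2 * κ N * (κ N * (κ e * x ^ 2)) := by rw [hs]; ring
      have h5 : κ N * (κ e * x ^ 2)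
          = -2 * A * (κ N + (κ q + 2) * A) * (κ N + 2 * A) + κ N * ((κ N - 1) * A + A ^ 2) := by
        rw [hAs]; linear_combination htA
      have h6 := congrArg t h5
      simp only [Derivation.leibniz, Derivation.leibniz_pow, map_add, map_sub, map_neg,
        derivation_ofNat, Derivation.map_algebraMap, smul_eq_mul, nsmul_eq_mul,
        Derivation.map_one_eq_zero] at h6 hs'
      push_cast at h6 hs'
      have h7 : (-2 * (κ N + (κ q + 2) * A) * (κ N + 2 * A) - 2 * A * (κ q + 2) * (κ N + 2 * A)
          - 4 * A * (κ N + (κ q + 2) * A) + κ N * ((κ N - 1) + 2 * A))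
            * (-2 * A * (κ N + (κ q + 2) * A) * (κ N + 2 * A))
          - 2 * κ N * (-2 * A * (κ N + (κ q + 2) * A) * (κ N + 2 * A)
            + κ N * ((κ N - 1) * A + A ^ 2)) = 0 := by
        linear_combination -κ N * h6 + hs' + 2 * κ N * h5
          - (-2 * (κ N + (κ q + 2) * A) * (κ N + 2 * A) - 2 * A * (κ q + 2) * (κ N + 2 * A)
          - 4 * A * (κ N + (κ q + 2) * A) + κ N * ((κ N - 1) + 2 * A)) * htA
      have k4 : κ 4 = 4 := map_ofNat _ 4
      rcases derivation_eq_zero_or t (y := A)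
        ((-C 2 * (C N + (C q + C 2) * X) * (C N + C 2 * X) - C 2 * X * (C q + C 2) * (C N + C 2 * X)
          - C 4 * X * (C N + (C q + C 2) * X) + C N * ((C N - 1) + C 2 * X))
            * (-C 2 * X * (C N + (C q + C 2) * X) * (C N + C 2 * X))
          - C 2 * C N * (-C 2 * X * (C N + (C q + C 2) * X) * (C N + C 2 * X)
            + C N * ((C N - 1) * X + X ^ 2))) (by
          simp only [map_mul, map_sub, map_add, map_neg, aeval_C, aeval_X, map_one, map_pow, k2, k4]
          exact h7) with h | h
      · exact h
      · exfalso
        simp only [eval_mul, eval_sub, eval_add, eval_neg, eval_C, eval_X, eval_one, eval_pow] at h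
        have e0 := h 0
        have e1 := h 1
        have e2 := h 2
        have e3 := h 3
        have e4 := h 4
        have e5 := h 5
        -- The fifth difference reads off the leading coefficient in `A`. When it vanishes, `q = -2`
        -- and the polynomial is a cubic with leading coefficient a multiple of `N²`.
        have f5 : (q + 2) ^ 2 = 0 := by
          linear_combination (1 / 5760) * (e5 - 5 * e4 + 10 * e3 - 10 * e2 + 5 * e1 - e0)
        have g5 : q = -2 := by have := pow_eq_zero_iff two_ne_zero |>.1 f5; linarith
        rw [g5] at e0 e1 e2 e3
        have f3 : N ^ 2 = 0 := by
          linear_combination (1 / 144) * (e3 - 3 * e2 + 3 * e1 - e0)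
        exact hN (pow_eq_zero_iff two_ne_zero |>.1 f3)
    have hs0 : κ e * x ^ 2 = 0 := by
      have h5 : t (κ e * x ^ 2) = 0 := by
        rw [hAs, htA0]
        simp [Derivation.leibniz, Derivation.leibniz_pow, htA0]
      rw [hs] at h5
      simpa using h5
    have hA1 : A = 1 - κ N := by
      have : A * (A - (1 - κ N)) = 0 := by rw [htA0] at hAs; linear_combination hs0 - hAs
      linear_combination (mul_eq_zero.1 this).resolve_left hA0
    have hm : κ N + (κ q + 2) * A = 0 := by
      rw [htA0] at htA
      have : A * ((κ N + 2 * A) * (κ N + (κ q + 2) * A)) = 0 := by linear_combination htA / 2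
      exact (mul_eq_zero.1 ((mul_eq_zero.1 this).resolve_left hA0)).resolve_left hu0
    have hqN : q * (N - 1) = 2 - N := by
      apply (algebraMap ℝ K).injective
      simp only [map_mul, map_sub, map_one, k2]
      rw [hA1] at hm
      linear_combination -hm
    have hqNK : κ q * (κ N - 1) = 2 - κ N := by
      have := congrArg κ hqN
      simpa only [map_mul, map_sub, map_one, k2] using this
    refine Or.inr (Or.inl ⟨hA1, hc0, ?_, hqN, ?_⟩)
    · rw [hβt0]; linear_combination -β * hm
    · have h5 : (2 - κ N) * (β ^ 2 - κ k) = 0 := by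
        rw [hA1] at hXA
        linear_combination hXA + κ k * hqNK
      rcases mul_eq_zero.1 h5 with h | h
      · exfalso
        have hN1 : κ N = 2 := by linear_combination -h
        rw [hN1] at hqNK
        exact hq0 (by linear_combination hqNK)
      · linear_combination h
  have hc0 : c = 0 := eq_zero_of_log_deriv hreal hx hx0 hN hr1 hV hc' hw0
    (by rw [hw]; ring) (by rw [h4'])
  have hA' : t A = κ e * x ^ 2 - (κ N - 1) * A - A ^ 2 := by rw [hA, hc0]; ring
  have hrel := conic_relation (r := r) (k := κ k) hqK hA' hβ (Derivation.map_algebraMap _ _)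
    (Derivation.map_algebraMap _ _) hZ hwZ rfl hw h1'
  by_cases he : e = 0
  swap
  · exact (conic_false hx hx0 he hN hr1 hA' hw0 hw hrel).elim
  subst he
  by_cases hA0 : A = 0
  · subst hA0
    have hL : 2 * κ r * w - 2 * κ N = 0 := by
      have : β ^ 2 * (2 * κ r * w - 2 * κ N) = 0 := by linear_combination h1'
      exact (mul_eq_zero.1 this).resolve_left hX0
    have hrw : κ r * w = κ N := by linear_combination hL / 2
    have hr0 : κ r ≠ 0 := by
      intro h; rw [h, zero_mul] at hrw; exact hN0 hrw.symm
    have hw1 : w = κ N + 1 := by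
      have h5 := congrArg t hrw
      rw [Derivation.leibniz, Derivation.map_algebraMap, Derivation.map_algebraMap, hw] at h5
      simp only [smul_eq_mul] at h5
      have h6 : κ r * (w * (1 + κ N - w)) = 0 := by linear_combination h5
      have := (mul_eq_zero.1 ((mul_eq_zero.1 h6).resolve_left hr0)).resolve_left hw0
      linear_combination -this
    left
    refine ⟨rfl, hc0, ?_, ?_⟩
    · rw [hβt, hw1]; ring
    · apply (algebraMap ℝ K).injective
      simp only [map_mul, map_add, map_one, k2]
      rw [hw1] at hrw
      rw [hqK]
      linear_combination -2 * hrw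
  · have hA'' : t A = -A * (κ N - 1 + A) := by rw [hA', map_zero]; ring
    have hQ : conic (κ N) (κ r) A w = 0 := by
      have : A * conic (κ N) (κ r) A w = 0 := by
        rw [map_zero] at hrel
        linear_combination -hrel / 2
      exact (mul_eq_zero.1 this).resolve_left hA0
    have hL : 2 * κ r * w - 2 * κ N - 4 * A ≠ 0 := by
      intro h
      rw [h, mul_zero] at h1'
      exact mul_ne_zero (mul_ne_zero (mul_ne_zero two_ne_zero hk0) hq0) hA0 h1'.symm
    have htA0 := const_of_conic hN hr1 hA'' hw hQ hL
    have hA1 : A = 1 - κ N := by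
      rw [hA''] at htA0
      have := (mul_eq_zero.1 htA0).resolve_left (neg_ne_zero.2 hA0)
      linear_combination this
    -- With `A = 1 - N` the conic is a quadratic equation for `w` over `ℝ`. It degenerates only for
    -- `r = 0`, `N = 2`, where `hL` fails.
    have htw0 : t w = 0 := by
      rcases derivation_eq_zero_or t (y := w) (conic (C N) (C r) (C (1 - N)) X) (by
        rw [conic] at hQ ⊢
        rw [hA1] at hQ
        simp only [map_add, map_sub, map_mul, map_pow, map_neg, map_one,
          map_ofNat, aeval_C, aeval_X]
        exact hQ) with h | h
      · exact h
      · exfalso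
        simp only [conic, eval_add, eval_sub, eval_mul, eval_pow, eval_neg,
          eval_C, eval_X, eval_ofNat] at h
        have e0 := h 0
        have e1 := h 1
        have e2 := h (-1)
        have f2 : r = 0 := by linear_combination (e1 + e2 - 2 * e0) / 2
        rw [f2] at e0 e1 e2
        have f1 : N = 2 := by linear_combination (e1 - e2) / 4
        apply hL
        rw [hA1, f1, f2, map_zero, k2]; ring
    have hw1 : w = 3 - κ N := by
      rw [hw, hA1] at htw0
      have := (mul_eq_zero.1 htw0).resolve_left hw0
      linear_combination -this
    -- At `A = 1 - N`, `w = 3 - N` the conic factors, and `hL` removes one factor.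
    have hprod : (κ q * (1 - κ N) - 1) * (2 * κ r * w - 2 * κ N - 4 * A) = 0 := by
      rw [conic, hw1, hA1] at hQ
      rw [hqK, hw1, hA1]
      linear_combination -hQ
    have hq1 : κ q * (1 - κ N) = 1 := by
      linear_combination (mul_eq_zero.1 hprod).resolve_right hL
    have hfin : β ^ 2 * (κ N + 1) = 2 * κ k * (κ N - 1) := by
      rw [hw1, hA1] at h1'
      have hqe : κ r = 1 - κ q / 2 := by rw [hqK]; ring
      rw [hqe] at h1'
      have hN1 : (1 : K) - κ N ≠ 0 := by
        intro h; rw [h, mul_zero] at hq1; exact zero_ne_one hq1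
      linear_combination -(1 - κ N) * h1' - (β ^ 2 * (3 - κ N) + 2 * κ k * (1 - κ N)) * hq1
    have hN1 : N + 1 ≠ 0 := by
      intro h
      have hNm : κ N = -1 := by
        have : N = -1 := by linarith
        rw [this, map_neg, map_one]
      rw [hNm] at hfin
      exact hk0 (by linear_combination hfin / 4)
    refine Or.inr (Or.inr ⟨hA1, hc0, ?_, ?_, hN1, hfin⟩)
    · rw [hβt, hw1, hA1]; linear_combination -β * hq1
    · apply (algebraMap ℝ K).injective
      simp only [map_mul, map_sub, map_one]
      exact hq1

end Real

end DifferentialField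

/-! ### Classification of the coefficients in the differential field -/

namespace DifferentialField

variable {K : Type*} [Field K] [Algebra ℝ K] {t : Derivation ℝ K K}
  {N q k : ℝ} {A c x α β Br Bi D s : K}

local notation "κ" => algebraMap ℝ K

section

theorem algebraMap_ne {r : ℝ} (hr : r ≠ 0) : κ r ≠ 0 := by
  simpa using hr

theorem real_eq_of_algebraMap {r r' : ℝ} (h : κ r = κ r') : r = r' :=
  (algebraMap ℝ K).injective h

/-- Eliminating `t β` gives `(2 - q) Bi = 2 N β`. As `N ≠ 0`, `β` is a constant multiple of `Bi` and
inherits `t Bi = Bi`. -/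
theorem classify_imaginary_power [CharZero K] (hN : N ≠ 0) (hβ : β ≠ 0)
    (hB : Bi = t β + κ N * β) (hBt : t Bi = Bi) (h : 2 * t β = κ q * Bi) :
    t β = β ∧ q * (N + 1) = 2 := by
  have k2 : κ 2 = 2 := map_ofNat _ 2
  have h1 : (2 - κ q) * Bi = 2 * κ N * β := by rw [hB] at h ⊢; linear_combination h
  have h2 : t β = β := by
    have h3 := congrArg t h1
    have hq : t (2 - κ q) = 0 := by rw [← k2, ← map_sub]; simp
    have hN' : t (2 * κ N) = 0 := by rw [← k2, ← map_mul]; simp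
    rw [Derivation.leibniz, Derivation.leibniz _ (2 * κ N), hq, hN', hBt] at h3
    simp only [smul_eq_mul, mul_zero, add_zero] at h3
    have h4 : 2 * κ N * (t β - β) = 0 := by linear_combination h1 - h3
    have h5 : 2 * κ N ≠ 0 := mul_ne_zero two_ne_zero (algebraMap_ne hN)
    exact sub_eq_zero.1 ((mul_eq_zero.1 h4).resolve_left h5)
  refine ⟨h2, ?_⟩
  have h6 : κ (q * (N + 1)) * β = κ 2 * β := by
    rw [map_mul, map_add, map_one, k2]
    rw [hB, h2] at h
    linear_combination -h
  exact real_eq_of_algebraMap (mul_right_cancel₀ hβ h6)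

/-- If `c ≠ 0`, then `t c = c`, so `D = N c` would satisfy both `t D = D` and `t D = 2 D`. -/
theorem eq_zero_of_stationary [CharZero K] (hN : N ≠ 0) (hD : t D = 2 * D)
    (hc : t c = c * (1 - κ N) + D) (h : c * (t c - c) = 0) : c = 0 := by
  by_contra hc0
  have h1 : t c = c := sub_eq_zero.1 ((mul_eq_zero.1 h).resolve_left hc0)
  have h2 : D = κ N * c := by rw [h1] at hc; linear_combination -hc
  rw [h2, Derivation.leibniz, h1, Derivation.map_algebraMap] at hD
  simp only [smul_eq_mul, mul_zero, add_zero] at hD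
  have h3 : κ N * c = 0 := by linear_combination -hD
  exact mul_ne_zero (algebraMap_ne hN) hc0 h3

/-- No resonance between `|v|^p` and the powers occurring in the ansatz. -/
theorem classify_generic [CharZero K] (hN : N ≠ 0) (hD : t D = 2 * D) (hs : t s = 2 * s)
    (hA0 : A = 0) (hα : α = 0) (hβ : β ≠ 0)
    (hA : t A = s + c ^ 2 - (κ N - 1) * A - A ^ 2)
    (hc : t c = c * (1 - κ N - 2 * A) + D)
    (hBi : Bi = t β + κ N * β + κ q * β * A + 2 * (A * β + c * α))
    (h1i : t Bi - Bi + κ q * Bi * A - κ q * α * D = 0)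
    (h2r : t ((κ q + 1) * α ^ 2 - β ^ 2) + 2 * κ q * ((κ q + 1) * α ^ 2 - β ^ 2) * A
      + κ q * Br * α + κ q * β * Bi = 0) :
    A = 0 ∧ c = 0 ∧ α = 0 ∧ t β = β ∧ q * (N + 1) = 2 := by
  subst hA0 hα
  have h0 : s = -c ^ 2 := by rw [map_zero] at hA; linear_combination -hA
  have hc0 : c = 0 := by
    refine eq_zero_of_stationary hN hD (by rw [hc]; ring) ?_
    have h := hs
    rw [h0, map_neg, Derivation.leibniz_pow] at h
    simp only [smul_eq_mul, nsmul_eq_mul] at h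
    push_cast at h
    linear_combination -h / 2
  subst hc0
  have := classify_imaginary_power (t := t) (q := q) hN hβ (Bi := Bi) (by rw [hBi]; ring)
    (by linear_combination h1i) (by
      have hh : t ((κ q + 1) * 0 ^ 2 - β ^ 2) = - (2 * β * t β) := by
        rw [show (κ q + 1) * 0 ^ 2 - β ^ 2 = -β ^ 2 by ring, map_neg, Derivation.leibniz_pow]
        simp only [smul_eq_mul, nsmul_eq_mul]
        push_cast
        ring
      rw [hh] at h2r
      refine mul_left_cancel₀ hβ ?_
      linear_combination -h2r)
  exact ⟨rfl, rfl, rfl, this⟩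

/-- The case `p = -q`. -/
theorem classify_neg [CharZero K] (hreal : ∀ f g : K, f ^ 2 + g ^ 2 = 0 → f = 0)
    (hx : t x = x) (hx0 : x ≠ 0)
    (hN : N ≠ 0) (hq : q ≠ 0) (hk : k ≠ 0) (hD : t D = 2 * D) (h0 : α ≠ 0 ∨ β ≠ 0)
    (hA0 : A = 0)
    (hE : -2 * c * t c + 2 * c ^ 2 - κ k * κ q * α * x ^ 3 = 0)
    (hc : t c = c * (1 - κ N - 2 * A) + D)
    (hBr : Br = t α + κ N * α + κ q * α * A + 2 * (A * α - c * β))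
    (hBi : Bi = t β + κ N * β + κ q * β * A + 2 * (A * β + c * α))
    (h1i : t Bi - Bi + κ q * Bi * A - κ q * α * D = 0)
    (h2r : t ((κ q + 1) * α ^ 2 - β ^ 2) + 2 * κ q * ((κ q + 1) * α ^ 2 - β ^ 2) * A
      + κ q * Br * α + κ q * β * Bi = 0)
    (h3r : 2 * ((κ q + 1) * α ^ 2 - β ^ 2) * α + β * ((κ q + 2) * α * β) = 0)
    (h3i : (κ q + 2) * α * β * α = 0) :
    A = 0 ∧ c = 0 ∧ α = 0 ∧ t β = β ∧ q * (N + 1) = 2 := by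
  have k1 : κ 1 = 1 := map_one _
  have k2 : κ 2 = 2 := map_ofNat _ 2
  have k3 : κ 3 = 3 := map_ofNat _ 3
  subst hA0
  by_cases hα : α = 0
  · subst hα
    have hβ : β ≠ 0 := by simpa using h0
    have hc0 : c = 0 := eq_zero_of_stationary hN hD (by rw [hc]; ring)
      (by linear_combination -hE / 2)
    subst hc0
    refine classify_generic (s := 0) (Br := Br) hN hD (by simp) rfl rfl hβ (by simp) hc hBi h1i h2r
  -- For `α ≠ 0` the cubic equations and formal reality force `β = 0` and `q = -1`. The lower ones
  -- leave only `N = 3` with `t c = 2 c`.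
  exfalso
  have hCi : (κ q + 2) * β = 0 := by
    have : α ^ 2 * ((κ q + 2) * β) = 0 := by linear_combination h3i
    exact (mul_eq_zero.1 this).resolve_left (pow_ne_zero _ hα)
  have hCr : (κ q + 1) * α ^ 2 - β ^ 2 = 0 := by
    have : 2 * α * ((κ q + 1) * α ^ 2 - β ^ 2) = 0 := by
      linear_combination h3r - α * β * hCi
    exact (mul_eq_zero.1 this).resolve_left (mul_ne_zero two_ne_zero hα)
  have hβ : β = 0 := by
    by_contra hβ
    have : κ q + 2 = 0 := (mul_eq_zero.1 hCi).resolve_right hβ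
    exact hα (hreal α β (by linear_combination -hCr + α ^ 2 * this))
  subst hβ
  have hq1 : κ q = -1 := by
    have : (κ q + 1) * α ^ 2 = 0 := by linear_combination hCr
    linear_combination (mul_eq_zero.1 this).resolve_right (pow_ne_zero _ hα)
  rw [hCr, map_zero, hq1] at h2r
  have hBr0 : Br = 0 := by
    have : Br * α = 0 := by linear_combination -h2r
    exact (mul_eq_zero.1 this).resolve_right hα
  have htα : t α = -(κ N * α) := by rw [hBr0] at hBr; linear_combination -hBr
  have hBi' : Bi = 2 * (c * α) := by rw [hBi]; simp
  have h3D : 3 * D = 4 * κ N * c := by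
    rw [hBi', Derivation.leibniz, Derivation.leibniz, derivation_ofNat, hc, htα, hq1] at h1i
    simp only [smul_eq_mul] at h1i
    refine mul_left_cancel₀ hα ?_
    linear_combination h1i
  by_cases hc0 : c = 0
  · rw [hc0] at hE
    have : κ k * κ q * α * x ^ 3 = 0 := by rw [map_zero] at hE; linear_combination -hE
    have h' : κ k * κ q * α * x ^ 3 ≠ 0 :=
      mul_ne_zero (mul_ne_zero (mul_ne_zero (algebraMap_ne hk) (algebraMap_ne hq)) hα)
        (pow_ne_zero _ hx0)
    exact h' this
  · have htc : 3 * t c = c * (3 + κ N) := by linear_combination 3 * hc + h3D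
    have hN3 : κ N = 3 := by
      have h := congrArg t h3D
      rw [Derivation.leibniz, Derivation.leibniz, derivation_ofNat, Derivation.leibniz,
        derivation_ofNat, Derivation.map_algebraMap, hD] at h
      simp only [smul_eq_mul, mul_zero, add_zero] at h
      have h' : κ N * c * (κ N - 3) = 0 := by
        linear_combination (-3/4 : K) * h + (3/2 : K) * h3D - κ N * htc
      exact sub_eq_zero.1 ((mul_eq_zero.1 h').resolve_left (mul_ne_zero (algebraMap_ne hN) hc0))
    have htc' : t c = 2 * c := by rw [hN3] at htc; linear_combination htc / 3
    rw [htc'] at hE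
    have h := congrArg t hE
    rw [hN3] at htα
    have e1 : -2 * c * (2 * c) + 2 * c ^ 2 - κ k * κ q * α * x ^ 3
      = κ (-2) * c ^ 2 - κ (k * q) * (α * x ^ 3) := by
      rw [map_mul, map_neg, k2]; ring
    rw [e1, map_sub, Derivation.leibniz, Derivation.map_algebraMap, Derivation.leibniz,
      Derivation.map_algebraMap, Derivation.leibniz, Derivation.leibniz_pow,
      Derivation.leibniz_pow, htα, htc', hx, map_zero, map_neg, k2] at h
    simp only [smul_eq_mul, nsmul_eq_mul] at h
    push_cast at h
    -- As `t α = -3 α`, the product `α x³` is constant, so differentiating `hE` leaves a multiple of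
    -- `c²`.
    have : c ^ 2 = 0 := by linear_combination -h / 8
    exact hc0 (by simpa using this)

/-- The case `p = 2q`. -/
theorem classify_double [CharZero K] (hreal : ∀ f g : K, f ^ 2 + g ^ 2 = 0 → f = 0)
    (hx : t x = x) (hx0 : x ≠ 0) {e d : ℝ}
    (hN : N ≠ 0) (hq : q ≠ 0) (hk : k ≠ 0) (h0 : α ≠ 0 ∨ β ≠ 0)
    (hA : t A = κ e * x ^ 2 + c ^ 2 - (κ N - 1) * A - A ^ 2)
    (hc : t c = c * (1 - κ N - 2 * A) + κ d * x ^ 2)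
    (hBr : Br = t α + κ N * α + κ q * α * A + 2 * (A * α - c * β))
    (hBi : Bi = t β + κ N * β + κ q * β * A + 2 * (A * β + c * α))
    (h1r : t Br - Br + κ q * Br * A + κ q * β * (κ d * x ^ 2) = 0)
    (h1i : t Bi - Bi + κ q * Bi * A - κ q * α * (κ d * x ^ 2) = 0)
    (h2r : t ((κ q + 1) * α ^ 2 - β ^ 2) + 2 * κ q * ((κ q + 1) * α ^ 2 - β ^ 2) * A
      + κ q * Br * α + κ q * β * Bi + 2 * κ k * κ q * A = 0)
    (h3r : 2 * ((κ q + 1) * α ^ 2 - β ^ 2) * α + β * ((κ q + 2) * α * β) + 2 * κ k * α = 0)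
    (h3i : (κ q + 2) * α * β * α = 0) :
    (A = 0 ∧ c = 0 ∧ α = 0 ∧ t β = β ∧ q * (N + 1) = 2) ∨
    (A = 1 - κ N ∧ c = 0 ∧ α = 0 ∧ t β = 0 ∧ q * (1 - N) = 1 ∧ N + 1 ≠ 0 ∧
      β ^ 2 * (κ N + 1) = 2 * κ k * (κ N - 1)) ∨
    (A = 1 - κ N ∧ c = 0 ∧ α = 0 ∧ t β = 0 ∧ q * (N - 1) = 2 - N ∧ β ^ 2 = κ k) ∨
    (A = 1 - κ N ∧ c = 0 ∧ β = 0 ∧ t α = 0 ∧ q * (N - 1) = 2 - N ∧ α ^ 2 = -κ k * (κ N - 1)) := by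
  have k1 : κ 1 = 1 := map_one _
  have k2 : κ 2 = 2 := map_ofNat _ 2
  by_cases hα : α = 0
  · subst hα
    have hβ : β ≠ 0 := by simpa using h0
    have hBr' : Br = -(2 * (c * β)) := by rw [hBr]; simp
    have hh : t ((κ q + 1) * 0 ^ 2 - β ^ 2) = - (2 * β * t β) := by
      rw [show (κ q + 1) * 0 ^ 2 - β ^ 2 = -β ^ 2 by ring, map_neg, Derivation.leibniz_pow]
      simp only [smul_eq_mul, nsmul_eq_mul]
      push_cast
      ring
    have htB : t Br = -(2 * t (c * β)) := by
      rw [hBr', map_neg, Derivation.leibniz, derivation_ofNat]; simp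
    rw [hh] at h2r
    rw [htB, hBr'] at h1r
    rcases classify_double_imaginary (Z := Bi) hreal hx hx0 hN hq hk hA hc hβ
      (by rw [hBi]; ring) (by linear_combination h1i) (by linear_combination h2r)
      (by linear_combination h1r) with h | h | h
    · exact Or.inl ⟨h.1, h.2.1, rfl, h.2.2⟩
    · exact Or.inr (Or.inr (Or.inl ⟨h.1, h.2.1, rfl, h.2.2.1, h.2.2.2⟩))
    · exact Or.inr (Or.inl ⟨h.1, h.2.1, rfl, h.2.2.1, h.2.2.2⟩)
  -- For `α ≠ 0` the cubic equations make `(q + 1) α² - β²` the constant `-k`; the quadratic one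
  -- then reduces to `Br α + β Bi = 0`.
  right; right; right
  have hCi : (κ q + 2) * β = 0 := by
    have : α ^ 2 * ((κ q + 2) * β) = 0 := by linear_combination h3i
    exact (mul_eq_zero.1 this).resolve_left (pow_ne_zero _ hα)
  have hCr : (κ q + 1) * α ^ 2 - β ^ 2 = -κ k := by
    have : 2 * α * ((κ q + 1) * α ^ 2 - β ^ 2 + κ k) = 0 := by
      linear_combination h3r - α * β * hCi
    exact eq_neg_of_add_eq_zero_left
      ((mul_eq_zero.1 this).resolve_left (mul_ne_zero two_ne_zero hα))
  have htCr : t ((κ q + 1) * α ^ 2 - β ^ 2) = 0 := by rw [hCr]; simp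
  have htexp : t ((κ q + 1) * α ^ 2 - β ^ 2) = 2 * ((κ q + 1) * α * t α - β * t β) := by
    rw [map_sub, Derivation.leibniz, Derivation.leibniz_pow, Derivation.leibniz_pow, ← k1,
      ← map_add, Derivation.map_algebraMap]
    simp only [smul_eq_mul, nsmul_eq_mul]
    push_cast
    ring
  have hBB : Br * α + β * Bi = 0 := by
    rw [htCr, hCr] at h2r
    refine (mul_eq_zero.1 (?_ : κ q * (Br * α + β * Bi) = 0)).resolve_left (algebraMap_ne hq)
    linear_combination h2r
  rw [htexp] at htCr
  have hβ : β = 0 := by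
    by_contra hβ
    have hq2 : κ q = -2 := by
      linear_combination (mul_eq_zero.1 hCi).resolve_right hβ
    rw [hq2] at hCr htCr
    rw [hBr, hBi, hq2] at hBB
    have : κ N * κ k = 0 := by
      linear_combination hBB + (1/2 : K) * htCr + κ N * hCr
    exact mul_ne_zero (algebraMap_ne hN) (algebraMap_ne hk) this
  subst hβ
  have hq1 : κ q + 1 ≠ 0 := by
    intro h
    rw [h] at hCr
    exact algebraMap_ne (K := K) hk (by linear_combination hCr)
  have htα : t α = 0 := by
    have : 2 * ((κ q + 1) * α) * t α = 0 := by linear_combination htCr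
    exact (mul_eq_zero.1 this).resolve_left (mul_ne_zero two_ne_zero (mul_ne_zero hq1 hα))
  have hu : κ N + (κ q + 2) * A = 0 := by
    have h1 : Br * α = 0 := by linear_combination hBB
    have h2 := (mul_eq_zero.1 h1).resolve_right hα
    rw [hBr, htα] at h2
    refine mul_left_cancel₀ hα ?_
    linear_combination h2
  have hq2 : q + 2 ≠ 0 := by
    intro h
    have : κ q + 2 = 0 := by rw [← k2, ← map_add, h, map_zero]
    rw [this] at hu
    exact algebraMap_ne (K := K) hN (by linear_combination hu)
  have hAm : A = κ (-N / (q + 2)) := by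
    have : κ q + 2 ≠ 0 := by rw [← k2, ← map_add]; exact algebraMap_ne hq2
    rw [map_div₀, map_neg, map_add, k2, eq_div_iff this]
    linear_combination hu
  have hA00 : A ≠ 0 := by
    intro h
    rw [h] at hu
    exact algebraMap_ne (K := K) hN (by linear_combination hu)
  have htA : t A = 0 := by rw [hAm, Derivation.map_algebraMap]
  have hBi' : Bi = 2 * (c * α) := by rw [hBi]; simp
  have hcD : 4 * κ q * A * c + (2 - κ q) * (κ d * x ^ 2) = 0 := by
    rw [hBi', Derivation.leibniz, Derivation.leibniz, derivation_ofNat, hc, htα] at h1i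
    simp only [smul_eq_mul] at h1i
    refine mul_left_cancel₀ hα ?_
    linear_combination h1i + 2 * c * α * hu
  have hD := derivation_const_mul_sq (t := t) hx d
  have hs := derivation_const_mul_sq (t := t) hx e
  -- Here `A` is a real constant and `D` a constant multiple of `c`. A nonzero `c` would satisfy `t
  -- c = 2 c` with `s + c²` constant.
  have hc0 : c = 0 := by
    by_contra hc0
    have hq2' : q ≠ 2 := by
      intro h
      rw [h, k2] at hcD
      exact mul_ne_zero hA00 hc0 (by linear_combination hcD / 8)
    have hq2k : 2 - κ q ≠ 0 := by
      rw [← k2, ← map_sub]; exact algebraMap_ne (sub_ne_zero.2 hq2'.symm)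
    set δ : K := κ (-4 * q * (-N / (q + 2)) / (2 - q)) with hδdef
    have hδ : κ d * x ^ 2 = c * δ := by
      rw [hδdef, map_div₀, map_mul, ← hAm, map_sub, k2, map_mul, map_neg,
        show κ 4 = 4 from map_ofNat _ 4, mul_div_assoc', eq_div_iff hq2k]
      linear_combination hcD
    have hδ0 : δ ≠ 0 := by
      refine algebraMap_ne (div_ne_zero (mul_ne_zero (by simpa using hq) (div_ne_zero ?_ hq2)) ?_)
      · simpa using hN
      · exact sub_ne_zero.2 hq2'.symm
    have h1 := riccati_delta (u := κ N + 2 * A) (by rw [hc]; ring) hD hc0 hδ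
    rw [show t δ = 0 by rw [hδdef, Derivation.map_algebraMap]] at h1
    have h2 := (mul_eq_zero.1 h1.symm).resolve_left hδ0
    refine riccati_const_false hs (by rw [hc, hδ]; linear_combination -c * h2) hc0 ?_
    have : κ e * x ^ 2 + c ^ 2 = κ ((N - 1) * (-N / (q + 2)) + (-N / (q + 2)) ^ 2) := by
      rw [map_add, map_mul, map_pow, map_sub, k1, ← hAm]
      rw [htA] at hA
      linear_combination -hA
    rw [this, Derivation.map_algebraMap]
  subst hc0
  have hs0 : κ e * x ^ 2 = 0 := by
    have : κ e * x ^ 2 = κ ((N - 1) * (-N / (q + 2)) + (-N / (q + 2)) ^ 2) := by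
      rw [map_add, map_mul, map_pow, map_sub, k1, ← hAm]
      rw [htA] at hA
      linear_combination -hA
    rw [this, Derivation.map_algebraMap, ← this] at hs
    have h2 : (2 : K) ≠ 0 := two_ne_zero
    exact (mul_eq_zero.1 hs.symm).resolve_left h2
  have hA1 : A = 1 - κ N := by
    rw [htA, hs0] at hA
    refine mul_left_cancel₀ hA00 ?_
    linear_combination hA
  have hqN : q * (N - 1) = 2 - N := by
    apply real_eq_of_algebraMap (K := K)
    rw [map_mul, map_sub, map_sub, k1, k2]
    rw [hA1] at hu
    linear_combination -hu
  refine ⟨hA1, rfl, rfl, htα, hqN, ?_⟩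
  have h1 : (κ q + 1) * (κ N - 1) = 1 := by
    have := congrArg κ hqN
    rw [map_mul, map_sub, map_sub, k1, k2] at this
    linear_combination this
  linear_combination (κ N - 1) * hCr - α ^ 2 * h1

end

/-- The case `p = q`. -/
theorem classify_single [CharZero K] (hreal : ∀ f g : K, f ^ 2 + g ^ 2 = 0 → f = 0)
    (hx : t x = x) (hx0 : x ≠ 0) {e d : ℝ}
    (hN : N ≠ 0) (hq : q ≠ 0) (hk : k ≠ 0) (h0 : α ≠ 0 ∨ β ≠ 0)
    (hA : t A = κ e * x ^ 2 + c ^ 2 - (κ N - 1) * A - A ^ 2)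
    (hc : t c = c * (1 - κ N - 2 * A) + κ d * x ^ 2)
    (hBr : Br = t α + κ N * α + κ q * α * A + 2 * (A * α - c * β))
    (hBi : Bi = t β + κ N * β + κ q * β * A + 2 * (A * β + c * α))
    (h1r : t Br - Br + κ q * Br * A + κ q * β * (κ d * x ^ 2) + κ k * κ q * x * A = 0)
    (h1i : t Bi - Bi + κ q * Bi * A - κ q * α * (κ d * x ^ 2) = 0)
    (h2r : t ((κ q + 1) * α ^ 2 - β ^ 2) + 2 * κ q * ((κ q + 1) * α ^ 2 - β ^ 2) * A
      + κ q * Br * α + κ q * β * Bi + κ k * κ q * x * α = 0)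
    (h3r : 2 * ((κ q + 1) * α ^ 2 - β ^ 2) * α + β * ((κ q + 2) * α * β) = 0)
    (h3i : (κ q + 2) * α * β * α = 0) :
    (A = 0 ∧ c = 0 ∧ α = 0 ∧ t β = β ∧ q * (N + 1) = 2) ∨
    (q = -1 ∧ c = 0 ∧ β = 0 ∧ Br = -κ k * x) := by
  have k1 : κ 1 = 1 := map_one _
  have k2 : κ 2 = 2 := map_ofNat _ 2
  have hD := derivation_const_mul_sq (t := t) hx d
  have hs := derivation_const_mul_sq (t := t) hx e
  have hqK : κ q ≠ 0 := algebraMap_ne hq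
  have hNK : κ N ≠ 0 := algebraMap_ne hN
  have hkK : κ k ≠ 0 := algebraMap_ne hk
  have h4 := riccati_four_mul (u := κ N + 2 * A) hA rfl
  by_cases hα : α = 0
  · left
    subst hα
    have hβ : β ≠ 0 := by simpa using h0
    -- After division by powers of `β`, the ratios `w = Bi / β` and `ζ = k q x / β` turn all the
    -- equations into relations among `w, ζ, c, A, D`.
    obtain ⟨w, hw⟩ : ∃ w, Bi = w * β := ⟨Bi / β, by field_simp⟩
    obtain ⟨ζ, hζ⟩ : ∃ ζ, κ k * κ q * x = ζ * β := ⟨κ k * κ q * x / β, by field_simp⟩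
    have hζ0 : ζ ≠ 0 := by
      intro h
      rw [h, zero_mul] at hζ
      exact mul_ne_zero (mul_ne_zero hkK hqK) hx0 hζ
    have htβ : t β = β * (w - κ N - (κ q + 2) * A) := by
      rw [hw] at hBi; linear_combination -hBi
    have htw : t w = w * (1 + (κ N + 2 * A) - w) := by
      rw [hw, Derivation.leibniz, htβ] at h1i
      simp only [smul_eq_mul] at h1i
      refine mul_left_cancel₀ hβ ?_
      linear_combination h1i
    have htζ : t ζ = ζ * (1 - w + (κ N + 2 * A) + κ q * A) := by
      have h := congrArg t hζ
      rw [← map_mul, Derivation.leibniz, Derivation.map_algebraMap, hx, Derivation.leibniz,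
        htβ, map_mul] at h
      simp only [smul_eq_mul] at h
      refine mul_left_cancel₀ hβ ?_
      linear_combination hζ - h
    have hwu : (2 - κ q) * w = 2 * (κ N + 2 * A) := by
      have hh : t ((κ q + 1) * 0 ^ 2 - β ^ 2) = - (2 * β * t β) := by
        rw [show (κ q + 1) * 0 ^ 2 - β ^ 2 = -β ^ 2 by ring, map_neg, Derivation.leibniz_pow]
        simp only [smul_eq_mul, nsmul_eq_mul]
        push_cast
        ring
      rw [hh, hw, htβ] at h2r
      refine mul_left_cancel₀ (pow_ne_zero 2 hβ) ?_
      linear_combination -h2r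
    have hcD : 2 * c * w * (1 - κ q) - (2 - κ q) * (κ d * x ^ 2) + ζ * A = 0 := by
      have hBr' : Br = -(2 * (c * β)) := by rw [hBr]; simp
      have htB : t Br = -(2 * t (c * β)) := by
        rw [hBr', map_neg, Derivation.leibniz, derivation_ofNat]; simp
      rw [htB, hBr', Derivation.leibniz, hc, htβ] at h1r
      simp only [smul_eq_mul] at h1r
      refine mul_left_cancel₀ hβ ?_
      linear_combination h1r - A * hζ + 2 * c * β * hwu
    -- If `w = 0`, then `u = 0` and `A` is constant; repeatedly differentiating the constant `4 (s +
    -- c²)` gives `3 c + D = 0`, hence `D = 0`, a contradiction.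
    by_cases hw0 : w = 0
    · exfalso
      subst hw0
      have hu : κ N + 2 * A = 0 := by linear_combination -hwu / 2
      have hA00 : A ≠ 0 := by rintro rfl; exact hNK (by linear_combination hu)
      have hD0 : κ d * x ^ 2 ≠ 0 := by
        intro h
        rw [h] at hcD
        exact mul_ne_zero hζ0 hA00 (by linear_combination hcD)
      set D := κ d * x ^ 2
      have htc : t c = c + D := by rw [hc]; linear_combination -c * hu
      rw [hu, map_zero] at h4
      have hM : 4 * (κ e * x ^ 2 + c ^ 2) = κ (N * (2 - N)) := by
        rw [h4, map_mul, map_sub, k2]; ring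
      have h5 := congrArg t hM
      rw [Derivation.map_algebraMap, Derivation.leibniz, derivation_ofNat, map_add, hs,
        Derivation.leibniz_pow, htc] at h5
      simp only [smul_eq_mul, nsmul_eq_mul] at h5
      push_cast at h5
      have h6 : 4 * (c * D) = -κ (N * (2 - N)) := by linear_combination h5 / 2 - hM
      have h7 := congrArg t h6
      rw [map_neg, Derivation.map_algebraMap, Derivation.leibniz, derivation_ofNat,
        Derivation.leibniz, htc, hD] at h7
      simp only [smul_eq_mul] at h7
      have h8 : 3 * c + D = 0 := by
        refine (mul_eq_zero.1 (?_ : D * (3 * c + D) = 0)).resolve_left hD0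
        linear_combination h7 / 4
      have h9 : t (3 * c + D) = 3 * (c + D) + 2 * D := by
        rw [map_add, Derivation.leibniz, derivation_ofNat, htc, hD]; simp
      rw [h8, map_zero] at h9
      exact hD0 (by linear_combination (1/4 : K) * (- h9 - h8))
    -- Degenerate because again `u = 0`. Now `D` is the constant multiple `-(1 + N) c`, which
    -- requires `N = -1` or `N = -2`, and neither is consistent.
    by_cases hq2 : q = 2
    · exfalso
      rw [hq2, k2] at hwu hcD htζ
      have hu : κ N + 2 * A = 0 := by linear_combination -hwu / 2
      have hA' : A = -κ N / 2 := by linear_combination hu / 2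
      have hζc : κ N * ζ = -4 * (c * w) := by
        rw [hA'] at hcD; linear_combination -2 * hcD
      have hc0 : c ≠ 0 := by
        rintro rfl
        exact mul_ne_zero hNK hζ0 (by linear_combination hζc)
      set D := κ d * x ^ 2
      have htc : t c = c + D := by rw [hc]; linear_combination -c * hu
      rw [hu] at htw htζ
      have h5 := congrArg t hζc
      rw [Derivation.leibniz, Derivation.map_algebraMap, htζ, Derivation.leibniz,
        Derivation.leibniz, htc, htw, map_neg, derivation_ofNat] at h5
      simp only [smul_eq_mul] at h5
      have hDc : D = -(1 + κ N) * c := by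
        refine mul_left_cancel₀ hw0 ?_
        rw [hA'] at h5
        linear_combination (1/4 : K) * h5 - (1/4 : K) * (1 - w - κ N) * hζc
      have htc' : t c = -κ N * c := by rw [htc, hDc]; ring
      rw [hu, map_zero] at h4
      have hM : 4 * (κ e * x ^ 2 + c ^ 2) = κ (N * (2 - N)) := by
        rw [h4, map_mul, map_sub, k2]; ring
      have h6 := congrArg t hM
      rw [Derivation.map_algebraMap, Derivation.leibniz, derivation_ofNat, map_add, hs,
        Derivation.leibniz_pow, htc'] at h6
      simp only [smul_eq_mul, nsmul_eq_mul] at h6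
      push_cast at h6
      have h7 : κ (N * (2 - N)) = 4 * (1 + κ N) * c ^ 2 := by linear_combination h6 / 2 - hM
      have h8 : (1 + κ N) * (2 + κ N) = 0 := by
        rw [hDc, show -(1 + κ N) * c = κ (-(1 + N)) * c by rw [map_neg, map_add, k1],
          Derivation.leibniz, Derivation.map_algebraMap, htc'] at hD
        simp only [smul_eq_mul, map_neg, map_add, k1] at hD
        refine mul_left_cancel₀ hc0 ?_
        linear_combination hD
      rcases mul_eq_zero.1 h8 with h | h
      · have h9 : N = -1 := by
          apply real_eq_of_algebraMap (K := K); rw [map_neg, k1]; linear_combination h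
        rw [h, h9, mul_zero, zero_mul] at h7
        exact algebraMap_ne (K := K) (by norm_num) h7
      · have h9 := congrArg t h7
        rw [Derivation.map_algebraMap, ← k1, ← map_add, show (4:K) = κ 4 from (map_ofNat _ 4).symm,
          ← map_mul, Derivation.leibniz, Derivation.map_algebraMap, Derivation.leibniz_pow, htc',
          show κ N = -2 by linear_combination h,
          show N = -2 by
            apply real_eq_of_algebraMap (K := K); rw [map_neg, k2]; linear_combination h] at h9
        simp only [smul_eq_mul, nsmul_eq_mul] at h9
        rw [map_mul, map_add, map_neg, show κ 4 = 4 from map_ofNat _ 4, k1, k2] at h9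
        push_cast at h9
        exact mul_ne_zero hc0 hc0 (by linear_combination h9 / 16)
    · have hq2k : 2 - κ q ≠ 0 := by
        rw [← k2, ← map_sub]; exact algebraMap_ne (sub_ne_zero.2 (Ne.symm hq2))
      have hq2r : (2 - q) ≠ 0 := sub_ne_zero.2 (Ne.symm hq2)
      have hu0 : κ N + 2 * A ≠ 0 := by
        intro h
        rw [h, mul_zero] at hwu
        exact mul_ne_zero hq2k hw0 hwu
      have htu : t (κ N + 2 * A) = (κ N + 2 * A) * (1 - κ (q / (2 - q)) * (κ N + 2 * A)) := by
        have h := congrArg t hwu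
        rw [Derivation.leibniz, Derivation.leibniz, derivation_ofNat, htw, ← k2, ← map_sub,
          Derivation.map_algebraMap, map_sub, k2] at h
        simp only [smul_eq_mul, mul_zero, add_zero] at h
        have hm : κ (q / (2 - q)) * (2 - κ q) = κ q := by
          rw [map_div₀, map_sub, k2, div_mul_cancel₀ _ hq2k]
        refine mul_left_cancel₀ hq2k ?_
        have h' : 2 * t (κ N + 2 * A) = 2 * (κ N + 2 * A) * (1 + (κ N + 2 * A) - w) := by
          rw [← hwu]; linear_combination -h
        linear_combination (2 - κ q) / 2 * h' - (κ N + 2 * A) * hwu + (κ N + 2 * A) ^ 2 * hm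
      have hc0 : c = 0 := eq_zero_of_logistic (e := e) (d := d) hreal hx hx0 (div_ne_zero hq hq2r) h4
        (by rw [hc]; ring) hu0 htu
      subst hc0
      have hD0 : κ d * x ^ 2 = 0 := by rw [map_zero] at hc; linear_combination -hc
      rw [hD0] at hcD
      have hA0 : A = 0 :=
        (mul_eq_zero.1 (by linear_combination hcD : ζ * A = 0)).resolve_left hζ0
      subst hA0
      have hNu : κ N + 2 * 0 = κ N := by ring
      rw [hNu] at htu htw hwu
      rw [Derivation.map_algebraMap] at htu
      have hw1 : w = 1 + κ N := by
        have h1 := (mul_eq_zero.1 htu.symm).resolve_left hNK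
        rw [map_div₀, map_sub, k2] at h1
        field_simp at h1
        refine mul_left_cancel₀ hq2k ?_
        linear_combination hwu - h1
      refine ⟨rfl, rfl, rfl, by rw [htβ, hw1]; ring, ?_⟩
      apply real_eq_of_algebraMap (K := K)
      rw [map_mul, map_add, k1, k2]
      rw [hw1] at hwu
      linear_combination -hwu
  · right
    have hCi : (κ q + 2) * β = 0 := by
      have : α ^ 2 * ((κ q + 2) * β) = 0 := by linear_combination h3i
      exact (mul_eq_zero.1 this).resolve_left (pow_ne_zero _ hα)
    have hCr : (κ q + 1) * α ^ 2 - β ^ 2 = 0 := by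
      have : 2 * α * ((κ q + 1) * α ^ 2 - β ^ 2) = 0 := by
        linear_combination h3r - α * β * hCi
      exact (mul_eq_zero.1 this).resolve_left (mul_ne_zero two_ne_zero hα)
    have hβ : β = 0 := by
      by_contra hβ
      have : κ q + 2 = 0 := (mul_eq_zero.1 hCi).resolve_right hβ
      exact hα (hreal α β (by linear_combination -hCr + α ^ 2 * this))
    subst hβ
    have hq1 : κ q = -1 := by
      have : (κ q + 1) * α ^ 2 = 0 := by linear_combination hCr
      linear_combination (mul_eq_zero.1 this).resolve_right (pow_ne_zero _ hα)
    have hq1' : q = -1 := by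
      apply real_eq_of_algebraMap (K := K); rw [hq1, map_neg, k1]
    rw [hCr, map_zero, hq1] at h2r
    have hBr0 : Br = -κ k * x := by
      refine mul_right_cancel₀ hα ?_
      linear_combination -h2r
    have htα : t α = -κ k * x - κ N * α - A * α := by
      rw [hBr0, hq1] at hBr; linear_combination -hBr
    have hBi' : Bi = 2 * (c * α) := by rw [hBi]; simp
    have h3D : 3 * (κ d * x ^ 2) * α = c * (4 * (κ N + 2 * A) * α + 2 * κ k * x) := by
      rw [hBi', Derivation.leibniz, Derivation.leibniz, derivation_ofNat, hc, htα, hq1] at h1i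
      simp only [smul_eq_mul] at h1i
      linear_combination h1i
    refine ⟨hq1', ?_, rfl, hBr0⟩
    -- This ratio has logarithmic derivative `1 + ρ + (u + N)/2`, so `x` and `α` disappear from the
    -- equations.
    obtain ⟨ρ, hρ⟩ : ∃ ρ, κ k * x = ρ * α := ⟨κ k * x / α, by field_simp⟩
    have hρ0 : ρ ≠ 0 := by
      intro h
      rw [h, zero_mul] at hρ
      exact mul_ne_zero hkK hx0 hρ
    refine eq_zero_of_affine (ρ := ρ) (u := κ N + 2 * A) hreal hx hx0 (d := d) hN h4
      (by rw [hc]; ring) hρ0 ?_ ?_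
    · have h := congrArg t hρ
      rw [Derivation.leibniz, Derivation.map_algebraMap, hx, Derivation.leibniz,
        htα] at h
      simp only [smul_eq_mul] at h
      refine mul_left_cancel₀ hα ?_
      linear_combination (1 + ρ) * hρ - h
    · refine mul_right_cancel₀ hα ?_
      linear_combination h3D + 2 * c * hρ

end DifferentialField

/-! ### A formally real differential field of germs -/

namespace SmoothGerm

open Filter Set
open scoped ContDiff

/-- The filter of neighbourhoods of `U`-almost every point. -/
def nhdsFilter (U : Ultrafilter ℝ) : Filter ℝ := Filter.bind (U : Filter ℝ) 𝓝

variable {U : Ultrafilter ℝ}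

theorem mem_nhdsFilter {s : Set ℝ} : s ∈ nhdsFilter U ↔ interior s ∈ U := by
  rw [nhdsFilter, Filter.mem_bind']
  have : {a | s ∈ 𝓝 a} = interior s := by ext a; exact mem_interior_iff_mem_nhds.symm
  rw [this]; rfl

attribute [irreducible] nhdsFilter

theorem interior_mem {s : Set ℝ} (h : s ∈ nhdsFilter U) : interior s ∈ nhdsFilter U := by
  rw [mem_nhdsFilter, interior_interior]; exact mem_nhdsFilter.1 h

theorem eventually_eventually_nhds {P : ℝ → Prop} (h : ∀ᶠ y in nhdsFilter U, P y) :
    ∀ᶠ y in nhdsFilter U, ∀ᶠ z in 𝓝 y, P z :=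
  mem_of_superset (interior_mem h) fun _ hy => mem_interior_iff_mem_nhds.1 hy

/-- The functions which are smooth near `U`-almost every point. -/
def smooth (U : Ultrafilter ℝ) : Subalgebra ℝ (ℝ → ℝ) where
  carrier := {f | ∀ᶠ y in nhdsFilter U, ContDiffAt ℝ ∞ f y}
  mul_mem' hf hg := (Eventually.and hf hg).mono fun _ h => h.1.mul h.2
  add_mem' hf hg := (Eventually.and hf hg).mono fun _ h => h.1.add h.2
  algebraMap_mem' _ := Eventually.of_forall fun _ => contDiffAt_const

/-- The functions which vanish near `U`-almost every point. -/
def vanishing (U : Ultrafilter ℝ) : Ideal (smooth U) where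
  carrier := {f | ∀ᶠ y in nhdsFilter U, (f : ℝ → ℝ) y = 0}
  add_mem' hf hg := (Eventually.and hf hg).mono fun _ h => by simp [h.1, h.2]
  zero_mem' := Eventually.of_forall fun _ => rfl
  smul_mem' c _ hf := Eventually.mono hf fun _ h => by simp [h]

theorem eventually_contDiffAt (f : smooth U) :
    ∀ᶠ y in nhdsFilter U, ContDiffAt ℝ ∞ (f : ℝ → ℝ) y := f.2

theorem mem_vanishing {f : smooth U} :
    f ∈ vanishing U ↔ ∀ᶠ y in nhdsFilter U, (f : ℝ → ℝ) y = 0 := Iff.rfl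

/-- The open set where `f ≠ 0` together with the interior of its complement is open and dense, hence
residual, so the ultrafilter contains one of the two. In the first case `f` is invertible modulo the
ideal; in the second it lies in the ideal. -/
theorem isMaximal_vanishing (hU : (U : Filter ℝ) ≤ residual ℝ) : (vanishing U).IsMaximal := by
  rw [Ideal.isMaximal_iff]
  refine ⟨?_, ?_⟩
  · intro h
    have h1 : ∀ᶠ y in nhdsFilter U, (1 : ℝ) = 0 := h
    have h2 := mem_nhdsFilter.1 h1
    simp at h2
  · intro J f hJ hf hfJ
    have hW : interior {y | ContDiffAt ℝ ∞ (f : ℝ → ℝ) y} ∈ U := mem_nhdsFilter.1 (eventually_contDiffAt f)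
    set W := interior {y | ContDiffAt ℝ ∞ (f : ℝ → ℝ) y} with hWdef
    have hWf : ∀ y ∈ W, ContDiffAt ℝ ∞ (f : ℝ → ℝ) y := fun y hy =>
      (interior_subset hy : y ∈ {y | ContDiffAt ℝ ∞ (f : ℝ → ℝ) y})
    have hcont : ContinuousOn (f : ℝ → ℝ) W := fun y hy =>
      (hWf y hy).continuousAt.continuousWithinAt
    have hO : IsOpen (W ∩ (f : ℝ → ℝ) ⁻¹' {0}ᶜ) :=
      hcont.isOpen_inter_preimage isOpen_interior isOpen_compl_singleton
    set O := W ∩ (f : ℝ → ℝ) ⁻¹' {0}ᶜ with hOdef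
    have hdense : O ∪ interior Oᶜ ∈ (U : Filter ℝ) := by
      refine hU (residual_of_dense_open (hO.union isOpen_interior) ?_)
      rw [dense_iff_closure_eq, closure_union, closure_eq_compl_interior_compl,
        interior_compl, eq_univ_iff_forall]
      intro y
      by_cases hy : y ∈ closure O
      · exact Or.inl (by simpa [interior_compl] using hy)
      · exact Or.inr (subset_closure hy)
    rcases (Ultrafilter.union_mem_iff.1 hdense) with h | h
    · have hinv : ∀ᶠ y in nhdsFilter U, ContDiffAt ℝ ∞ (fun y => ((f : ℝ → ℝ) y)⁻¹) y := by
        refine mem_nhdsFilter.2 (mem_of_superset h ?_)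
        refine interior_maximal (fun y hy => ?_) hO
        exact (hWf y hy.1).inv hy.2
      let g : smooth U := ⟨fun y => ((f : ℝ → ℝ) y)⁻¹, hinv⟩
      have h1 : 1 - g * f ∈ J := hJ (by
        refine mem_nhdsFilter.2 (mem_of_superset h ?_)
        refine interior_maximal (fun y hy => ?_) hO
        change 1 - ((f : ℝ → ℝ) y)⁻¹ * (f : ℝ → ℝ) y = 0
        rw [inv_mul_cancel₀ hy.2, sub_self])
      have h2 := J.add_mem h1 (J.mul_mem_left g hfJ)
      rwa [sub_add_cancel] at h2
    · refine absurd ?_ hf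
      change ∀ᶠ y in nhdsFilter U, (f : ℝ → ℝ) y = 0
      refine mem_nhdsFilter.2 (mem_of_superset (inter_mem hW h) ?_)
      refine interior_maximal (fun y hy => ?_) (isOpen_interior.inter isOpen_interior)
      by_contra h0
      exact interior_subset hy.2 ⟨hy.1, h0⟩

theorem contDiffAt_mul_deriv {f : ℝ → ℝ} {y : ℝ} (hf : ContDiffAt ℝ ∞ f y) :
    ContDiffAt ℝ ∞ (fun z => z * deriv f z) y := by
  have h : ContDiffAt ℝ ∞ (fun z => fderiv ℝ f z 1) y :=
    (hf.fderiv_right (m := ∞) (by simp)).clm_apply contDiffAt_const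
  exact contDiffAt_id.mul h

/-- The map `f ↦ x f'`. -/
noncomputable def eulerMap (f : smooth U) : smooth U :=
  ⟨fun z => z * deriv f z, (eventually_contDiffAt f).mono fun _ h => contDiffAt_mul_deriv h⟩

/-- Vanishing is required near almost every point and not just at it; this is what lets
differentiation descend to the quotient. -/
theorem eulerMap_congr {f g : smooth U} (h : f - g ∈ vanishing U) :
    eulerMap f - eulerMap g ∈ vanishing U := by
  have h1 : ∀ᶠ y in nhdsFilter U, (f : ℝ → ℝ) y - (g : ℝ → ℝ) y = 0 := h
  have h2 := eventually_eventually_nhds h1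
  refine h2.mono fun y hy => ?_
  have h3 : (f : ℝ → ℝ) =ᶠ[𝓝 y] g := hy.mono fun z hz => sub_eq_zero.1 hz
  change y * deriv f y - y * deriv g y = 0
  rw [h3.deriv_eq, sub_self]

theorem differentiableAt (f : smooth U) : ∀ᶠ y in nhdsFilter U, DifferentiableAt ℝ (f : ℝ → ℝ) y :=
  (eventually_contDiffAt f).mono fun _ h => ContDiffAt.differentiableAt h (by simp)

/-- The derivation `x d/dx` on germs. -/
noncomputable def euler (U : Ultrafilter ℝ) : Derivation ℝ (smooth U ⧸ vanishing U) (smooth U ⧸ vanishing U) :=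
  Derivation.mk'
    { toFun := Quotient.map' (s₁ := (vanishing U).quotientRel) (s₂ := (vanishing U).quotientRel)
        eulerMap (fun f g h => by
          rw [Submodule.quotientRel_def] at h ⊢
          exact eulerMap_congr h)
      map_add' := by
        intro f g
        obtain ⟨f, rfl⟩ := Ideal.Quotient.mk_surjective f
        obtain ⟨g, rfl⟩ := Ideal.Quotient.mk_surjective g
        refine Ideal.Quotient.eq.2 ?_
        change ∀ᶠ y in nhdsFilter U, _
        filter_upwards [differentiableAt f, differentiableAt g] with y hf hg
        change y * deriv (fun z => (f : ℝ → ℝ) z + (g : ℝ → ℝ) z) y - (y * deriv f y + y * deriv g y) = 0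
        rw [deriv_fun_add hf hg]; ring
      map_smul' := by
        intro r f
        obtain ⟨f, rfl⟩ := Ideal.Quotient.mk_surjective f
        refine Ideal.Quotient.eq.2 ?_
        change ∀ᶠ y in nhdsFilter U, _
        filter_upwards [differentiableAt f] with y hf
        change y * deriv (fun z => r * (f : ℝ → ℝ) z) y - r * (y * deriv f y) = 0
        rw [deriv_const_mul _ hf]; ring }
    (by
      intro f g
      obtain ⟨f, rfl⟩ := Ideal.Quotient.mk_surjective f
      obtain ⟨g, rfl⟩ := Ideal.Quotient.mk_surjective g
      refine Ideal.Quotient.eq.2 ?_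
      change ∀ᶠ y in nhdsFilter U, _
      filter_upwards [differentiableAt f, differentiableAt g] with y hf hg
      change y * deriv (fun z => (f : ℝ → ℝ) z * (g : ℝ → ℝ) z) y
        - ((f : ℝ → ℝ) y * (y * deriv g y) + (g : ℝ → ℝ) y * (y * deriv f y)) = 0
      rw [deriv_fun_mul hf hg]; ring)

/-- The algebra of functions which are smooth on `V`. -/
def smoothOn (V : Set ℝ) : Subalgebra ℝ (ℝ → ℝ) where
  carrier := {f | ∀ y ∈ V, ContDiffAt ℝ ∞ f y}
  mul_mem' hf hg y hy := (hf y hy).mul (hg y hy)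
  add_mem' hf hg y hy := (hf y hy).add (hg y hy)
  algebraMap_mem' _ _ _ := contDiffAt_const

/-- The map `f ↦ x f'`. -/
noncomputable def eulerMapOn {V : Set ℝ} (f : smoothOn V) : smoothOn V :=
  ⟨fun z => z * deriv f z, fun y hy => contDiffAt_mul_deriv (f.2 y hy)⟩

/-- The smooth functions on an open set map to a formally real differential field, such that
the functions in the kernel vanish on some nonempty open subset. -/
theorem exists_field {V : Set ℝ} (hV : IsOpen V) (hne : V.Nonempty) :
    ∃ (K : Type) (_ : Field K) (_ : Algebra ℝ K) (t : Derivation ℝ K K) (φ : smoothOn V →ₐ[ℝ] K),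
      (∀ f g : K, f ^ 2 + g ^ 2 = 0 → f = 0) ∧ (∀ f, t (φ f) = φ (eulerMapOn f)) ∧
      (∀ f : smoothOn V, (∀ y ∈ V, (f : ℝ → ℝ) y = 0) → φ f = 0) ∧
      ∀ f : smoothOn V, φ f = 0 → ∃ W ⊆ V, IsOpen W ∧ W.Nonempty ∧ ∀ y ∈ W, (f : ℝ → ℝ) y = 0 := by
  -- Baire: residual sets are dense, so they all meet `V`.
  have hbot : NeBot (residual ℝ ⊓ 𝓟 V) := by
    rw [inf_principal_neBot_iff]
    intro s hs
    have := (dense_of_mem_residual hs).inter_open_nonempty V hV hne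
    rwa [inter_comm]
  let U : Ultrafilter ℝ := Ultrafilter.of (residual ℝ ⊓ 𝓟 V)
  have hU : (U : Filter ℝ) ≤ residual ℝ := (Ultrafilter.of_le _).trans inf_le_left
  have hUV : V ∈ (U : Filter ℝ) := (Ultrafilter.of_le _).trans inf_le_right (mem_principal_self V)
  have hUV' : V ∈ nhdsFilter U := mem_nhdsFilter.2 (by rwa [hV.interior_eq])
  have := isMaximal_vanishing hU
  let ψ : smoothOn V →ₐ[ℝ] smooth U :=
    Subalgebra.inclusion (fun f (hf : ∀ y ∈ V, ContDiffAt ℝ ∞ f y) =>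
      (mem_of_superset hUV' hf : ∀ᶠ y in nhdsFilter U, ContDiffAt ℝ ∞ f y))
  refine ⟨smooth U ⧸ vanishing U, Ideal.Quotient.field _, inferInstance, euler U,
    (Ideal.Quotient.mkₐ ℝ (vanishing U)).comp ψ, ?_, ?_, ?_, ?_⟩
  · intro f g h
    obtain ⟨f, rfl⟩ := Ideal.Quotient.mk_surjective f
    obtain ⟨g, rfl⟩ := Ideal.Quotient.mk_surjective g
    have h1 := Ideal.Quotient.eq_zero_iff_mem.1 ((map_add (Ideal.Quotient.mk _) _ _).trans h : Ideal.Quotient.mk (vanishing U) (f ^ 2 + g ^ 2) = 0)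
    refine Ideal.Quotient.eq_zero_iff_mem.2 ?_
    have h2 : ∀ᶠ y in nhdsFilter U, (f : ℝ → ℝ) y ^ 2 + (g : ℝ → ℝ) y ^ 2 = 0 := by
      simpa using mem_vanishing.1 h1
    refine h2.mono fun y hy => ?_
    nlinarith [sq_nonneg ((f : ℝ → ℝ) y), sq_nonneg ((g : ℝ → ℝ) y)]
  · intro f; rfl
  · intro f hf
    exact Ideal.Quotient.eq_zero_iff_mem.2 (mem_of_superset hUV' hf)
  · intro f hf
    have h1 : ∀ᶠ y in nhdsFilter U, (f : ℝ → ℝ) y = 0 := Ideal.Quotient.eq_zero_iff_mem.1 hf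
    have h2 := mem_nhdsFilter.1 h1
    have h3 : interior {y | (f : ℝ → ℝ) y = 0} ∩ V ∈ (U : Filter ℝ) := inter_mem h2 hUV
    exact ⟨_, inter_subset_right, isOpen_interior.inter hV, U.nonempty_of_mem h3,
      fun y hy => (interior_subset hy.1 : y ∈ {y | (f : ℝ → ℝ) y = 0})⟩

end SmoothGerm

/-! ### Reduction of the system to functions of `x` and `|v|` -/

namespace RadialNLS

open Set ComplexConjugate

theorem hasFDerivAt_norm {v : ℂ} (hv : v ≠ 0) :
    HasFDerivAt (fun w : ℂ => ‖w‖) (‖v‖⁻¹ • innerSL ℝ v) v := by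
  have h1 := (hasStrictFDerivAt_norm_sq v).hasFDerivAt
  have h2 := h1.sqrt (by simpa using hv)
  have h3 : (fun w : ℂ => √(‖w‖ ^ 2)) = fun w => ‖w‖ := by
    ext w; exact Real.sqrt_sq (norm_nonneg w)
  rw [h3, Real.sqrt_sq (norm_nonneg v)] at h2
  have h4 : (1 / (2 * ‖v‖)) • 2 • innerSL ℝ v = ‖v‖⁻¹ • innerSL ℝ v := by
    rw [← Nat.cast_smul_eq_nsmul ℝ, smul_smul]
    congr 1
    field_simp
    norm_num
  rwa [h4] at h2

/-- To first order, moving `v` by `η v` scales `|v|` by `1 + Re η`; only the real part of `η` acts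
on the radial factor. -/
theorem fderiv_radial {f : ℝ → ℂ} {f' v : ℂ} (hv : v ≠ 0) (hf : HasDerivAt f f' ‖v‖) (η : ℂ) :
    fderiv ℝ (fun w : ℂ => f ‖w‖ * w) v (η * v) = (f ‖v‖ * η + ‖v‖ * f' * η.re) * v := by
  have h1 := hf.hasFDerivAt.comp v (hasFDerivAt_norm hv)
  have h2 : HasFDerivAt (fun w : ℂ => f ‖w‖ * w) _ v := h1.mul (hasFDerivAt_id (𝕜 := ℝ) v)
  rw [h2.fderiv]
  have h3 : inner ℝ v (η * v) = ‖v‖ ^ 2 * η.re := by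
    rw [Complex.inner, mul_assoc, Complex.mul_conj, Complex.re_mul_ofReal,
      Complex.normSq_eq_norm_sq, mul_comm]
  have hn : (‖v‖ : ℂ) ≠ 0 := by simpa using hv
  simp [h3]
  field_simp

/-- The combinations of Wirtinger derivatives in the system are real directional derivatives. -/
theorem mul_dv_add (F : ℝ → ℂ → ℂ) (x : ℝ) (v h : ℂ) :
    h * dv F x v + conj h * dvbar F x v = fderiv ℝ (F x) v h := by
  have h1 : h = h.re • (1 : ℂ) + h.im • Complex.I := by
    simp [Complex.re_add_im]
  conv_rhs => rw [h1, map_add, map_smul, map_smul]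
  have h2 : conj h = h.re - h.im * Complex.I := by
    apply Complex.ext <;> simp
  have h3 : h = h.re + h.im * Complex.I := (Complex.re_add_im h).symm
  rw [dv, dvbar, h2]
  set r : ℝ := h.re
  set i : ℝ := h.im
  rw [h3]
  simp only [Complex.real_smul]
  linear_combination (-(i : ℂ) * fderiv ℝ (F x) v Complex.I) * Complex.I_mul_I

variable {J : Set ℝ} {H G : ℝ → ℂ → ℂ} {h g : ℝ → ℝ → ℂ}

theorem dx_radial (hJ : IsOpen J) (hH : ∀ x ∈ J, ∀ v : ℂ, v ≠ 0 → H x v = h x ‖v‖ * v)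
    {x : ℝ} (hx : x ∈ J) {v h' : ℂ} (hv : v ≠ 0) (hh : HasDerivAt (fun s => h s ‖v‖) h' x) :
    dx H x v = h' * v := by
  have h1 : (fun s => H s v) =ᶠ[𝓝 x] fun s => h s ‖v‖ * v := by
    filter_upwards [hJ.mem_nhds hx] with s hs using hH s hs v hv
  rw [dx, h1.deriv_eq, (hh.mul_const v).deriv]

theorem transport_radial (hH : ∀ x ∈ J, ∀ v : ℂ, v ≠ 0 → H x v = h x ‖v‖ * v)
    {x : ℝ} (hx : x ∈ J) {v h' : ℂ} (hv : v ≠ 0) (hh : HasDerivAt (h x) h' ‖v‖) (η : ℂ) :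
    η * v * dv H x v + conj (η * v) * dvbar H x v = (h x ‖v‖ * η + ‖v‖ * h' * η.re) * v := by
  rw [mul_dv_add, ← fderiv_radial hv hh]
  have h1 : H x =ᶠ[𝓝 v] fun w => h x ‖w‖ * w := by
    filter_upwards [isOpen_ne.mem_nhds hv] with w hw using hH x hx w hw
  rw [h1.fderiv_eq]

/-- In the difference of the two transport terms the product of `h` and `g` cancels, so the first
equation only sees their real parts moving `|v|`. -/
theorem eq_one_radial_iff (hJ : IsOpen J) (hH : ∀ x ∈ J, ∀ v : ℂ, v ≠ 0 → H x v = h x ‖v‖ * v)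
    (hG : ∀ x ∈ J, ∀ v : ℂ, v ≠ 0 → G x v = g x ‖v‖ * v)
    {x : ℝ} (hx : x ∈ J) {v hρ gρ gx : ℂ} (hv : v ≠ 0) (hhρ : HasDerivAt (h x) hρ ‖v‖)
    (hgρ : HasDerivAt (g x) gρ ‖v‖) (hgx : HasDerivAt (fun s => g s ‖v‖) gx x) :
    dx G x v + H x v * dv G x v - G x v * dv H x v
      + conj (H x v) * dvbar G x v - conj (G x v) * dvbar H x v = 0 ↔
    gx + ‖v‖ * gρ * (h x ‖v‖).re - ‖v‖ * hρ * (g x ‖v‖).re = 0 := by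
  have e1 := transport_radial hH hx hv hhρ (g x ‖v‖)
  have e2 := transport_radial hG hx hv hgρ (h x ‖v‖)
  rw [← hG x hx v hv] at e1
  rw [← hH x hx v hv] at e2
  have e3 := dx_radial hJ hG hx hv hgx
  constructor
  · intro e
    refine (mul_eq_zero.1 (?_ : (gx + ‖v‖ * gρ * (h x ‖v‖).re - ‖v‖ * hρ * (g x ‖v‖).re) * v = 0)
      ).resolve_right hv
    linear_combination e - e3 - e2 + e1
  · intro e
    linear_combination v * e + e3 + e2 - e1

theorem eq_two_radial_iff {n k p : ℝ} (hJ : IsOpen J)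
    (hH : ∀ x ∈ J, ∀ v : ℂ, v ≠ 0 → H x v = h x ‖v‖ * v)
    {x : ℝ} (hx : x ∈ J) {v hρ hx' γ : ℂ} (hv : v ≠ 0) (hhρ : HasDerivAt (h x) hρ ‖v‖)
    (hhx : HasDerivAt (fun s => h s ‖v‖) hx' x) (hG : G x v = γ * v) :
    Complex.I * G x v - ((n - 1 : ℝ) : ℂ) * H x v / (x : ℂ) - dx H x v
      - H x v * dv H x v - conj (H x v) * dvbar H x v = (k : ℂ) * absPow v p * v ↔
    Complex.I * γ = ((n - 1 : ℝ) : ℂ) * h x ‖v‖ / (x : ℂ) + hx' + h x ‖v‖ ^ 2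
      + ‖v‖ * hρ * (h x ‖v‖).re + (k : ℂ) * (‖v‖ ^ p : ℝ) := by
  have e1 := transport_radial hH hx hv hhρ (h x ‖v‖)
  rw [← hH x hx v hv] at e1
  have e3 := dx_radial hJ hH hx hv hhx
  have e4 := hH x hx v hv
  rw [absPow]
  constructor
  · intro e
    refine mul_right_cancel₀ hv ?_
    linear_combination e + e3 + e1 - Complex.I * hG + ((n - 1 : ℝ) : ℂ) / x * e4
  · intro e
    linear_combination v * e - e3 - e1 + Complex.I * hG - ((n - 1 : ℝ) : ℂ) / x * e4

end RadialNLS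

/-! ### Comparison of powers of `|v|` and the coefficient system -/

namespace RadialNLS

open Set ComplexConjugate

/-- Real powers with different exponents are linearly independent on `(0, ∞)`. -/
theorem sum_coeff_eq_zero {ι : Type*} [Fintype ι] (s : ι → ℝ) (c : ι → ℂ)
    (h : ∀ ρ : ℝ, 0 < ρ → ∑ i, c i * (ρ ^ s i : ℝ) = 0) (r : ℝ) :
    ∑ i, (if s i = r then c i else 0) = 0 := by
  let f : ℝ → Multiplicative ℝ →* ℂ := fun r =>
    { toFun := fun τ => (Real.exp (τ.toAdd * r) : ℝ)
      map_one' := by simp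
      map_mul' := fun x y => by
        rw [← Complex.ofReal_mul, ← Real.exp_add, toAdd_mul, add_mul] }
  have hf : Function.Injective f := by
    intro r r' hr
    have h1 := DFunLike.congr_fun hr (Multiplicative.ofAdd 1)
    have h2 : ((Real.exp (1 * r) : ℝ) : ℂ) = (Real.exp (1 * r') : ℝ) := h1
    rw [Complex.ofReal_inj, Real.exp_eq_exp] at h2
    linarith
  -- Dedekind's independence of characters, for the characters `τ ↦ exp (r τ)` of the additive
  -- reals; these are the powers of `ρ = exp τ`.
  have h1 := (linearIndependent_monoidHom (Multiplicative ℝ) ℂ).comp f hf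
  rw [linearIndependent_iff] at h1
  have h2 := h1 (∑ i, Finsupp.single (s i) (c i)) (by
    rw [map_sum]
    ext τ
    have h3 := h (Real.exp τ.toAdd) (Real.exp_pos _)
    simp only [Finsupp.linearCombination_single, Finset.sum_apply, Pi.smul_apply, smul_eq_mul,
      Pi.zero_apply, Function.comp]
    rw [← h3]
    refine Finset.sum_congr rfl fun i _ => ?_
    rw [← Real.exp_mul]; rfl)
  have h3 := DFunLike.congr_fun h2 r
  rw [Finsupp.finsetSum_apply] at h3
  simpa [Finsupp.single_apply] using h3

/-- The system satisfied by the real and imaginary parts of the coefficients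
`h₁ = a + i b`, `h₂ = α + i β` of `H`, and of the coefficients `e + i d`, `r + i s` of
`|v|^0` and `|v|^q` in `i G / v`. -/
structure CoeffSystem (N q p k : ℝ) (J : Set ℝ) (a b α β e d r s : ℝ → ℝ) : Prop where
  deriv_a : ∀ x ∈ J, HasDerivAt a (e x - N / x * a x - a x ^ 2 + b x ^ 2) x
  deriv_b : ∀ x ∈ J, HasDerivAt b (d x - N / x * b x - 2 * a x * b x) x
  deriv_α : ∀ x ∈ J, HasDerivAt α
    (r x - N / x * α x - q * α x * a x - 2 * (a x * α x - b x * β x)) x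
  deriv_β : ∀ x ∈ J, HasDerivAt β
    (s x - N / x * β x - q * β x * a x - 2 * (a x * β x + b x * α x)) x
  deriv_e : ∀ x ∈ J, HasDerivAt e (-if p = -q then k * p * α x else 0) x
  deriv_d : ∀ x ∈ J, HasDerivAt d 0 x
  deriv_r : ∀ x ∈ J, HasDerivAt r
    (-q * r x * a x - q * β x * d x - if p = q then k * p * a x else 0) x
  deriv_s : ∀ x ∈ J, HasDerivAt s (-q * s x * a x + q * α x * d x) x
  second : ∀ x ∈ J, 2 * (q + 1) * α x * deriv α x - 2 * β x * deriv β x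
    + 2 * q * ((q + 1) * α x ^ 2 - β x ^ 2) * a x + q * r x * α x + q * β x * s x
    + (if p = q then k * p * α x else 0) + (if p = 2 * q then k * p * a x else 0) = 0
  third_re : ∀ x ∈ J, q * (2 * ((q + 1) * α x ^ 2 - β x ^ 2) * α x
      + β x * ((q + 2) * α x * β x))
    + (if p = 2 * q then k * p * α x else 0) + (if p = 3 * q then k * p * a x else 0) = 0
  third_im : ∀ x ∈ J, (q + 2) * α x * β x * α x = 0
  generic : p ≠ q → p ≠ 2 * q → p ≠ -q → ∀ x ∈ J, a x = 0 ∧ α x = 0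
  neg : p = -q → ∀ x ∈ J, a x = 0

end RadialNLS

namespace RadialNLS

open Set ComplexConjugate

theorem hasDerivAt_re {f : ℝ → ℂ} {f' : ℂ} {x : ℝ} (h : HasDerivAt f f' x) :
    HasDerivAt (fun y => (f y).re) f'.re x :=
  Complex.reCLM.hasFDerivAt.comp_hasDerivAt x h

theorem hasDerivAt_im {f : ℝ → ℂ} {f' : ℂ} {x : ℝ} (h : HasDerivAt f f' x) :
    HasDerivAt (fun y => (f y).im) f'.im x :=
  Complex.imCLM.hasFDerivAt.comp_hasDerivAt x h

theorem hasDerivAt_rpow_ofReal (s : ℝ) {ρ : ℝ} (hρ : 0 < ρ) :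
    HasDerivAt (fun y : ℝ => ((y ^ s : ℝ) : ℂ)) ((s * ρ ^ (s - 1) : ℝ) : ℂ) ρ :=
  (Real.hasDerivAt_rpow_const (Or.inl hρ.ne')).ofReal_comp

theorem mul_rpow_sub_one (s : ℝ) {ρ : ℝ} (hρ : 0 < ρ) : ρ * (s * ρ ^ (s - 1)) = s * ρ ^ s := by
  rw [Real.rpow_sub_one hρ.ne']; field_simp

/-- The coefficient identities obtained by comparing powers of `|v|`. -/
theorem coeff_identities {q p k : ℝ} (hq : q ≠ 0) (hp : p ≠ 0) {A' B' C' A B C h₁ h₂ : ℂ}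
    (h : ∀ ρ : ℝ, 0 < ρ → A' + B' * (ρ ^ q : ℝ) + C' * (ρ ^ (2 * q) : ℝ)
      + (k * p * (ρ ^ p : ℝ) + q * B * (ρ ^ q : ℝ) + 2 * q * C * (ρ ^ (2 * q) : ℝ))
        * (h₁.re + h₂.re * (ρ ^ q : ℝ))
      - Complex.I * q * h₂ * (ρ ^ q : ℝ)
        * (A.im + B.im * (ρ ^ q : ℝ) + C.im * (ρ ^ (2 * q) : ℝ)) = 0) :
    (A' + (if p = -q then (k * p * h₂.re : ℂ) else 0) = 0) ∧
    (B' + q * B * h₁.re - Complex.I * q * h₂ * A.im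
      + (if p = q then (k * p * h₁.re : ℂ) else 0) = 0) ∧
    (C' + 2 * q * C * h₁.re + q * B * h₂.re - Complex.I * q * h₂ * B.im
      + (if p = q then (k * p * h₂.re : ℂ) else 0)
      + (if p = 2 * q then (k * p * h₁.re : ℂ) else 0) = 0) ∧
    (2 * q * C * h₂.re - Complex.I * q * h₂ * C.im
      + (if p = 2 * q then (k * p * h₂.re : ℂ) else 0)
      + (if p = 3 * q then (k * p * h₁.re : ℂ) else 0) = 0) ∧
    (p ≠ q → p ≠ 2 * q → p ≠ -q → (k * p * h₂.re : ℂ) = 0) ∧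
    (p ≠ q → p ≠ 2 * q → p ≠ 3 * q → (k * p * h₁.re : ℂ) = 0) := by
  -- The exponents `p` and `p + q` carry the nonlinearity. Since `p, q ≠ 0`, they meet `0, q, 2q,
  -- 3q` exactly at the resonances recorded by the `if` terms.
  have key := sum_coeff_eq_zero ![0, q, 2 * q, 3 * q, p, p + q]
    ![A', B' + q * B * h₁.re - Complex.I * q * h₂ * A.im,
      C' + 2 * q * C * h₁.re + q * B * h₂.re - Complex.I * q * h₂ * B.im,
      2 * q * C * h₂.re - Complex.I * q * h₂ * C.im, k * p * h₁.re, k * p * h₂.re] (by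
    intro ρ hρ
    rw [← h ρ hρ]
    have e2 : (ρ ^ (2 * q) : ℝ) = (ρ ^ q) ^ 2 := by
      rw [mul_comm, Real.rpow_mul hρ.le]; norm_cast
    have e3 : (ρ ^ (3 * q) : ℝ) = (ρ ^ q) ^ 3 := by
      rw [mul_comm, Real.rpow_mul hρ.le]; norm_cast
    simp only [Fin.sum_univ_six, Matrix.cons_val, e2, e3, Real.rpow_add hρ, Real.rpow_zero]
    push_cast
    ring)
  simp only [Fin.sum_univ_six, Matrix.cons_val] at key
  have c1 : ¬ (0 = q) := Ne.symm hq
  have c2 : ¬ (2 * q = 0) := by simpa using hq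
  have c3 : ¬ (3 * q = 0) := by simpa using hq
  have c4 : (p + q = 0) ↔ p = -q := by constructor <;> intro <;> linarith
  have c5 : ¬ (2 * q = q) := by intro h'; apply hq; linarith
  have c6 : ¬ (3 * q = q) := by intro h'; apply hq; linarith
  have c7 : ¬ (p + q = q) := by intro h'; apply hp; linarith
  have c8 : ¬ (0 = 2 * q) := Ne.symm c2
  have c9 : ¬ (q = 2 * q) := Ne.symm c5
  have c10 : ¬ (3 * q = 2 * q) := by intro h'; apply hq; linarith
  have c11 : (p + q = 2 * q) ↔ p = q := by constructor <;> intro <;> linarith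
  have c12 : ¬ (0 = 3 * q) := Ne.symm c3
  have c13 : ¬ (q = 3 * q) := Ne.symm c6
  have c14 : ¬ (2 * q = 3 * q) := Ne.symm c10
  have c15 : (p + q = 3 * q) ↔ p = 2 * q := by constructor <;> intro <;> linarith
  have k0 := key 0
  have k1 := key q
  have k2 := key (2 * q)
  have k3 := key (3 * q)
  have k4 := key p
  have k5 := key (p + q)
  simp only [hq, c2, c3, hp, c4, if_true, if_false, add_zero] at k0
  simp only [c1, c5, c6, c7, if_true, if_false, add_zero, zero_add] at k1
  simp only [c8, c9, c10, c11, if_true, if_false, add_zero, zero_add] at k2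
  simp only [c12, c13, c14, c15, if_true, if_false, add_zero, zero_add] at k3
  refine ⟨k0, k1, ?_, ?_, ?_, ?_⟩
  · rw [add_right_comm]; exact k2
  · rw [add_right_comm]; exact k3
  · intro h1 h2 h3
    have d1 : ¬ (0 = p + q) := fun h' => h3 (by linarith)
    have d2 : ¬ (q = p + q) := fun h' => hp (by linarith)
    have d3 : ¬ (2 * q = p + q) := fun h' => h1 (by linarith)
    have d4 : ¬ (3 * q = p + q) := fun h' => h2 (by linarith)
    have d5 : ¬ (p = p + q) := fun h' => hq (by linarith)
    simpa only [d1, d2, d3, d4, d5, if_true, if_false, add_zero, zero_add] using k5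
  · intro h1 h2 h3
    have d5 : ¬ (p + q = p) := fun h' => hq (by linarith)
    simpa only [Ne.symm hp, h1.symm, h2.symm, h3.symm, d5, if_true, if_false, add_zero,
      zero_add] using k4

/-- A solution of the separable power form satisfies the coefficient system. -/
theorem exists_coeffSystem {n p k : ℝ} (hp : p ≠ 0) (hk : k ≠ 0) {J : Set ℝ} (hJ : IsOpen J)
    {H G : ℝ → ℂ → ℂ} (hA : HasAnsatzForm n p k J H G) (hS : IsSolution n p k J H G) :
    ∃ q : ℝ, q ≠ 0 ∧ ∃ a b α β e d r s : ℝ → ℝ, CoeffSystem (n - 1) q p k J a b α β e d r s ∧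
      ∀ x ∈ J, ∀ v : ℂ, v ≠ 0 →
        H x v = ((a x + Complex.I * b x) + (α x + Complex.I * β x) * absPow v q) * v ∧
        G x v = -Complex.I * (k * absPow v p + (e x + Complex.I * d x)
          + (r x + Complex.I * s x) * absPow v q
          + ((q + 1) * α x ^ 2 - β x ^ 2 + Complex.I * ((q + 2) * α x * β x))
            * absPow v (2 * q)) * v := by
  obtain ⟨a₀, ha₀, h₁, h₂, hform⟩ := hA
  set q := 2 * a₀ with hqdef
  have hq : q ≠ 0 := mul_ne_zero two_ne_zero ha₀
  -- Because `2 ^ q ≠ 1`, the values of `H` at `v = 1` and `v = 2` determine `h₁` and `h₂`, which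
  -- therefore are `C¹`.
  have two_pow : ((2 : ℝ) ^ q : ℝ) ≠ 1 := by
    intro h
    rw [← Real.rpow_zero 2] at h
    exact hq ((Real.rpow_right_inj (by norm_num) (by norm_num)).1 h)
  have two_pow' : (((2 : ℝ) ^ q : ℝ) : ℂ) - 1 ≠ 0 := by
    rw [sub_ne_zero]; exact_mod_cast two_pow
  set hf : ℝ → ℝ → ℂ := fun x ρ => h₁ x + h₂ x * (ρ ^ q : ℝ) with hfdef
  have hH : ∀ x ∈ J, ∀ v : ℂ, v ≠ 0 → H x v = hf x ‖v‖ * v := by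
    intro x hx v hv
    rw [hfdef, (hform x hx v hv).1, absPow]; ring
  have hslice : ∀ (F : ℝ → ℂ → ℂ),
      ContDiffOn ℝ 1 (fun q : ℝ × ℂ => F q.1 q.2) (J ×ˢ {v : ℂ | v ≠ 0}) → ∀ v : ℂ, v ≠ 0 →
      ContDiffOn ℝ 1 (fun x => F x v) J := by
    intro F hF v hv
    have h1 : ContDiffOn ℝ 1 (fun x : ℝ => (x, v)) J := by fun_prop
    exact hF.comp h1 fun x hx => ⟨hx, hv⟩
  have hH1 : ∀ x ∈ J, H x 1 = h₁ x + h₂ x := by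
    intro x hx
    rw [hH x hx 1 one_ne_zero]; simp [hfdef]
  have hH2 : ∀ x ∈ J, H x 2 = (h₁ x + h₂ x * ((2 : ℝ) ^ q : ℝ)) * 2 := by
    intro x hx
    rw [hH x hx 2 two_ne_zero]; simp [hfdef]
  have c1 := hslice H hS.contDiffOn_H 1 one_ne_zero
  have c2 := hslice H hS.contDiffOn_H 2 two_ne_zero
  have hh₂ : ContDiffOn ℝ 1 h₂ J := by
    have h : ContDiffOn ℝ 1
        (fun x => (H x 2 / 2 - H x 1) / ((((2 : ℝ) ^ q : ℝ) : ℂ) - 1)) J := by fun_prop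
    refine h.congr fun x hx => ?_
    rw [hH1 x hx, hH2 x hx]; field_simp; ring
  have hh₁ : ContDiffOn ℝ 1 h₁ J := by
    have h : ContDiffOn ℝ 1 (fun x => H x 1 - h₂ x) J := c1.sub hh₂
    refine h.congr fun x hx => ?_
    rw [hH1 x hx]; ring
  have hasd : ∀ {f : ℝ → ℂ}, ContDiffOn ℝ 1 f J → ∀ x ∈ J, HasDerivAt f (deriv f x) x :=
    fun hf x hx => ((hf.differentiableOn (by simp)).differentiableAt
      (hJ.mem_nhds hx)).hasDerivAt
  have dh₁ := hasd hh₁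
  have dh₂ := hasd hh₂
  set A : ℝ → ℂ := fun x => deriv h₁ x + (((n - 1) / x : ℝ) : ℂ) * h₁ x + h₁ x ^ 2 with hAdef
  set B : ℝ → ℂ := fun x => deriv h₂ x + (((n - 1) / x : ℝ) : ℂ) * h₂ x + q * h₂ x * (h₁ x).re
    + 2 * h₁ x * h₂ x with hBdef
  set C : ℝ → ℂ := fun x => q * h₂ x * (h₂ x).re + h₂ x ^ 2 with hCdef
  have dρ : ∀ x (ρ : ℝ), 0 < ρ → HasDerivAt (hf x)
      (h₂ x * ((q * ρ ^ (q - 1) : ℝ) : ℂ)) ρ := fun x ρ hρ =>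
    ((hasDerivAt_rpow_ofReal q hρ).const_mul (h₂ x)).const_add _
  have rpow_two : ∀ {ρ : ℝ}, 0 < ρ → (ρ ^ (2 * q) : ℝ) = (ρ ^ q) ^ 2 := fun {ρ} hρ => by
    rw [mul_comm, Real.rpow_mul hρ.le]; norm_cast
  set gf : ℝ → ℝ → ℂ := fun x ρ => -Complex.I * (k * (ρ ^ p : ℝ) + A x + B x * (ρ ^ q : ℝ)
        + C x * (ρ ^ (2 * q) : ℝ)) with gfdef
  have hG : ∀ x ∈ J, ∀ v : ℂ, v ≠ 0 → G x v = gf x ‖v‖ * v := by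
    intro x hx v hv
    have hv' : 0 < ‖v‖ := norm_pos_iff.2 hv
    have h1 := (eq_two_radial_iff (hx' := deriv h₁ x + deriv h₂ x * (‖v‖ ^ q : ℝ)) (γ := G x v / v) (n := n) (k := k) (p := p) hJ hH hx hv
      (dρ x ‖v‖ hv') (by exact (dh₁ x hx).add ((dh₂ x hx).mul_const _)) (by field_simp)).1
      (hS.eq_two x hx v hv)
    have h2 : (‖v‖ : ℂ) * ((q * ‖v‖ ^ (q - 1) : ℝ) : ℂ) = q * (‖v‖ ^ q : ℝ) := by
      rw [← Complex.ofReal_mul, mul_rpow_sub_one q hv']; push_cast; ring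
    have h3 : (hf x ‖v‖).re = (h₁ x).re + (h₂ x).re * ‖v‖ ^ q := by
      rw [hfdef]; simp only [Complex.add_re, Complex.re_mul_ofReal]
    have h4 : G x v / v = -Complex.I * (Complex.I * (G x v / v)) := by
      linear_combination (G x v / v) * Complex.I_mul_I
    have h5 : G x v = G x v / v * v := by field_simp
    rw [h5, h4, h1, h3]
    simp only [hfdef, gfdef, hAdef, hBdef, hCdef, rpow_two hv']
    push_cast
    push_cast at h2
    linear_combination -Complex.I * v * h₂ x * ((h₁ x).re + (h₂ x).re * (‖v‖ ^ q : ℝ)) * h2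
  have hC : ContDiffOn ℝ 1 C J := by
    have h : ContDiffOn ℝ 1 (fun x => ((h₂ x).re : ℂ)) J :=
      (Complex.ofRealCLM.comp Complex.reCLM).contDiff.comp_contDiffOn hh₂
    rw [hCdef]; fun_prop
  have hG1 : ∀ x ∈ J, A x + B x = Complex.I * G x 1 - k - C x := by
    intro x hx
    rw [hG x hx 1 one_ne_zero]
    simp [gfdef]
    linear_combination (A x + B x + C x + k) * Complex.I_mul_I
  have hG2 : ∀ x ∈ J, A x + B x * ((2 : ℝ) ^ q : ℝ) = Complex.I * G x 2 / 2
      - k * ((2 : ℝ) ^ p : ℝ) - C x * ((2 : ℝ) ^ (2 * q) : ℝ) := by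
    intro x hx
    rw [hG x hx 2 two_ne_zero]
    simp only [gfdef, Complex.norm_ofNat]
    linear_combination (A x + B x * ((2 : ℝ) ^ q : ℝ) + C x * ((2 : ℝ) ^ (2 * q) : ℝ)
      + k * ((2 : ℝ) ^ p : ℝ)) * Complex.I_mul_I
  have g1 := hslice G hS.contDiffOn_G 1 one_ne_zero
  have g2 := hslice G hS.contDiffOn_G 2 two_ne_zero
  -- `A` and `B` contain derivatives of `h₁, h₂` and are a priori only continuous. The same
  -- two-point argument applied to `G` shows that they are `C¹`.
  have hB : ContDiffOn ℝ 1 B J := by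
    have h : ContDiffOn ℝ 1 (fun x => (Complex.I * G x 2 / 2
      - k * ((2 : ℝ) ^ p : ℝ) - C x * ((2 : ℝ) ^ (2 * q) : ℝ) - (Complex.I * G x 1 - k - C x))
        / ((((2 : ℝ) ^ q : ℝ) : ℂ) - 1)) J := by fun_prop
    refine h.congr fun x hx => ?_
    rw [← hG1 x hx, ← hG2 x hx]; field_simp; ring
  have hA : ContDiffOn ℝ 1 A J := by
    have h : ContDiffOn ℝ 1 (fun x => Complex.I * G x 1 - k - C x - B x) J := by fun_prop
    refine h.congr fun x hx => ?_
    rw [← hG1 x hx]; ring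
  have dA := hasd hA
  have dB := hasd hB
  have dC : ∀ x ∈ J, HasDerivAt C (q * (deriv h₂ x * (h₂ x).re + h₂ x * (deriv h₂ x).re)
      + 2 * h₂ x * deriv h₂ x) x := by
    intro x hx
    have h1 := (hasDerivAt_re (dh₂ x hx)).ofReal_comp
    have h2 := (((dh₂ x hx).mul h1).const_mul (q : ℂ)).add ((dh₂ x hx).pow 2)
    refine (h2.congr_deriv ?_).congr_of_eventuallyEq (Filter.Eventually.of_forall fun y => ?_)
    · push_cast; ring
    · simp [hCdef]; ring
  have key : ∀ x ∈ J, _ := fun x hx => coeff_identities (k := k) hq hp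
    (A' := deriv A x) (B' := deriv B x)
    (C' := q * (deriv h₂ x * (h₂ x).re + h₂ x * (deriv h₂ x).re) + 2 * h₂ x * deriv h₂ x)
    (A := A x) (B := B x) (C := C x) (h₁ := h₁ x) (h₂ := h₂ x) (by
    intro ρ hρ
    have hn : ‖(ρ : ℂ)‖ = ρ := by simp [hρ.le]
    have hv : (ρ : ℂ) ≠ 0 := by exact_mod_cast hρ.ne'
    have h1 := (eq_one_radial_iff (hρ := h₂ x * ((q * ρ ^ (q - 1) : ℝ) : ℂ))
      (gρ := -Complex.I * (k * ((p * ρ ^ (p - 1) : ℝ) : ℂ) + B x * ((q * ρ ^ (q - 1) : ℝ) : ℂ)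
        + C x * ((2 * q * ρ ^ (2 * q - 1) : ℝ) : ℂ))) (gx := -Complex.I * (deriv A x + deriv B x * (ρ ^ q : ℝ)
        + (q * (deriv h₂ x * (h₂ x).re + h₂ x * (deriv h₂ x).re) + 2 * h₂ x * deriv h₂ x)
          * (ρ ^ (2 * q) : ℝ))) hJ hH hG hx hv (by rw [hn]; exact dρ x ρ hρ)
      (by
        rw [hn]
        exact (((((hasDerivAt_rpow_ofReal p hρ).const_mul (k : ℂ)).add_const (A x)).add
          ((hasDerivAt_rpow_ofReal q hρ).const_mul (B x))).add
          ((hasDerivAt_rpow_ofReal (2 * q) hρ).const_mul (C x))).const_mul (-Complex.I))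
      (by
        rw [hn]
        exact ((((dA x hx).const_add _).add ((dB x hx).mul_const _)).add
          ((dC x hx).mul_const _)).const_mul _)).1 (hS.eq_one x hx ρ hv)
    simp only [hn] at h1
    have e0 : ∀ s : ℝ, (ρ : ℂ) * ((s * ρ ^ (s - 1) : ℝ) : ℂ) = s * (ρ ^ s : ℝ) := fun s => by
      rw [← Complex.ofReal_mul, mul_rpow_sub_one s hρ]; push_cast; ring
    have e1 : (hf x ρ).re = (h₁ x).re + (h₂ x).re * ρ ^ q := by
      rw [hfdef]; simp only [Complex.add_re, Complex.re_mul_ofReal]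
    have e2 : (gf x ρ).re
        = (A x).im + (B x).im * ρ ^ q + (C x).im * ρ ^ (2 * q) := by
      simp only [gfdef, ← Complex.ofReal_mul, neg_mul, Complex.neg_re, Complex.I_mul_re, neg_neg, Complex.add_im,
        Complex.ofReal_im, Complex.im_mul_ofReal, zero_add]
    rw [e1, e2] at h1
    have ep := e0 p
    have eq := e0 q
    have eqq := e0 (2 * q)
    push_cast at h1 ep eq eqq ⊢
    linear_combination Complex.I * h1
      + (k * ep + B x * eq + C x * eqq) * ((h₁ x).re + (h₂ x).re * (ρ ^ q : ℝ)) * (-1)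
      + Complex.I * h₂ x * eq * ((A x).im + (B x).im * (ρ ^ q : ℝ) + (C x).im * (ρ ^ (2 * q) : ℝ))
      + (deriv A x + deriv B x * (ρ ^ q : ℝ)
          + (q * (deriv h₂ x * (h₂ x).re + h₂ x * (deriv h₂ x).re) + 2 * h₂ x * deriv h₂ x)
            * (ρ ^ (2 * q) : ℝ)
          + ρ * (k * (p * (ρ ^ (p - 1) : ℝ)) + B x * (q * (ρ ^ (q - 1) : ℝ))
            + C x * (2 * q * (ρ ^ (2 * q - 1) : ℝ))) * ((h₁ x).re + (h₂ x).re * (ρ ^ q : ℝ)))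
        * Complex.I_mul_I)
  have hCre : ∀ x, (C x).re = (q + 1) * (h₂ x).re ^ 2 - (h₂ x).im ^ 2 := fun x => by
    simp [hCdef, pow_two]; ring
  have hCim : ∀ x, (C x).im = (q + 2) * (h₂ x).re * (h₂ x).im := fun x => by
    simp [hCdef, pow_two]; ring
  have hkp : ∀ y : ℝ, (k * p * y : ℂ) = 0 → y = 0 := fun y hy => by
    have : k * p * y = 0 := by exact_mod_cast hy
    exact (mul_eq_zero.1 this).resolve_left (mul_ne_zero hk hp)
  have ifre : ∀ (P : Prop) [Decidable P] (y : ℝ),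
      (if P then (k * p * y : ℂ) else 0) = ((if P then k * p * y else 0 : ℝ) : ℂ) := fun P _ y => by
    split_ifs <;> simp
  have dh₁re : ∀ x, (deriv h₁ x).re = (A x).re - (n - 1) / x * (h₁ x).re - (h₁ x).re ^ 2
      + (h₁ x).im ^ 2 := fun x => by
    simp [hAdef, pow_two, -Complex.ofReal_div, -Complex.ofReal_sub]; ring
  have dh₁im : ∀ x, (deriv h₁ x).im = (A x).im - (n - 1) / x * (h₁ x).im
      - 2 * (h₁ x).re * (h₁ x).im := fun x => by
    simp [hAdef, pow_two, -Complex.ofReal_div, -Complex.ofReal_sub]; ring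
  have dh₂re : ∀ x, (deriv h₂ x).re = (B x).re - (n - 1) / x * (h₂ x).re
      - q * (h₂ x).re * (h₁ x).re
      - 2 * ((h₁ x).re * (h₂ x).re - (h₁ x).im * (h₂ x).im) := fun x => by
    simp [hBdef, -Complex.ofReal_div, -Complex.ofReal_sub]; ring
  have dh₂im : ∀ x, (deriv h₂ x).im = (B x).im - (n - 1) / x * (h₂ x).im
      - q * (h₂ x).im * (h₁ x).re
      - 2 * ((h₁ x).re * (h₂ x).im + (h₁ x).im * (h₂ x).re) := fun x => by
    simp [hBdef, -Complex.ofReal_div, -Complex.ofReal_sub]; ring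
  clear_value A B C
  refine ⟨q, hq, fun x => (h₁ x).re, fun x => (h₁ x).im, fun x => (h₂ x).re, fun x => (h₂ x).im,
    fun x => (A x).re, fun x => (A x).im, fun x => (B x).re, fun x => (B x).im, ?_, ?_⟩
  · refine ⟨fun x hx => ?_, fun x hx => ?_, fun x hx => ?_, fun x hx => ?_, fun x hx => ?_,
      fun x hx => ?_, fun x hx => ?_, fun x hx => ?_, fun x hx => ?_, fun x hx => ?_,
      fun x hx => ?_, fun h1 h2 h3 x hx => ?_, fun h1 x hx => ?_⟩
    · rw [← dh₁re]; exact hasDerivAt_re (dh₁ x hx)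
    · rw [← dh₁im]; exact hasDerivAt_im (dh₁ x hx)
    · rw [← dh₂re]; exact hasDerivAt_re (dh₂ x hx)
    · rw [← dh₂im]; exact hasDerivAt_im (dh₂ x hx)
    · refine (hasDerivAt_re (dA x hx)).congr_deriv ?_
      have h := congrArg Complex.re (key x hx).1
      simp only [ifre, Complex.add_re, Complex.ofReal_re, Complex.zero_re] at h
      linarith
    · refine (hasDerivAt_im (dA x hx)).congr_deriv ?_
      have h := congrArg Complex.im (key x hx).1
      simp only [ifre, Complex.add_im, Complex.ofReal_im, Complex.zero_im] at h
      linarith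
    · refine (hasDerivAt_re (dB x hx)).congr_deriv ?_
      have h := congrArg Complex.re (key x hx).2.1
      simp only [ifre] at h
      simp at h
      linarith
    · refine (hasDerivAt_im (dB x hx)).congr_deriv ?_
      have h := congrArg Complex.im (key x hx).2.1
      simp only [ifre] at h
      simp at h
      linarith
    · have h := congrArg Complex.re (key x hx).2.2.1
      simp only [ifre] at h
      simp [hCre] at h
      rw [(hasDerivAt_re (dh₂ x hx)).deriv, (hasDerivAt_im (dh₂ x hx)).deriv]
      linarith
    · have h := congrArg Complex.re (key x hx).2.2.2.1
      simp only [ifre] at h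
      simp [hCre, hCim] at h
      linarith
    · have h := congrArg Complex.im (key x hx).2.2.2.1
      simp only [ifre] at h
      simp [hCre, hCim] at h
      refine (mul_eq_zero.1 (?_ : q * ((q + 2) * (h₂ x).re * (h₂ x).im * (h₂ x).re) = 0)).resolve_left hq
      linarith
    · have h4 := hkp _ ((key x hx).2.2.2.2.1 h1 h2 h3)
      refine ⟨?_, h4⟩
      -- At this resonance the coefficient of `|v|^(3q)` still gives `a = 0`, because `α = 0` kills
      -- the other terms.
      by_cases h5 : p = 3 * q
      · have h := congrArg Complex.re (key x hx).2.2.2.1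
        simp only [ifre] at h
        simp [hCim, h4, h5] at h
        have h6 : 3 * q ≠ 2 * q := by rw [← h5]; exact h2
        simpa [h6, hk, hq, hp] using h
      · exact hkp _ ((key x hx).2.2.2.2.2 h1 h2 h5)
    · refine hkp _ ((key x hx).2.2.2.2.2 ?_ ?_ ?_) <;>
      · rw [h1]; intro h; apply hq; linarith
  · intro x hx v hv
    have r1 : ∀ z : ℂ, (z.re : ℂ) + Complex.I * z.im = z := fun z => by
      rw [mul_comm]; exact Complex.re_add_im z
    refine ⟨?_, ?_⟩
    · rw [hH x hx v hv, r1, r1]; rfl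
    · rw [hG x hx v hv, r1, r1]
      have h := r1 (C x)
      rw [hCre, hCim] at h
      push_cast at h
      rw [h]; simp only [gfdef, absPow]

end RadialNLS

/-! ### Local classification of the coefficient functions -/

namespace RadialNLS

open Set SmoothGerm DifferentialField
open scoped ContDiff

variable {N q p k : ℝ} {J : Set ℝ} {a b α β e d r s : ℝ → ℝ}

namespace CoeffSystem

/-- Bootstrapping: the right sides are polynomials in the unknowns and in `1/x`, so one more
derivative is gained for all eight functions at once. -/
theorem contDiffOn_nat (S : CoeffSystem N q p k J a b α β e d r s) (hJ : IsOpen J)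
    (hJ0 : J ⊆ Ioi 0) (m : ℕ) :
    ContDiffOn ℝ m a J ∧ ContDiffOn ℝ m b J ∧ ContDiffOn ℝ m α J ∧ ContDiffOn ℝ m β J ∧
    ContDiffOn ℝ m e J ∧ ContDiffOn ℝ m d J ∧ ContDiffOn ℝ m r J ∧ ContDiffOn ℝ m s J := by
  have h0 : ∀ {f f' : ℝ → ℝ}, (∀ x ∈ J, HasDerivAt f (f' x) x) → ContDiffOn ℝ 0 f J :=
    fun h => contDiffOn_zero.2 fun x hx => (h x hx).continuousAt.continuousWithinAt
  have hs : ∀ {f f' : ℝ → ℝ} {m : ℕ}, (∀ x ∈ J, HasDerivAt f (f' x) x) → ContDiffOn ℝ m f' J →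
      ContDiffOn ℝ (m + 1 : ℕ) f J := fun {f f' m} h h' => by
    push_cast
    rw [contDiffOn_succ_iff_deriv_of_isOpen hJ]
    exact ⟨fun x hx => (h x hx).differentiableAt.differentiableWithinAt, by simp,
      h'.congr fun x hx => (h x hx).deriv⟩
  induction m with
  | zero =>
    exact ⟨h0 S.deriv_a, h0 S.deriv_b, h0 S.deriv_α, h0 S.deriv_β,
      h0 S.deriv_e, h0 (f' := fun _ => 0) S.deriv_d, h0 S.deriv_r, h0 S.deriv_s⟩
  | succ m ih =>
    obtain ⟨ia, ib, iα, iβ, ie, id, ir, is⟩ := ih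
    have hinv : ContDiffOn ℝ m (fun x : ℝ => N / x) J :=
      contDiffOn_const.div contDiffOn_id fun x hx => (hJ0 hx).ne'
    refine ⟨hs S.deriv_a ?_, hs S.deriv_b ?_, hs S.deriv_α ?_, hs S.deriv_β ?_,
      hs S.deriv_e ?_, hs (f' := fun _ => 0) S.deriv_d ?_, hs S.deriv_r ?_, hs S.deriv_s ?_⟩
    · fun_prop
    · fun_prop
    · fun_prop
    · fun_prop
    · split_ifs <;> fun_prop
    · fun_prop
    · split_ifs <;> fun_prop
    · fun_prop

theorem contDiffAt (S : CoeffSystem N q p k J a b α β e d r s) (hJ : IsOpen J)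
    (hJ0 : J ⊆ Ioi 0) {x : ℝ} (hx : x ∈ J) :
    ContDiffAt ℝ ∞ a x ∧ ContDiffAt ℝ ∞ b x ∧ ContDiffAt ℝ ∞ α x ∧ ContDiffAt ℝ ∞ β x ∧
    ContDiffAt ℝ ∞ r x ∧ ContDiffAt ℝ ∞ s x := by
  have h := fun m => S.contDiffOn_nat hJ hJ0 m
  have hn := hJ.mem_nhds hx
  exact ⟨(contDiffOn_infty.2 fun m => (h m).1).contDiffAt hn,
    (contDiffOn_infty.2 fun m => (h m).2.1).contDiffAt hn,
    (contDiffOn_infty.2 fun m => (h m).2.2.1).contDiffAt hn,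
    (contDiffOn_infty.2 fun m => (h m).2.2.2.1).contDiffAt hn,
    (contDiffOn_infty.2 fun m => (h m).2.2.2.2.2.2.1).contDiffAt hn,
    (contDiffOn_infty.2 fun m => (h m).2.2.2.2.2.2.2).contDiffAt hn⟩

theorem exists_const {f : ℝ → ℝ} (hJ : IsOpen J) (hJc : IsPreconnected J) (hne : J.Nonempty)
    (h : ∀ x ∈ J, HasDerivAt f 0 x) : ∃ c, ∀ x ∈ J, f x = c :=
  ⟨f hne.some, fun _ hx => hJ.is_const_of_deriv_eq_zero hJc
    (fun y hy => (h y hy).differentiableAt.differentiableWithinAt) (fun y hy => (h y hy).deriv)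
    hx hne.some_mem⟩

set_option maxHeartbeats 1000000 in
/-- Classification of the coefficient functions on some open subset. -/
theorem exists_local (S : CoeffSystem N q p k J a b α β e d r s) (hN : N ≠ 0) (hq : q ≠ 0)
    (hk : k ≠ 0) (hJ : IsOpen J) (hJc : IsPreconnected J) (hJ0 : J ⊆ Ioi 0)
    (hne : ∃ x ∈ J, α x ≠ 0 ∨ β x ≠ 0) :
    ∃ W ⊆ J, IsOpen W ∧ W.Nonempty ∧ (∀ x ∈ W, α x ≠ 0 ∨ β x ≠ 0) ∧
      ((q * (N + 1) = 2 ∧ ∀ x ∈ W, a x = 0 ∧ b x = 0 ∧ α x = 0 ∧ x * deriv β x = β x) ∨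
      (p = 2 * q ∧ q * (1 - N) = 1 ∧ N + 1 ≠ 0 ∧ ∀ x ∈ W, x * a x = 1 - N ∧ b x = 0 ∧
        α x = 0 ∧ deriv β x = 0 ∧ β x ^ 2 * (N + 1) = 2 * k * (N - 1)) ∨
      (p = 2 * q ∧ q * (N - 1) = 2 - N ∧ ∀ x ∈ W, x * a x = 1 - N ∧ b x = 0 ∧
        α x = 0 ∧ deriv β x = 0 ∧ β x ^ 2 = k) ∨
      (p = 2 * q ∧ q * (N - 1) = 2 - N ∧ ∀ x ∈ W, x * a x = 1 - N ∧ b x = 0 ∧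
        β x = 0 ∧ deriv α x = 0 ∧ α x ^ 2 = -k * (N - 1)) ∨
      (p = q ∧ q = -1 ∧ ∀ x ∈ W, b x = 0 ∧ β x = 0 ∧ r x = -k)) := by
  obtain ⟨x₀, hx₀, hx₀'⟩ := hne
  have hJne : J.Nonempty := ⟨x₀, hx₀⟩
  -- Restricting to the open set where `h₂ ≠ 0` ensures that `α` and `β` do not both map to zero in
  -- the field.
  set V : Set ℝ := {x ∈ J | α x ^ 2 + β x ^ 2 ≠ 0} with hVdef
  have hVJ : V ⊆ J := fun x hx => hx.1
  have hne0 : ∀ {u w : ℝ}, u ^ 2 + w ^ 2 ≠ 0 ↔ u ≠ 0 ∨ w ≠ 0 := fun {u w} => by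
    constructor
    · intro h
      by_contra hc
      push Not at hc
      apply h; rw [hc.1, hc.2]; norm_num
    · rintro (h | h) <;> positivity
  have cα : ContinuousOn α J := fun x hx => (S.deriv_α x hx).continuousAt.continuousWithinAt
  have cβ : ContinuousOn β J := fun x hx => (S.deriv_β x hx).continuousAt.continuousWithinAt
  have hV : IsOpen V := (by fun_prop : ContinuousOn (fun x => α x ^ 2 + β x ^ 2) J
    ).isOpen_inter_preimage hJ isOpen_compl_singleton
  have hVne : V.Nonempty := ⟨x₀, hx₀, hne0.2 hx₀'⟩
  obtain ⟨K, _, _, t, φ, hreal, ht, hφ, hker⟩ := exists_field hV hVne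
  have : CharZero K := charZero_of_injective_algebraMap (algebraMap ℝ K).injective
  have hφ' : ∀ f g : smoothOn V, (∀ y ∈ V, (f : ℝ → ℝ) y = (g : ℝ → ℝ) y) → φ f = φ g := by
    intro f g h
    rw [← sub_eq_zero, ← map_sub]
    refine hφ _ fun y hy => ?_
    change (f : ℝ → ℝ) y - (g : ℝ → ℝ) y = 0
    rw [h y hy, sub_self]
  have hsm := fun y (hy : y ∈ V) => S.contDiffAt hJ hJ0 (hVJ hy)
  -- The factors `y` are the weights for which `x d/dx` makes the system autonomous, up to constants
  -- times powers of `X`.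
  let X : smoothOn V := ⟨fun y => y, fun y _ => contDiffAt_id⟩
  let fA : smoothOn V := ⟨fun y => y * a y, fun y hy => contDiffAt_id.mul (hsm y hy).1⟩
  let fc : smoothOn V := ⟨fun y => y * b y, fun y hy => contDiffAt_id.mul (hsm y hy).2.1⟩
  let fα : smoothOn V := ⟨α, fun y hy => (hsm y hy).2.2.1⟩
  let fβ : smoothOn V := ⟨β, fun y hy => (hsm y hy).2.2.2.1⟩
  let fr : smoothOn V := ⟨fun y => y * r y, fun y hy => contDiffAt_id.mul (hsm y hy).2.2.2.2.1⟩
  let fs : smoothOn V := ⟨fun y => y * s y, fun y hy => contDiffAt_id.mul (hsm y hy).2.2.2.2.2⟩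
  have hκ : ∀ c : ℝ, φ (algebraMap ℝ _ c) = algebraMap ℝ K c := φ.commutes
  obtain ⟨d₀, hd₀⟩ := exists_const hJ hJc hJne S.deriv_d
  have hx : t (φ X) = φ X := by
    rw [ht]
    refine hφ' _ _ fun y hy => ?_
    change y * deriv (fun y => y) y = y
    simp
  have hVpos : ∀ y ∈ V, 0 < y := fun y hy => hJ0 (hVJ hy)
  have hx0 : φ X ≠ 0 := by
    intro h
    obtain ⟨W, hWV, -, ⟨w, hw⟩, h0⟩ := hker _ h
    exact (hVpos w (hWV hw)).ne' (h0 w hw)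
  have h0 : φ fα ≠ 0 ∨ φ fβ ≠ 0 := by
    by_contra hc
    push Not at hc
    have h1 : φ (fα ^ 2 + fβ ^ 2) = 0 := by
      rw [map_add, map_pow, map_pow, hc.1, hc.2]; ring
    obtain ⟨W, hWV, -, ⟨w, hw⟩, h0⟩ := hker _ h1
    exact (hWV hw).2 (h0 w hw)
  have htα : t (φ fα) = φ (eulerMapOn fα) := ht fα
  have htβ : t (φ fβ) = φ (eulerMapOn fβ) := ht fβ
  have h2 : φ 2 = 2 := map_ofNat φ 2
  have ha' : ∀ y ∈ V, deriv (fun y => y * a y) y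
      = a y + y * (e y - N / y * a y - a y ^ 2 + b y ^ 2) := fun y hy => by
    rw [((hasDerivAt_id' y).fun_mul (S.deriv_a y (hVJ hy))).deriv]; simp
  have hb' : ∀ y ∈ V, deriv (fun y => y * b y) y
      = b y + y * (d y - N / y * b y - 2 * a y * b y) := fun y hy => by
    rw [((hasDerivAt_id' y).fun_mul (S.deriv_b y (hVJ hy))).deriv]; simp
  have hc : t (φ fc) = φ fc * (1 - algebraMap ℝ K N - 2 * φ fA)
      + algebraMap ℝ K d₀ * φ X ^ 2 := by
    have := hφ' (eulerMapOn fc) (fc * (1 - algebraMap ℝ _ N - 2 * fA) + algebraMap ℝ _ d₀ * X ^ 2)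
      (fun y hy => by
        change y * deriv (fun y => y * b y) y
          = (y * b y) * (1 - N - 2 * (y * a y)) + d₀ * y ^ 2
        have := (hVpos y hy).ne'
        rw [hb' y hy, hd₀ y (hVJ hy)]; field_simp; ring)
    rw [ht, this]
    simp [hκ, h2]
  have hBr : φ fr = t (φ fα) + algebraMap ℝ K N * φ fα + algebraMap ℝ K q * φ fα * φ fA
      + 2 * (φ fA * φ fα - φ fc * φ fβ) := by
    have := hφ' fr (eulerMapOn fα + algebraMap ℝ _ N * fα + algebraMap ℝ _ q * fα * fA
      + 2 * (fA * fα - fc * fβ)) (fun y hy => by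
        change y * r y = y * deriv α y + N * α y + q * α y * (y * a y)
          + 2 * (y * a y * α y - y * b y * β y)
        have := (hVpos y hy).ne'
        rw [(S.deriv_α y (hVJ hy)).deriv]; field_simp; ring)
    rw [this, htα]
    simp [hκ, h2]
  have hBi : φ fs = t (φ fβ) + algebraMap ℝ K N * φ fβ + algebraMap ℝ K q * φ fβ * φ fA
      + 2 * (φ fA * φ fβ + φ fc * φ fα) := by
    have := hφ' fs (eulerMapOn fβ + algebraMap ℝ _ N * fβ + algebraMap ℝ _ q * fβ * fA
      + 2 * (fA * fβ + fc * fα)) (fun y hy => by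
        change y * s y = y * deriv β y + N * β y + q * β y * (y * a y)
          + 2 * (y * a y * β y + y * b y * α y)
        have := (hVpos y hy).ne'
        rw [(S.deriv_β y (hVJ hy)).deriv]; field_simp; ring)
    rw [this, htβ]
    simp [hκ, h2]
  have h1i : t (φ fs) - φ fs + algebraMap ℝ K q * φ fs * φ fA
      - algebraMap ℝ K q * φ fα * (algebraMap ℝ K d₀ * φ X ^ 2) = 0 := by
    have := hφ (eulerMapOn fs - fs + algebraMap ℝ _ q * fs * fA
      - algebraMap ℝ _ q * fα * (algebraMap ℝ _ d₀ * X ^ 2)) (fun y hy => by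
        change y * deriv (fun y => y * s y) y - y * s y + q * (y * s y) * (y * a y)
          - q * α y * (d₀ * y ^ 2) = 0
        rw [((hasDerivAt_id' y).fun_mul (S.deriv_s y (hVJ hy))).deriv, ← hd₀ y (hVJ hy)]
        simp; ring)
    rw [ht]
    simpa [hκ, h2] using this
  have htC : t ((algebraMap ℝ K q + 1) * φ fα ^ 2 - φ fβ ^ 2)
      = 2 * (algebraMap ℝ K q + 1) * φ fα * φ (eulerMapOn fα)
        - 2 * φ fβ * φ (eulerMapOn fβ) := by
    rw [map_sub, Derivation.leibniz, Derivation.leibniz_pow, Derivation.leibniz_pow, htα, htβ,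
      ← map_one (algebraMap ℝ K), ← map_add, Derivation.map_algebraMap]
    simp only [smul_eq_mul, nsmul_eq_mul]
    push_cast
    ring
  have h3i : (algebraMap ℝ K q + 2) * φ fα * φ fβ * φ fα = 0 := by
    have := hφ ((algebraMap ℝ _ q + 2) * fα * fβ * fα) (fun y hy => S.third_im y (hVJ hy))
    simpa [hκ, h2] using this
  -- The kernel property handles one function at a time; a sum of squares makes several of them
  -- vanish on a common open set.
  have hout : ∀ f₁ f₂ f₃ f₄ f₅ : smoothOn V, φ f₁ = 0 → φ f₂ = 0 → φ f₃ = 0 → φ f₄ = 0 →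
      φ f₅ = 0 →
      ∃ W ⊆ V, IsOpen W ∧ W.Nonempty ∧ ∀ y ∈ W, (f₁ : ℝ → ℝ) y = 0 ∧ (f₂ : ℝ → ℝ) y = 0 ∧
        (f₃ : ℝ → ℝ) y = 0 ∧ (f₄ : ℝ → ℝ) y = 0 ∧ (f₅ : ℝ → ℝ) y = 0 := by
    intro f₁ f₂ f₃ f₄ f₅ g₁ g₂ g₃ g₄ g₅
    obtain ⟨W, hWV, hWo, hWne, hW⟩ := hker (f₁ ^ 2 + f₂ ^ 2 + f₃ ^ 2 + f₄ ^ 2 + f₅ ^ 2) (by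
      simp [g₁, g₂, g₃, g₄, g₅])
    refine ⟨W, hWV, hWo, hWne, fun y hy => ?_⟩
    have h : (f₁ : ℝ → ℝ) y ^ 2 + (f₂ : ℝ → ℝ) y ^ 2 + (f₃ : ℝ → ℝ) y ^ 2 + (f₄ : ℝ → ℝ) y ^ 2
      + (f₅ : ℝ → ℝ) y ^ 2 = 0 := hW y hy
    refine ⟨?_, ?_, ?_, ?_, ?_⟩ <;> refine pow_eq_zero_iff two_ne_zero |>.1 ?_ <;>
      nlinarith [sq_nonneg ((f₁ : ℝ → ℝ) y), sq_nonneg ((f₂ : ℝ → ℝ) y),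
        sq_nonneg ((f₃ : ℝ → ℝ) y), sq_nonneg ((f₄ : ℝ → ℝ) y), sq_nonneg ((f₅ : ℝ → ℝ) y)]
  have out_power : φ fA = 0 ∧ φ fc = 0 ∧ φ fα = 0 ∧ t (φ fβ) = φ fβ ∧ q * (N + 1) = 2 →
      ∃ W ⊆ V, IsOpen W ∧ W.Nonempty ∧ q * (N + 1) = 2 ∧
        ∀ x ∈ W, a x = 0 ∧ b x = 0 ∧ α x = 0 ∧ x * deriv β x = β x := by
    rintro ⟨g1, g2, g3, g4, g5⟩
    obtain ⟨W, hWV, hWo, hWne, hW⟩ := hout fA fc fα (eulerMapOn fβ - fβ) 0 g1 g2 g3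
      (by rw [map_sub, ← htβ, g4, sub_self]) (map_zero _)
    refine ⟨W, hWV, hWo, hWne, g5, fun y hy => ?_⟩
    have hy0 := (hVpos y (hWV hy)).ne'
    obtain ⟨w1, w2, w3, w4, -⟩ := hW y hy
    exact ⟨(mul_eq_zero.1 w1).resolve_left hy0, (mul_eq_zero.1 w2).resolve_left hy0, w3,
      sub_eq_zero.1 w4⟩
  have out_power' : φ fA = 0 ∧ φ fc = 0 ∧ φ fα = 0 ∧ t (φ fβ) = φ fβ ∧ q * (N + 1) = 2 →
      ∃ W ⊆ J, IsOpen W ∧ W.Nonempty ∧ (∀ x ∈ W, α x ≠ 0 ∨ β x ≠ 0) ∧ q * (N + 1) = 2 ∧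
        ∀ x ∈ W, a x = 0 ∧ b x = 0 ∧ α x = 0 ∧ x * deriv β x = β x := fun h => by
    obtain ⟨W, hWV, h1, h2, h3, h4⟩ := out_power h
    exact ⟨W, hWV.trans hVJ, h1, h2, fun y hy => hne0.1 (hWV hy).2, h3, h4⟩
  by_cases hpn : p = -q
  · have ha0 := S.neg hpn
    -- For `p = -q` the function `e` need not be constant, but `a = 0` turns the equation of `a`
    -- into this identity. Its derivative, compared with the equation of `e`, is the relation `hE`.
    have hb2 : ∀ x ∈ J, e x = -b x ^ 2 := fun x hx => by
      have h1 : HasDerivAt a 0 x := (hasDerivAt_const x (0 : ℝ)).congr_of_eventuallyEq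
        (Filter.eventually_of_mem (hJ.mem_nhds hx) ha0)
      have h3 := (S.deriv_a x hx).unique h1
      rw [ha0 x hx] at h3
      linarith
    have hq1 : p ≠ q := fun h => hq (by linarith)
    have hq2 : p ≠ 2 * q := fun h => hq (by linarith)
    have hq3 : p ≠ 3 * q := fun h => hq (by linarith)
    have hA0 : φ fA = 0 := hφ _ fun y hy => by
      change y * a y = 0
      rw [ha0 y (hVJ hy), mul_zero]
    have hE : -2 * φ fc * t (φ fc) + 2 * φ fc ^ 2
        - algebraMap ℝ K k * algebraMap ℝ K q * φ fα * φ X ^ 3 = 0 := by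
      have := hφ (-2 * fc * eulerMapOn fc + 2 * fc ^ 2
        - algebraMap ℝ _ k * algebraMap ℝ _ q * fα * X ^ 3) (fun y hy => by
          change -2 * (y * b y) * (y * deriv (fun y => y * b y) y) + 2 * (y * b y) ^ 2
            - k * q * α y * y ^ 3 = 0
          have hyJ := hVJ hy
          have h1 := (((S.deriv_b y hyJ).pow 2).neg.congr_of_eventuallyEq
            (Filter.eventually_of_mem (hJ.mem_nhds hyJ) hb2)).unique (S.deriv_e y hyJ)
          rw [if_pos hpn, hpn] at h1
          rw [hb' y hy]
          simp only [Nat.cast_ofNat] at h1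
          linear_combination y ^ 3 * h1)
      rw [ht]
      simpa [hκ, h2] using this
    have h2r : t ((algebraMap ℝ K q + 1) * φ fα ^ 2 - φ fβ ^ 2)
        + 2 * algebraMap ℝ K q * ((algebraMap ℝ K q + 1) * φ fα ^ 2 - φ fβ ^ 2) * φ fA
        + algebraMap ℝ K q * φ fr * φ fα + algebraMap ℝ K q * φ fβ * φ fs = 0 := by
      have := hφ (2 * (algebraMap ℝ _ q + 1) * fα * eulerMapOn fα - 2 * fβ * eulerMapOn fβ
        + 2 * algebraMap ℝ _ q * ((algebraMap ℝ _ q + 1) * fα ^ 2 - fβ ^ 2) * fA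
        + algebraMap ℝ _ q * fr * fα + algebraMap ℝ _ q * fβ * fs) (fun y hy => by
          change 2 * (q + 1) * α y * (y * deriv α y) - 2 * β y * (y * deriv β y)
            + 2 * q * ((q + 1) * α y ^ 2 - β y ^ 2) * (y * a y)
            + q * (y * r y) * α y + q * β y * (y * s y) = 0
          have h1 := S.second y (hVJ hy)
          rw [if_neg hq1, if_neg hq2] at h1
          linear_combination y * h1)
      rw [htC]
      simpa [hκ, h2] using this
    have h3r : 2 * ((algebraMap ℝ K q + 1) * φ fα ^ 2 - φ fβ ^ 2) * φ fα
        + φ fβ * ((algebraMap ℝ K q + 2) * φ fα * φ fβ) = 0 := by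
      have := hφ (2 * ((algebraMap ℝ _ q + 1) * fα ^ 2 - fβ ^ 2) * fα
        + fβ * ((algebraMap ℝ _ q + 2) * fα * fβ)) (fun y hy => by
          change 2 * ((q + 1) * α y ^ 2 - β y ^ 2) * α y + β y * ((q + 2) * α y * β y) = 0
          have h1 := S.third_re y (hVJ hy)
          rw [if_neg hq2, if_neg hq3] at h1
          refine (mul_eq_zero.1 (?_ : q * _ = 0)).resolve_left hq
          linear_combination h1)
      simpa [hκ, h2] using this
    obtain ⟨W, w1, w2, w3, w4, w5⟩ := out_power' (classify_neg hreal hx hx0 hN hq hk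
      (derivation_const_mul_sq hx d₀) h0 hA0 hE hc hBr hBi h1i h2r h3r h3i)
    exact ⟨W, w1, w2, w3, w4, Or.inl w5⟩
  obtain ⟨e₀, he₀⟩ := exists_const hJ hJc hJne (f := e) (fun x hx => by
    have := S.deriv_e x hx
    rwa [if_neg hpn, neg_zero] at this)
  have hA : t (φ fA) = algebraMap ℝ K e₀ * φ X ^ 2 + φ fc ^ 2
      - (algebraMap ℝ K N - 1) * φ fA - φ fA ^ 2 := by
    have := hφ' (eulerMapOn fA) (algebraMap ℝ _ e₀ * X ^ 2 + fc ^ 2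
        - (algebraMap ℝ _ N - 1) * fA - fA ^ 2)
      (fun y hy => by
        change y * deriv (fun y => y * a y) y
          = e₀ * y ^ 2 + (y * b y) ^ 2 - (N - 1) * (y * a y) - (y * a y) ^ 2
        have := (hVpos y hy).ne'
        rw [ha' y hy, he₀ y (hVJ hy)]; field_simp; ring)
    rw [ht, this]
    simp [hκ]
  by_cases hp2 : p = 2 * q
  · have hq1 : p ≠ q := fun h => hq (by linarith)
    have hq3 : p ≠ 3 * q := fun h => hq (by linarith)
    have h1r : t (φ fr) - φ fr + algebraMap ℝ K q * φ fr * φ fA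
        + algebraMap ℝ K q * φ fβ * (algebraMap ℝ K d₀ * φ X ^ 2) = 0 := by
      have := hφ (eulerMapOn fr - fr + algebraMap ℝ _ q * fr * fA
        + algebraMap ℝ _ q * fβ * (algebraMap ℝ _ d₀ * X ^ 2)) (fun y hy => by
          change y * deriv (fun y => y * r y) y - y * r y + q * (y * r y) * (y * a y)
            + q * β y * (d₀ * y ^ 2) = 0
          rw [((hasDerivAt_id' y).fun_mul (S.deriv_r y (hVJ hy))).deriv, ← hd₀ y (hVJ hy),
            if_neg hq1]
          ring)
      rw [ht]
      simpa [hκ, h2] using this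
    have h2r : t ((algebraMap ℝ K q + 1) * φ fα ^ 2 - φ fβ ^ 2)
        + 2 * algebraMap ℝ K q * ((algebraMap ℝ K q + 1) * φ fα ^ 2 - φ fβ ^ 2) * φ fA
        + algebraMap ℝ K q * φ fr * φ fα + algebraMap ℝ K q * φ fβ * φ fs
        + 2 * algebraMap ℝ K k * algebraMap ℝ K q * φ fA = 0 := by
      have := hφ (2 * (algebraMap ℝ _ q + 1) * fα * eulerMapOn fα - 2 * fβ * eulerMapOn fβ
        + 2 * algebraMap ℝ _ q * ((algebraMap ℝ _ q + 1) * fα ^ 2 - fβ ^ 2) * fA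
        + algebraMap ℝ _ q * fr * fα + algebraMap ℝ _ q * fβ * fs
        + 2 * algebraMap ℝ _ k * algebraMap ℝ _ q * fA) (fun y hy => by
          change 2 * (q + 1) * α y * (y * deriv α y) - 2 * β y * (y * deriv β y)
            + 2 * q * ((q + 1) * α y ^ 2 - β y ^ 2) * (y * a y)
            + q * (y * r y) * α y + q * β y * (y * s y) + 2 * k * q * (y * a y) = 0
          have h1 := S.second y (hVJ hy)
          rw [if_neg hq1, if_pos hp2, hp2] at h1
          linear_combination y * h1)
      rw [htC]
      simpa [hκ, h2] using this
    have h3r : 2 * ((algebraMap ℝ K q + 1) * φ fα ^ 2 - φ fβ ^ 2) * φ fα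
        + φ fβ * ((algebraMap ℝ K q + 2) * φ fα * φ fβ)
        + 2 * algebraMap ℝ K k * φ fα = 0 := by
      have := hφ (2 * ((algebraMap ℝ _ q + 1) * fα ^ 2 - fβ ^ 2) * fα
        + fβ * ((algebraMap ℝ _ q + 2) * fα * fβ) + 2 * algebraMap ℝ _ k * fα) (fun y hy => by
          change 2 * ((q + 1) * α y ^ 2 - β y ^ 2) * α y + β y * ((q + 2) * α y * β y)
            + 2 * k * α y = 0
          have h1 := S.third_re y (hVJ hy)
          rw [if_pos hp2, if_neg hq3, hp2] at h1
          refine (mul_eq_zero.1 (?_ : q * _ = 0)).resolve_left hq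
          linear_combination h1)
      simpa [hκ, h2] using this
    have hfA : φ fA = 1 - algebraMap ℝ K N → φ (fA - algebraMap ℝ _ (1 - N)) = 0 := fun h => by
      rw [map_sub, h, hκ, map_sub, map_one, sub_self]
    rcases classify_double hreal hx hx0 hN hq hk h0 hA hc hBr hBi h1r h1i h2r h3r h3i with
      h | ⟨g1, g2, g3, g4, g5, g6, g7⟩ | ⟨g1, g2, g3, g4, g5, g6⟩ | ⟨g1, g2, g3, g4, g5, g6⟩
    · obtain ⟨W, w1, w2, w3, w4, w5⟩ := out_power' h
      exact ⟨W, w1, w2, w3, w4, Or.inl w5⟩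
    · obtain ⟨W, hWV, hWo, hWne, hW⟩ := hout (fA - algebraMap ℝ _ (1 - N)) fc fα
        (eulerMapOn fβ) (fβ ^ 2 * algebraMap ℝ _ (N + 1) - algebraMap ℝ _ (2 * k * (N - 1)))
        (hfA g1) g2 g3 (by rw [← htβ, g4])
        (by
          have k2 : algebraMap ℝ K 2 = 2 := map_ofNat _ 2
          rw [map_sub, map_mul, map_pow, hκ, hκ, map_add, map_mul, map_mul, map_sub, map_one,
            k2, g7, sub_self])
      refine ⟨W, hWV.trans hVJ, hWo, hWne, fun y hy => hne0.1 (hWV hy).2,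
        Or.inr (Or.inl ⟨hp2, g5, g6, fun y hy => ?_⟩)⟩
      have hy0 := (hVpos y (hWV hy)).ne'
      obtain ⟨w1, w2, w3, w4, w5⟩ := hW y hy
      exact ⟨sub_eq_zero.1 w1, (mul_eq_zero.1 w2).resolve_left hy0, w3,
        (mul_eq_zero.1 w4).resolve_left hy0, sub_eq_zero.1 w5⟩
    · obtain ⟨W, hWV, hWo, hWne, hW⟩ := hout (fA - algebraMap ℝ _ (1 - N)) fc fα
        (eulerMapOn fβ) (fβ ^ 2 - algebraMap ℝ _ k)
        (hfA g1) g2 g3 (by rw [← htβ, g4]) (by rw [map_sub, map_pow, hκ, g6, sub_self])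
      refine ⟨W, hWV.trans hVJ, hWo, hWne, fun y hy => hne0.1 (hWV hy).2,
        Or.inr (Or.inr (Or.inl ⟨hp2, g5, fun y hy => ?_⟩))⟩
      have hy0 := (hVpos y (hWV hy)).ne'
      obtain ⟨w1, w2, w3, w4, w5⟩ := hW y hy
      exact ⟨sub_eq_zero.1 w1, (mul_eq_zero.1 w2).resolve_left hy0, w3,
        (mul_eq_zero.1 w4).resolve_left hy0, sub_eq_zero.1 w5⟩
    · obtain ⟨W, hWV, hWo, hWne, hW⟩ := hout (fA - algebraMap ℝ _ (1 - N)) fc fβ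
        (eulerMapOn fα) (fα ^ 2 - algebraMap ℝ _ (-k * (N - 1)))
        (hfA g1) g2 g3 (by rw [← htα, g4])
        (by rw [map_sub, map_pow, hκ, g6, map_mul, map_neg, map_sub, map_one, sub_self])
      refine ⟨W, hWV.trans hVJ, hWo, hWne, fun y hy => hne0.1 (hWV hy).2,
        Or.inr (Or.inr (Or.inr (Or.inl ⟨hp2, g5, fun y hy => ?_⟩)))⟩
      have hy0 := (hVpos y (hWV hy)).ne'
      obtain ⟨w1, w2, w3, w4, w5⟩ := hW y hy
      exact ⟨sub_eq_zero.1 w1, (mul_eq_zero.1 w2).resolve_left hy0, w3,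
        (mul_eq_zero.1 w4).resolve_left hy0, sub_eq_zero.1 w5⟩
  by_cases hp1 : p = q
  · have hq3 : p ≠ 3 * q := fun h => hq (by linarith)
    have h1r : t (φ fr) - φ fr + algebraMap ℝ K q * φ fr * φ fA
        + algebraMap ℝ K q * φ fβ * (algebraMap ℝ K d₀ * φ X ^ 2)
        + algebraMap ℝ K k * algebraMap ℝ K q * φ X * φ fA = 0 := by
      have := hφ (eulerMapOn fr - fr + algebraMap ℝ _ q * fr * fA
        + algebraMap ℝ _ q * fβ * (algebraMap ℝ _ d₀ * X ^ 2)
        + algebraMap ℝ _ k * algebraMap ℝ _ q * X * fA) (fun y hy => by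
          change y * deriv (fun y => y * r y) y - y * r y + q * (y * r y) * (y * a y)
            + q * β y * (d₀ * y ^ 2) + k * q * y * (y * a y) = 0
          rw [((hasDerivAt_id' y).fun_mul (S.deriv_r y (hVJ hy))).deriv, ← hd₀ y (hVJ hy),
            if_pos hp1, hp1]
          ring)
      rw [ht]
      simpa [hκ, h2] using this
    have h2r : t ((algebraMap ℝ K q + 1) * φ fα ^ 2 - φ fβ ^ 2)
        + 2 * algebraMap ℝ K q * ((algebraMap ℝ K q + 1) * φ fα ^ 2 - φ fβ ^ 2) * φ fA
        + algebraMap ℝ K q * φ fr * φ fα + algebraMap ℝ K q * φ fβ * φ fs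
        + algebraMap ℝ K k * algebraMap ℝ K q * φ X * φ fα = 0 := by
      have := hφ (2 * (algebraMap ℝ _ q + 1) * fα * eulerMapOn fα - 2 * fβ * eulerMapOn fβ
        + 2 * algebraMap ℝ _ q * ((algebraMap ℝ _ q + 1) * fα ^ 2 - fβ ^ 2) * fA
        + algebraMap ℝ _ q * fr * fα + algebraMap ℝ _ q * fβ * fs
        + algebraMap ℝ _ k * algebraMap ℝ _ q * X * fα) (fun y hy => by
          change 2 * (q + 1) * α y * (y * deriv α y) - 2 * β y * (y * deriv β y)
            + 2 * q * ((q + 1) * α y ^ 2 - β y ^ 2) * (y * a y)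
            + q * (y * r y) * α y + q * β y * (y * s y) + k * q * y * α y = 0
          have h1 := S.second y (hVJ hy)
          rw [if_pos hp1, if_neg hp2, hp1] at h1
          linear_combination y * h1)
      rw [htC]
      simpa [hκ, h2] using this
    have h3r : 2 * ((algebraMap ℝ K q + 1) * φ fα ^ 2 - φ fβ ^ 2) * φ fα
        + φ fβ * ((algebraMap ℝ K q + 2) * φ fα * φ fβ) = 0 := by
      have := hφ (2 * ((algebraMap ℝ _ q + 1) * fα ^ 2 - fβ ^ 2) * fα
        + fβ * ((algebraMap ℝ _ q + 2) * fα * fβ)) (fun y hy => by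
          change 2 * ((q + 1) * α y ^ 2 - β y ^ 2) * α y + β y * ((q + 2) * α y * β y) = 0
          have h1 := S.third_re y (hVJ hy)
          rw [if_neg hp2, if_neg hq3] at h1
          refine (mul_eq_zero.1 (?_ : q * _ = 0)).resolve_left hq
          linear_combination h1)
      simpa [hκ, h2] using this
    rcases classify_single hreal hx hx0 hN hq hk h0 hA hc hBr hBi h1r h1i h2r h3r h3i with
      h | ⟨g1, g2, g3, g4⟩
    · obtain ⟨W, w1, w2, w3, w4, w5⟩ := out_power' h
      exact ⟨W, w1, w2, w3, w4, Or.inl w5⟩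
    · obtain ⟨W, hWV, hWo, hWne, hW⟩ := hout fc fβ (fr + algebraMap ℝ _ k * X) 0 0 g2 g3
        (by rw [map_add, map_mul, hκ, g4]; ring) (map_zero _) (map_zero _)
      refine ⟨W, hWV.trans hVJ, hWo, hWne, fun y hy => hne0.1 (hWV hy).2,
        Or.inr (Or.inr (Or.inr (Or.inr ⟨hp1, g1, fun y hy => ?_⟩)))⟩
      have hy0 := (hVpos y (hWV hy)).ne'
      obtain ⟨w1, w2, w3, -⟩ := hW y hy
      refine ⟨(mul_eq_zero.1 w1).resolve_left hy0, w2, ?_⟩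
      have w3' : y * r y + k * y = 0 := w3
      refine mul_left_cancel₀ hy0 ?_
      linear_combination w3'
  have hgen := S.generic hp1 hp2 hpn
  have hA0 : φ fA = 0 := hφ _ fun y hy => by
    change y * a y = 0
    rw [(hgen y (hVJ hy)).1, mul_zero]
  have hα0 : φ fα = 0 := hφ _ fun y hy => (hgen y (hVJ hy)).2
  have h2r : t ((algebraMap ℝ K q + 1) * φ fα ^ 2 - φ fβ ^ 2)
      + 2 * algebraMap ℝ K q * ((algebraMap ℝ K q + 1) * φ fα ^ 2 - φ fβ ^ 2) * φ fA
      + algebraMap ℝ K q * φ fr * φ fα + algebraMap ℝ K q * φ fβ * φ fs = 0 := by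
    have := hφ (2 * (algebraMap ℝ _ q + 1) * fα * eulerMapOn fα - 2 * fβ * eulerMapOn fβ
      + 2 * algebraMap ℝ _ q * ((algebraMap ℝ _ q + 1) * fα ^ 2 - fβ ^ 2) * fA
      + algebraMap ℝ _ q * fr * fα + algebraMap ℝ _ q * fβ * fs) (fun y hy => by
        change 2 * (q + 1) * α y * (y * deriv α y) - 2 * β y * (y * deriv β y)
          + 2 * q * ((q + 1) * α y ^ 2 - β y ^ 2) * (y * a y)
          + q * (y * r y) * α y + q * β y * (y * s y) = 0
        have h1 := S.second y (hVJ hy)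
        rw [if_neg hp1, if_neg hp2] at h1
        linear_combination y * h1)
    rw [htC]
    simpa [hκ, h2] using this
  obtain ⟨W, w1, w2, w3, w4, w5⟩ := out_power' (classify_generic hN
    (derivation_const_mul_sq hx d₀) (derivation_const_mul_sq hx e₀) hA0 hα0
    (h0.resolve_left (not_not_intro hα0)) hA hc hBi h1i h2r)
  exact ⟨W, w1, w2, w3, w4, Or.inl w5⟩

end CoeffSystem

end RadialNLS

/-! ### Continuation from a small open set to the whole interval -/

namespace RadialNLS

open Set

theorem exists_primitive {J : Set ℝ} (hJ : IsOpen J) (hJc : IsPreconnected J) {c : ℝ → ℝ}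
    (hc : ContinuousOn c J) {x₀ : ℝ} (hx₀ : x₀ ∈ J) :
    ∃ C : ℝ → ℝ, ∀ x ∈ J, HasDerivAt C (c x) x := by
  refine ⟨fun x => ∫ y in x₀..x, c y, fun x hx => ?_⟩
  have hsub : uIcc x₀ x ⊆ J := hJc.ordConnected.uIcc_subset hx₀ hx
  exact intervalIntegral.integral_hasDerivAt_right (hc.mono hsub).intervalIntegrable
    (hc.stronglyMeasurableAtFilter hJ x hx) (hc.continuousAt (hJ.mem_nhds hx))

/-- Uniqueness for a homogeneous linear equation of first order. -/
theorem eq_zero_of_linear {J : Set ℝ} (hJ : IsOpen J) (hJc : IsPreconnected J) {c y : ℝ → ℝ}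
    (hc : ContinuousOn c J) (hy : ∀ x ∈ J, HasDerivAt y (c x * y x) x) {x₀ : ℝ} (hx₀ : x₀ ∈ J)
    (h0 : y x₀ = 0) : ∀ x ∈ J, y x = 0 := by
  obtain ⟨C, hC⟩ := exists_primitive hJ hJc hc hx₀
  have hd : ∀ x ∈ J, HasDerivAt (fun x => y x * Real.exp (-C x)) 0 x := fun x hx => by
    refine ((hy x hx).fun_mul (hC x hx).neg.exp).congr_deriv ?_
    ring
  obtain ⟨m, hm⟩ := CoeffSystem.exists_const hJ hJc ⟨x₀, hx₀⟩ hd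
  intro x hx
  have h1 := hm x hx
  rw [← hm x₀ hx₀, h0, zero_mul] at h1
  exact (mul_eq_zero.1 h1).resolve_right (Real.exp_ne_zero _)

theorem hasDerivAt_zero_of_eqOn {W : Set ℝ} (hW : IsOpen W) {f : ℝ → ℝ} {c x : ℝ}
    (h : ∀ y ∈ W, f y = c) (hx : x ∈ W) : HasDerivAt f 0 x :=
  (hasDerivAt_const x c).congr_of_eventuallyEq (Filter.eventually_of_mem (hW.mem_nhds hx) h)

theorem continuousOn_const_div {J : Set ℝ} (hJ0 : J ⊆ Ioi 0) (m : ℝ) :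
    ContinuousOn (fun x : ℝ => m / x) J :=
  continuousOn_const.div continuousOn_id fun _ hx => (hJ0 hx).ne'

/-- Uniqueness for a triangular linear system. -/
theorem eq_zero_of_linear_pair {J : Set ℝ} (hJ : IsOpen J) (hJc : IsPreconnected J)
    {c₁ c₂ f g : ℝ → ℝ} (hc₁ : ContinuousOn c₁ J) (hc₂ : ContinuousOn c₂ J)
    (hg : ∀ x ∈ J, HasDerivAt g (c₂ x * g x) x)
    (hf : ∀ x ∈ J, HasDerivAt f (g x + c₁ x * f x) x) {W : Set ℝ} (hW : IsOpen W) (hWJ : W ⊆ J)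
    (hWne : W.Nonempty) (h0 : ∀ x ∈ W, f x = 0) : (∀ x ∈ J, g x = 0) ∧ ∀ x ∈ J, f x = 0 := by
  obtain ⟨x₀, hx₀⟩ := hWne
  have h1 := (hf x₀ (hWJ hx₀)).unique (hasDerivAt_zero_of_eqOn hW h0 hx₀)
  rw [h0 x₀ hx₀, mul_zero, add_zero] at h1
  have h2 := eq_zero_of_linear hJ hJc hc₂ hg (hWJ hx₀) h1
  refine ⟨h2, eq_zero_of_linear hJ hJc hc₁ (fun x hx => ?_) (hWJ hx₀) (h0 x₀ hx₀)⟩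
  have := hf x hx
  rwa [h2 x hx, zero_add] at this

/-- Uniqueness for the complex Riccati equation `h' = -(N/x) h - h²`, at the solution `m/x`. -/
theorem riccati_unique {J : Set ℝ} (hJ : IsOpen J) (hJc : IsPreconnected J) (hJ0 : J ⊆ Ioi 0)
    {N m : ℝ} (hm : m * (1 - N - m) = 0) {a b : ℝ → ℝ}
    (ha : ∀ x ∈ J, HasDerivAt a (-(N / x) * a x - a x ^ 2 + b x ^ 2) x)
    (hb : ∀ x ∈ J, HasDerivAt b (-(N / x) * b x - 2 * a x * b x) x)
    {x₀ : ℝ} (hx₀ : x₀ ∈ J) (ha0 : x₀ * a x₀ = m) (hb0 : b x₀ = 0) :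
    ∀ x ∈ J, a x = m / x ∧ b x = 0 := by
  have hca : ContinuousOn a J := fun x hx => (ha x hx).continuousAt.continuousWithinAt
  -- The difference of two solutions of a Riccati equation satisfies a homogeneous linear equation,
  -- and so does its squared modulus.
  have key := eq_zero_of_linear hJ hJc (c := fun x => -2 * (N / x + a x + m / x))
    (y := fun x => (a x - m / x) ^ 2 + b x ^ 2)
    (continuousOn_const.mul (((continuousOn_const_div hJ0 N).add hca).add
      (continuousOn_const_div hJ0 m)))
    (fun x hx => by
      have hx0 : x ≠ 0 := (hJ0 hx).ne'
      have h1 : HasDerivAt (fun x : ℝ => m / x) (-m / x ^ 2) x := by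
        refine ((hasDerivAt_inv hx0).const_mul m).congr_deriv ?_
        field_simp
      refine ((((ha x hx).fun_sub h1).fun_pow 2).fun_add ((hb x hx).fun_pow 2)).congr_deriv ?_
      have hx2 : x ≠ 0 := hx0
      have h2 : -m / x ^ 2 = -(N / x) * (m / x) - (m / x) ^ 2 := by
        field_simp
        linear_combination -hm
      rw [h2]
      push_cast
      ring) hx₀ (by
      have hx0 : x₀ ≠ 0 := (hJ0 hx₀).ne'
      rw [← ha0, hb0]; field_simp; ring)
  intro x hx
  have := key x hx
  have h1 : a x - m / x = 0 := by
    nlinarith [sq_nonneg (a x - m / x), sq_nonneg (b x)]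
  have h2 : b x = 0 := by
    nlinarith [sq_nonneg (a x - m / x), sq_nonneg (b x)]
  exact ⟨by linarith, h2⟩

/-- A coefficient that is constant near one point is constant. -/
theorem const_of_linear_pair {J : Set ℝ} (hJ : IsOpen J) (hJc : IsPreconnected J)
    (hJ0 : J ⊆ Ioi 0) {l m : ℝ} (hlm : m * (1 - l) = 0) {f g : ℝ → ℝ}
    (hg : ∀ x ∈ J, HasDerivAt g (-(l / x) * g x) x)
    (hf : ∀ x ∈ J, HasDerivAt f (g x - m / x * f x) x) {x₀ : ℝ} (hx₀ : x₀ ∈ J)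
    (h0 : deriv f x₀ = 0) : ∃ c, ∀ x ∈ J, f x = c ∧ g x = m * c / x := by
  have h1 : g x₀ = m / x₀ * f x₀ := by
    rw [(hf x₀ hx₀).deriv] at h0; linarith
  -- `x g - m f` equals `x f'`, so it vanishes at `x₀`; `hlm` makes its equation homogeneous.
  have hz := eq_zero_of_linear hJ hJc (c := fun x => (1 - l - m) / x)
    (y := fun x => x * g x - m * f x) (continuousOn_const_div hJ0 _)
    (fun x hx => by
      have hx0 : x ≠ 0 := (hJ0 hx).ne'
      refine (((hasDerivAt_id' x).fun_mul (hg x hx)).fun_sub ((hf x hx).const_mul m)).congr_deriv ?_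
      field_simp
      linear_combination f x * hlm) hx₀ (by
      have hx0 : x₀ ≠ 0 := (hJ0 hx₀).ne'
      rw [h1]; field_simp; ring)
  have hg' : ∀ x ∈ J, g x = m / x * f x := fun x hx => by
    have hx0 : x ≠ 0 := (hJ0 hx).ne'
    have := hz x hx
    field_simp
    linarith
  obtain ⟨c, hc⟩ := CoeffSystem.exists_const hJ hJc ⟨x₀, hx₀⟩ (f := f) (fun x hx => by
    have := hf x hx
    rwa [hg' x hx, sub_self] at this)
  exact ⟨c, fun x hx => ⟨hc x hx, by rw [hg' x hx, hc x hx]; ring⟩⟩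

/-- The system for `H = (a + α/|v|) v`, `G = -i E v` in the case `p = -1`. -/
structure IsRealStatic (n k E : ℝ) (J : Set ℝ) (a α : ℝ → ℝ) : Prop where
  deriv_a : ∀ x ∈ J, HasDerivAt a (E - (n - 1) / x * a x - a x ^ 2) x
  deriv_α : ∀ x ∈ J, HasDerivAt α (-k - (n - 1) / x * α x - a x * α x) x

namespace CoeffSystem

variable {N q p k : ℝ} {J : Set ℝ} {a b α β e d r s : ℝ → ℝ}

/-- With `h₂ = 0` the term `k |v|^p` can only be balanced by `a = 0`, whatever the resonance. Then
`b² = -e` is constant; if `b ≠ 0`, then `d x = N b`, and differentiating gives `d = 0` and hence `b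
= 0`, since `N ≠ 0`. -/
theorem eq_zero_of_linear_case (S : CoeffSystem N q p k J a b α β e d r s) (hN : N ≠ 0)
    (hp : p ≠ 0) (hk : k ≠ 0) (hJ : IsOpen J) (hJc : IsPreconnected J) (hJ0 : J ⊆ Ioi 0)
    (hJne : J.Nonempty) (hα : ∀ x ∈ J, α x = 0) (hβ : ∀ x ∈ J, β x = 0) :
    ∀ x ∈ J, a x = 0 ∧ b x = 0 ∧ e x = 0 ∧ d x = 0 ∧ r x = 0 ∧ s x = 0 := by
  have hr : ∀ x ∈ J, r x = 0 := fun x hx => by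
    have := (S.deriv_α x hx).unique (hasDerivAt_zero_of_eqOn hJ hα hx)
    simpa [hα x hx, hβ x hx] using this
  have hs : ∀ x ∈ J, s x = 0 := fun x hx => by
    have := (S.deriv_β x hx).unique (hasDerivAt_zero_of_eqOn hJ hβ hx)
    simpa [hα x hx, hβ x hx] using this
  have ha : ∀ x ∈ J, a x = 0 := fun x hx => by
    by_cases h1 : p = q
    · have := (S.deriv_r x hx).unique (hasDerivAt_zero_of_eqOn hJ hr hx)
      rw [if_pos h1, hr x hx, hβ x hx] at this
      have : k * p * a x = 0 := by linarith
      exact (mul_eq_zero.1 this).resolve_left (mul_ne_zero hk hp)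
    by_cases h2 : p = 2 * q
    · have := S.second x hx
      rw [if_neg h1, if_pos h2, hα x hx, hβ x hx] at this
      have : k * p * a x = 0 := by linarith
      exact (mul_eq_zero.1 this).resolve_left (mul_ne_zero hk hp)
    by_cases h3 : p = -q
    · exact S.neg h3 x hx
    · exact (S.generic h1 h2 h3 x hx).1
  have heb : ∀ x ∈ J, e x = -b x ^ 2 := fun x hx => by
    have := (S.deriv_a x hx).unique (hasDerivAt_zero_of_eqOn hJ ha hx)
    rw [ha x hx] at this
    linarith
  obtain ⟨e₀, he₀⟩ := exists_const hJ hJc hJne (f := e) (fun x hx => by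
    simpa [hα x hx] using S.deriv_e x hx)
  obtain ⟨d₀, hd₀⟩ := exists_const hJ hJc hJne S.deriv_d
  have hb : ∀ x ∈ J, b x = 0 := by
    by_contra hc
    push Not at hc
    obtain ⟨x₁, hx₁, hb₁⟩ := hc
    have hb2 : ∀ x ∈ J, b x ^ 2 = -e₀ := fun x hx => by rw [← he₀ x hx, heb x hx]; ring
    have hb0 : ∀ x ∈ J, b x ≠ 0 := fun x hx h0 => by
      have h1 := hb2 x hx
      rw [h0, ← hb2 x₁ hx₁] at h1
      exact pow_ne_zero 2 hb₁ (by rw [← h1]; norm_num)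
    have hdb : ∀ x ∈ J, d₀ - N / x * b x = 0 := fun x hx => by
      have h1 := S.deriv_b x hx
      have h2 := (h1.fun_pow 2).unique (hasDerivAt_zero_of_eqOn hJ hb2 hx)
      rw [ha x hx, hd₀ x hx] at h2
      have h3 : 2 * b x * (d₀ - N / x * b x) = 0 := by
        push_cast at h2; linear_combination h2
      exact (mul_eq_zero.1 h3).resolve_left (mul_ne_zero two_ne_zero (hb0 x hx))
    have h1 := hasDerivAt_zero_of_eqOn hJ (f := fun x => d₀ * x - N * b x) (c := 0)
      (fun x hx => by
        have hx0 : x ≠ 0 := (hJ0 hx).ne'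
        have := hdb x hx
        field_simp at this
        linarith) hx₁
    have h2 := (((hasDerivAt_id' x₁).const_mul d₀).fun_sub
      ((S.deriv_b x₁ hx₁).const_mul N)).unique h1
    have h3 := hdb x₁ hx₁
    rw [ha x₁ hx₁, hd₀ x₁ hx₁] at h2
    have h4 : d₀ = 0 := by linear_combination h2 + N * h3
    have h5 : N / x₁ * b x₁ = 0 := by linarith
    exact mul_ne_zero (div_ne_zero hN (hJ0 hx₁).ne') (hb0 x₁ hx₁) h5
  refine fun x hx => ⟨ha x hx, hb x hx, ?_, ?_, hr x hx, hs x hx⟩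
  · rw [heb x hx, hb x hx]; norm_num
  · have := (S.deriv_b x hx).unique (hasDerivAt_zero_of_eqOn hJ hb hx)
    simpa [hb x hx] using this

/-- The coefficients on the whole interval, in the imaginary power case. -/
theorem eq_of_power (S : CoeffSystem N q p k J a b α β e d r s)
    (hJ : IsOpen J) (hJc : IsPreconnected J) (hJ0 : J ⊆ Ioi 0)
    {W : Set ℝ} (hWJ : W ⊆ J) (hW : IsOpen W) (hWne : W.Nonempty) (hqN : q * (N + 1) = 2)
    (h : ∀ x ∈ W, a x = 0 ∧ b x = 0 ∧ α x = 0 ∧ x * deriv β x = β x) :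
    ∃ c, ∀ x ∈ J, a x = 0 ∧ b x = 0 ∧ e x = 0 ∧ d x = 0 ∧ α x = 0 ∧ r x = 0 ∧ β x = c * x ∧
      s x = c * (N + 1) := by
  obtain ⟨x₀, hx₀⟩ := hWne
  have hx₀J := hWJ hx₀
  have hJne : J.Nonempty := ⟨x₀, hx₀J⟩
  obtain ⟨d₀, hd₀⟩ := exists_const hJ hJc hJne S.deriv_d
  have hd : ∀ x ∈ J, d x = 0 := fun x hx => by
    have := (S.deriv_b x₀ hx₀J).unique (hasDerivAt_zero_of_eqOn hW (fun y hy => (h y hy).2.1) hx₀)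
    rw [(h x₀ hx₀).2.1] at this
    rw [hd₀ x hx, ← hd₀ x₀ hx₀J]
    linarith
  have hab : ∀ x ∈ J, a x = 0 ∧ b x = 0 ∧ e x = 0 := by
    -- At this resonance `a = 0` holds on all of `J` already, and `b` solves a linear equation.
    -- Otherwise `e` is constant and Riccati uniqueness applies.
    by_cases hpq : p = -q
    · have ha := S.neg hpq
      have hb := eq_zero_of_linear hJ hJc (c := fun x => -(N / x))
        (continuousOn_const_div hJ0 N).neg (fun x hx => by
          have := S.deriv_b x hx
          rw [ha x hx, hd x hx] at this
          convert this using 1; ring) hx₀J (h x₀ hx₀).2.1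
      refine fun x hx => ⟨ha x hx, hb x hx, ?_⟩
      have := (S.deriv_a x hx).unique (hasDerivAt_zero_of_eqOn hJ ha hx)
      simpa [ha x hx, hb x hx] using this
    · obtain ⟨e₀, he₀⟩ := exists_const hJ hJc hJne (f := e) (fun x hx => by
        simpa [hpq] using S.deriv_e x hx)
      have he : ∀ x ∈ J, e x = 0 := fun x hx => by
        have := (S.deriv_a x₀ hx₀J).unique
          (hasDerivAt_zero_of_eqOn hW (fun y hy => (h y hy).1) hx₀)
        rw [(h x₀ hx₀).2.1, (h x₀ hx₀).1] at this
        rw [he₀ x hx, ← he₀ x₀ hx₀J]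
        linarith
      have := riccati_unique hJ hJc hJ0 (N := N) (m := 0) (by ring)
        (fun x hx => by convert S.deriv_a x hx using 1; rw [he x hx]; ring)
        (fun x hx => by convert S.deriv_b x hx using 1; rw [hd x hx]; ring) hx₀J
        (by rw [(h x₀ hx₀).1, mul_zero]) (h x₀ hx₀).2.1
      exact fun x hx => ⟨by rw [(this x hx).1, zero_div], (this x hx).2, he x hx⟩
  obtain ⟨hr, hα⟩ := eq_zero_of_linear_pair hJ hJc (c₁ := fun x => -(N / x)) (c₂ := fun _ => 0)
    (g := r) (f := α) (continuousOn_const_div hJ0 N).neg continuousOn_const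
    (fun x hx => by
      have := S.deriv_r x hx
      rw [(hab x hx).1, hd x hx] at this
      convert this using 1
      split_ifs <;> ring)
    (fun x hx => by
      have := S.deriv_α x hx
      rw [(hab x hx).1, (hab x hx).2.1] at this
      convert this using 1
      ring) hW hWJ ⟨x₀, hx₀⟩ (fun x hx => (h x hx).2.2.1)
  obtain ⟨s₀, hs₀⟩ := exists_const hJ hJc hJne (f := s) (fun x hx => by
    have := S.deriv_s x hx
    rw [(hab x hx).1, hd x hx] at this
    convert this using 1
    ring)
  have hN1 : N + 1 ≠ 0 := by rintro h0; rw [h0] at hqN; norm_num at hqN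
  have hβ := eq_zero_of_linear hJ hJc (c := fun x => -(N / x))
    (y := fun x => β x - s₀ / (N + 1) * x)
    (continuousOn_const_div hJ0 N).neg (fun x hx => by
      have hx0 : x ≠ 0 := (hJ0 hx).ne'
      have := S.deriv_β x hx
      rw [(hab x hx).1, (hab x hx).2.1, hs₀ x hx] at this
      refine (this.fun_sub ((hasDerivAt_id' x).const_mul (s₀ / (N + 1)))).congr_deriv ?_
      field_simp
      ring) hx₀J (by
      have hx0 : x₀ ≠ 0 := (hJ0 hx₀J).ne'
      have h1 := (h x₀ hx₀).2.2.2
      rw [(S.deriv_β x₀ hx₀J).deriv, (hab x₀ hx₀J).1, (hab x₀ hx₀J).2.1, hs₀ x₀ hx₀J] at h1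
      field_simp at h1 ⊢
      linear_combination -h1)
  refine ⟨s₀ / (N + 1), fun x hx => ⟨(hab x hx).1, (hab x hx).2.1, (hab x hx).2.2, hd x hx,
    hα x hx, hr x hx, by linarith [hβ x hx], ?_⟩⟩
  rw [hs₀ x hx]; field_simp

/-- The coefficients on the whole interval, in the case `p = 2q`. -/
theorem eq_of_double (S : CoeffSystem N q p k J a b α β e d r s) (hq : q ≠ 0)
    (hJ : IsOpen J) (hJc : IsPreconnected J) (hJ0 : J ⊆ Ioi 0)
    {W : Set ℝ} (hWJ : W ⊆ J) (hW : IsOpen W) (hWne : W.Nonempty) (hp : p = 2 * q)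
    (hm : (N + (q + 2) * (1 - N)) * (1 - q * (1 - N)) = 0)
    (h : ∀ x ∈ W, x * a x = 1 - N ∧ b x = 0) :
    (∀ x ∈ J, a x = (1 - N) / x ∧ b x = 0 ∧ e x = 0 ∧ d x = 0) ∧
    ((∀ x ∈ W, α x = 0) → ∀ x ∈ J, α x = 0 ∧ r x = 0) ∧
    ((∀ x ∈ W, β x = 0) → ∀ x ∈ J, β x = 0 ∧ s x = 0) ∧
    ((∀ x ∈ W, deriv α x = 0) →
      ∃ c, ∀ x ∈ J, α x = c ∧ r x = (N + (q + 2) * (1 - N)) * c / x) ∧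
    ((∀ x ∈ W, deriv β x = 0) →
      ∃ c, ∀ x ∈ J, β x = c ∧ s x = (N + (q + 2) * (1 - N)) * c / x) := by
  obtain ⟨x₀, hx₀⟩ := hWne
  have hx₀J := hWJ hx₀
  have hJne : J.Nonempty := ⟨x₀, hx₀J⟩
  have hx₀0 : x₀ ≠ 0 := (hJ0 hx₀J).ne'
  have hp1 : p ≠ q := fun h => hq (by linarith)
  have hp3 : p ≠ -q := fun h => hq (by linarith)
  obtain ⟨d₀, hd₀⟩ := exists_const hJ hJc hJne S.deriv_d
  have hd : ∀ x ∈ J, d x = 0 := fun x hx => by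
    have := (S.deriv_b x₀ hx₀J).unique (hasDerivAt_zero_of_eqOn hW (fun y hy => (h y hy).2) hx₀)
    rw [(h x₀ hx₀).2] at this
    rw [hd₀ x hx, ← hd₀ x₀ hx₀J]
    linarith
  obtain ⟨e₀, he₀⟩ := exists_const hJ hJc hJne (f := e) (fun x hx => by
    simpa [hp3] using S.deriv_e x hx)
  have he : ∀ x ∈ J, e x = 0 := fun x hx => by
    have h1 := ((hasDerivAt_id' x₀).fun_mul (S.deriv_a x₀ hx₀J)).unique
      (hasDerivAt_zero_of_eqOn hW (fun y hy => (h y hy).1) hx₀)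
    have h2 := (h x₀ hx₀).1
    rw [(h x₀ hx₀).2] at h1
    rw [he₀ x hx, ← he₀ x₀ hx₀J]
    refine (mul_eq_zero.1 (?_ : x₀ ^ 2 * e x₀ = 0)).resolve_left (pow_ne_zero 2 hx₀0)
    field_simp at h1
    linear_combination x₀ * h1 + (x₀ * a x₀) * h2
  have hab := riccati_unique hJ hJc hJ0 (N := N) (m := 1 - N) (by ring)
    (fun x hx => by convert S.deriv_a x hx using 1; rw [he x hx]; ring)
    (fun x hx => by convert S.deriv_b x hx using 1; rw [hd x hx]; ring) hx₀J
    (h x₀ hx₀).1 (h x₀ hx₀).2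
  set m := N + (q + 2) * (1 - N) with hmdef
  have hα' : ∀ x ∈ J, HasDerivAt α (r x - m / x * α x) x := fun x hx => by
    have := S.deriv_α x hx
    rw [(hab x hx).1, (hab x hx).2] at this
    convert this using 1
    rw [hmdef]; ring
  have hβ' : ∀ x ∈ J, HasDerivAt β (s x - m / x * β x) x := fun x hx => by
    have := S.deriv_β x hx
    rw [(hab x hx).1, (hab x hx).2] at this
    convert this using 1
    rw [hmdef]; ring
  have hr' : ∀ x ∈ J, HasDerivAt r (-(q * (1 - N) / x) * r x) x := fun x hx => by
    have := S.deriv_r x hx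
    rw [(hab x hx).1, hd x hx, if_neg hp1] at this
    convert this using 1
    ring
  have hs' : ∀ x ∈ J, HasDerivAt s (-(q * (1 - N) / x) * s x) x := fun x hx => by
    have := S.deriv_s x hx
    rw [(hab x hx).1, hd x hx] at this
    convert this using 1
    ring
  refine ⟨fun x hx => ⟨(hab x hx).1, (hab x hx).2, he x hx, hd x hx⟩, fun h0 => ?_, fun h0 => ?_,
    fun h0 => const_of_linear_pair hJ hJc hJ0 hm hr' hα' hx₀J (h0 x₀ hx₀),
    fun h0 => const_of_linear_pair hJ hJc hJ0 hm hs' hβ' hx₀J (h0 x₀ hx₀)⟩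
  · obtain ⟨h1, h2⟩ := eq_zero_of_linear_pair hJ hJc (c₁ := fun x => -(m / x))
      (continuousOn_const_div hJ0 _).neg (continuousOn_const_div hJ0 _).neg hr'
      (fun x hx => by convert hα' x hx using 1; ring) hW hWJ ⟨x₀, hx₀⟩ h0
    exact fun x hx => ⟨h2 x hx, h1 x hx⟩
  · obtain ⟨h1, h2⟩ := eq_zero_of_linear_pair hJ hJc (c₁ := fun x => -(m / x))
      (continuousOn_const_div hJ0 _).neg (continuousOn_const_div hJ0 _).neg hs'
      (fun x hx => by convert hβ' x hx using 1; ring) hW hWJ ⟨x₀, hx₀⟩ h0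
    exact fun x hx => ⟨h2 x hx, h1 x hx⟩

/-- The coefficients on the whole interval, in the case `p = q = -1`. -/
theorem eq_of_static (S : CoeffSystem N q p k J a b α β e d r s)
    (hJ : IsOpen J) (hJc : IsPreconnected J) (hJ0 : J ⊆ Ioi 0)
    {W : Set ℝ} (hWJ : W ⊆ J) (hW : IsOpen W) (hWne : W.Nonempty) (hpq : p = q) (hq : q = -1)
    (h : ∀ x ∈ W, b x = 0 ∧ β x = 0 ∧ r x = -k) :
    ∃ E, (∀ x ∈ J, b x = 0 ∧ β x = 0 ∧ r x = -k ∧ s x = 0 ∧ d x = 0 ∧ e x = E) ∧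
      IsRealStatic (N + 1) k E J a α := by
  obtain ⟨x₀, hx₀⟩ := hWne
  have hx₀J := hWJ hx₀
  have hJne : J.Nonempty := ⟨x₀, hx₀J⟩
  have hp3 : p ≠ -q := by rw [hpq, hq]; norm_num
  have hca : ContinuousOn a J := fun x hx => (S.deriv_a x hx).continuousAt.continuousWithinAt
  obtain ⟨d₀, hd₀⟩ := exists_const hJ hJc hJne S.deriv_d
  have hd : ∀ x ∈ J, d x = 0 := fun x hx => by
    have := (S.deriv_b x₀ hx₀J).unique (hasDerivAt_zero_of_eqOn hW (fun y hy => (h y hy).1) hx₀)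
    rw [(h x₀ hx₀).1] at this
    rw [hd₀ x hx, ← hd₀ x₀ hx₀J]
    linarith
  obtain ⟨e₀, he₀⟩ := exists_const hJ hJc hJne (f := e) (fun x hx => by
    simpa [hp3] using S.deriv_e x hx)
  have hNx := continuousOn_const_div hJ0 N
  have hb := eq_zero_of_linear hJ hJc (c := fun x => -(N / x) - 2 * a x)
    (by fun_prop) (fun x hx => by
      have := S.deriv_b x hx
      rw [hd x hx] at this
      convert this using 1; ring) hx₀J (h x₀ hx₀).1
  obtain ⟨hs, hβ⟩ := eq_zero_of_linear_pair hJ hJc (c₁ := fun x => -(N / x) - (q + 2) * a x)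
    (c₂ := fun x => -q * a x) (g := s) (f := β) (by fun_prop) (by fun_prop)
    (fun x hx => by
      have := S.deriv_s x hx
      rw [hd x hx] at this
      convert this using 1; ring)
    (fun x hx => by
      have := S.deriv_β x hx
      rw [hb x hx] at this
      convert this using 1; ring) hW hWJ ⟨x₀, hx₀⟩ (fun x hx => (h x hx).2.1)
  have hr := eq_zero_of_linear hJ hJc (c := a) (y := fun x => r x + k) hca (fun x hx => by
      have := S.deriv_r x hx
      rw [hd x hx, if_pos hpq, hpq, hq] at this
      refine (this.add_const k).congr_deriv ?_; ring) hx₀J (by rw [(h x₀ hx₀).2.2]; ring)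
  refine ⟨e₀, fun x hx => ⟨hb x hx, hβ x hx, by linarith [hr x hx], hs x hx, hd x hx, he₀ x hx⟩,
    fun x hx => ?_, fun x hx => ?_⟩
  · have := S.deriv_a x hx
    rw [hb x hx, he₀ x hx] at this
    convert this using 1; ring
  · have := S.deriv_α x hx
    rw [hb x hx, show r x = -k by linarith [hr x hx], hq] at this
    convert this using 1; ring

end CoeffSystem

end RadialNLS

/-! ### Recognition of families 1 to 5 -/

namespace RadialNLS

open Set

variable {n p k : ℝ} {J : Set ℝ} {H G : ℝ → ℂ → ℂ}

theorem absPow_neg_one (v : ℂ) : absPow v (-1) = (‖v‖⁻¹ : ℝ) := by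
  rw [absPow, Real.rpow_neg_one]

theorem sign_mul_sqrt {y z : ℝ} (h : y ^ 2 = z) :
    ∃ ε : ℝ, (ε = 1 ∨ ε = -1) ∧ y = ε * √z := by
  rcases le_total 0 y with hy | hy
  · exact ⟨1, Or.inl rfl, by rw [← h, Real.sqrt_sq hy, one_mul]⟩
  · exact ⟨-1, Or.inr rfl, by rw [← h, Real.sqrt_sq_eq_abs, abs_of_nonpos hy]; ring⟩

/-- Every solution of the separable power form is one of the families 1 to 5, or comes from
a solution of the system `IsRealStatic`. -/
theorem listed_or_static (hn : n ≠ 1) (hp : p ≠ 0) (hk : k ≠ 0) (hJ : IsOpen J)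
    (hJc : IsPreconnected J) (hJne : J.Nonempty) (hJ0 : J ⊆ Ioi 0)
    (hA : HasAnsatzForm n p k J H G) (hS : IsSolution n p k J H G) :
    (Family1 p k J H G ∨ Family2 n p k J H G ∨ Family3 n p k J H G ∨ Family4 n p k J H G ∨
      Family5 n p k J H G) ∨
    p = -1 ∧ ∃ (E : ℝ) (a α : ℝ → ℝ), IsRealStatic n k E J a α ∧ ∀ x ∈ J, ∀ v : ℂ, v ≠ 0 →
      H x v = (a x + α x * ‖v‖⁻¹ : ℝ) * v ∧ G x v = -Complex.I * E * v := by
  obtain ⟨q, hq, a, b, α, β, e, d, r, s, S, hform⟩ := exists_coeffSystem hp hk hJ hA hS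
  have hN : n - 1 ≠ 0 := sub_ne_zero.2 hn
  by_cases hzero : ∃ x ∈ J, α x ≠ 0 ∨ β x ≠ 0
  swap
  · push Not at hzero
    have h := S.eq_zero_of_linear_case hN hp hk hJ hJc hJ0 hJne (fun x hx => (hzero x hx).1)
      (fun x hx => (hzero x hx).2)
    refine Or.inl (Or.inl fun x hx v hv => ?_)
    obtain ⟨h1, h2, h3, h4, h5, h6⟩ := h x hx
    obtain ⟨h7, h8⟩ := hzero x hx
    obtain ⟨e1, e2⟩ := hform x hx v hv
    rw [e1, e2, h1, h2, h3, h4, h5, h6, h7, h8]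
    constructor
    · simp
    · push_cast; ring
  obtain ⟨W, hWJ, hWo, hWne, hWn, hcases⟩ := S.exists_local hN hq hk hJ hJc hJ0 hzero
  obtain ⟨x₀, hx₀⟩ := hWne
  have hx₀J := hWJ hx₀
  -- The five patterns give, in order, families 2, 3, 4, 5 and the real system for `p = -1`.
  rcases hcases with ⟨hqN, h⟩ | ⟨hpq, hqN, hN1, h⟩ | ⟨hpq, hqN, h⟩ | ⟨hpq, hqN, h⟩ | ⟨hpq, hq1, h⟩
  · obtain ⟨c, hc⟩ := S.eq_of_power hJ hJc hJ0 hWJ hWo ⟨x₀, hx₀⟩ hqN h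
    have hn0 : n ≠ 0 := by rintro rfl; norm_num at hqN
    have hqn : q = 2 / n := by
      rw [eq_div_iff hn0]; linear_combination hqN
    refine Or.inl (Or.inr (Or.inl ⟨hn0, c, ?_, fun x hx v hv => ?_⟩))
    · rintro rfl
      obtain ⟨-, -, -, -, h1, -, h2, -⟩ := hc x₀ hx₀J
      rw [zero_mul] at h2
      exact (hWn x₀ hx₀).elim (fun h => h h1) (fun h => h h2)
    · obtain ⟨h1, h2, h3, h4, h5, h6, h7, h8⟩ := hc x hx
      obtain ⟨e1, e2⟩ := hform x hx v hv
      rw [e1, e2, h1, h2, h3, h4, h5, h6, h7, h8, hqn,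
        show 2 * (2 / n) = 4 / n by ring]
      constructor
      · push_cast; ring
      · push_cast
        linear_combination (-(c : ℂ) * n * absPow v (2 / n) * v) * Complex.I_mul_I
  · obtain ⟨hab, hα, -, -, hβ⟩ := S.eq_of_double hq hJ hJc hJ0 hWJ hWo ⟨x₀, hx₀⟩ hpq
      (by rw [hqN]; ring) (fun x hx => ⟨(h x hx).1, (h x hx).2.1⟩)
    have hα := hα (fun x hx => (h x hx).2.2.1)
    obtain ⟨c, hc⟩ := hβ (fun x hx => (h x hx).2.2.2.1)
    have hn0 : n ≠ 0 := by rintro rfl; exact hN1 (by norm_num)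
    have hn2 : 2 - n ≠ 0 := by
      intro h0
      rw [show 1 - (n - 1) = 2 - n by ring, h0, mul_zero] at hqN
      exact zero_ne_one hqN
    have hqn : q = 1 / (2 - n) := by
      rw [eq_div_iff hn2]; linear_combination hqN
    have hc2 : c ^ 2 = 2 * k * (1 - 2 / n) := by
      have := (h x₀ hx₀).2.2.2.2
      rw [(hc x₀ hx₀J).1] at this
      field_simp
      linear_combination this
    have hc0 : c ≠ 0 := by
      rintro rfl
      exact (hWn x₀ hx₀).elim (fun h => h (hα x₀ hx₀J).1) (fun h => h (hc x₀ hx₀J).1)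
    obtain ⟨ε, hε, hcε⟩ := sign_mul_sqrt hc2
    refine Or.inl (Or.inr (Or.inr (Or.inl ⟨?_, hn0, fun h0 => hn2 (by rw [h0]; ring), ?_, ε, hε,
      fun x hx v hv => ?_⟩)))
    · rw [hpq, hqn]; ring
    · have : 0 < c ^ 2 := by positivity
      rw [hc2] at this
      linarith
    · obtain ⟨h1, h2, h3, h4⟩ := hab x hx
      obtain ⟨h5, h6⟩ := hα x hx
      obtain ⟨h7, h8⟩ := hc x hx
      obtain ⟨e1, e2⟩ := hform x hx v hv
      have hm : n - 1 + (q + 2) * (1 - (n - 1)) = 4 - n := by linear_combination hqN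
      rw [hm] at h8
      rw [e1, e2, h1, h2, h3, h4, h5, h6, h7, h8, hpq, hqn,
        show 2 * (1 / (2 - n)) = 2 / (2 - n) by ring,
        show ε * (4 - n) * √(2 * k * (1 - 2 / n)) * x⁻¹ = (4 - n) * c * x⁻¹ by rw [hcε]; ring,
        ← hcε]
      have hc2' : (c : ℂ) ^ 2 = 2 * k * (1 - 2 / n) := by exact_mod_cast hc2
      constructor
      · push_cast; ring
      · push_cast
        linear_combination (-(4 - n : ℂ) * c / x * absPow v (1 / (2 - n)) * v) * Complex.I_mul_I
          + Complex.I * absPow v (2 / (2 - n)) * v * hc2'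
  · have hm : n - 1 + (q + 2) * (1 - (n - 1)) = 0 := by linear_combination -hqN
    obtain ⟨hab, hα, -, -, hβ⟩ := S.eq_of_double hq hJ hJc hJ0 hWJ hWo ⟨x₀, hx₀⟩ hpq
      (by rw [hm, zero_mul]) (fun x hx => ⟨(h x hx).1, (h x hx).2.1⟩)
    have hα := hα (fun x hx => (h x hx).2.2.1)
    obtain ⟨c, hc⟩ := hβ (fun x hx => (h x hx).2.2.2.1)
    have hn2 : n - 2 ≠ 0 := by
      intro h0
      rw [show n - 1 - 1 = n - 2 by ring, h0] at hqN
      linarith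
    have hn3 : n ≠ 3 := by rintro rfl; apply hq; linarith
    have hqn : q = (3 - n) / (n - 2) := by
      rw [eq_div_iff hn2]; linear_combination hqN
    have hc2 : c ^ 2 = k := by
      have := (h x₀ hx₀).2.2.2.2
      rwa [(hc x₀ hx₀J).1] at this
    have hc0 : c ≠ 0 := by
      rintro rfl
      exact (hWn x₀ hx₀).elim (fun h => h (hα x₀ hx₀J).1) (fun h => h (hc x₀ hx₀J).1)
    obtain ⟨ε, hε, hcε⟩ := sign_mul_sqrt hc2
    refine Or.inl (Or.inr (Or.inr (Or.inr (Or.inl ⟨?_, fun h0 => hn2 (by rw [h0]; ring), hn3, ?_,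
      ε, hε, fun x hx v hv => ?_⟩))))
    · rw [hpq, hqn]; ring
    · rw [← hc2]; positivity
    · obtain ⟨h1, h2, h3, h4⟩ := hab x hx
      obtain ⟨h5, h6⟩ := hα x hx
      obtain ⟨h7, h8⟩ := hc x hx
      obtain ⟨e1, e2⟩ := hform x hx v hv
      rw [hm] at h8
      rw [e1, e2, h1, h2, h3, h4, h5, h6, h7, h8, hpq, ← hqn, ← hcε]
      have hc2' : (c : ℂ) ^ 2 = k := by exact_mod_cast hc2
      constructor
      · push_cast; ring
      · push_cast
        linear_combination Complex.I * absPow v (2 * q) * v * hc2'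
  · have hm : n - 1 + (q + 2) * (1 - (n - 1)) = 0 := by linear_combination -hqN
    obtain ⟨hab, -, hβ, hα, -⟩ := S.eq_of_double hq hJ hJc hJ0 hWJ hWo ⟨x₀, hx₀⟩ hpq
      (by rw [hm, zero_mul]) (fun x hx => ⟨(h x hx).1, (h x hx).2.1⟩)
    have hβ := hβ (fun x hx => (h x hx).2.2.1)
    obtain ⟨c, hc⟩ := hα (fun x hx => (h x hx).2.2.2.1)
    have hn2 : n - 2 ≠ 0 := by
      intro h0
      rw [show n - 1 - 1 = n - 2 by ring, h0] at hqN
      linarith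
    have hn2' : 2 - n ≠ 0 := fun h0 => hn2 (by linarith)
    have hn3 : n ≠ 3 := by rintro rfl; apply hq; linarith
    have hqn : q = (3 - n) / (n - 2) := by
      rw [eq_div_iff hn2]; linear_combination hqN
    have hqn' : q = (n - 3) / (2 - n) := by
      rw [eq_div_iff hn2']; linear_combination -hqN
    -- The root enters family 5 with a minus sign, hence the sign `ε` is that of `-c`.
    have hc2 : (-c) ^ 2 = (2 - n) * k := by
      have := (h x₀ hx₀).2.2.2.2
      rw [(hc x₀ hx₀J).1] at this
      linear_combination this
    have hc0 : c ≠ 0 := by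
      rintro rfl
      exact (hWn x₀ hx₀).elim (fun h => h (hc x₀ hx₀J).1) (fun h => h (hβ x₀ hx₀J).1)
    obtain ⟨ε, hε, hcε⟩ := sign_mul_sqrt hc2
    refine Or.inl (Or.inr (Or.inr (Or.inr (Or.inr ⟨?_, fun h0 => hn2 (by rw [h0]; ring), hn3, ?_,
      ε, hε, fun x hx v hv => ?_⟩))))
    · rw [hpq, hqn]; ring
    · have : 0 < (-c) ^ 2 := pow_two_pos_of_ne_zero (neg_ne_zero.2 hc0)
      rw [hc2] at this
      linarith
    · obtain ⟨h1, h2, h3, h4⟩ := hab x hx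
      obtain ⟨h5, h6⟩ := hβ x hx
      obtain ⟨h7, h8⟩ := hc x hx
      obtain ⟨e1, e2⟩ := hform x hx v hv
      rw [hm] at h8
      rw [e1, e2, h1, h2, h3, h4, h5, h6, h7, h8, hpq, ← hqn', ← hcε]
      have hc2' : ((q : ℂ) + 1) * c ^ 2 = -k := by
        have : (q + 1) * c ^ 2 = -k := by linear_combination (q + 1) * hc2 - k * hqN
        exact_mod_cast this
      constructor
      · push_cast; ring
      · push_cast
        linear_combination -Complex.I * absPow v (2 * q) * v * hc2'
  · obtain ⟨E, hE, hst⟩ := S.eq_of_static hJ hJc hJ0 hWJ hWo ⟨x₀, hx₀⟩ hpq hq1 h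
    refine Or.inr ⟨hpq.trans hq1, E, a, α, ?_, fun x hx v hv => ?_⟩
    · convert hst using 1; ring
    · obtain ⟨h1, h2, h3, h4, h5, h6⟩ := hE x hx
      obtain ⟨e1, e2⟩ := hform x hx v hv
      rw [e1, e2, h1, h2, h3, h4, h5, h6, hpq, hq1, absPow_neg_one]
      constructor
      · push_cast; ring
      · push_cast; ring

end RadialNLS

/-! ### Verification that the families are solutions -/

namespace RadialNLS

open Set

variable {n p k q : ℝ} {J : Set ℝ} {H G : ℝ → ℂ → ℂ}

theorem contDiffOn_one_of_hasDerivAt {f f' : ℝ → ℝ} (hJ : IsOpen J)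
    (hf : ∀ x ∈ J, HasDerivAt f (f' x) x) (hf' : ContinuousOn f' J) : ContDiffOn ℝ 1 f J := by
  rw [show (1 : WithTop ℕ∞) = 0 + 1 from rfl, contDiffOn_succ_iff_deriv_of_isOpen hJ]
  refine ⟨fun x hx => (hf x hx).differentiableAt.differentiableWithinAt, by simp, ?_⟩
  rw [contDiffOn_zero]
  exact hf'.congr fun x hx => (hf x hx).deriv

theorem contDiffOn_coeff {f : ℝ → ℝ} (hf : ContDiffOn ℝ 1 f J) :
    ContDiffOn ℝ 1 (fun y : ℝ × ℂ => ((f y.1 : ℝ) : ℂ)) (J ×ˢ {v : ℂ | v ≠ 0}) :=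
  Complex.ofRealCLM.contDiff.comp_contDiffOn
    (hf.comp contDiff_fst.contDiffOn fun _ hy => hy.1)

theorem contDiffOn_absPow (s : ℝ) :
    ContDiffOn ℝ 1 (fun y : ℝ × ℂ => absPow y.2 s) (J ×ˢ {v : ℂ | v ≠ 0}) := by
  refine Complex.ofRealCLM.contDiff.comp_contDiffOn fun y hy => ContDiffAt.contDiffWithinAt ?_
  exact (contDiff_snd.contDiffAt.norm ℝ hy.2).rpow_const_of_ne (by simpa using hy.2)

theorem absPow_two_mul (v : ℂ) (q : ℝ) : absPow v (2 * q) = absPow v q ^ 2 := by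
  rw [absPow, absPow, mul_comm, Real.rpow_mul (norm_nonneg v)]
  norm_cast

/-- A sufficient condition for `H = (a + (α + iβ) |v|^q) v`,
`G = (u |v|^q + i (w₀ + w |v|^{2q} + c |v|^p)) v` to be a solution. -/
theorem solution_of_coefficients (hq : q ≠ 0) (hJ : IsOpen J)
    {a α β u w a' α' β' u' w' : ℝ → ℝ} {w₀ c : ℝ}
    (ha : ∀ x ∈ J, HasDerivAt a (a' x) x) (hα : ∀ x ∈ J, HasDerivAt α (α' x) x)
    (hβ : ∀ x ∈ J, HasDerivAt β (β' x) x) (hu : ∀ x ∈ J, HasDerivAt u (u' x) x)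
    (hw : ∀ x ∈ J, HasDerivAt w (w' x) x)
    (ca : ContinuousOn a' J) (cα : ContinuousOn α' J) (cβ : ContinuousOn β' J)
    (cu : ContinuousOn u' J) (cw : ContinuousOn w' J)
    (hH : ∀ x ∈ J, ∀ v : ℂ, v ≠ 0 → H x v = (a x + (α x + Complex.I * β x) * absPow v q) * v)
    (hG : ∀ x ∈ J, ∀ v : ℂ, v ≠ 0 → G x v =
      (u x * absPow v q + Complex.I * (w₀ + w x * absPow v q ^ 2 + c * absPow v p)) * v)
    (h1 : ∀ x ∈ J, u' x + q * a x * u x = 0)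
    (h2 : ∀ x ∈ J, ∀ P R ρ : ℝ, 0 < ρ → P = ρ ^ q → R = ρ ^ p →
      w' x * P ^ 2 + (2 * q * w x * P ^ 2 + p * c * R) * (a x + α x * P)
        - q * β x * u x * P ^ 2 = 0)
    (h3 : ∀ x ∈ J, ∀ P R ρ : ℝ, 0 < ρ → P = ρ ^ q → R = ρ ^ p →
      -(w₀ + w x * P ^ 2 + c * R) = (n - 1) * (a x + α x * P) / x + a' x + α' x * P
        + a x ^ 2 + 2 * a x * α x * P + (α x ^ 2 - β x ^ 2) * P ^ 2
        + q * a x * α x * P + q * α x ^ 2 * P ^ 2 + k * R)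
    (h4 : ∀ x ∈ J, ∀ P : ℝ, u x = (n - 1) * β x / x + β' x + 2 * a x * β x + 2 * α x * β x * P
      + q * a x * β x + q * α x * β x * P) :
    HasAnsatzForm n p k J H G ∧ IsSolution n p k J H G ∧ IsPhaseEquivariant J H G := by
  set h : ℝ → ℝ → ℂ := fun x ρ => a x + (α x + Complex.I * β x) * (ρ ^ q : ℝ) with hh
  set g : ℝ → ℝ → ℂ := fun x ρ => u x * (ρ ^ q : ℝ)
    + Complex.I * (w₀ + w x * (ρ ^ q : ℝ) ^ 2 + c * (ρ ^ p : ℝ)) with hg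
  have hH' : ∀ x ∈ J, ∀ v : ℂ, v ≠ 0 → H x v = h x ‖v‖ * v := hH
  have hG' : ∀ x ∈ J, ∀ v : ℂ, v ≠ 0 → G x v = g x ‖v‖ * v := hG
  have hpow : ∀ (s ρ : ℝ), 0 < ρ →
      HasDerivAt (fun ρ : ℝ => ((ρ ^ s : ℝ) : ℂ)) ((s * ρ ^ (s - 1) : ℝ) : ℂ) ρ := fun s ρ hρ =>
    (Real.hasDerivAt_rpow_const (Or.inl hρ.ne')).ofReal_comp
  have hhρ : ∀ x ρ, 0 < ρ →
      HasDerivAt (h x) ((α x + Complex.I * β x) * (q * ρ ^ (q - 1) : ℝ)) ρ := fun x ρ hρ =>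
    ((hpow q ρ hρ).const_mul _).const_add _
  have hgρ : ∀ x ρ, 0 < ρ → HasDerivAt (g x) (u x * (q * ρ ^ (q - 1) : ℝ)
      + Complex.I * (w x * (2 * (ρ ^ q : ℝ) * (q * ρ ^ (q - 1) : ℝ))
        + c * (p * ρ ^ (p - 1) : ℝ))) ρ := fun x ρ hρ =>
    (((hpow q ρ hρ).const_mul _).fun_add ((((((hpow q ρ hρ).fun_pow 2).const_mul _).const_add
      _).fun_add ((hpow p ρ hρ).const_mul _)).const_mul _)).congr_deriv (by push_cast; ring)
  have hhx : ∀ x ∈ J, ∀ ρ : ℝ, HasDerivAt (fun s => h s ρ)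
      (a' x + (α' x + Complex.I * β' x) * (ρ ^ q : ℝ)) x := fun x hx ρ =>
    (ha x hx).ofReal_comp.fun_add (((hα x hx).ofReal_comp.fun_add
      ((hβ x hx).ofReal_comp.const_mul _)).mul_const _)
  have hgx : ∀ x ∈ J, ∀ ρ : ℝ, HasDerivAt (fun s => g s ρ)
      (u' x * (ρ ^ q : ℝ) + Complex.I * (w' x * (ρ ^ q : ℝ) ^ 2)) x := fun x hx ρ =>
    ((hu x hx).ofReal_comp.mul_const _).fun_add
      (((((hw x hx).ofReal_comp.mul_const _).const_add _).add_const _).const_mul _)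
  have hreh : ∀ x ρ, (h x ρ).re = a x + α x * ρ ^ q := fun x ρ => by
    simp only [hh, Complex.add_re, Complex.re_mul_ofReal, Complex.ofReal_re, Complex.I_re,
      zero_mul, add_zero]
  have hreg : ∀ x ρ, (g x ρ).re = u x * ρ ^ q := fun x ρ => by
    have : g x ρ = ((u x * ρ ^ q : ℝ) : ℂ)
        + Complex.I * ((w₀ + w x * (ρ ^ q) ^ 2 + c * ρ ^ p : ℝ) : ℂ) := by
      simp only [hg]; push_cast; ring
    rw [this]
    simp only [Complex.add_re, Complex.ofReal_re, Complex.I_mul_re, Complex.ofReal_im, neg_zero,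
      add_zero]
  have hC := contDiffOn_absPow (J := J) q
  have hsnd : ContDiffOn ℝ 1 (fun y : ℝ × ℂ => y.2) (J ×ˢ {v : ℂ | v ≠ 0}) :=
    contDiff_snd.contDiffOn
  have hcH : ContDiffOn ℝ 1 (fun y : ℝ × ℂ => H y.1 y.2) (J ×ˢ {v : ℂ | v ≠ 0}) := by
    refine ContDiffOn.congr (f := fun y : ℝ × ℂ =>
      (a y.1 + (α y.1 + Complex.I * β y.1) * absPow y.2 q) * y.2) ?_
      fun y hy => hH y.1 hy.1 y.2 hy.2
    exact ((contDiffOn_coeff (contDiffOn_one_of_hasDerivAt hJ ha ca)).add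
      (((contDiffOn_coeff (contDiffOn_one_of_hasDerivAt hJ hα cα)).add
        (contDiffOn_const.mul (contDiffOn_coeff
          (contDiffOn_one_of_hasDerivAt hJ hβ cβ)))).mul hC)).mul hsnd
  have hcG : ContDiffOn ℝ 1 (fun y : ℝ × ℂ => G y.1 y.2) (J ×ˢ {v : ℂ | v ≠ 0}) := by
    refine ContDiffOn.congr (f := fun y : ℝ × ℂ => (u y.1 * absPow y.2 q
      + Complex.I * (w₀ + w y.1 * absPow y.2 q ^ 2 + c * absPow y.2 p)) * y.2) ?_
      fun y hy => hG y.1 hy.1 y.2 hy.2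
    exact (((contDiffOn_coeff (contDiffOn_one_of_hasDerivAt hJ hu cu)).mul hC).add
      (contDiffOn_const.mul ((contDiffOn_const.add
        ((contDiffOn_coeff (contDiffOn_one_of_hasDerivAt hJ hw cw)).mul (hC.pow 2))).add
          (contDiffOn_const.mul (contDiffOn_absPow p))))).mul hsnd
  have hS : IsSolution n p k J H G := by
    refine ⟨hcH, hcG, fun x hx v hv => ?_, fun x hx v hv => ?_⟩
    · have hρ : 0 < ‖v‖ := norm_pos_iff.2 hv
      rw [eq_one_radial_iff (h := h) (g := g) hJ hH' hG' hx hv (hhρ x _ hρ) (hgρ x _ hρ)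
        (hgx x hx _), hreh, hreg]
      have e1 : (‖v‖ : ℂ) * (q * ‖v‖ ^ (q - 1) : ℝ) = q * (‖v‖ ^ q : ℝ) := by
        rw [← Complex.ofReal_mul, mul_rpow_sub_one _ hρ, Complex.ofReal_mul]
      have e2 : (‖v‖ : ℂ) * (p * ‖v‖ ^ (p - 1) : ℝ) = p * (‖v‖ ^ p : ℝ) := by
        rw [← Complex.ofReal_mul, mul_rpow_sub_one _ hρ, Complex.ofReal_mul]
      have k1 : (u' x : ℂ) + q * a x * u x = 0 := by exact_mod_cast h1 x hx
      have k2 := h2 x hx _ _ _ hρ rfl rfl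
      set P : ℝ := ‖v‖ ^ q
      set R : ℝ := ‖v‖ ^ p
      have k2' : (w' x : ℂ) * P ^ 2 + (2 * q * w x * P ^ 2 + p * c * R) * (a x + α x * P)
        - q * β x * u x * P ^ 2 = 0 := by exact_mod_cast k2
      push_cast at e1 e2 ⊢
      linear_combination (P : ℂ) * k1 + Complex.I * k2' + (u x * (a x + α x * P)
        + Complex.I * w x * 2 * P * (a x + α x * P) - (α x + Complex.I * β x) * (u x * P)) * e1
        + Complex.I * c * (a x + α x * P) * e2
    · have hρ : 0 < ‖v‖ := norm_pos_iff.2 hv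
      rw [eq_two_radial_iff (h := h) hJ hH' hx hv (hhρ x _ hρ) (hhx x hx _) (hG' x hx v hv), hreh]
      have e1 : (‖v‖ : ℂ) * (q * ‖v‖ ^ (q - 1) : ℝ) = q * (‖v‖ ^ q : ℝ) := by
        rw [← Complex.ofReal_mul, mul_rpow_sub_one _ hρ, Complex.ofReal_mul]
      have k3 := h3 x hx _ _ _ hρ rfl rfl
      have k4 := h4 x hx (‖v‖ ^ q)
      simp only [hg, hh]
      set P : ℝ := ‖v‖ ^ q
      set R : ℝ := ‖v‖ ^ p
      have k3' : -((w₀ : ℂ) + w x * P ^ 2 + c * R) = (n - 1) * (a x + α x * P) / x + a' x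
        + α' x * P + a x ^ 2 + 2 * a x * α x * P + (α x ^ 2 - β x ^ 2) * P ^ 2
        + q * a x * α x * P + q * α x ^ 2 * P ^ 2 + k * R := by exact_mod_cast k3
      have k4' : (u x : ℂ) = (n - 1) * β x / x + β' x + 2 * a x * β x + 2 * α x * β x * P
        + q * a x * β x + q * α x * β x * P := by exact_mod_cast k4
      push_cast at e1 ⊢
      linear_combination k3' + Complex.I * P * k4'
        - (α x + Complex.I * β x) * (a x + α x * P) * e1
        + ((w₀ : ℂ) + w x * P ^ 2 + c * R - (β x) ^ 2 * P ^ 2) * Complex.I_mul_I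
  -- The ansatz exponent is doubled in its definition. Its formula for `G` is the second equation
  -- multiplied by `-i`.
  refine ⟨⟨q / 2, div_ne_zero hq two_ne_zero, fun x => a x, fun x => α x + Complex.I * β x,
    fun x hx v hv => ⟨?_, ?_⟩⟩, hS, h, g, fun x hx v hv => ⟨hH' x hx v hv, hG' x hx v hv⟩⟩
  · rw [hH x hx v hv, mul_div_cancel₀ q two_ne_zero]; ring
  · have := hS.eq_two x hx v hv
    rw [Psi]
    linear_combination -Complex.I * this + G x v * Complex.I_mul_I

theorem Family1.solution (hJ : IsOpen J) (hF : Family1 p k J H G) :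
    HasAnsatzForm n p k J H G ∧ IsSolution n p k J H G ∧ IsPhaseEquivariant J H G := by
  -- The ansatz needs a nonzero exponent, but with `h₂ = 0` any value serves.
  refine solution_of_coefficients (q := 1) (a := 0) (α := 0) (β := 0) (u := 0) (w := 0)
    (a' := 0) (α' := 0) (β' := 0) (u' := 0) (w' := 0) (w₀ := 0) (c := -k) one_ne_zero hJ
    (fun x _ => hasDerivAt_const x 0) (fun x _ => hasDerivAt_const x 0)
    (fun x _ => hasDerivAt_const x 0) (fun x _ => hasDerivAt_const x 0)
    (fun x _ => hasDerivAt_const x 0) continuousOn_const continuousOn_const continuousOn_const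
    continuousOn_const continuousOn_const (fun x hx v hv => ?_) (fun x hx v hv => ?_)
    (fun x hx => ?_) (fun x hx P R ρ hρ hP hR => ?_) (fun x hx P R ρ hρ hP hR => ?_)
    (fun x hx P => ?_)
  · simp [(hF x hx v hv).1]
  · rw [(hF x hx v hv).2]; push_cast; simp only [Pi.zero_apply]; push_cast; ring
  all_goals simp

theorem Family2.solution (hJ : IsOpen J) (hJ0 : J ⊆ Ioi 0) (hF : Family2 n p k J H G) :
    HasAnsatzForm n p k J H G ∧ IsSolution n p k J H G ∧ IsPhaseEquivariant J H G := by
  obtain ⟨hn, C, -, hF⟩ := hF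
  have hs : ∀ x, HasDerivAt (fun x : ℝ => C * x) C x := fun x => by
    simpa using (hasDerivAt_id' x).const_mul C
  have hw : ∀ x, HasDerivAt (fun x : ℝ => C ^ 2 * x ^ 2) (C ^ 2 * (2 * x)) x := fun x => by
    simpa using (hasDerivAt_pow 2 x).const_mul (C ^ 2)
  refine solution_of_coefficients (q := 2 / n) (a := 0) (α := 0) (β := fun x => C * x)
    (u := fun _ => C * n) (w := fun x => C ^ 2 * x ^ 2)
    (a' := 0) (α' := 0) (β' := fun _ => C) (u' := 0) (w' := fun x => C ^ 2 * (2 * x)) (w₀ := 0)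
    (c := -k) (div_ne_zero two_ne_zero hn) hJ
    (fun x _ => hasDerivAt_const x 0) (fun x _ => hasDerivAt_const x 0)
    (fun x _ => hs x) (fun x _ => hasDerivAt_const x _) (fun x _ => hw x)
    continuousOn_const continuousOn_const continuousOn_const continuousOn_const (by fun_prop)
    (fun x hx v hv => ?_) (fun x hx v hv => ?_)
    (fun x hx => ?_) (fun x hx P R ρ hρ hP hR => ?_) (fun x hx P R ρ hρ hP hR => ?_)
    (fun x hx P => ?_)
  · rw [(hF x hx v hv).1]; simp only [Pi.zero_apply]; push_cast; ring
  · rw [(hF x hx v hv).2, show 4 / n = 2 * (2 / n) by ring, absPow_two_mul]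
    push_cast; ring
  · simp
  · simp; field_simp; ring
  · simp; ring
  · have := (mem_Ioi.1 (hJ0 hx)).ne'
    simp; field_simp; ring

theorem Family3.solution (hJ : IsOpen J) (hJ0 : J ⊆ Ioi 0) (hF : Family3 n p k J H G) :
    HasAnsatzForm n p k J H G ∧ IsSolution n p k J H G ∧ IsPhaseEquivariant J H G := by
  obtain ⟨hp, hn, hn2, hpos, ε, hε, hF⟩ := hF
  have hn2' : 2 - n ≠ 0 := sub_ne_zero.2 hn2.symm
  obtain ⟨c, hcε, hc⟩ : ∃ c, ε * √(2 * k * (1 - 2 / n)) = c ∧ c ^ 2 = 2 * k * (1 - 2 / n) := by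
    refine ⟨_, rfl, ?_⟩
    rw [mul_pow, Real.sq_sqrt (by linarith)]
    rcases hε with rfl | rfl <;> ring
  have hi : ∀ C, ∀ x ∈ J, HasDerivAt (fun x : ℝ => C * x⁻¹) (-C * (x ^ 2)⁻¹) x := fun C x hx =>
    ((hasDerivAt_inv (hJ0 hx).ne').const_mul C).congr_deriv (by ring)
  have hcont : ∀ C : ℝ, ContinuousOn (fun x : ℝ => -C * (x ^ 2)⁻¹) J := fun C =>
    continuousOn_const.mul ((continuousOn_id.pow 2).inv₀ fun x hx => pow_ne_zero 2 (hJ0 hx).ne')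
  refine solution_of_coefficients (q := 1 / (2 - n)) (a := fun x => (2 - n) * x⁻¹) (α := 0)
    (β := fun _ => c) (u := fun x => (4 - n) * c * x⁻¹) (w := fun _ => k * (1 - 4 / n))
    (a' := _) (α' := 0) (β' := 0) (u' := _) (w' := 0) (w₀ := 0)
    (c := 0) (div_ne_zero one_ne_zero hn2') hJ
    (hi _) (fun x _ => hasDerivAt_const x 0)
    (fun x _ => hasDerivAt_const x _) (hi _) (fun x _ => hasDerivAt_const x _)
    (hcont _) continuousOn_const continuousOn_const (hcont _) continuousOn_const
    (fun x hx v hv => ?_) (fun x hx v hv => ?_)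
    (fun x hx => ?_) (fun x hx P R ρ hρ hP hR => ?_) (fun x hx P R ρ hρ hP hR => ?_)
    (fun x hx P => ?_)
  · rw [(hF x hx v hv).1, hcε]; simp
  · rw [(hF x hx v hv).2, show 2 / (2 - n) = 2 * (1 / (2 - n)) by ring, absPow_two_mul,
      show ε * (4 - n) * √(2 * k * (1 - 2 / n)) * x⁻¹ = (4 - n) * c * x⁻¹ by rw [← hcε]; ring]
    push_cast; ring
  · have := (mem_Ioi.1 (hJ0 hx)).ne'
    field_simp; ring
  · have := (mem_Ioi.1 (hJ0 hx)).ne'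
    simp
    field_simp
    rw [hc]
    field_simp
    ring
  · have := (mem_Ioi.1 (hJ0 hx)).ne'
    -- In this family `p = 2q`, so the nonlinearity combines with the quadratic terms; likewise in
    -- the next two families.
    have hRP : R = P ^ 2 := by
      rw [hR, hP, hp, ← Real.rpow_mul_natCast hρ.le]; congr 1; push_cast; ring
    rw [hRP]
    simp only [Pi.zero_apply, zero_mul, mul_zero, add_zero, zero_add]
    rw [hc]
    field_simp
    ring
  · have := (mem_Ioi.1 (hJ0 hx)).ne'
    simp; field_simp; ring

theorem Family4.solution (hJ : IsOpen J) (hJ0 : J ⊆ Ioi 0) (hF : Family4 n p k J H G) :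
    HasAnsatzForm n p k J H G ∧ IsSolution n p k J H G ∧ IsPhaseEquivariant J H G := by
  obtain ⟨hp, hn2, hn3, hpos, ε, hε, hF⟩ := hF
  have hn2' : n - 2 ≠ 0 := sub_ne_zero.2 hn2
  have hn3' : 3 - n ≠ 0 := sub_ne_zero.2 hn3.symm
  obtain ⟨c, hcε, hc⟩ : ∃ c, ε * √k = c ∧ c ^ 2 = k := by
    refine ⟨_, rfl, ?_⟩
    rw [mul_pow, Real.sq_sqrt hpos.le]
    rcases hε with rfl | rfl <;> ring
  have hi : ∀ C, ∀ x ∈ J, HasDerivAt (fun x : ℝ => C * x⁻¹) (-C * (x ^ 2)⁻¹) x := fun C x hx =>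
    ((hasDerivAt_inv (hJ0 hx).ne').const_mul C).congr_deriv (by ring)
  have hcont : ∀ C : ℝ, ContinuousOn (fun x : ℝ => -C * (x ^ 2)⁻¹) J := fun C =>
    continuousOn_const.mul ((continuousOn_id.pow 2).inv₀ fun x hx => pow_ne_zero 2 (hJ0 hx).ne')
  refine solution_of_coefficients (q := (3 - n) / (n - 2)) (a := fun x => (2 - n) * x⁻¹) (α := 0)
    (β := fun _ => c) (u := 0) (w := 0)
    (a' := _) (α' := 0) (β' := 0) (u' := 0) (w' := 0) (w₀ := 0)
    (c := 0) (div_ne_zero hn3' hn2') hJ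
    (hi _) (fun x _ => hasDerivAt_const x 0)
    (fun x _ => hasDerivAt_const x _) (fun x _ => hasDerivAt_const x 0)
    (fun x _ => hasDerivAt_const x 0)
    (hcont _) continuousOn_const continuousOn_const continuousOn_const continuousOn_const
    (fun x hx v hv => ?_) (fun x hx v hv => ?_)
    (fun x hx => ?_) (fun x hx P R ρ hρ hP hR => ?_) (fun x hx P R ρ hρ hP hR => ?_)
    (fun x hx P => ?_)
  · rw [(hF x hx v hv).1, hcε]; simp
  · rw [(hF x hx v hv).2]; simp
  · simp
  · simp
  · have := (mem_Ioi.1 (hJ0 hx)).ne'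
    have hRP : R = P ^ 2 := by
      rw [hR, hP, hp, ← Real.rpow_mul_natCast hρ.le]; congr 1; push_cast; ring
    rw [hRP]
    simp only [Pi.zero_apply, zero_mul, add_zero]
    rw [hc]
    field_simp
    ring
  · have := (mem_Ioi.1 (hJ0 hx)).ne'
    simp; field_simp; ring

theorem Family5.solution (hJ : IsOpen J) (hJ0 : J ⊆ Ioi 0) (hF : Family5 n p k J H G) :
    HasAnsatzForm n p k J H G ∧ IsSolution n p k J H G ∧ IsPhaseEquivariant J H G := by
  obtain ⟨hp, hn2, hn3, hpos, ε, hε, hF⟩ := hF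
  have hn2' : n - 2 ≠ 0 := sub_ne_zero.2 hn2
  have hn2'' : 2 - n ≠ 0 := sub_ne_zero.2 hn2.symm
  have hn3' : n - 3 ≠ 0 := sub_ne_zero.2 hn3
  obtain ⟨c, hcε, hc⟩ : ∃ c, ε * √((2 - n) * k) = c ∧ c ^ 2 = (2 - n) * k := by
    refine ⟨_, rfl, ?_⟩
    rw [mul_pow, Real.sq_sqrt (by linarith)]
    rcases hε with rfl | rfl <;> ring
  have hi : ∀ C, ∀ x ∈ J, HasDerivAt (fun x : ℝ => C * x⁻¹) (-C * (x ^ 2)⁻¹) x := fun C x hx =>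
    ((hasDerivAt_inv (hJ0 hx).ne').const_mul C).congr_deriv (by ring)
  have hcont : ∀ C : ℝ, ContinuousOn (fun x : ℝ => -C * (x ^ 2)⁻¹) J := fun C =>
    continuousOn_const.mul ((continuousOn_id.pow 2).inv₀ fun x hx => pow_ne_zero 2 (hJ0 hx).ne')
  refine solution_of_coefficients (q := (n - 3) / (2 - n)) (a := fun x => (2 - n) * x⁻¹) (β := 0)
    (α := fun _ => -c) (u := 0) (w := 0)
    (a' := _) (α' := 0) (β' := 0) (u' := 0) (w' := 0) (w₀ := 0)
    (c := 0) (div_ne_zero hn3' hn2'') hJ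
    (hi _) (fun x _ => hasDerivAt_const x _)
    (fun x _ => hasDerivAt_const x 0) (fun x _ => hasDerivAt_const x 0)
    (fun x _ => hasDerivAt_const x 0)
    (hcont _) continuousOn_const continuousOn_const continuousOn_const continuousOn_const
    (fun x hx v hv => ?_) (fun x hx v hv => ?_)
    (fun x hx => ?_) (fun x hx P R ρ hρ hP hR => ?_) (fun x hx P R ρ hρ hP hR => ?_)
    (fun x hx P => ?_)
  · rw [(hF x hx v hv).1, hcε]; simp only [Pi.zero_apply]; push_cast; ring
  · rw [(hF x hx v hv).2]; simp
  · simp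
  · simp
  · have := (mem_Ioi.1 (hJ0 hx)).ne'
    have hRP : R = P ^ 2 := by
      rw [hR, hP, hp, ← Real.rpow_mul_natCast hρ.le]; congr 1; push_cast
      field_simp
      ring
    rw [hRP]
    simp only [Pi.zero_apply, zero_mul, add_zero, neg_sq]
    rw [hc]
    field_simp
    ring
  · simp

theorem IsRealStatic.solution {E : ℝ} {a α : ℝ → ℝ} (hJ : IsOpen J) (hJ0 : J ⊆ Ioi 0)
    (hp : p = -1) (h : IsRealStatic n k E J a α)
    (hF : ∀ x ∈ J, ∀ v : ℂ, v ≠ 0 →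
      H x v = (a x + α x * ‖v‖⁻¹ : ℝ) * v ∧ G x v = -Complex.I * E * v) :
    HasAnsatzForm n p k J H G ∧ IsSolution n p k J H G ∧ IsPhaseEquivariant J H G := by
  have hca : ContinuousOn a J := fun x hx => (h.deriv_a x hx).continuousAt.continuousWithinAt
  have hcα : ContinuousOn α J := fun x hx => (h.deriv_α x hx).continuousAt.continuousWithinAt
  have hc := continuousOn_const_div hJ0 (n - 1)
  refine solution_of_coefficients (q := -1) (a := a) (β := 0)
    (α := α) (u := 0) (w := 0)
    (a' := _) (α' := _) (β' := 0) (u' := 0) (w' := 0) (w₀ := -E)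
    (c := 0) (by norm_num) hJ h.deriv_a h.deriv_α
    (fun x _ => hasDerivAt_const x 0) (fun x _ => hasDerivAt_const x 0)
    (fun x _ => hasDerivAt_const x 0)
    ((continuousOn_const.sub (hc.mul hca)).sub (hca.pow 2))
    ((continuousOn_const.sub (hc.mul hcα)).sub (hca.mul hcα))
    continuousOn_const continuousOn_const continuousOn_const
    (fun x hx v hv => ?_) (fun x hx v hv => ?_)
    (fun x hx => ?_) (fun x hx P R ρ hρ hP hR => ?_) (fun x hx P R ρ hρ hP hR => ?_)
    (fun x hx P => ?_)
  · rw [(hF x hx v hv).1, absPow_neg_one]; push_cast; simp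
  · rw [(hF x hx v hv).2]; push_cast; simp
  · simp
  · simp
  · have := (mem_Ioi.1 (hJ0 hx)).ne'
    rw [hR, hp, ← hP]
    simp only [Pi.zero_apply, zero_mul, add_zero]
    field_simp
    ring
  · simp

end RadialNLS

/-! ### Linearisation for `p = -1`, and the families with `E = 0` -/

namespace RadialNLS

open Set

variable {n p k E : ℝ} {J : Set ℝ} {H G : ℝ → ℂ → ℂ}

theorem hasDerivAt_rpow_div (s : ℝ) {x : ℝ} (hx : 0 < x) :
    HasDerivAt (fun x : ℝ => x ^ s) (s * x ^ s / x) x := by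
  refine (Real.hasDerivAt_rpow_const (Or.inl hx.ne')).congr_deriv ?_
  rw [Real.rpow_sub_one hx.ne', mul_div_assoc]

/-- The linear system obtained from `IsRealStatic` by the substitution `a = y'/y`, `α = w/y`. -/
structure IsLinearStatic (n k E : ℝ) (J : Set ℝ) (y y' w : ℝ → ℝ) : Prop where
  deriv_y : ∀ x ∈ J, HasDerivAt y (y' x) x
  deriv_y' : ∀ x ∈ J, HasDerivAt y' (E * y x - (n - 1) / x * y' x) x
  deriv_w : ∀ x ∈ J, HasDerivAt w (-k * y x - (n - 1) / x * w x) x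

namespace IsLinearStatic

variable {y y' w a α : ℝ → ℝ}

theorem isRealStatic (h : IsLinearStatic n k E J y y' w) (hy : ∀ x ∈ J, y x ≠ 0) :
    IsRealStatic n k E J (fun x => y' x / y x) (fun x => w x / y x) := by
  constructor
  · intro x hx
    have := hy x hx
    refine ((h.deriv_y' x hx).fun_div (h.deriv_y x hx) this).congr_deriv ?_
    field_simp
  · intro x hx
    have := hy x hx
    refine ((h.deriv_w x hx).fun_div (h.deriv_y x hx) this).congr_deriv ?_
    field_simp

theorem solution (h : IsLinearStatic n k E J y y' w) (hy : ∀ x ∈ J, y x ≠ 0) (hJ : IsOpen J)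
    (hJ0 : J ⊆ Ioi 0) (hp : p = -1)
    (hF : ∀ x ∈ J, ∀ v : ℂ, v ≠ 0 →
      H x v = (y' x / y x + w x / y x * ‖v‖⁻¹ : ℝ) * v ∧ G x v = -Complex.I * E * v) :
    HasAnsatzForm n p k J H G ∧ IsSolution n p k J H G ∧ IsPhaseEquivariant J H G :=
  (h.isRealStatic hy).solution hJ hJ0 hp hF

/-- `y' - a y` and then `w - α y` solve homogeneous linear equations and vanish at `x₀`, hence
everywhere. From `y' = a y` it follows that `y` has no zeros. A solution is thus identified by
matching its values at one point. -/
theorem eq_div (h : IsLinearStatic n k E J y y' w) (hs : IsRealStatic n k E J a α)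
    (hJ : IsOpen J) (hJc : IsPreconnected J) (hJ0 : J ⊆ Ioi 0) {x₀ : ℝ} (hx₀ : x₀ ∈ J)
    (hy : y x₀ ≠ 0) (hy' : y' x₀ = a x₀ * y x₀) (hw : w x₀ = α x₀ * y x₀) :
    ∀ x ∈ J, y x ≠ 0 ∧ a x = y' x / y x ∧ α x = w x / y x := by
  have hca : ContinuousOn a J := fun x hx => (hs.deriv_a x hx).continuousAt.continuousWithinAt
  have hc := continuousOn_const_div hJ0 (n - 1)
  have h1 := eq_zero_of_linear hJ hJc (c := fun x => -((n - 1) / x + a x))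
    (y := fun x => y' x - a x * y x) (hc.add hca).neg (fun x hx =>
      ((h.deriv_y' x hx).fun_sub ((hs.deriv_a x hx).fun_mul (h.deriv_y x hx))).congr_deriv
        (by ring)) hx₀ (by rw [hy', sub_self])
  have h2 : ∀ x ∈ J, y x ≠ 0 := fun x hx hyx => hy <| eq_zero_of_linear hJ hJc (c := a) hca
    (fun z hz => (h.deriv_y z hz).congr_deriv (sub_eq_zero.1 (h1 z hz))) hx hyx x₀ hx₀
  have h3 := eq_zero_of_linear hJ hJc (c := fun x => -((n - 1) / x))
    (y := fun x => w x - α x * y x) hc.neg (fun x hx =>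
      ((h.deriv_w x hx).fun_sub ((hs.deriv_α x hx).fun_mul (h.deriv_y x hx))).congr_deriv
        (by linear_combination -α x * h1 x hx)) hx₀ (by rw [hw, sub_self])
  intro x hx
  refine ⟨h2 x hx, ?_, ?_⟩
  · rw [eq_div_iff (h2 x hx)]; exact (sub_eq_zero.1 (h1 x hx)).symm
  · rw [eq_div_iff (h2 x hx)]; exact (sub_eq_zero.1 (h3 x hx)).symm

end IsLinearStatic

theorem isLinearStatic_one_power (hn : n ≠ 0) (hJ0 : J ⊆ Ioi 0) (C : ℝ) :
    IsLinearStatic n k 0 J (fun _ => 1) (fun _ => 0) (fun x => -(k / n) * x + C * x ^ (1 - n)) := by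
  refine ⟨fun x _ => hasDerivAt_const x 1, fun x _ => ?_, fun x hx => ?_⟩
  · exact (hasDerivAt_const x 0).congr_deriv (by simp)
  · have hx0 := (mem_Ioi.1 (hJ0 hx)).ne'
    refine (((hasDerivAt_id' x).const_mul _).fun_add
      ((hasDerivAt_rpow_div (1 - n) (hJ0 hx)).const_mul C)).congr_deriv ?_
    field_simp
    ring

theorem isLinearStatic_one_log (hn : n = 0) (hJ0 : J ⊆ Ioi 0) (C : ℝ) :
    IsLinearStatic n k 0 J (fun _ => 1) (fun _ => 0) (fun x => x * (C - k * Real.log x)) := by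
  subst hn
  refine ⟨fun x _ => hasDerivAt_const x 1, fun x _ => ?_, fun x hx => ?_⟩
  · exact (hasDerivAt_const x 0).congr_deriv (by simp)
  · have hx0 := (mem_Ioi.1 (hJ0 hx)).ne'
    refine ((hasDerivAt_id' x).fun_mul
      (((Real.hasDerivAt_log hx0).const_mul k).const_sub C)).congr_deriv ?_
    field_simp
    ring

theorem rpow_two_sub {x : ℝ} (hx : 0 < x) (n : ℝ) : x ^ (2 - n) = x ^ (1 - n) * x := by
  rw [← Real.rpow_add_one hx.ne']; congr 1; ring

/-- At `E = 0` the homogeneous equation for `y` has the solutions `1` and `x ^ (2 - n)`. Logarithms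
replace powers in `w` when `n = 0` and in `y` when `n = 2`, whence the two variants that follow. -/
theorem isLinearStatic_power (hn : n ≠ 0) (hJ0 : J ⊆ Ioi 0) (C₁ C₂ : ℝ) :
    IsLinearStatic n k 0 J (fun x => x ^ (2 - n) + C₁) (fun x => (2 - n) * x ^ (1 - n))
      (fun x => (2 - n) * x ^ (1 - n) * (C₂ + k / (2 * n) * x ^ 2)
        - k / n * x * (x ^ (2 - n) + C₁)) := by
  refine ⟨fun x hx => ?_, fun x hx => ?_, fun x hx => ?_⟩
  · have hx0 := (mem_Ioi.1 (hJ0 hx)).ne'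
    refine ((hasDerivAt_rpow_div (2 - n) (hJ0 hx)).add_const C₁).congr_deriv ?_
    rw [rpow_two_sub (hJ0 hx)]
    field_simp
  · have hx0 := (mem_Ioi.1 (hJ0 hx)).ne'
    refine ((hasDerivAt_rpow_div (1 - n) (hJ0 hx)).const_mul (2 - n)).congr_deriv ?_
    field_simp
    ring
  · have hx0 := (mem_Ioi.1 (hJ0 hx)).ne'
    refine ((((hasDerivAt_rpow_div (1 - n) (hJ0 hx)).const_mul (2 - n)).fun_mul
      (((hasDerivAt_pow 2 x).const_mul (k / (2 * n))).const_add C₂)).fun_sub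
      (((hasDerivAt_id' x).const_mul (k / n)).fun_mul
        ((hasDerivAt_rpow_div (2 - n) (hJ0 hx)).add_const C₁))).congr_deriv ?_
    rw [rpow_two_sub (hJ0 hx)]
    push_cast
    field_simp
    ring

theorem isLinearStatic_sq (hn : n = 0) (hJ0 : J ⊆ Ioi 0) (C₁ C₂ : ℝ) :
    IsLinearStatic n k 0 J (fun x => x ^ 2 + C₁) (fun x => 2 * x)
      (fun x => -(x * (k * C₁ * Real.log x + C₂)) - k / 2 * x * (x ^ 2 + C₁)) := by
  subst hn
  refine ⟨fun x hx => ?_, fun x hx => ?_, fun x hx => ?_⟩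
  · exact ((hasDerivAt_pow 2 x).add_const C₁).congr_deriv (by norm_num)
  · have hx0 := (mem_Ioi.1 (hJ0 hx)).ne'
    refine ((hasDerivAt_id' x).const_mul 2).congr_deriv ?_
    field_simp
    ring
  · have hx0 := (mem_Ioi.1 (hJ0 hx)).ne'
    refine (((hasDerivAt_id' x).fun_mul
      (((Real.hasDerivAt_log hx0).const_mul (k * C₁)).add_const C₂)).fun_neg.fun_sub
      (((hasDerivAt_id' x).const_mul (k / 2)).fun_mul
        ((hasDerivAt_pow 2 x).add_const C₁))).congr_deriv ?_
    push_cast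
    field_simp
    ring

theorem isLinearStatic_log (hn : n = 2) (hJ0 : J ⊆ Ioi 0) (C₁ C₂ : ℝ) :
    IsLinearStatic n k 0 J (fun x => Real.log x + C₁) (fun x => x⁻¹)
      (fun x => x⁻¹ * (C₂ + k / 4 * x ^ 2) - k / 2 * x * (Real.log x + C₁)) := by
  subst hn
  refine ⟨fun x hx => ?_, fun x hx => ?_, fun x hx => ?_⟩
  · exact (Real.hasDerivAt_log (mem_Ioi.1 (hJ0 hx)).ne').add_const C₁
  · have hx0 := (mem_Ioi.1 (hJ0 hx)).ne'
    refine (hasDerivAt_inv hx0).congr_deriv ?_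
    field_simp
    ring
  · have hx0 := (mem_Ioi.1 (hJ0 hx)).ne'
    refine (((hasDerivAt_inv hx0).fun_mul
      (((hasDerivAt_pow 2 x).const_mul (k / 4)).const_add C₂)).fun_sub
      (((hasDerivAt_id' x).const_mul (k / 2)).fun_mul
        ((Real.hasDerivAt_log hx0).add_const C₁))).congr_deriv ?_
    push_cast
    field_simp
    ring

theorem power_factor {x : ℝ} (hx : 0 < x) (n C : ℝ) :
    x + C * x ^ (n - 1) = (x ^ (2 - n) + C) * x ^ (n - 1) := by
  rw [add_mul, ← Real.rpow_add hx, show 2 - n + (n - 1) = 1 by ring, Real.rpow_one]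

theorem power_inv {x : ℝ} (hx : 0 < x) (n C : ℝ) :
    (x + C * x ^ (n - 1))⁻¹ = x ^ (1 - n) / (x ^ (2 - n) + C) := by
  rw [power_factor hx, mul_inv, ← Real.rpow_neg hx.le, neg_sub, mul_comm, div_eq_mul_inv]

theorem Family6.solution (hJ : IsOpen J) (hJ0 : J ⊆ Ioi 0) (hF : Family6 n p k J H G) :
    HasAnsatzForm n p k J H G ∧ IsSolution n p k J H G ∧ IsPhaseEquivariant J H G := by
  obtain ⟨hp, hn, C, hF⟩ := hF
  refine (isLinearStatic_one_power hn hJ0 C).solution (fun _ _ => one_ne_zero) hJ hJ0 hp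
    fun x hx v hv => ?_
  rw [(hF x hx v hv).1, (hF x hx v hv).2]
  simp

theorem Family7.solution (hJ : IsOpen J) (hJ0 : J ⊆ Ioi 0) (hF : Family7 n p k J H G) :
    HasAnsatzForm n p k J H G ∧ IsSolution n p k J H G ∧ IsPhaseEquivariant J H G := by
  obtain ⟨hp, hn, C, hF⟩ := hF
  refine (isLinearStatic_one_log hn hJ0 C).solution (fun _ _ => one_ne_zero) hJ hJ0 hp
    fun x hx v hv => ?_
  rw [(hF x hx v hv).1, (hF x hx v hv).2]
  simp

theorem Family8.solution (hJ : IsOpen J) (hJ0 : J ⊆ Ioi 0) (hF : Family8 n p k J H G) :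
    HasAnsatzForm n p k J H G ∧ IsSolution n p k J H G ∧ IsPhaseEquivariant J H G := by
  obtain ⟨hp, hn, -, C₁, C₂, hne, hF⟩ := hF
  have hne' : ∀ x ∈ J, x ^ (2 - n) + C₁ ≠ 0 := fun x hx h => hne x hx <| by
    rw [power_factor (hJ0 hx), h, zero_mul]
  refine (isLinearStatic_power hn hJ0 C₁ C₂).solution hne' hJ hJ0 hp fun x hx v hv => ?_
  have := hne' x hx
  rw [(hF x hx v hv).1, (hF x hx v hv).2, power_inv (hJ0 hx)]
  refine ⟨?_, by simp⟩
  congr 2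
  field_simp
  ring

theorem Family9.solution (hJ : IsOpen J) (hJ0 : J ⊆ Ioi 0) (hF : Family9 n p k J H G) :
    HasAnsatzForm n p k J H G ∧ IsSolution n p k J H G ∧ IsPhaseEquivariant J H G := by
  obtain ⟨hp, hn, C₁, C₂, hne, hF⟩ := hF
  refine (isLinearStatic_sq hn hJ0 C₁ C₂).solution hne hJ hJ0 hp fun x hx v hv => ?_
  have := hne x hx
  rw [(hF x hx v hv).1, (hF x hx v hv).2]
  refine ⟨?_, by simp⟩
  congr 2
  field_simp
  ring

theorem Family10.solution (hJ : IsOpen J) (hJ0 : J ⊆ Ioi 0) (hF : Family10 n p k J H G) :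
    HasAnsatzForm n p k J H G ∧ IsSolution n p k J H G ∧ IsPhaseEquivariant J H G := by
  obtain ⟨hp, hn, C₁, C₂, hne, hF⟩ := hF
  refine (isLinearStatic_log hn hJ0 C₁ C₂).solution hne hJ hJ0 hp fun x hx v hv => ?_
  have := hne x hx
  rw [(hF x hx v hv).1, (hF x hx v hv).2]
  refine ⟨?_, by simp⟩
  congr 2
  field_simp
  ring

/-- If `a` vanishes at `x₀`, then `y = 1` works. Otherwise `C₁` is solved from `y' = a y` at `x₀`,
and `C₂` from `w = α y` there; `eq_div` does the rest. -/
theorem IsRealStatic.listed_of_zero {a α : ℝ → ℝ} (hJ : IsOpen J) (hJc : IsPreconnected J)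
    (hJ0 : J ⊆ Ioi 0) (hJne : J.Nonempty) (hp : p = -1) (hs : IsRealStatic n k 0 J a α)
    (hF : ∀ x ∈ J, ∀ v : ℂ, v ≠ 0 → H x v = (a x + α x * ‖v‖⁻¹ : ℝ) * v ∧ G x v = 0) :
    IsListedStatic n p k J H G := by
  obtain ⟨x₀, hx₀⟩ := hJne
  have hpos : 0 < x₀ := hJ0 hx₀
  have hx0 := hpos.ne'
  by_cases ha : a x₀ = 0
  · by_cases hn : n = 0
    · refine Or.inr (Or.inr (Or.inr (Or.inl ⟨hp, hn, α x₀ / x₀ + k * Real.log x₀,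
        fun x hx v hv => ⟨?_, (hF x hx v hv).2⟩⟩)))
      obtain ⟨-, h1, h2⟩ := (isLinearStatic_one_log (k := k) hn hJ0
        (α x₀ / x₀ + k * Real.log x₀)).eq_div hs hJ hJc hJ0 hx₀ one_ne_zero (by simp [ha])
        (by field_simp; ring) x hx
      rw [(hF x hx v hv).1, h1, h2]
      simp
    · have hX : x₀ ^ (1 - n) ≠ 0 := (Real.rpow_pos_of_pos hpos _).ne'
      refine Or.inr (Or.inr (Or.inl ⟨hp, hn, (α x₀ + k / n * x₀) / x₀ ^ (1 - n),
        fun x hx v hv => ⟨?_, (hF x hx v hv).2⟩⟩))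
      obtain ⟨-, h1, h2⟩ := (isLinearStatic_one_power (k := k) hn hJ0
        ((α x₀ + k / n * x₀) / x₀ ^ (1 - n))).eq_div hs hJ hJc hJ0 hx₀ one_ne_zero (by simp [ha])
        (by field_simp; ring) x hx
      rw [(hF x hx v hv).1, h1, h2]
      simp
  by_cases hn : n = 0
  · set C₁ := 2 * x₀ / a x₀ - x₀ ^ 2 with hC₁
    have hy : x₀ ^ 2 + C₁ = 2 * x₀ / a x₀ := by rw [hC₁]; ring
    set C₂ := -(α x₀ * (x₀ ^ 2 + C₁) + k / 2 * x₀ * (x₀ ^ 2 + C₁)) / x₀ - k * C₁ * Real.log x₀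
      with hC₂
    have key := (isLinearStatic_sq (k := k) hn hJ0 C₁ C₂).eq_div hs hJ hJc hJ0 hx₀
      (by simp only [hy]; positivity) (by simp only [hy]; field_simp)
      (by simp only [hC₂]; field_simp; ring)
    refine Or.inr (Or.inr (Or.inr (Or.inr (Or.inr (Or.inl ⟨hp, hn, C₁, C₂,
      fun x hx => (key x hx).1, fun x hx v hv => ⟨?_, (hF x hx v hv).2⟩⟩)))))
    obtain ⟨h0, h1, h2⟩ := key x hx
    rw [(hF x hx v hv).1, h1, h2]
    congr 2
    field_simp
    ring
  by_cases hn2 : n = 2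
  · set C₁ := x₀⁻¹ / a x₀ - Real.log x₀ with hC₁
    have hy : Real.log x₀ + C₁ = x₀⁻¹ / a x₀ := by rw [hC₁]; ring
    set C₂ := (α x₀ * (Real.log x₀ + C₁) + k / 2 * x₀ * (Real.log x₀ + C₁)) * x₀
      - k / 4 * x₀ ^ 2 with hC₂
    have key := (isLinearStatic_log (k := k) hn2 hJ0 C₁ C₂).eq_div hs hJ hJc hJ0 hx₀
      (by simp only [hy]; positivity) (by simp only [hy]; field_simp)
      (by simp only [hC₂]; field_simp; ring)
    refine Or.inr (Or.inr (Or.inr (Or.inr (Or.inr (Or.inr ⟨hp, hn2, C₁, C₂,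
      fun x hx => (key x hx).1, fun x hx v hv => ⟨?_, (hF x hx v hv).2⟩⟩)))))
    obtain ⟨h0, h1, h2⟩ := key x hx
    rw [(hF x hx v hv).1, h1, h2]
    congr 2
    field_simp
    ring
  · have hn2' : 2 - n ≠ 0 := sub_ne_zero.2 (Ne.symm hn2)
    have hX : x₀ ^ (1 - n) ≠ 0 := (Real.rpow_pos_of_pos hpos _).ne'
    set C₁ := (2 - n) * x₀ ^ (1 - n) / a x₀ - x₀ ^ (2 - n) with hC₁
    have hy : x₀ ^ (2 - n) + C₁ = (2 - n) * x₀ ^ (1 - n) / a x₀ := by rw [hC₁]; ring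
    set Y := x₀ ^ (2 - n) + C₁
    set C₂ := (α x₀ * Y + k / n * x₀ * Y) / ((2 - n) * x₀ ^ (1 - n)) - k / (2 * n) * x₀ ^ 2
      with hC₂
    have key := (isLinearStatic_power (k := k) hn hJ0 C₁ C₂).eq_div hs hJ hJc hJ0 hx₀
      (show Y ≠ 0 by rw [hy]; positivity)
      (show (2 - n) * x₀ ^ (1 - n) = a x₀ * Y by rw [hy]; field_simp)
      (show (2 - n) * x₀ ^ (1 - n) * (C₂ + k / (2 * n) * x₀ ^ 2) - k / n * x₀ * Y = α x₀ * Y by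
        rw [hC₂]; field_simp; ring)
    refine Or.inr (Or.inr (Or.inr (Or.inr (Or.inl ⟨hp, hn, hn2, C₁, C₂,
      fun x hx => ?_, fun x hx v hv => ⟨?_, (hF x hx v hv).2⟩⟩))))
    · rw [power_factor (hJ0 hx)]
      exact mul_ne_zero (key x hx).1 (Real.rpow_pos_of_pos (hJ0 hx) _).ne'
    · obtain ⟨h0, h1, h2⟩ := key x hx
      rw [(hF x hx v hv).1, h1, h2, power_inv (hJ0 hx)]
      congr 2
      field_simp
      ring

end RadialNLS

/-! ### The series of Bessel type and their dependence on the order -/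

section

open Set

/-- The entire function `1 / Γ` on the real line. -/
noncomputable def invGamma (s : ℝ) : ℝ := (Real.Gamma s)⁻¹

/-- The derivative of `invGamma`. -/
noncomputable def invGammaDeriv (s : ℝ) : ℝ := (deriv (fun z : ℂ => (Complex.Gamma z)⁻¹) s).re

theorem hasDerivAt_invGamma (s : ℝ) : HasDerivAt invGamma (invGammaDeriv s) s := by
  have h := (Complex.differentiable_one_div_Gamma s).hasDerivAt.real_of_complex
  refine h.congr_of_eventuallyEq (.of_forall fun t => ?_)
  simp only [invGamma]
  rw [Complex.Gamma_ofReal, ← Complex.ofReal_inv, Complex.ofReal_re]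

theorem continuous_invGammaDeriv : Continuous invGammaDeriv :=
  Complex.continuous_re.comp
    (((Complex.differentiable_one_div_Gamma.contDiff (n := 1)).continuous_deriv le_rfl).comp
      Complex.continuous_ofReal)

/-- At `s = 0` both sides vanish because of the convention `Real.Gamma 0 = 0`. -/
theorem invGamma_eq_mul (s : ℝ) : invGamma s = s * invGamma (s + 1) := by
  rcases eq_or_ne s 0 with rfl | hs
  · simp [invGamma, Real.Gamma_zero]
  · rw [invGamma, invGamma, Real.Gamma_add_one hs]
    field_simp

theorem invGammaDeriv_eq (s : ℝ) :
    invGammaDeriv s = invGamma (s + 1) + s * invGammaDeriv (s + 1) := by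
  have h : HasDerivAt (fun s : ℝ => s * invGamma (s + 1))
      (invGamma (s + 1) + s * invGammaDeriv (s + 1)) s :=
    ((hasDerivAt_id' s).fun_mul
      ((hasDerivAt_invGamma (s + 1)).comp_add_const s 1)).congr_deriv (by ring)
  rw [← (hasDerivAt_invGamma s).unique (h.congr_of_eventuallyEq (.of_forall invGamma_eq_mul))]

/-- Growth along the progressions `s + ℕ` that is at most geometric, locally uniformly in `s`. -/
def HasGeomGrowth (g : ℝ → ℝ) : Prop :=
  ∀ R : ℝ, ∃ C : ℝ, ∀ s ∈ Icc (-R) R, ∀ j : ℕ, |g (s + j)| ≤ C * 2 ^ j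

/-- Compactness bounds the finitely many terms with `s + j ≤ R + 2`. Beyond `1`, the functional
equation does not increase `|1/Γ|` and adds at most `|1/Γ|` to the derivative, so doubling the bound
at each step suffices. -/
theorem invGamma_bound (R : ℝ) : ∃ C : ℝ, ∀ s ∈ Icc (-R) R, ∀ j : ℕ,
    |invGamma (s + j)| ≤ C * 2 ^ j ∧ |invGammaDeriv (s + j)| ≤ C * 2 ^ j := by
  have hcont : Continuous invGamma := continuous_iff_continuousAt.2 fun s =>
    (hasDerivAt_invGamma s).continuousAt
  obtain ⟨C₁, h₁⟩ := (isCompact_Icc (a := -R) (b := R + 2)).exists_bound_of_continuousOn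
    hcont.continuousOn
  obtain ⟨C₂, h₂⟩ := (isCompact_Icc (a := -R) (b := R + 2)).exists_bound_of_continuousOn
    continuous_invGammaDeriv.continuousOn
  set C := max (max C₁ C₂) 0 with hC
  have hC0 : 0 ≤ C := le_max_right _ _
  refine ⟨C, fun s hs j => ?_⟩
  have hle : ∀ t ∈ Icc (-R) (R + 2), ∀ j : ℕ,
      |invGamma t| ≤ C * 2 ^ j ∧ |invGammaDeriv t| ≤ C * 2 ^ j := fun t ht j => by
    have h2 : C ≤ C * 2 ^ j := le_mul_of_one_le_right hC0 (one_le_pow₀ one_le_two)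
    exact ⟨(h₁ t ht).trans (((le_max_left _ _).trans (le_max_left _ _)).trans h2),
      (h₂ t ht).trans (((le_max_right _ _).trans (le_max_left _ _)).trans h2)⟩
  induction j with
  | zero => exact hle _ ⟨by push_cast; linarith [hs.1], by push_cast; linarith [hs.2]⟩ 0
  | succ j ih =>
    by_cases hj : 1 ≤ s + j
    · have e1 := invGamma_eq_mul (s + j)
      have e2 := invGammaDeriv_eq (s + j)
      push_cast
      rw [← add_assoc]
      set t : ℝ := s + j
      have ht : 1 ≤ |t| := hj.trans (le_abs_self t)
      have i1 : |invGamma (t + 1)| ≤ |invGamma t| := by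
        rw [e1, abs_mul]; exact le_mul_of_one_le_left (abs_nonneg _) ht
      have i2 : |invGammaDeriv (t + 1)| ≤ |invGammaDeriv t| + |invGamma t| := by
        have : t * invGammaDeriv (t + 1) = invGammaDeriv t - invGamma (t + 1) := by
          rw [e2]; ring
        calc |invGammaDeriv (t + 1)| ≤ |t| * |invGammaDeriv (t + 1)| :=
              le_mul_of_one_le_left (abs_nonneg _) ht
          _ = |invGammaDeriv t - invGamma (t + 1)| := by rw [← abs_mul, this]
          _ ≤ |invGammaDeriv t| + |invGamma (t + 1)| := abs_sub _ _
          _ ≤ _ := by gcongr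
      have hp : (0 : ℝ) ≤ C * 2 ^ j := by positivity
      rw [pow_succ]
      constructor <;> linarith [ih.1, ih.2]
    · push Not at hj
      refine hle _ ⟨?_, ?_⟩ _
      · have : (0 : ℝ) ≤ ((j + 1 : ℕ) : ℝ) := Nat.cast_nonneg _
        linarith [hs.1]
      · push_cast; linarith [hs.1, hs.2]

theorem hasGeomGrowth_invGamma : HasGeomGrowth invGamma := fun R =>
  (invGamma_bound R).imp fun _ h s hs j => (h s hs j).1

theorem hasGeomGrowth_invGammaDeriv : HasGeomGrowth invGammaDeriv := fun R =>
  (invGamma_bound R).imp fun _ h s hs j => (h s hs j).2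

/-- `∑ g(ν + j + 1) z^j / j!` -/
noncomputable def shiftSeries (g : ℝ → ℝ) (ν z : ℝ) : ℝ :=
  ∑' j : ℕ, g (ν + j + 1) * (z ^ j / (j.factorial : ℝ))

namespace HasGeomGrowth

variable {g g' : ℝ → ℝ}

theorem bound (hg : HasGeomGrowth g) (ν : ℝ) : ∃ C : ℝ, ∀ μ ∈ Icc (ν - 1) (ν + 1), ∀ j : ℕ,
    |g (μ + j + 1)| ≤ C * 2 ^ j := by
  obtain ⟨C, hC⟩ := hg (|ν| + 2)
  refine ⟨C, fun μ hμ j => ?_⟩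
  rw [show μ + j + 1 = μ + 1 + j by ring]
  refine hC _ ⟨?_, ?_⟩ j
  · linarith [hμ.1, neg_abs_le ν]
  · linarith [hμ.2, le_abs_self ν]

theorem norm_term_le {C ν z : ℝ} {j : ℕ} (h : |g (ν + j + 1)| ≤ C * 2 ^ j) :
    ‖g (ν + j + 1) * (z ^ j / (j.factorial : ℝ))‖ ≤
      C * ((2 * |z|) ^ j / (j.factorial : ℝ)) := by
  rw [norm_mul, norm_div, norm_pow, Real.norm_eq_abs, Real.norm_eq_abs, Real.norm_natCast,
    mul_pow]
  calc |g (ν + j + 1)| * (|z| ^ j / (j.factorial : ℝ)) ≤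
        C * 2 ^ j * (|z| ^ j / (j.factorial : ℝ)) := by gcongr
    _ = _ := by ring

theorem summable (hg : HasGeomGrowth g) (ν z : ℝ) :
    Summable fun j : ℕ => g (ν + j + 1) * (z ^ j / (j.factorial : ℝ)) := by
  obtain ⟨C, hC⟩ := hg.bound ν
  exact .of_norm_bounded ((Real.summable_pow_div_factorial (2 * |z|)).mul_left C)
    fun j => norm_term_le (hC ν ⟨by linarith, by linarith⟩ j)

theorem hasSum (hg : HasGeomGrowth g) (ν z : ℝ) :
    HasSum (fun j : ℕ => g (ν + j + 1) * (z ^ j / (j.factorial : ℝ))) (shiftSeries g ν z) :=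
  (hg.summable ν z).hasSum

/-- Termwise differentiation in the order. -/
theorem hasDerivAt_order (hg : HasGeomGrowth g) (hg' : HasGeomGrowth g')
    (h : ∀ s, HasDerivAt g (g' s) s) (ν z : ℝ) :
    HasDerivAt (fun ν => shiftSeries g ν z) (shiftSeries g' ν z) ν := by
  obtain ⟨C, hC⟩ := hg'.bound ν
  refine hasDerivAt_tsum_of_isPreconnected
    ((Real.summable_pow_div_factorial (2 * |z|)).mul_left C) isOpen_Ioo
    (isPreconnected_Ioo (a := ν - 1) (b := ν + 1))
    (fun j μ _ => ?_) (fun j μ hμ => norm_term_le (hC μ ⟨hμ.1.le, hμ.2.le⟩ j))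
    (y₀ := ν) ⟨by linarith, by linarith⟩ (hg.summable ν z) ⟨by linarith, by linarith⟩
  have := (h (μ + (j + 1))).comp_add_const μ (j + 1 : ℝ)
  simp only [← add_assoc] at this
  exact this.mul_const _

theorem hasSum_mul (hg : HasGeomGrowth g) (ν z : ℝ) :
    HasSum (fun j : ℕ => (j : ℝ) * (g (ν + j + 1) * (z ^ j / (j.factorial : ℝ))))
      (z * shiftSeries g (ν + 1) z) := by
  have h := (hg.hasSum (ν + 1) z).mul_left z
  rw [← hasSum_nat_add_iff' 1]
  simp only [Finset.range_one, Finset.sum_singleton, Nat.cast_zero, zero_mul, sub_zero]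
  refine h.congr_fun fun j => ?_
  rw [Nat.factorial_succ, pow_succ]
  push_cast
  rw [show ν + 1 + (j : ℝ) + 1 = ν + (j + 1) + 1 by ring]
  field_simp

theorem tsum_deriv (hg : HasGeomGrowth g) (ν z : ℝ) :
    ∑' j : ℕ, g (ν + j + 1) * ((j : ℝ) * z ^ (j - 1) / (j.factorial : ℝ)) =
      shiftSeries g (ν + 1) z := by
  refine HasSum.tsum_eq ?_
  rw [← hasSum_nat_add_iff' 1]
  simp only [Finset.range_one, Finset.sum_singleton, Nat.cast_zero, zero_mul, zero_div, mul_zero,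
    sub_zero]
  refine (hg.hasSum (ν + 1) z).congr_fun fun j => ?_
  rw [Nat.factorial_succ, Nat.add_sub_cancel]
  push_cast
  rw [show ν + 1 + (j : ℝ) + 1 = ν + (j + 1) + 1 by ring]
  field_simp

theorem norm_deriv_term_le {C R ν y : ℝ} (hC0 : 0 ≤ C) (hy : |y| ≤ R) {j : ℕ}
    (h : |g (ν + 1 + j + 1)| ≤ C * 2 ^ j) :
    ‖g (ν + (j + 1 : ℕ) + 1) * (((j + 1 : ℕ) : ℝ) * y ^ j / ((j + 1).factorial : ℝ))‖ ≤
      C * ((2 * R) ^ j / (j.factorial : ℝ)) := by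
  have h1 := norm_term_le (z := y) h
  refine le_trans (le_of_eq ?_) (h1.trans (by gcongr))
  congr 1
  rw [Nat.factorial_succ]
  push_cast
  rw [show ν + 1 + (j : ℝ) + 1 = ν + (j + 1) + 1 by ring]
  field_simp

/-- Termwise differentiation in the argument. -/
theorem hasDerivAt_arg (hg : HasGeomGrowth g) (ν z : ℝ) :
    HasDerivAt (shiftSeries g ν) (shiftSeries g (ν + 1) z) z := by
  obtain ⟨C, hC⟩ := hg.bound (ν + 1)
  have hmem : ν + 1 ∈ Icc (ν + 1 - 1) (ν + 1 + 1) := ⟨by linarith, by linarith⟩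
  have hC0 : 0 ≤ C := by
    have := hC (ν + 1) hmem 0
    rw [pow_zero, mul_one] at this
    exact (abs_nonneg _).trans this
  have hz : z ∈ Metric.ball (0 : ℝ) (|z| + 1) := by simp
  generalize hR : |z| + 1 = R at hz
  have hu : Summable fun j : ℕ =>
      if j = 0 then 0 else C * ((2 * R) ^ (j - 1) / ((j - 1).factorial : ℝ)) := by
    rw [← summable_nat_add_iff 1]
    simpa using (Real.summable_pow_div_factorial (2 * R)).mul_left C
  have hd : ∀ (j : ℕ) (y : ℝ), y ∈ Metric.ball (0 : ℝ) R →
      HasDerivAt (fun y => g (ν + j + 1) * (y ^ j / (j.factorial : ℝ)))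
        (g (ν + j + 1) * ((j : ℝ) * y ^ (j - 1) / (j.factorial : ℝ))) y := fun j y _ =>
    ((hasDerivAt_pow j y).div_const _).const_mul _
  have hb : ∀ (j : ℕ) (y : ℝ), y ∈ Metric.ball (0 : ℝ) R →
      ‖g (ν + j + 1) * ((j : ℝ) * y ^ (j - 1) / (j.factorial : ℝ))‖ ≤
        if j = 0 then 0 else C * ((2 * R) ^ (j - 1) / ((j - 1).factorial : ℝ)) := fun j y hy => by
    rcases j with _ | j
    · simp
    · have hy' : |y| ≤ R := (mem_ball_zero_iff.1 hy).le
      rw [if_neg j.succ_ne_zero, Nat.add_sub_cancel]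
      exact norm_deriv_term_le hC0 hy' (hC (ν + 1) hmem j)
  have := hasDerivAt_tsum_of_isPreconnected hu Metric.isOpen_ball
    (convex_ball (0 : ℝ) R).isPreconnected hd hb hz (hg.summable ν z) hz
  rw [hg.tsum_deriv] at this
  exact this

end HasGeomGrowth

/-- `∑ z^j / (j! Γ(ν + j + 1))` -/
noncomputable def besselPhi (ν z : ℝ) : ℝ := shiftSeries invGamma ν z

/-- The derivative of `besselPhi` in the order. -/
noncomputable def besselPhiDeriv (ν z : ℝ) : ℝ := shiftSeries invGammaDeriv ν z

theorem hasDerivAt_besselPhi (ν z : ℝ) :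
    HasDerivAt (besselPhi ν) (besselPhi (ν + 1) z) z :=
  hasGeomGrowth_invGamma.hasDerivAt_arg ν z

theorem hasDerivAt_besselPhiDeriv (ν z : ℝ) :
    HasDerivAt (besselPhiDeriv ν) (besselPhiDeriv (ν + 1) z) z :=
  hasGeomGrowth_invGammaDeriv.hasDerivAt_arg ν z

theorem hasDerivAt_besselPhi_order (ν z : ℝ) :
    HasDerivAt (fun ν => besselPhi ν z) (besselPhiDeriv ν z) ν :=
  hasGeomGrowth_invGamma.hasDerivAt_order hasGeomGrowth_invGammaDeriv hasDerivAt_invGamma ν z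

/-- Termwise this is `1/Γ(s) = s/Γ(s + 1)` at `s = ν + j`, with the factor `ν + j` split. -/
theorem besselPhi_sub_one (ν z : ℝ) :
    besselPhi (ν - 1) z = ν * besselPhi ν z + z * besselPhi (ν + 1) z := by
  refine (hasGeomGrowth_invGamma.hasSum (ν - 1) z).unique ?_
  refine (((hasGeomGrowth_invGamma.hasSum ν z).mul_left ν).add
    (hasGeomGrowth_invGamma.hasSum_mul ν z)).congr_fun fun j => ?_
  rw [show ν - 1 + (j : ℝ) + 1 = ν + j by ring, invGamma_eq_mul (ν + j)]
  ring

/-- The preceding recurrence differentiated in the order. -/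
theorem besselPhiDeriv_sub_one (ν z : ℝ) : besselPhiDeriv (ν - 1) z =
    besselPhi ν z + ν * besselPhiDeriv ν z + z * besselPhiDeriv (ν + 1) z := by
  have h1 : HasDerivAt (fun ν => besselPhi (ν - 1) z) (besselPhiDeriv (ν - 1) z) ν :=
    (hasDerivAt_besselPhi_order (ν - 1) z).comp_sub_const ν 1
  have h2 : HasDerivAt (fun ν => ν * besselPhi ν z + z * besselPhi (ν + 1) z)
      (besselPhi ν z + ν * besselPhiDeriv ν z + z * besselPhiDeriv (ν + 1) z) ν :=
    (((hasDerivAt_id' ν).fun_mul (hasDerivAt_besselPhi_order ν z)).fun_add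
      (((hasDerivAt_besselPhi_order (ν + 1) z).comp_add_const ν 1).const_mul z)).congr_deriv
        (by ring)
  exact h1.unique (h2.congr_of_eventuallyEq (.of_forall fun ν => besselPhi_sub_one ν z))

theorem besselPhi_zero (ν : ℝ) : besselPhi ν 0 = invGamma (ν + 1) := by
  rw [besselPhi, shiftSeries, tsum_eq_single 0 fun j hj => by simp [hj]]
  simp

theorem besselPhi_pos {ν z : ℝ} (hν : -1 < ν) (hz : 0 ≤ z) : 0 < besselPhi ν z := by
  have h : ∀ j : ℕ, 0 < invGamma (ν + j + 1) := fun j =>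
    inv_pos.2 (Real.Gamma_pos_of_pos (by have : (0 : ℝ) ≤ j := j.cast_nonneg; linarith))
  refine (hasGeomGrowth_invGamma.summable ν z).tsum_pos
    (fun j => mul_nonneg (h j).le (by positivity)) 0 ?_
  simpa using h 0

/-- The Wronskian relation between the orders `ν` and `-ν`. -/
theorem besselPhi_wronskian (ν z : ℝ) :
    besselPhi ν z * besselPhi (-ν - 1) z - z * besselPhi (ν + 1) z * besselPhi (-ν) z =
      invGamma (ν + 1) * invGamma (-ν) := by
  -- The recurrences make the expression independent of `z`; its value is found at `z = 0`.
  have hd : ∀ z, HasDerivAt (fun z => besselPhi ν z * besselPhi (-ν - 1) z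
      - z * besselPhi (ν + 1) z * besselPhi (-ν) z) 0 z := fun z => by
    refine (((hasDerivAt_besselPhi ν z).fun_mul (hasDerivAt_besselPhi (-ν - 1) z)).fun_sub
      (((hasDerivAt_id' z).fun_mul (hasDerivAt_besselPhi (ν + 1) z)).fun_mul
        (hasDerivAt_besselPhi (-ν) z))).congr_deriv ?_
    have h1 := besselPhi_sub_one (ν + 1) z
    have h2 := besselPhi_sub_one (-ν) z
    rw [add_sub_cancel_right] at h1
    rw [sub_add_cancel]
    linear_combination besselPhi (-ν) z * h1 + besselPhi (ν + 1) z * h2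
  have := is_const_of_deriv_eq_zero (fun z => (hd z).differentiableAt) (fun z => (hd z).deriv) z 0
  rw [this, besselPhi_zero, besselPhi_zero]
  simp

end

/-! ### Recurrences and Wronskians for `J`, `Y` and `I` -/

section

open Set Filter

/-- The recurrences shared by the Bessel functions: `(σ, τ)` is `(-1, 1)` for `J` and `Y`,
`(1, 1)` for `I` and `(-1, -1)` for `K`. -/
structure IsCylinder (σ τ : ℝ) (Z : ℝ → ℝ → ℝ) : Prop where
  hasDerivAt : ∀ ν x : ℝ, 0 < x → HasDerivAt (Z ν) (ν / x * Z ν x + σ * Z (ν + 1) x) x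
  recurrence : ∀ ν x : ℝ, 0 < x → τ * Z (ν - 1) x = 2 * ν / x * Z ν x + σ * Z (ν + 1) x

namespace IsCylinder

variable {σ τ : ℝ} {Z : ℝ → ℝ → ℝ}

theorem hasDerivAt' (hZ : IsCylinder σ τ Z) (ν : ℝ) {x : ℝ} (hx : 0 < x) :
    HasDerivAt (Z ν) (τ * Z (ν - 1) x - ν / x * Z ν x) x :=
  (hZ.hasDerivAt ν x hx).congr_deriv (by rw [hZ.recurrence ν x hx]; ring)

theorem congr {Z' : ℝ → ℝ → ℝ} (hZ : IsCylinder σ τ Z) (h : ∀ ν x, 0 < x → Z' ν x = Z ν x) :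
    IsCylinder σ τ Z' := by
  refine ⟨fun ν x hx => ?_, fun ν x hx => ?_⟩
  · rw [h _ _ hx, h _ _ hx]
    exact (hZ.hasDerivAt ν x hx).congr_of_eventuallyEq
      (eventually_of_mem (Ioi_mem_nhds hx) fun y hy => h ν y hy)
  · rw [h _ _ hx, h _ _ hx, h _ _ hx, hZ.recurrence ν x hx]

end IsCylinder

/-- `J` for `σ = -1` and `I` for `σ = 1`. -/
noncomputable def besselPower (σ ν x : ℝ) : ℝ := (x / 2) ^ ν * besselPhi ν (σ * (x / 2) ^ 2)

theorem half_rpow_add_one {x : ℝ} (hx : 0 < x) (ν : ℝ) :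
    (x / 2) ^ (ν + 1) = (x / 2) ^ ν * (x / 2) :=
  Real.rpow_add_one (half_pos hx).ne' ν

theorem half_rpow_sub_one {x : ℝ} (hx : 0 < x) (ν : ℝ) :
    (x / 2) ^ (ν - 1) = (x / 2) ^ ν / (x / 2) :=
  Real.rpow_sub_one (half_pos hx).ne' ν

theorem hasDerivAt_half_rpow {x : ℝ} (hx : 0 < x) (ν : ℝ) :
    HasDerivAt (fun x : ℝ => (x / 2) ^ ν) (ν / x * (x / 2) ^ ν) x := by
  refine (((hasDerivAt_id' x).div_const 2).rpow_const (Or.inl (half_pos hx).ne')).congr_deriv ?_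
  rw [half_rpow_sub_one hx]
  field_simp

theorem hasDerivAt_const_mul_half_sq (σ x : ℝ) :
    HasDerivAt (fun x : ℝ => σ * (x / 2) ^ 2) (σ * (x / 2)) x :=
  ((((hasDerivAt_id' x).div_const 2).fun_pow 2).const_mul σ).congr_deriv (by push_cast; ring)

theorem isCylinder_besselPower (σ : ℝ) : IsCylinder σ 1 (besselPower σ) := by
  refine ⟨fun ν x hx => ?_, fun ν x hx => ?_⟩
  · refine ((hasDerivAt_half_rpow hx ν).fun_mul ((hasDerivAt_besselPhi ν _).comp x
      (hasDerivAt_const_mul_half_sq σ x))).congr_deriv ?_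
    rw [besselPower, besselPower, half_rpow_add_one hx]
    simp only [Function.comp]
    ring
  · rw [besselPower, besselPower, besselPower, half_rpow_add_one hx, half_rpow_sub_one hx,
      besselPhi_sub_one]
    field_simp

theorem half_rpow_two_mul_add {x : ℝ} (hx : 0 < x) (j : ℕ) (ν : ℝ) :
    (x / 2) ^ (2 * (j : ℝ) + ν) = (x / 2) ^ ν * ((x / 2) ^ 2) ^ j := by
  rw [add_comm, Real.rpow_add (half_pos hx), ← pow_mul]
  congr 1
  exact_mod_cast Real.rpow_natCast (x / 2) (2 * j)

theorem besselJ_eq_besselPower (ν : ℝ) {x : ℝ} (hx : 0 < x) :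
    besselJ ν x = besselPower (-1) ν x := by
  rw [besselJ, besselPower, besselPhi, shiftSeries, ← tsum_mul_left]
  refine tsum_congr fun j => ?_
  rw [half_rpow_two_mul_add hx, mul_pow, invGamma, div_mul_eq_div_div]
  ring

theorem besselI_eq_besselPower (ν : ℝ) {x : ℝ} (hx : 0 < x) :
    besselI ν x = besselPower 1 ν x := by
  rw [besselI, besselPower, besselPhi, shiftSeries, ← tsum_mul_left]
  refine tsum_congr fun j => ?_
  rw [half_rpow_two_mul_add hx, one_mul, invGamma, div_mul_eq_div_div]
  ring

theorem isCylinder_besselJ : IsCylinder (-1) 1 besselJ :=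
  (isCylinder_besselPower (-1)).congr fun ν _ hx => besselJ_eq_besselPower ν hx

theorem isCylinder_besselI : IsCylinder 1 1 besselI :=
  (isCylinder_besselPower 1).congr fun ν _ hx => besselI_eq_besselPower ν hx

theorem besselI_pos {ν x : ℝ} (hν : -1 < ν) (hx : 0 < x) : 0 < besselI ν x := by
  rw [besselI_eq_besselPower ν hx]
  exact mul_pos (Real.rpow_pos_of_pos (half_pos hx) ν) (besselPhi_pos hν (by positivity))

/-- The derivative of `J` in the order. -/
noncomputable def besselJOrder (ν x : ℝ) : ℝ :=
  (x / 2) ^ ν * (Real.log (x / 2) * besselPhi ν (-1 * (x / 2) ^ 2)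
    + besselPhiDeriv ν (-1 * (x / 2) ^ 2))

theorem hasDerivAt_besselJ_order (ν : ℝ) {x : ℝ} (hx : 0 < x) :
    HasDerivAt (fun ν => besselJ ν x) (besselJOrder ν x) ν := by
  have h : (fun ν => besselJ ν x) = fun ν => (x / 2) ^ ν * besselPhi ν (-1 * (x / 2) ^ 2) :=
    funext fun ν => besselJ_eq_besselPower ν hx
  rw [h]
  refine (((hasDerivAt_id' ν).const_rpow (half_pos hx)).fun_mul
    (hasDerivAt_besselPhi_order ν _)).congr_deriv ?_
  rw [besselJOrder]
  ring

theorem hasDerivAt_besselJOrder (ν : ℝ) {x : ℝ} (hx : 0 < x) :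
    HasDerivAt (besselJOrder ν)
      (ν / x * besselJOrder ν x - besselJOrder (ν + 1) x + besselJ ν x / x) x := by
  have h := hasDerivAt_const_mul_half_sq (-1) x
  have hlog : HasDerivAt (fun x : ℝ => Real.log (x / 2)) x⁻¹ x :=
    (((hasDerivAt_id' x).div_const 2).log (half_pos hx).ne').congr_deriv (by field_simp)
  refine ((hasDerivAt_half_rpow hx ν).fun_mul ((hlog.fun_mul
    ((hasDerivAt_besselPhi ν _).comp x h)).fun_add
      ((hasDerivAt_besselPhiDeriv ν _).comp x h))).congr_deriv ?_
  rw [besselJ_eq_besselPower ν hx, besselPower, besselJOrder, besselJOrder, half_rpow_add_one hx]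
  simp only [Function.comp]
  field_simp
  ring

/-- The recurrence of `J` differentiated in the order; the term `2/x * J` comes from the coefficient
`2ν/x`. -/
theorem besselJOrder_recurrence (ν : ℝ) {x : ℝ} (hx : 0 < x) :
    besselJOrder (ν - 1) x + besselJOrder (ν + 1) x =
      2 * ν / x * besselJOrder ν x + 2 / x * besselJ ν x := by
  rw [besselJ_eq_besselPower ν hx, besselPower, besselJOrder, besselJOrder, besselJOrder,
    half_rpow_add_one hx, half_rpow_sub_one hx, besselPhi_sub_one, besselPhiDeriv_sub_one]
  field_simp
  ring

theorem hasDerivAt_besselJOrder' (ν : ℝ) {x : ℝ} (hx : 0 < x) :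
    HasDerivAt (besselJOrder ν)
      (besselJOrder (ν - 1) x - ν / x * besselJOrder ν x - besselJ ν x / x) x :=
  (hasDerivAt_besselJOrder ν hx).congr_deriv
    (by linear_combination -besselJOrder_recurrence ν hx)

theorem cos_int_mul_pi_sq (m : ℤ) : Real.cos (m * Real.pi) ^ 2 = 1 := by
  have h := Real.sin_sq_add_cos_sq (m * Real.pi)
  rw [Real.sin_int_mul_pi] at h
  linear_combination h

theorem cos_add_one_mul_pi (ν : ℝ) : Real.cos ((ν + 1) * Real.pi) = -Real.cos (ν * Real.pi) := by
  rw [add_mul, one_mul, Real.cos_add_pi]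

theorem sin_add_one_mul_pi (ν : ℝ) : Real.sin ((ν + 1) * Real.pi) = -Real.sin (ν * Real.pi) := by
  rw [add_mul, one_mul, Real.sin_add_pi]

/-- Both sides obey the same three-term recurrence in `m`. Orders `0` and `1` start it, order `1`
coming from the recurrence at order `0`. -/
theorem besselJ_neg_natCast (m : ℕ) {x : ℝ} (hx : 0 < x) :
    besselJ (-(m : ℝ)) x = Real.cos (m * Real.pi) * besselJ m x := by
  induction m using Nat.twoStepInduction with
  | zero => simp
  | one =>
    have := isCylinder_besselJ.recurrence 0 x hx
    norm_num at this ⊢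
    exact this
  | more m ih₁ ih₂ =>
    have h1 := isCylinder_besselJ.recurrence (m + 1 : ℝ) x hx
    have h2 := isCylinder_besselJ.recurrence (-(m + 1 : ℝ)) x hx
    push_cast at ih₂ ⊢
    rw [show (m : ℝ) + 2 = m + 1 + 1 by ring, cos_add_one_mul_pi, cos_add_one_mul_pi]
    rw [cos_add_one_mul_pi] at ih₂
    rw [add_sub_cancel_right] at h1
    rw [show -((m : ℝ) + 1) + 1 = -m by ring] at h2
    rw [show -((m : ℝ) + 1 + 1) = -(m + 1) - 1 by ring]
    linear_combination h2 - ih₁ - 2 * (m + 1) / x * ih₂ - Real.cos (m * Real.pi) * h1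

theorem besselJ_neg_intCast (m : ℤ) {x : ℝ} (hx : 0 < x) :
    besselJ (-(m : ℝ)) x = Real.cos (m * Real.pi) * besselJ m x := by
  obtain ⟨j, rfl | rfl⟩ := m.eq_nat_or_neg
  · exact_mod_cast besselJ_neg_natCast j hx
  · have h := besselJ_neg_natCast j hx
    have h2 := cos_int_mul_pi_sq j
    push_cast at h2 ⊢
    rw [neg_neg, h, neg_mul, Real.cos_neg]
    linear_combination -besselJ j x * h2

theorem tendsto_div_of_hasDerivAt {f g : ℝ → ℝ} {f' g' x : ℝ} (hf : HasDerivAt f f' x)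
    (hg : HasDerivAt g g' x) (hf0 : f x = 0) (hg0 : g x = 0) (hg' : g' ≠ 0) :
    Tendsto (fun y => f y / g y) (𝓝[≠] x) (𝓝 (f' / g')) := by
  refine ((hasDerivAt_iff_tendsto_slope.1 hf).div (hasDerivAt_iff_tendsto_slope.1 hg) hg').congr'
    (eventually_of_mem self_mem_nhdsWithin fun y hy => ?_)
  have hy : y - x ≠ 0 := sub_ne_zero.2 hy
  simp only [Pi.div_apply, slope_def_field, hf0, hg0, sub_zero]
  exact div_div_div_cancel_right₀ hy _ _

/-- The quotient that defines `Y` at the orders that are not integers. -/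
noncomputable def besselYQuot (ν x : ℝ) : ℝ :=
  (besselJ ν x * Real.cos (ν * Real.pi) - besselJ (-ν) x) / Real.sin (ν * Real.pi)

theorem hasDerivAt_mul_pi (ν : ℝ) : HasDerivAt (fun ν => ν * Real.pi) Real.pi ν := by
  simpa using (hasDerivAt_id' ν).mul_const Real.pi

theorem hasDerivAt_sin_mul_pi (ν : ℝ) :
    HasDerivAt (fun ν => Real.sin (ν * Real.pi)) (Real.cos (ν * Real.pi) * Real.pi) ν :=
  (hasDerivAt_mul_pi ν).sin

theorem cos_int_mul_pi_ne_zero (m : ℤ) : Real.cos (m * Real.pi) ≠ 0 := fun h => by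
  have := cos_int_mul_pi_sq m
  rw [h] at this
  norm_num at this

/-- L'Hôpital's rule in the order: the numerator vanishes at `m` by `besselJ_neg_intCast`, and `sin
(μ π)` has a simple zero there. -/
theorem tendsto_besselYQuot (m : ℤ) {x : ℝ} (hx : 0 < x) :
    Tendsto (fun μ => besselYQuot μ x) (𝓝[≠] (m : ℝ)) (𝓝 ((besselJOrder m x
      + Real.cos (m * Real.pi) * besselJOrder (-m) x) / Real.pi)) := by
  have hc := cos_int_mul_pi_ne_zero m
  have hf : HasDerivAt (fun ν => besselJ ν x * Real.cos (ν * Real.pi) - besselJ (-ν) x)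
      (besselJOrder m x * Real.cos (m * Real.pi) + besselJOrder (-m) x) (m : ℝ) := by
    have h1 : HasDerivAt (fun ν => besselJ (-ν) x) (-besselJOrder (-m) x) (m : ℝ) :=
      ((hasDerivAt_besselJ_order (-m) hx).comp (m : ℝ) (hasDerivAt_neg (m : ℝ))).congr_deriv
        (by ring)
    refine (((hasDerivAt_besselJ_order m hx).fun_mul (hasDerivAt_mul_pi (m : ℝ)).cos).fun_sub
      h1).congr_deriv ?_
    rw [Real.sin_int_mul_pi]
    ring
  have h := tendsto_div_of_hasDerivAt hf (hasDerivAt_sin_mul_pi m)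
    (by rw [besselJ_neg_intCast m hx]; ring) (Real.sin_int_mul_pi m)
    (mul_ne_zero hc Real.pi_ne_zero)
  have e : (besselJOrder m x + Real.cos (m * Real.pi) * besselJOrder (-m) x) / Real.pi =
      (besselJOrder m x * Real.cos (m * Real.pi) + besselJOrder (-m) x) /
        (Real.cos (m * Real.pi) * Real.pi) := by
    rw [div_eq_div_iff Real.pi_ne_zero (mul_ne_zero hc Real.pi_ne_zero)]
    linear_combination Real.pi * besselJOrder (-m) x * cos_int_mul_pi_sq m
  rw [e]
  exact h

theorem besselY_intCast (m : ℤ) {x : ℝ} (hx : 0 < x) : besselY m x = (besselJOrder m x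
    + Real.cos (m * Real.pi) * besselJOrder (-m) x) / Real.pi := by
  rw [besselY, if_pos ⟨m, rfl⟩]
  exact (tendsto_besselYQuot m hx).limUnder_eq

theorem besselY_of_not_int {ν : ℝ} (hν : ¬∃ m : ℤ, ν = m) (x : ℝ) :
    besselY ν x = besselYQuot ν x := by
  rw [besselY, if_neg hν, besselYQuot]

theorem sin_mul_pi_ne_zero {ν : ℝ} (hν : ¬∃ m : ℤ, ν = m) : Real.sin (ν * Real.pi) ≠ 0 := by
  rw [Ne, Real.sin_eq_zero_iff]
  rintro ⟨m, hm⟩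
  exact hν ⟨m, (mul_right_cancel₀ Real.pi_ne_zero hm).symm⟩

theorem besselYQuot_add_one (ν x : ℝ) : besselYQuot (ν + 1) x =
    (besselJ (ν + 1) x * Real.cos (ν * Real.pi) + besselJ (-ν - 1) x) / Real.sin (ν * Real.pi) := by
  rw [besselYQuot, cos_add_one_mul_pi, sin_add_one_mul_pi, neg_add', ← neg_div_neg_eq]
  ring

/-- At integer orders `Y` is a combination of order derivatives of `J`, whose equations have an
extra term in `J`. The contributions of `m` and `-m` cancel because `J_{-m} = cos (m π) J_m` and
`cos² (m π) = 1`. -/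
theorem isCylinder_besselY : IsCylinder (-1) 1 besselY := by
  refine ⟨fun ν x hx => ?_, fun ν x hx => ?_⟩
  · by_cases hν : ∃ m : ℤ, ν = m
    · obtain ⟨m, rfl⟩ := hν
      have h1 := ((hasDerivAt_besselJOrder m hx).fun_add ((hasDerivAt_besselJOrder' (-m) hx).const_mul
        (Real.cos (m * Real.pi)))).div_const Real.pi
      refine (h1.congr_of_eventuallyEq (eventually_of_mem (Ioi_mem_nhds hx) fun y hy =>
        besselY_intCast m hy)).congr_deriv ?_
      have h2 := besselY_intCast (m + 1) hx
      push_cast at h2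
      rw [h2, besselY_intCast m hx, cos_add_one_mul_pi, besselJ_neg_intCast m hx, neg_add']
      linear_combination -besselJ m x / x / Real.pi * cos_int_mul_pi_sq m
    · have hν' : ¬∃ m : ℤ, ν + 1 = m := by
        rintro ⟨m, hm⟩
        exact hν ⟨m - 1, by push_cast; linarith⟩
      have h1 := (((isCylinder_besselJ.hasDerivAt ν x hx).mul_const
        (Real.cos (ν * Real.pi))).fun_sub (isCylinder_besselJ.hasDerivAt' (-ν) hx)).div_const
          (Real.sin (ν * Real.pi))
      refine (h1.congr_of_eventuallyEq (.of_forall fun y => besselY_of_not_int hν y)).congr_deriv ?_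
      rw [besselY_of_not_int hν, besselY_of_not_int hν', besselYQuot_add_one, besselYQuot]
      ring
  · by_cases hν : ∃ m : ℤ, ν = m
    · obtain ⟨m, rfl⟩ := hν
      have h2 := besselY_intCast (m + 1) hx
      have h3 := besselY_intCast (m - 1) hx
      have h4 := cos_add_one_mul_pi (m - 1)
      push_cast at h2 h3
      rw [sub_add_cancel] at h4
      rw [h2, h3, besselY_intCast m hx, cos_add_one_mul_pi]
      have h5 := besselJOrder_recurrence m hx
      have h6 := besselJOrder_recurrence (-m) hx
      rw [besselJ_neg_intCast m hx] at h6
      rw [neg_add', show -((m : ℝ) - 1) = -m + 1 by ring]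
      linear_combination (h5 - Real.cos (m * Real.pi) * h6
        - 2 / x * besselJ m x * cos_int_mul_pi_sq m) / Real.pi
        + besselJOrder (-m + 1) x / Real.pi * h4
    · have hν' : ¬∃ m : ℤ, ν + 1 = m := by
        rintro ⟨m, hm⟩
        exact hν ⟨m - 1, by push_cast; linarith⟩
      have hν'' : ¬∃ m : ℤ, ν - 1 = m := by
        rintro ⟨m, hm⟩
        exact hν ⟨m + 1, by push_cast; linarith⟩
      have h4 := cos_add_one_mul_pi (ν - 1)
      have h5 := sin_add_one_mul_pi (ν - 1)
      rw [sub_add_cancel] at h4 h5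
      have h6 : Real.cos ((ν - 1) * Real.pi) = -Real.cos (ν * Real.pi) := by rw [h4, neg_neg]
      have h7 : Real.sin ((ν - 1) * Real.pi) = -Real.sin (ν * Real.pi) := by rw [h5, neg_neg]
      rw [besselY_of_not_int hν, besselY_of_not_int hν', besselY_of_not_int hν'',
        besselYQuot_add_one, besselYQuot, besselYQuot, h6, h7,
        show -(ν - 1) = -ν + 1 by ring]
      have h8 := isCylinder_besselJ.recurrence ν x hx
      have h9 := isCylinder_besselJ.recurrence (-ν) x hx
      have := sin_mul_pi_ne_zero hν
      rw [div_neg]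
      linear_combination (Real.cos (ν * Real.pi) * h8 + h9) / Real.sin (ν * Real.pi)

theorem invGamma_mul_invGamma (ν : ℝ) :
    invGamma (ν + 1) * invGamma (-ν) = -(Real.sin (ν * Real.pi) / Real.pi) := by
  have h := Real.Gamma_mul_Gamma_one_sub (-ν)
  rw [sub_neg_eq_add, add_comm] at h
  rw [invGamma, invGamma, ← mul_inv, mul_comm, h, inv_div, mul_neg, Real.sin_neg, neg_div,
    mul_comm Real.pi]

/-- The Wronskian of the orders `ν` and `-ν` is `1/(Γ(ν + 1) Γ(-ν))` up to powers of `x`. The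
reflection formula turns this into a multiple of `sin (ν π)`, which cancels the denominator of `Y`.
-/
theorem besselYQuot_wronskian {ν x : ℝ} (hx : 0 < x) (hν : Real.sin (ν * Real.pi) ≠ 0) :
    besselJ (ν + 1) x * besselYQuot ν x - besselJ ν x * besselYQuot (ν + 1) x =
      2 / (Real.pi * x) := by
  have h1 := besselPhi_wronskian ν (-1 * (x / 2) ^ 2)
  rw [invGamma_mul_invGamma] at h1
  have h2 : (x / 2) ^ ν * (x / 2) ^ (-ν) = 1 := by
    rw [← Real.rpow_add (half_pos hx), add_neg_cancel, Real.rpow_zero]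
  have h3 : besselJ (ν + 1) x * besselJ (-ν) x + besselJ ν x * besselJ (-ν - 1) x =
      -(2 / (Real.pi * x) * Real.sin (ν * Real.pi)) := by
    simp only [besselJ_eq_besselPower _ hx, besselPower]
    rw [half_rpow_add_one hx, half_rpow_sub_one hx]
    have hpi := Real.pi_ne_zero
    calc _ = (x / 2) ^ ν * (x / 2) ^ (-ν) * (2 / x) * (besselPhi ν (-1 * (x / 2) ^ 2)
          * besselPhi (-ν - 1) (-1 * (x / 2) ^ 2) - -1 * (x / 2) ^ 2
          * besselPhi (ν + 1) (-1 * (x / 2) ^ 2) * besselPhi (-ν) (-1 * (x / 2) ^ 2)) := by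
          field_simp
          ring
      _ = _ := by
          rw [h1, h2]
          field_simp
  rw [besselYQuot_add_one, besselYQuot]
  have : ∀ a b c d e s : ℝ, a * ((b * c - d) / s) - b * ((a * c + e) / s) = -(a * d + b * e) / s :=
    fun _ _ _ _ _ _ => by ring
  rw [this, h3, neg_neg, mul_div_assoc, div_self hν, mul_one]

/-- At integer orders the identity is the limit of the one at nearby orders, its right side being
independent of the order. -/
theorem besselJ_besselY_wronskian (ν : ℝ) {x : ℝ} (hx : 0 < x) :
    besselJ (ν + 1) x * besselY ν x - besselJ ν x * besselY (ν + 1) x = 2 / (Real.pi * x) := by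
  by_cases hν : ∃ m : ℤ, ν = m
  · obtain ⟨m, rfl⟩ := hν
    have hJ : ∀ ν, Tendsto (fun μ => besselJ μ x) (𝓝 ν) (𝓝 (besselJ ν x)) := fun ν =>
      (hasDerivAt_besselJ_order ν hx).continuousAt
    have hshift : Tendsto (fun μ : ℝ => μ + 1) (𝓝 (m : ℝ)) (𝓝 (m + 1 : ℝ)) :=
      (continuous_add_const 1).tendsto _
    have hshift' : Tendsto (fun μ : ℝ => μ + 1) (𝓝[≠] (m : ℝ)) (𝓝[≠] (m + 1 : ℝ)) :=
      tendsto_nhdsWithin_iff.2 ⟨hshift.mono_left nhdsWithin_le_nhds,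
        eventually_of_mem self_mem_nhdsWithin fun y hy h => hy (add_right_cancel h)⟩
    have h0 := tendsto_besselYQuot m hx
    have h1 := tendsto_besselYQuot (m + 1) hx
    rw [← besselY_intCast m hx] at h0
    rw [← besselY_intCast (m + 1) hx] at h1
    push_cast at h1
    have hlim := ((((hJ (m + 1)).comp hshift).mono_left nhdsWithin_le_nhds).mul h0).sub
      (((hJ m).mono_left nhdsWithin_le_nhds).mul (h1.comp hshift'))
    refine tendsto_nhds_unique hlim (tendsto_const_nhds.congr' ?_)
    filter_upwards [(hasDerivAt_sin_mul_pi m).eventually_ne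
      (mul_ne_zero (cos_int_mul_pi_ne_zero m) Real.pi_ne_zero) (c := 0)] with μ hμ
    exact (besselYQuot_wronskian hx hμ).symm
  · have hν' : ¬∃ m : ℤ, ν + 1 = m := by
      rintro ⟨m, hm⟩
      exact hν ⟨m - 1, by push_cast; linarith⟩
    rw [besselY_of_not_int hν, besselY_of_not_int hν']
    exact besselYQuot_wronskian hx (sin_mul_pi_ne_zero hν)

end

/-! ### The integral `K` and its recurrences -/

section

open Set Filter MeasureTheory

/-- The integrand of `K`. -/
noncomputable def besselKernel (ν x t : ℝ) : ℝ := Real.exp (-(x * Real.cosh t)) * Real.cosh (ν * t)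

theorem continuous_besselKernel (ν x : ℝ) : Continuous (besselKernel ν x) := by
  unfold besselKernel
  fun_prop

theorem besselKernel_pos (ν x t : ℝ) : 0 < besselKernel ν x t :=
  mul_pos (Real.exp_pos _) (Real.cosh_pos _)

theorem cosh_mul_besselKernel (ν x t : ℝ) :
    Real.cosh t * besselKernel ν x t = (besselKernel (ν - 1) x t + besselKernel (ν + 1) x t) / 2 := by
  simp only [besselKernel]
  rw [sub_mul, add_mul, one_mul, Real.cosh_add, Real.cosh_sub]
  ring

theorem sinh_mul_sinh (ν t : ℝ) : Real.sinh t * Real.sinh (ν * t) =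
    (Real.cosh ((ν + 1) * t) - Real.cosh ((ν - 1) * t)) / 2 := by
  rw [sub_mul, add_mul, one_mul, Real.cosh_add, Real.cosh_sub]
  ring

theorem cosh_le_exp_abs (t : ℝ) : Real.cosh t ≤ Real.exp |t| := by
  rw [← Real.cosh_abs, Real.cosh_eq]
  have : Real.exp (-|t|) ≤ Real.exp |t| := Real.exp_le_exp.2 (by linarith [abs_nonneg t])
  linarith

theorem sq_le_cosh {t : ℝ} (ht : 0 ≤ t) : t ^ 2 / 4 ≤ Real.cosh t := by
  rw [Real.cosh_eq]
  have := Real.quadratic_le_exp_of_nonneg ht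
  have := Real.exp_pos (-t)
  linarith

theorem isBigO_besselKernel (ν : ℝ) {x : ℝ} (hx : 0 < x) :
    besselKernel ν x =O[atTop] fun t => Real.exp (-1 * t) := by
  refine Asymptotics.IsBigO.of_bound 1 ?_
  -- Beyond this threshold `x t²/4 ≥ (|ν| + 1) t`, so the quadratic lower bound for `cosh` beats
  -- `exp (|ν| t)` with `exp (-t)` to spare.
  filter_upwards [eventually_ge_atTop (4 * (|ν| + 1) / x), eventually_ge_atTop 0] with t ht ht0
  rw [one_mul, Real.norm_of_nonneg (besselKernel_pos ν x t).le,
    Real.norm_of_nonneg (Real.exp_pos _).le]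
  have h1 := cosh_le_exp_abs (ν * t)
  rw [abs_mul, abs_of_nonneg ht0] at h1
  calc besselKernel ν x t ≤ Real.exp (-(x * Real.cosh t)) * Real.exp (|ν| * t) :=
        mul_le_mul_of_nonneg_left h1 (Real.exp_pos _).le
    _ = Real.exp (-(x * Real.cosh t) + |ν| * t) := (Real.exp_add _ _).symm
    _ ≤ Real.exp (-1 * t) := by
        refine Real.exp_le_exp.2 ?_
        rw [div_le_iff₀ hx] at ht
        have h2 := mul_le_mul_of_nonneg_left (sq_le_cosh ht0) hx.le
        have h3 := mul_le_mul_of_nonneg_left ht ht0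
        nlinarith

theorem integrableOn_besselKernel (ν : ℝ) {x : ℝ} (hx : 0 < x) :
    IntegrableOn (besselKernel ν x) (Ioi 0) :=
  integrable_of_isBigO_exp_neg one_pos (continuous_besselKernel ν x).continuousOn
    (isBigO_besselKernel ν hx)

theorem tendsto_besselKernel (ν : ℝ) {x : ℝ} (hx : 0 < x) :
    Tendsto (besselKernel ν x) atTop (𝓝 0) := by
  refine (isBigO_besselKernel ν hx).trans_tendsto ?_
  simpa using Real.tendsto_exp_neg_atTop_nhds_zero

theorem besselK_eq (ν x : ℝ) : besselK ν x = ∫ t in Ioi (0 : ℝ), besselKernel ν x t := rfl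

theorem besselK_pos (ν : ℝ) {x : ℝ} (hx : 0 < x) : 0 < besselK ν x := by
  rw [besselK_eq, setIntegral_pos_iff_support_of_nonneg_ae
    (.of_forall fun t => (besselKernel_pos ν x t).le) (integrableOn_besselKernel ν hx)]
  have : Function.support (besselKernel ν x) = univ :=
    eq_univ_of_forall fun t => (besselKernel_pos ν x t).ne'
  rw [this, univ_inter, Real.volume_Ioi]
  exact ENNReal.zero_lt_top

/-- Differentiation under the integral; for `y > x/2` the kernel at `x/2` dominates. -/
theorem hasDerivAt_besselK (ν : ℝ) {x : ℝ} (hx : 0 < x) :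
    HasDerivAt (besselK ν) (-(besselK (ν - 1) x + besselK (ν + 1) x) / 2) x := by
  have hi := fun (μ : ℝ) {y : ℝ} (hy : 0 < y) => integrableOn_besselKernel μ hy
  have hF' : ∀ y t, HasDerivAt (fun y => besselKernel ν y t)
      (-((besselKernel (ν - 1) y t + besselKernel (ν + 1) y t) / 2)) y := fun y t => by
    rw [← cosh_mul_besselKernel]
    refine (((hasDerivAt_id' y).mul_const (Real.cosh t)).fun_neg.exp.mul_const _).congr_deriv ?_
    rw [besselKernel]
    ring
  have hmono : ∀ μ t y, x / 2 < y → besselKernel μ y t ≤ besselKernel μ (x / 2) t :=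
    fun μ t y hy => by
      refine mul_le_mul_of_nonneg_right (Real.exp_le_exp.2 ?_) (Real.cosh_pos _).le
      have := mul_le_mul_of_nonneg_right hy.le (Real.cosh_pos t).le
      linarith
  have h := (hasDerivAt_integral_of_dominated_loc_of_deriv_le (μ := volume.restrict (Ioi 0))
    (F := fun y t => besselKernel ν y t)
    (F' := fun y t => -((besselKernel (ν - 1) y t + besselKernel (ν + 1) y t) / 2))
    (bound := fun t => (besselKernel (ν - 1) (x / 2) t + besselKernel (ν + 1) (x / 2) t) / 2)
    (Ioi_mem_nhds (half_lt_self hx))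
    (.of_forall fun y => (continuous_besselKernel ν y).aestronglyMeasurable) (hi ν hx)
    (((continuous_besselKernel _ x).add
      (continuous_besselKernel _ x)).div_const 2).neg.aestronglyMeasurable
    (.of_forall fun t y hy => ?_)
    (((hi (ν - 1) (half_pos hx)).add (hi (ν + 1) (half_pos hx))).div_const 2)
    (.of_forall fun t y _ => hF' y t)).2
  · refine h.congr_deriv ?_
    rw [integral_neg, integral_div, integral_add (hi _ hx) (hi _ hx), ← besselK_eq, ← besselK_eq]
    ring
  · have h1 := besselKernel_pos (ν - 1) y t
    have h2 := besselKernel_pos (ν + 1) y t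
    rw [norm_neg, Real.norm_of_nonneg (by positivity)]
    have := hmono (ν - 1) t y hy
    have := hmono (ν + 1) t y hy
    linarith

/-- Integration by parts, in the form that the derivative of `exp (-x cosh t) sinh (ν t)` has
integral zero over `(0, ∞)`. -/
theorem besselK_recurrence (ν : ℝ) {x : ℝ} (hx : 0 < x) :
    besselK (ν + 1) x - besselK (ν - 1) x = 2 * ν / x * besselK ν x := by
  have hi := fun μ : ℝ => integrableOn_besselKernel μ hx
  have hd : ∀ t ∈ Ici (0 : ℝ), HasDerivAt
      (fun t => Real.exp (-(x * Real.cosh t)) * Real.sinh (ν * t))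
      (ν * besselKernel ν x t - x / 2 * (besselKernel (ν + 1) x t - besselKernel (ν - 1) x t))
      t := fun t _ => by
    refine ((((Real.hasDerivAt_cosh t).const_mul x).fun_neg.exp).fun_mul
      (((hasDerivAt_id' t).const_mul ν).sinh)).congr_deriv ?_
    simp only [besselKernel]
    linear_combination -x * Real.exp (-(x * Real.cosh t)) * sinh_mul_sinh ν t
  have hlim : Tendsto (fun t => Real.exp (-(x * Real.cosh t)) * Real.sinh (ν * t)) atTop (𝓝 0) := by
    refine squeeze_zero_norm (fun t => ?_) (tendsto_besselKernel ν hx)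
    rw [norm_mul, Real.norm_of_nonneg (Real.exp_pos _).le, Real.norm_eq_abs, besselKernel]
    refine mul_le_mul_of_nonneg_left ?_ (Real.exp_pos _).le
    rw [Real.abs_sinh, ← Real.cosh_abs]
    exact (Real.sinh_lt_cosh _).le
  have hsub : IntegrableOn (fun t => x / 2 * (besselKernel (ν + 1) x t - besselKernel (ν - 1) x t))
      (Ioi 0) := ((hi (ν + 1)).sub (hi (ν - 1))).const_mul (x / 2)
  have h := integral_Ioi_of_hasDerivAt_of_tendsto' hd (((hi ν).const_mul ν).sub hsub) hlim
  rw [integral_sub ((hi ν).const_mul ν) hsub,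
    integral_const_mul, integral_const_mul, integral_sub (hi _) (hi _), ← besselK_eq,
    ← besselK_eq, ← besselK_eq, mul_zero, Real.sinh_zero, mul_zero, sub_zero] at h
  field_simp
  linear_combination -2 * h

theorem isCylinder_besselK : IsCylinder (-1) (-1) besselK := by
  refine ⟨fun ν x hx => (hasDerivAt_besselK ν hx).congr_deriv ?_, fun ν x hx => ?_⟩
  · linear_combination 1 / 2 * besselK_recurrence ν hx
  · linear_combination besselK_recurrence ν hx

end

/-! ### The families with `E ≠ 0`, and the conclusion -/

namespace RadialNLS

open Set

variable {n p k E : ℝ} {J : Set ℝ} {H G : ℝ → ℂ → ℂ}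

/-- The pair `(y, y')` solves `y'' + (n - 1) y' / x = E y`. -/
structure IsHomogeneous (n E : ℝ) (J : Set ℝ) (y y' : ℝ → ℝ) : Prop where
  deriv_y : ∀ x ∈ J, HasDerivAt y (y' x) x
  deriv_y' : ∀ x ∈ J, HasDerivAt y' (E * y x - (n - 1) / x * y' x) x

namespace IsHomogeneous

variable {y y' z z' : ℝ → ℝ}

theorem linear_combination (hy : IsHomogeneous n E J y y') (hz : IsHomogeneous n E J z z')
    (b c : ℝ) :
    IsHomogeneous n E J (fun x => b * y x + c * z x) (fun x => b * y' x + c * z' x) :=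
  ⟨fun x hx => ((hy.deriv_y x hx).const_mul b).fun_add ((hz.deriv_y x hx).const_mul c),
    fun x hx => (((hy.deriv_y' x hx).const_mul b).fun_add
      ((hz.deriv_y' x hx).const_mul c)).congr_deriv (by ring)⟩

/-- `-(k/E) y'` is a particular solution for `w`, because `y'' + (n - 1) y'/x = E y`; `x ^ (1 - n)`
spans the homogeneous ones. -/
theorem isLinearStatic (hy : IsHomogeneous n E J y y') (hE : E ≠ 0) (hJ0 : J ⊆ Ioi 0) (c : ℝ) :
    IsLinearStatic n k E J y y' (fun x => -(k / E) * y' x + c * x ^ (1 - n)) := by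
  refine ⟨hy.deriv_y, hy.deriv_y', fun x hx => ?_⟩
  have hx0 := (mem_Ioi.1 (hJ0 hx)).ne'
  refine (((hy.deriv_y' x hx).const_mul _).fun_add
    ((hasDerivAt_rpow_div (1 - n) (hJ0 hx)).const_mul c)).congr_deriv ?_
  field_simp
  ring

/-- In terms of a fundamental system, `a` and `α` are quotients of linear combinations. -/
theorem exists_coefficients {a α : ℝ → ℝ} (hy : IsHomogeneous n E J y y')
    (hz : IsHomogeneous n E J z z') (hE : E ≠ 0) (hs : IsRealStatic n k E J a α)
    (hJ : IsOpen J) (hJc : IsPreconnected J) (hJ0 : J ⊆ Ioi 0) {x₀ : ℝ} (hx₀ : x₀ ∈ J)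
    (hdet : y x₀ * z' x₀ - y' x₀ * z x₀ ≠ 0) : ∃ b c d : ℝ, ∀ x ∈ J,
      b * y x + c * z x ≠ 0 ∧ a x = (b * y' x + c * z' x) / (b * y x + c * z x) ∧
      α x = (-(k / E) * (b * y' x + c * z' x) + d * x ^ (1 - n)) / (b * y x + c * z x) := by
  have hX : x₀ ^ (1 - n) ≠ 0 := (Real.rpow_pos_of_pos (hJ0 hx₀) _).ne'
  set D := y x₀ * z' x₀ - y' x₀ * z x₀ with hD
  -- Cramer's rule for a combination with value `1` and derivative `a x₀` at `x₀`.
  set b := (z' x₀ - a x₀ * z x₀) / D with hb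
  set c := (a x₀ * y x₀ - y' x₀) / D with hc
  have h1 : b * y x₀ + c * z x₀ = 1 := by
    rw [hb, hc]; field_simp; rw [hD]; ring
  have h2 : b * y' x₀ + c * z' x₀ = a x₀ := by
    rw [hb, hc]; field_simp; rw [hD]; ring
  refine ⟨b, c, (α x₀ + k / E * a x₀) / x₀ ^ (1 - n), ?_⟩
  refine ((hy.linear_combination hz b c).isLinearStatic hE hJ0 _).eq_div hs hJ hJc hJ0 hx₀
    (by simp only [h1]; exact one_ne_zero) (by simp only [h1, h2, mul_one])
    (by simp only [h1, h2]; field_simp; ring)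

end IsHomogeneous

/-- The solutions `x^(1-n/2) Z_ν(s x)` with `ν = ±(1 - n/2)`. -/
theorem _root_.IsCylinder.isHomogeneous {σ τ κ ε ν s : ℝ} {Z : ℝ → ℝ → ℝ} (hZ : IsCylinder σ τ Z)
    (hε : ε = 1 ∧ κ = τ ∨ ε = -1 ∧ κ = σ) (hν : ν = ε * (1 - n / 2)) (hs : 0 < s)
    (hJ0 : J ⊆ Ioi 0) :
    IsHomogeneous n (σ * τ * s ^ 2) J (fun x => x ^ (1 - n / 2) * Z ν (s * x))
      (fun x => κ * s * (x ^ (1 - n / 2) * Z (ν - ε) (s * x))) := by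
  have hp : ∀ x ∈ J, HasDerivAt (fun x : ℝ => x ^ (1 - n / 2)) _ x := fun x hx =>
    hasDerivAt_rpow_div (1 - n / 2) (hJ0 hx)
  have hm : ∀ x, HasDerivAt (fun x : ℝ => s * x) s x := fun x => by
    simpa using (hasDerivAt_id' x).const_mul s
  refine ⟨fun x hx => ?_, fun x hx => ?_⟩ <;>
  have hx0 := (mem_Ioi.1 (hJ0 hx)).ne' <;>
  have hsx : 0 < s * x := mul_pos hs (hJ0 hx) <;>
  -- For `ε = 1` differentiation lowers the order and produces `τ`; for `ε = -1` it raises the order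
  -- and produces `σ`.
  rcases hε with ⟨rfl, rfl⟩ | ⟨rfl, rfl⟩
  · refine ((hp x hx).fun_mul ((hZ.hasDerivAt' ν hsx).comp x (hm x))).congr_deriv ?_
    simp only [Function.comp, hν]
    field_simp
    ring
  · refine ((hp x hx).fun_mul ((hZ.hasDerivAt ν _ hsx).comp x (hm x))).congr_deriv ?_
    simp only [Function.comp, hν, sub_neg_eq_add]
    field_simp
    ring
  · refine (((hp x hx).fun_mul ((hZ.hasDerivAt (ν - 1) _ hsx).comp x (hm x))).const_mul
      _).congr_deriv ?_
    simp only [Function.comp, hν, sub_add_cancel]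
    field_simp
    ring
  · refine (((hp x hx).fun_mul ((hZ.hasDerivAt' (ν - -1) hsx).comp x (hm x))).const_mul
      _).congr_deriv ?_
    simp only [Function.comp, hν, sub_neg_eq_add, add_sub_cancel_right]
    field_simp
    ring

theorem abs_eq_sign_mul {ε y : ℝ} (hε : ε = 1 ∨ ε = -1) (h : 0 ≤ ε * y) : |y| = ε * y := by
  rcases hε with rfl | rfl
  · rw [one_mul] at h ⊢; exact abs_of_nonneg h
  · rw [neg_one_mul] at h ⊢; exact abs_of_nonpos (by linarith)

theorem exists_sign (y : ℝ) : ∃ ε : ℝ, (ε = 1 ∨ ε = -1) ∧ 0 ≤ ε * y := by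
  rcases le_total 0 y with h | h
  · exact ⟨1, Or.inl rfl, by linarith⟩
  · exact ⟨-1, Or.inr rfl, by linarith⟩

theorem rpow_one_sub_eq {x : ℝ} (hx : 0 < x) (n : ℝ) :
    x ^ (1 - n) = x ^ (1 - n / 2) * x ^ (-n / 2) := by
  rw [← Real.rpow_add hx]; congr 1; ring

theorem isHomogeneous_besselJ {ε ν s : ℝ} (hε : ε = 1 ∨ ε = -1) (hν : ν = ε * (1 - n / 2))
    (hs : 0 < s) (hJ0 : J ⊆ Ioi 0) :
    IsHomogeneous n (-s ^ 2) J (fun x => x ^ (1 - n / 2) * besselJ ν (s * x))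
      (fun x => ε * s * (x ^ (1 - n / 2) * besselJ (ν - ε) (s * x))) := by
  have := isCylinder_besselJ.isHomogeneous (κ := ε) (hε.imp (fun h => ⟨h, h⟩) fun h => ⟨h, h⟩)
    hν hs hJ0
  simpa using this

theorem isHomogeneous_besselY {ε ν s : ℝ} (hε : ε = 1 ∨ ε = -1) (hν : ν = ε * (1 - n / 2))
    (hs : 0 < s) (hJ0 : J ⊆ Ioi 0) :
    IsHomogeneous n (-s ^ 2) J (fun x => x ^ (1 - n / 2) * besselY ν (s * x))
      (fun x => ε * s * (x ^ (1 - n / 2) * besselY (ν - ε) (s * x))) := by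
  have := isCylinder_besselY.isHomogeneous (κ := ε) (hε.imp (fun h => ⟨h, h⟩) fun h => ⟨h, h⟩)
    hν hs hJ0
  simpa using this

theorem isHomogeneous_besselI {ε ν s : ℝ} (hε : ε = 1 ∨ ε = -1) (hν : ν = ε * (1 - n / 2))
    (hs : 0 < s) (hJ0 : J ⊆ Ioi 0) :
    IsHomogeneous n (s ^ 2) J (fun x => x ^ (1 - n / 2) * besselI ν (s * x))
      (fun x => s * (x ^ (1 - n / 2) * besselI (ν - ε) (s * x))) := by
  have := isCylinder_besselI.isHomogeneous (κ := 1) (hε.imp (fun h => ⟨h, rfl⟩) fun h => ⟨h, rfl⟩)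
    hν hs hJ0
  simpa using this

theorem isHomogeneous_besselK {ε ν s : ℝ} (hε : ε = 1 ∨ ε = -1) (hν : ν = ε * (1 - n / 2))
    (hs : 0 < s) (hJ0 : J ⊆ Ioi 0) :
    IsHomogeneous n (s ^ 2) J (fun x => x ^ (1 - n / 2) * besselK ν (s * x))
      (fun x => -1 * s * (x ^ (1 - n / 2) * besselK (ν - ε) (s * x))) := by
  have := isCylinder_besselK.isHomogeneous (κ := -1) (hε.imp (fun h => ⟨h, rfl⟩)
    fun h => ⟨h, rfl⟩) hν hs hJ0
  rwa [neg_mul_neg, one_mul, one_mul] at this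

theorem besselJ_besselY_det {ε ν x : ℝ} (hε : ε = 1 ∨ ε = -1) (hx : 0 < x) :
    besselJ ν x * besselY (ν - ε) x - besselJ (ν - ε) x * besselY ν x ≠ 0 := by
  have hW : 2 / (Real.pi * x) ≠ 0 := by positivity
  rcases hε with rfl | rfl
  · have h := besselJ_besselY_wronskian (ν - 1) hx
    rw [sub_add_cancel] at h
    rwa [h]
  · have h := besselJ_besselY_wronskian ν hx
    rw [sub_neg_eq_add]
    intro h0
    exact hW (by linarith)

/-- All four values are positive. Only the order `ν - 1`, possibly in `[-1, 0)`, needs the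
recurrence `I_{ν-1} = (2ν/x) I_ν + I_{ν+1}`. -/
theorem besselI_besselK_det {ε ν x : ℝ} (hε : ε = 1 ∨ ε = -1) (hν : 0 ≤ ν) (hx : 0 < x) :
    0 < besselI ν x * besselK (ν - ε) x + besselI (ν - ε) x * besselK ν x := by
  have h1 := besselI_pos (by linarith : -1 < ν) hx
  have h2 : 0 < besselI (ν - ε) x := by
    rcases hε with rfl | rfl
    · have h3 := isCylinder_besselI.recurrence ν x hx
      have h4 := besselI_pos (by linarith : -1 < ν + 1) hx
      rw [one_mul, one_mul] at h3
      rw [h3]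
      have : 0 ≤ 2 * ν / x * besselI ν x := by positivity
      linarith
    · exact besselI_pos (by linarith) hx
  have h3 := besselK_pos ν hx
  have h4 := besselK_pos (ν - ε) hx
  positivity

theorem Family11.solution (hJ : IsOpen J) (hJ0 : J ⊆ Ioi 0) (hF : Family11 n p k J H G) :
    HasAnsatzForm n p k J H G ∧ IsSolution n p k J H G ∧ IsPhaseEquivariant J H G := by
  obtain ⟨hp, ε, hε, hsgn, C₁, C₂, C₃, C₄, hC, hne, hF⟩ := hF
  have hs : 0 < √C₁ := Real.sqrt_pos.2 hC
  have hs2 : √C₁ ^ 2 = C₁ := Real.sq_sqrt hC.le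
  have hν := abs_eq_sign_mul hε hsgn
  have hν' : -ε * n / 2 = |1 - n / 2| - ε := by rw [hν]; ring
  have hX : ∀ x ∈ J, x ^ (1 - n / 2) ≠ 0 := fun x hx => (Real.rpow_pos_of_pos (hJ0 hx) _).ne'
  have hy := (isHomogeneous_besselJ hε hν hs hJ0).linear_combination
    (isHomogeneous_besselY hε hν hs hJ0) C₂ C₃
  rw [hs2] at hy
  -- The family has `ε √C₁` as a common prefactor, which also multiplies `C₄`. Dividing by `y` turns
  -- `x ^ (1 - n)` into `x ^ (-n/2)`.
  refine (hy.isLinearStatic (k := k) (neg_ne_zero.2 hC.ne') hJ0 (ε * √C₁ * C₄)).solution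
    (fun x hx => ?_) hJ hJ0 hp fun x hx v hv => ?_
  · have := mul_ne_zero (hX x hx) (hne x hx)
    intro h0
    exact this (by linear_combination h0)
  · obtain ⟨h1, h2⟩ := hF x hx v hv
    refine ⟨?_, by rw [h2]; push_cast; ring⟩
    rw [h1, hν', rpow_one_sub_eq (hJ0 hx) n]
    congr 2
    have h3 := hX x hx
    have h4 := hne x hx
    have h5 : C₂ * (x ^ (1 - n / 2) * besselJ |1 - n / 2| (√C₁ * x))
        + C₃ * (x ^ (1 - n / 2) * besselY |1 - n / 2| (√C₁ * x)) = x ^ (1 - n / 2) *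
        (C₂ * besselJ |1 - n / 2| (√C₁ * x) + C₃ * besselY |1 - n / 2| (√C₁ * x)) := by ring
    rw [h5]
    set Z := C₂ * besselJ |1 - n / 2| (√C₁ * x) + C₃ * besselY |1 - n / 2| (√C₁ * x)
    generalize x ^ (1 - n / 2) = X at h3 ⊢
    field_simp
    ring

theorem IsRealStatic.family11 {a α : ℝ → ℝ} (hJ : IsOpen J) (hJc : IsPreconnected J)
    (hJ0 : J ⊆ Ioi 0) (hJne : J.Nonempty) (hp : p = -1) (hE : E < 0)
    (hs : IsRealStatic n k E J a α)
    (hF : ∀ x ∈ J, ∀ v : ℂ, v ≠ 0 →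
      H x v = (a x + α x * ‖v‖⁻¹ : ℝ) * v ∧ G x v = -Complex.I * E * v) :
    Family11 n p k J H G := by
  obtain ⟨x₀, hx₀⟩ := hJne
  obtain ⟨ε, hε, hsgn⟩ := exists_sign (1 - n / 2)
  obtain ⟨C₁, rfl⟩ : ∃ C, E = -C := ⟨-E, (neg_neg E).symm⟩
  have hC : 0 < C₁ := by linarith
  have hs0 : 0 < √C₁ := Real.sqrt_pos.2 hC
  have hs2 : √C₁ ^ 2 = C₁ := Real.sq_sqrt hC.le
  have hν := abs_eq_sign_mul hε hsgn
  have hν' : -ε * n / 2 = |1 - n / 2| - ε := by rw [hν]; ring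
  have hX : ∀ x ∈ J, x ^ (1 - n / 2) ≠ 0 := fun x hx => (Real.rpow_pos_of_pos (hJ0 hx) _).ne'
  have hε0 : ε ≠ 0 := by rcases hε with rfl | rfl <;> norm_num
  have hy := isHomogeneous_besselJ hε hν hs0 hJ0
  have hz := isHomogeneous_besselY hε hν hs0 hJ0
  rw [hs2] at hy hz
  obtain ⟨b, c, d, key⟩ := hy.exists_coefficients hz hE.ne hs hJ hJc hJ0 hx₀ (by
    have := mul_ne_zero (mul_ne_zero (mul_ne_zero hε0 hs0.ne') (pow_ne_zero 2 (hX x₀ hx₀)))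
      (besselJ_besselY_det (ν := |1 - n / 2|) hε (mul_pos hs0 (hJ0 hx₀)))
    intro h0
    exact this (by linear_combination h0))
  have h5 : ∀ x, b * (x ^ (1 - n / 2) * besselJ |1 - n / 2| (√C₁ * x))
      + c * (x ^ (1 - n / 2) * besselY |1 - n / 2| (√C₁ * x)) = x ^ (1 - n / 2) *
      (b * besselJ |1 - n / 2| (√C₁ * x) + c * besselY |1 - n / 2| (√C₁ * x)) := fun x => by ring
  have hne : ∀ x ∈ J,
      b * besselJ |1 - n / 2| (√C₁ * x) + c * besselY |1 - n / 2| (√C₁ * x) ≠ 0 :=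
    fun x hx h0 => (key x hx).1 (by rw [h5, h0, mul_zero])
  refine ⟨hp, ε, hε, hsgn, C₁, b, c, d / (ε * √C₁), hC, hne, fun x hx v hv => ?_⟩
  obtain ⟨-, h1, h2⟩ := key x hx
  obtain ⟨e1, e2⟩ := hF x hx v hv
  refine ⟨?_, by rw [e2]; push_cast; ring⟩
  rw [e1, h1, h2, hν', h5, rpow_one_sub_eq (hJ0 hx) n]
  congr 2
  have h3 := hX x hx
  have h4 := hne x hx
  set Z := b * besselJ |1 - n / 2| (√C₁ * x) + c * besselY |1 - n / 2| (√C₁ * x)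
  generalize x ^ (1 - n / 2) = X at h3 ⊢
  field_simp
  ring

/-- Changing the order by `ε` changes the phase by `ε π`, hence the sign. This compensates for the
sign in the derivative formula of `K`, so that one real constant serves in both places. -/
theorem mul_exp_eq_neg {ε n : ℝ} (hε : ε = 1 ∨ ε = -1) (C : ℂ) :
    C * Complex.exp (-ε * Complex.I * Real.pi * n / 2) =
      -(C * Complex.exp (Complex.I * Real.pi * (ε * (1 - n / 2) : ℝ))) := by
  have h : -(ε : ℂ) * Complex.I * Real.pi * n / 2 =
      Complex.I * Real.pi * (ε * (1 - n / 2) : ℝ) - ε * (Real.pi * Complex.I) := by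
    push_cast; ring
  have h1 : Complex.exp (ε * (Real.pi * Complex.I)) = -1 := by
    rcases hε with rfl | rfl
    · simp
    · simp [Complex.exp_neg]
  rw [h, Complex.exp_sub, h1]
  ring

theorem Family12.solution (hJ : IsOpen J) (hJ0 : J ⊆ Ioi 0) (hF : Family12 n p k J H G) :
    HasAnsatzForm n p k J H G ∧ IsSolution n p k J H G ∧ IsPhaseEquivariant J H G := by
  obtain ⟨hp, ε, hε, hsgn, C₁, C₂, C₄, C₃, hC, him, hne, hF⟩ := hF
  have hs : 0 < √C₁ := Real.sqrt_pos.2 hC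
  have hs2 : √C₁ ^ 2 = C₁ := Real.sq_sqrt hC.le
  have hν := abs_eq_sign_mul hε hsgn
  have hν' : -ε * n / 2 = |1 - n / 2| - ε := by rw [hν]; ring
  have hX : ∀ x ∈ J, x ^ (1 - n / 2) ≠ 0 := fun x hx => (Real.rpow_pos_of_pos (hJ0 hx) _).ne'
  obtain ⟨c, hc⟩ : ∃ c : ℝ,
      C₃ * Complex.exp (Complex.I * Real.pi * (|1 - n / 2| : ℝ)) = c :=
    ⟨(C₃ * Complex.exp (Complex.I * Real.pi * (|1 - n / 2| : ℝ))).re,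
      Complex.ext (Complex.ofReal_re _).symm (him.trans (Complex.ofReal_im _).symm)⟩
  have hc' : C₃ * Complex.exp (-ε * Complex.I * Real.pi * n / 2) = -c := by
    rw [mul_exp_eq_neg hε, ← hν, hc]
  rw [hc] at hne
  have hne' : ∀ x ∈ J,
      C₂ * besselI |1 - n / 2| (√C₁ * x) + c * besselK |1 - n / 2| (√C₁ * x) ≠ 0 :=
    fun x hx => by exact_mod_cast hne x hx
  have hy := (isHomogeneous_besselI hε hν hs hJ0).linear_combination
    (isHomogeneous_besselK hε hν hs hJ0) C₂ c
  rw [hs2] at hy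
  refine (hy.isLinearStatic (k := k) hC.ne' hJ0 (√C₁ * C₄)).solution
    (fun x hx => ?_) hJ hJ0 hp fun x hx v hv => ?_
  · have := mul_ne_zero (hX x hx) (hne' x hx)
    intro h0
    exact this (by linear_combination h0)
  · obtain ⟨h1, h2⟩ := hF x hx v hv
    refine ⟨?_, h2⟩
    rw [h1, hc, hc', hν', rpow_one_sub_eq (hJ0 hx) n]
    have h3 := hX x hx
    have h4 := hne' x hx
    have h5 : C₂ * (x ^ (1 - n / 2) * besselI |1 - n / 2| (√C₁ * x))
        + c * (x ^ (1 - n / 2) * besselK |1 - n / 2| (√C₁ * x)) = x ^ (1 - n / 2) *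
        (C₂ * besselI |1 - n / 2| (√C₁ * x) + c * besselK |1 - n / 2| (√C₁ * x)) := by ring
    rw [h5]
    set Z := C₂ * besselI |1 - n / 2| (√C₁ * x) + c * besselK |1 - n / 2| (√C₁ * x) with hZ
    have h6 : (C₂ : ℂ) * besselI |1 - n / 2| (√C₁ * x) + c * besselK |1 - n / 2| (√C₁ * x) =
        (Z : ℝ) := by rw [hZ]; push_cast; ring
    rw [h6]
    congr 1
    have h7 : ∀ A B D Q : ℝ, (√C₁ : ℂ) * (Z : ℂ)⁻¹ * ((C₂ * A + -c * B) * (1 - D) + Q) =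
        ((√C₁ * Z⁻¹ * ((C₂ * A + -c * B) * (1 - D) + Q) : ℝ) : ℂ) := fun A B D Q => by
      push_cast; ring
    rw [h7]
    congr 1
    generalize x ^ (1 - n / 2) = X at h3 ⊢
    field_simp
    ring

theorem IsRealStatic.family12 {a α : ℝ → ℝ} (hJ : IsOpen J) (hJc : IsPreconnected J)
    (hJ0 : J ⊆ Ioi 0) (hJne : J.Nonempty) (hp : p = -1) (hC : 0 < E)
    (hs : IsRealStatic n k E J a α)
    (hF : ∀ x ∈ J, ∀ v : ℂ, v ≠ 0 →
      H x v = (a x + α x * ‖v‖⁻¹ : ℝ) * v ∧ G x v = -Complex.I * E * v) :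
    Family12 n p k J H G := by
  obtain ⟨x₀, hx₀⟩ := hJne
  obtain ⟨ε, hε, hsgn⟩ := exists_sign (1 - n / 2)
  have hs0 : 0 < √E := Real.sqrt_pos.2 hC
  have hs2 : √E ^ 2 = E := Real.sq_sqrt hC.le
  have hν := abs_eq_sign_mul hε hsgn
  have hν' : -ε * n / 2 = |1 - n / 2| - ε := by rw [hν]; ring
  have hX : ∀ x ∈ J, x ^ (1 - n / 2) ≠ 0 := fun x hx => (Real.rpow_pos_of_pos (hJ0 hx) _).ne'
  have hy := isHomogeneous_besselI hε hν hs0 hJ0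
  have hz := isHomogeneous_besselK hε hν hs0 hJ0
  rw [hs2] at hy hz
  obtain ⟨b, c, d, key⟩ := hy.exists_coefficients hz hC.ne' hs hJ hJc hJ0 hx₀ (by
    have := mul_ne_zero (mul_ne_zero hs0.ne' (pow_ne_zero 2 (hX x₀ hx₀)))
      (besselI_besselK_det hε (abs_nonneg (1 - n / 2)) (mul_pos hs0 (hJ0 hx₀))).ne'
    intro h0
    exact this (by linear_combination -h0))
  have h5 : ∀ x, b * (x ^ (1 - n / 2) * besselI |1 - n / 2| (√E * x))
      + c * (x ^ (1 - n / 2) * besselK |1 - n / 2| (√E * x)) = x ^ (1 - n / 2) *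
      (b * besselI |1 - n / 2| (√E * x) + c * besselK |1 - n / 2| (√E * x)) := fun x => by ring
  have hne : ∀ x ∈ J,
      b * besselI |1 - n / 2| (√E * x) + c * besselK |1 - n / 2| (√E * x) ≠ 0 :=
    fun x hx h0 => (key x hx).1 (by rw [h5, h0, mul_zero])
  -- The exponential is nonzero, so every real coefficient of `K` is reached by a complex `C₃`.
  obtain ⟨C₃, hc⟩ : ∃ C₃ : ℂ,
      C₃ * Complex.exp (Complex.I * Real.pi * (|1 - n / 2| : ℝ)) = c :=
    ⟨c / Complex.exp (Complex.I * Real.pi * (|1 - n / 2| : ℝ)),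
      div_mul_cancel₀ _ (Complex.exp_ne_zero _)⟩
  have hc' : C₃ * Complex.exp (-ε * Complex.I * Real.pi * n / 2) = -c := by
    rw [mul_exp_eq_neg hε, ← hν, hc]
  refine ⟨hp, ε, hε, hsgn, E, b, d / √E, C₃, hC, by rw [hc, Complex.ofReal_im], fun x hx => ?_,
    fun x hx v hv => ?_⟩
  · rw [hc]
    exact_mod_cast hne x hx
  obtain ⟨-, h1, h2⟩ := key x hx
  obtain ⟨e1, e2⟩ := hF x hx v hv
  refine ⟨?_, e2⟩
  rw [e1, h1, h2, hc, hc', hν', h5, rpow_one_sub_eq (hJ0 hx) n]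
  have h3 := hX x hx
  have h4 := hne x hx
  set Z := b * besselI |1 - n / 2| (√E * x) + c * besselK |1 - n / 2| (√E * x) with hZ
  have h6 : (b : ℂ) * besselI |1 - n / 2| (√E * x) + c * besselK |1 - n / 2| (√E * x) =
      (Z : ℝ) := by rw [hZ]; push_cast; ring
  rw [h6]
  congr 1
  have h7 : ∀ A B D Q : ℝ, (√E : ℂ) * (Z : ℂ)⁻¹ * ((b * A + -c * B) * (1 - D) + Q) =
      ((√E * Z⁻¹ * ((b * A + -c * B) * (1 - D) + Q) : ℝ) : ℂ) := fun A B D Q => by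
    push_cast; ring
  rw [h7]
  congr 1
  generalize x ^ (1 - n / 2) = X at h3 ⊢
  field_simp
  ring

theorem IsListedStatic.isTranslationInvariant (h : IsListedStatic n p k J H G) :
    IsTranslationInvariant J G := by
  intro x hx v hv
  rcases h with h | h | h | h | h | h | h
  · obtain ⟨-, -, -, -, _, -, h⟩ := h
    exact (h x hx v hv).2
  · obtain ⟨-, -, -, -, _, -, h⟩ := h
    exact (h x hx v hv).2
  · obtain ⟨-, -, _, h⟩ := h
    exact (h x hx v hv).2
  · obtain ⟨-, -, _, h⟩ := h
    exact (h x hx v hv).2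
  · obtain ⟨-, -, -, _, _, -, h⟩ := h
    exact (h x hx v hv).2
  · obtain ⟨-, -, _, _, -, h⟩ := h
    exact (h x hx v hv).2
  · obtain ⟨-, -, _, _, -, h⟩ := h
    exact (h x hx v hv).2

end RadialNLS

theorem proposition1 (n p k : ℝ) (hn : n ≠ 1) (hp : p ≠ 0) (hk : k ≠ 0)
    (J : Set ℝ) (hJ_open : IsOpen J) (hJ_conn : IsConnected J) (hJ_pos : J ⊆ Set.Ioi 0)
    (H G : ℝ → ℂ → ℂ) :
    (RadialNLS.IsListed n p k J H G →
      RadialNLS.HasAnsatzForm n p k J H G ∧ RadialNLS.IsSolution n p k J H G ∧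
      RadialNLS.IsPhaseEquivariant J H G) ∧
    (RadialNLS.HasAnsatzForm n p k J H G → RadialNLS.IsSolution n p k J H G →
      RadialNLS.IsListed n p k J H G) ∧
    (RadialNLS.IsListedStatic n p k J H G → RadialNLS.IsTranslationInvariant J G) := by
  refine ⟨fun h => ?_, fun hA hS => ?_, fun h => h.isTranslationInvariant⟩
  · rcases h with h | h | h | (h | h | h | h | h | h | h) | h | h
    · exact h.solution hJ_open
    all_goals exact h.solution hJ_open hJ_pos
  · have hc := hJ_conn.isPreconnected
    have hne := hJ_conn.nonempty
    rcases RadialNLS.listed_or_static hn hp hk hJ_open hc hne hJ_pos hA hS with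
      (h | h | h | h | h) | ⟨hp1, E, a, α, hs, hF⟩
    · exact Or.inl h
    · exact Or.inr (Or.inl h)
    · exact Or.inr (Or.inr (Or.inl h))
    · exact Or.inr (Or.inr (Or.inr (Or.inl (Or.inl h))))
    · exact Or.inr (Or.inr (Or.inr (Or.inl (Or.inr (Or.inl h)))))
    -- The sign of `E` decides between `J, Y`, elementary functions, and `I, K`.
    rcases lt_trichotomy E 0 with hE | rfl | hE
    · exact Or.inr (Or.inr (Or.inr (Or.inr (Or.inl
        (hs.family11 hJ_open hc hJ_pos hne hp1 hE hF)))))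
    · refine Or.inr (Or.inr (Or.inr (Or.inl
        (hs.listed_of_zero hJ_open hc hJ_pos hne hp1 fun x hx v hv => ?_))))
      obtain ⟨h1, h2⟩ := hF x hx v hv
      exact ⟨h1, by rw [h2]; simp⟩
    · exact Or.inr (Or.inr (Or.inr (Or.inr (Or.inr
        (hs.family12 hJ_open hc hJ_pos hne hp1 hE hF)))))
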